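/- **Setting.** Let $C=1-\mathsf H_2(p)>0$ be the capacity of a binary symmetric channel with crossover probability $p\neq\frac12$. *Outer code.* Let $F=\mathrm{GF}(2^\ell)$ and let $\mathcal G=(A:B,E)$ be a connected $\Delta$-regular bipartite graph with $|A|=|B|=n$ and with an ordering of the set $E(u)$ of edges at each vertex $u$. Let $\gamma$ be the second largest eigenvalue of its adjacency matrix divided by $\Delta$. Let $\mathcal C_A,\mathcal C_B\subseteq F^\Delta$ be generalized Reed–Solomon codes of rates $r_A,r_B$ and relative minimum distances $\delta_A,\delta_B$. Let $\mathbb C\subseteq F^E$ be the set of words $c$ with $(c)_{E(u)}\in\mathcal C_A$ for $u\in A$ and $(c)_{E(u)}\in\mathcal C_B$ for $u\in B$. Put $\Phi=F^{r_A\Delta}$, fix a linear bijection $\mathcal E_A:\Phi\to\mathcal C_A$, and let $\mathbb C_\Phi=\psi(\mathbb C)\subseteq\Phi^n$, where $\psi(c)=(\mathcal E_A^{-1}((c)_{E(u)}))_{u\in A}$. The decoder $\mathcal D_\Phi$ with $m$ rounds starts from the word $z$ with $(z)_{E(u)}=\mathcal E_A(x_u)$, $u\in A$. In round $i=1,\dots,m$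 it applies the half minimum distance decoder of $\mathcal C_B$ (for $i$ odd) at all $u\in B$, or that of $\mathcal C_A$ (for $i$ even) at all $u\in A$; where no codeword is at distance less than half the minimum distance, this decoder gives the zero codeword. Finally $\mathcal D_\Phi$ outputs $\psi(z)$ if $z\in\mathbb C$ and declares an error otherwise. Put $$\beta=\frac{\delta_B/2-\gamma\sqrt{\delta_B/\delta_A}}{1-\gamma}.$$ *Concatenation.* Let $\mathcal C_{in}\subseteq\mathrm{GF}(2)^{n_{in}}$ be a binary linear code of rate $R_{in}$ with a decoder $\mathcal D_{in}:\mathrm{GF}(2)^{n_{in}}\to\mathcal C_{in}$, and let $\mathcal E_0:\Phi\to\mathcal C_{in}$ be a $\mathrm{GF}(2)$-linear bijection. The concatenated code $\mathbb C_{cont}=\{(\mathcal E_0(x_1)|\cdots|\mathcal E_0(x_n)):x\in\mathbb C_\Phi\}$ has length $N_{cont}=n\,n_{in}$. Its decoder $\mathcal D_{cont}$ applies $\mathcal E_0^{-1}\circ\mathcal D_{in}$ to the $n$ blocks of the received word, then $\mathcal D_\Phi$, then $\mathcal E_0$ to each symbol (and declares an error if $\mathcal D_\Phi$ does). *Complexity.*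 Time is the number of steps of a unit-cost random access machine with addition and subtraction. It works on bits and indices, so elements of $F$ are given by their coordinates over $\mathrm{GF}(2)$. The descriptions of the codes (graph, multiplication table of a basis of $F$, parameters of $\mathcal C_A,\mathcal C_B$, matrices of $\mathcal E_A,\mathcal E_0$, the number $m$) are in memory. Each call of $\mathcal D_{in}$ costs the running time of a given program for $\mathcal D_{in}$ plus the lengths of its input and output. A real sequence $(a_i)_{i\ge1}$ is *dense* if $a_i\to\infty$, $a_1\le100$ and $a_{i+1}-a_i=o(a_i)$. **Theorem.** Let $\tau\in(0,1)$. There are two programs, depending only on $\tau$, such that the following holds. Let $p$ be as above, let $\kappa\in(0,1)$, $h_0>0$, $s,r\ge1$, $c>0$ and $\varepsilon_0<1$, and let $(\varphi_i)$ be a sequence of alphabet sizes such that $(\log_2\varphi_i)$ is dense. Then there is a polynomial $P$ such that, for every $\varepsilon\in(0,\varepsilon_0)$ and all codes as above with * (i) $|\Phi|$ the smallest $\varphi_i$ with $\log_2\varphi_i\ge 1/(\kappa\varepsilon)^{h_0}$, and design rate $r_A+r_B-1\ge\frac{1-\varepsilon}{1-\kappa\varepsilon}$ (so that $\mathbb C_\Phi$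 has at least this rate); * (ii) $R_{in}\ge(1-\kappa\varepsilon)C$, and $\mathcal D_{in}$ computed in time at most $c\,n_{in}^{s}\,\varepsilon^{-r}$ on every word, and for every $m\ge 0$ and every received word $y$: * (a) the first program outputs $\mathcal D_{cont}(y)$ in time at most $(m+1)\,N_{cont}\,P(1/\varepsilon)$, and in time at most $N_{cont}\,P(1/\varepsilon)$ if, for some codeword of $\mathbb C_{cont}$, the inner decoder fails on at most $\tau\beta n$ of the $n$ blocks of $y$; * (b) the second program always halts in time at most $N_{cont}\,P(1/\varepsilon)$. Its output is $\mathcal D_{cont}(y)$ or the declaration of an error, and it is $\mathcal D_{cont}(y)$ whenever, for some codeword of $\mathbb C_{cont}$, the inner decoder fails on at most $\tau\beta n$ of the $n$ blocks of $y$. Thus the decoding time is linear in $N_{cont}$ and polynomial in $1/\varepsilon$. -/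

import Mathlib

/-! ## The machine model: a unit-cost random access machine

Registers and array cells hold natural numbers.  The instructions are: constants, addition,
truncated subtraction, reading and writing a cell of an array, sequencing, branching, loops, and
the call of one external subroutine.  There is no multiplication and no bit operation.  A program
is a finite term, so that it mentions finitely many registers, arrays and constants. -/

inductive Cmd : Type
  | skip : Cmd
  /-- `x := v` for a constant `v` -/
  | const (x v : ℕ) : Cmd
  /-- `x := y + z` -/
  | add (x y z : ℕ) : Cmd
  /-- `x := y - z` (zero if `y < z`) -/
  | sub (x y z : ℕ) : Cmd
  /-- `x := a[y]` -/
  | load (x a y : ℕ) : Cmd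
  /-- `a[y] := x` -/
  | store (a y x : ℕ) : Cmd
  | seq (c d : Cmd) : Cmd
  /-- if `x < y` then `c` else `d` -/
  | ite (x y : ℕ) (c d : Cmd) : Cmd
  /-- while `x < y` do `c` -/
  | while (x y : ℕ) (c : Cmd) : Cmd
  /-- hand the first `x` cells of the array `a` over to the subroutine, write the list that it
  returns to the initial cells of the array `b`, and its length to the register `y` -/
  | call (x a b y : ℕ) : Cmd

structure State : Type where
  reg : ℕ → ℕ
  arr : ℕ → ℕ → ℕ

namespace State

def setReg (σ : State) (x v : ℕ) : State :=
  { σ with reg := Function.update σ.reg x v }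

def setCell (σ : State) (a i v : ℕ) : State :=
  { σ with arr := Function.update σ.arr a (Function.update (σ.arr a) i v) }

/-- The first `k` cells of the array `a`. -/
def read (σ : State) (a k : ℕ) : List ℕ :=
  (List.range k).map (σ.arr a)

/-- Overwrite the initial cells of the array `a` by the list `l`. -/
def write (σ : State) (a : ℕ) (l : List ℕ) : State :=
  { σ with arr := Function.update σ.arr a (fun i => l.getD i (σ.arr a i)) }

/-- Initial state: the `k`-th array holds the `k`-th input list, the `k`-th register its length,
and everything else is zero. -/
def init (L : List (List ℕ)) : State where
  reg k := (L.getD k []).length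
  arr k i := (L.getD k []).getD i 0

/-- The output is the list in array `0`; its length is in register `0`. -/
def output (σ : State) : List ℕ := σ.read 0 (σ.reg 0)

end State

/-- `Exec S c σ σ' t`: the program `c`, started in the state `σ`, halts in the state `σ'` after
`t` steps.  Here `S l l' u` says that the subroutine turns the list `l` into the list `l'` in `u`
steps; a call costs these steps and those for handing over both lists. -/
inductive Exec (S : List ℕ → List ℕ → ℕ → Prop) : Cmd → State → State → ℕ → Prop
  | skip (σ) : Exec S .skip σ σ 1
  | const (σ x v) : Exec S (.const x v) σ (σ.setReg x v) 1
  | add (σ x y z) : Exec S (.add x y z) σ (σ.setReg x (σ.reg y + σ.reg z)) 1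
  | sub (σ x y z) : Exec S (.sub x y z) σ (σ.setReg x (σ.reg y - σ.reg z)) 1
  | load (σ x a y) : Exec S (.load x a y) σ (σ.setReg x (σ.arr a (σ.reg y))) 1
  | store (σ a y x) : Exec S (.store a y x) σ (σ.setCell a (σ.reg y) (σ.reg x)) 1
  | seq {c d σ σ' σ'' t t'} (hc : Exec S c σ σ' t) (hd : Exec S d σ' σ'' t') :
      Exec S (.seq c d) σ σ'' (t + t')
  | iteTrue {x y c d σ σ' t} (h : σ.reg x < σ.reg y) (hc : Exec S c σ σ' t) :
      Exec S (.ite x y c d) σ σ' (t + 1)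
  | iteFalse {x y c d σ σ' t} (h : ¬ σ.reg x < σ.reg y) (hd : Exec S d σ σ' t) :
      Exec S (.ite x y c d) σ σ' (t + 1)
  | whileTrue {x y c σ σ' σ'' t t'} (h : σ.reg x < σ.reg y) (hc : Exec S c σ σ' t)
      (hw : Exec S (.while x y c) σ' σ'' t') :
      Exec S (.while x y c) σ σ'' (t + t' + 1)
  | whileFalse {x y c σ} (h : ¬ σ.reg x < σ.reg y) : Exec S (.while x y c) σ σ 1
  | call {x a b y σ l t} (h : S (σ.read a (σ.reg x)) l t) :
      Exec S (.call x a b y) σ ((σ.write b l).setReg y l.length)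
        (1 + σ.reg x + l.length + t)

/-- The program `c` turns the input lists `L` into the output list `out` in exactly `t` steps. -/
def Runs (S : List ℕ → List ℕ → ℕ → Prop) (c : Cmd) (L : List (List ℕ)) (out : List ℕ)
    (t : ℕ) : Prop :=
  ∃ σ', Exec S c (State.init L) σ' t ∧ σ'.output = out

/-- No subroutine (a call never returns). -/
def noSub : List ℕ → List ℕ → ℕ → Prop := fun _ _ _ => False

/-- The program `c` as a subroutine, run in a memory of its own, in which the fixed data `desc`
are available besides the list that is handed over. -/
def asSub (c : Cmd) (desc : List (List ℕ)) : List ℕ → List ℕ → ℕ → Prop :=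
  fun l l' t => Runs noSub c (l :: desc) l' t

/-! ## Codes -/

open Classical in
/-- Minimum distance of a linear code. -/
noncomputable def minDist {F ι : Type} [Field F] [Fintype ι] (C : Submodule F (ι → F)) : ℕ :=
  sInf {d | ∃ c ∈ C, c ≠ 0 ∧ hammingNorm c = d}

open Classical in
/-- Half minimum distance decoder: the codeword at distance less than half the minimum distance
(it is unique if it exists), and the zero codeword if there is none. -/
noncomputable def halfMinDistDecode {F ι : Type} [Field F] [Fintype ι] (C : Submodule F (ι → F))
    (w : ι → F) : ι → F :=
  if h : ∃ c ∈ C, 2 * hammingDist w c < minDist C then h.choose else 0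

/-- Data of a generalized Reed-Solomon code of length `Δ` and dimension `k`. -/
structure GRS (F : Type) [Field F] (Δ : ℕ) where
  k : ℕ
  k_pos : 0 < k
  k_le : k ≤ Δ
  /-- code locators -/
  loc : Fin Δ → F
  loc_injective : Function.Injective loc
  /-- column multipliers -/
  mult : Fin Δ → F
  mult_ne_zero : ∀ j, mult j ≠ 0

/-- The code of all words `(mult j * f (loc j))_j`, where `f` is a polynomial of degree `< k`. -/
noncomputable def GRS.code {F : Type} [Field F] {Δ : ℕ} (G : GRS F Δ) :
    Submodule F (Fin Δ → F) :=
  (Polynomial.degreeLT F G.k).map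
    (LinearMap.pi fun j => G.mult j • Polynomial.leval (G.loc j))

/-- A `Δ`-regular bipartite graph (without multiple edges) with `n` vertices on each side `A`, `B`
and with an ordering of the edges at each vertex.  The edge set is `Fin n × Fin Δ`: the edge
`(u, j)` is the `j`-th edge at `u ∈ A`, and `rot (u, j) = (v, i)` says that it is the `i`-th edge
at `v ∈ B`. -/
structure BipGraph (n Δ : ℕ) where
  rot : Fin n × Fin Δ ≃ Fin n × Fin Δ
  simple : ∀ u, Function.Injective fun j => (rot (u, j)).1

namespace BipGraph

variable {n Δ : ℕ} (G : BipGraph n Δ)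

/-- The underlying graph on `A ∪ B`. -/
def graph : SimpleGraph (Fin n ⊕ Fin n) :=
  SimpleGraph.fromRel fun x y => ∃ u j, x = Sum.inl u ∧ y = Sum.inr (G.rot (u, j)).1

open Classical in
/-- The second largest eigenvalue of the adjacency matrix (counted with multiplicity). -/
noncomputable def secondEigenvalue : ℝ :=
  if h : 1 < Fintype.card (Fin n ⊕ Fin n) then
    (G.graph.isHermitian_adjMatrix ℝ).eigenvalues₀ ⟨1, h⟩
  else 0

/-- The second largest eigenvalue divided by the degree. -/
noncomputable def gamma : ℝ := G.secondEigenvalue / Δ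

end BipGraph

/-! ## The expander code of Roth and Skachek and its decoder -/

structure OuterCode (F : Type) [Field F] (n Δ : ℕ) where
  G : BipGraph n Δ
  connected : G.graph.Connected
  CA : GRS F Δ
  CB : GRS F Δ
  /-- the linear one-to-one mapping of the alphabet `Φ = F ^ k_A` onto the code `C_A` -/
  encA : (Fin CA.k → F) ≃ₗ[F] CA.code

namespace OuterCode

variable {F : Type} [Field F] {n Δ : ℕ} (O : OuterCode F n Δ)

/-- The alphabet of the outer code. -/
abbrev Phi : Type := Fin O.CA.k → F

/-- The subword on the edges at the vertex `u ∈ A`. -/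
def wordA (z : Fin n × Fin Δ → F) (u : Fin n) : Fin Δ → F := fun j => z (u, j)

/-- The subword on the edges at the vertex `v ∈ B`. -/
def wordB (z : Fin n × Fin Δ → F) (v : Fin n) : Fin Δ → F := fun i => z (O.G.rot.symm (v, i))

/-- The code of length `Δ n` over `F`. -/
def edgeCode : Set (Fin n × Fin Δ → F) :=
  {c | (∀ u, wordA c u ∈ O.CA.code) ∧ ∀ v, O.wordB c v ∈ O.CB.code}

/-- The mapping `ψ`, which sends `c` to the family of the preimages of its subwords at `A`. -/
noncomputable def psi (c : O.edgeCode) : Fin n → O.Phi :=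
  fun u => O.encA.symm ⟨wordA c.1 u, c.2.1 u⟩

/-- The code of length `n` over `Φ`. -/
def code : Set (Fin n → O.Phi) := Set.range O.psi

/-- Relative minimum distances of the constituent codes. -/
noncomputable def deltaA : ℝ := minDist O.CA.code / Δ

noncomputable def deltaB : ℝ := minDist O.CB.code / Δ

/-- Rates of the constituent codes. -/
noncomputable def rateA : ℝ := O.CA.k / Δ

noncomputable def rateB : ℝ := O.CB.k / Δ

/-- The fraction of errors that the decoder is designed to correct. -/
noncomputable def beta : ℝ :=
  (O.deltaB / 2 - O.G.gamma * √(O.deltaB / O.deltaA)) / (1 - O.G.gamma)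

/-- One round of decoding at all the vertices of `A`. -/
noncomputable def stepA (z : Fin n × Fin Δ → F) : Fin n × Fin Δ → F :=
  fun e => halfMinDistDecode O.CA.code (wordA z e.1) e.2

/-- One round of decoding at all the vertices of `B`. -/
noncomputable def stepB (z : Fin n × Fin Δ → F) : Fin n × Fin Δ → F :=
  fun e => halfMinDistDecode O.CB.code (O.wordB z (O.G.rot e).1) (O.G.rot e).2

/-- The content of the edges after `i` rounds; odd rounds decode at `B`, even rounds at `A`. -/
noncomputable def iter (x : Fin n → O.Phi) : ℕ → Fin n × Fin Δ → F
  | 0 => fun e => (O.encA (x e.1)).1 e.2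
  | i + 1 => if Even (i + 1) then O.stepA (iter x i) else O.stepB (iter x i)

open Classical in
/-- The iterative decoder with `m` rounds; `none` is the declaration of an error. -/
noncomputable def decode (m : ℕ) (x : Fin n → O.Phi) : Option (Fin n → O.Phi) :=
  if h : O.iter x m ∈ O.edgeCode then some (O.psi ⟨O.iter x m, h⟩) else none

end OuterCode

/-! ## Concatenation with a binary inner code -/

structure ConcatCode (F : Type) [Field F] [Algebra (ZMod 2) F] (n Δ : ℕ) where
  O : OuterCode F n Δ
  nin : ℕ
  Cin : Submodule (ZMod 2) (Fin nin → ZMod 2)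
  /-- the linear one-to-one mapping of `Φ` onto the inner code -/
  enc0 : O.Phi ≃ₗ[ZMod 2] Cin
  /-- the decoder of the inner code -/
  decIn : (Fin nin → ZMod 2) → Cin

namespace ConcatCode

variable {F : Type} [Field F] [Algebra (ZMod 2) F] {n Δ : ℕ} (K : ConcatCode F n Δ)

/-- Words of length `n * nin`, as `n` blocks of length `nin`. -/
abbrev Word : Type := Fin n → Fin K.nin → ZMod 2

/-- The concatenated code. -/
def code : Set K.Word := {w | ∃ x ∈ K.O.code, w = fun i => (K.enc0 (x i)).1}

/-- Length of the concatenated code. -/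
def length : ℕ := n * K.nin

/-- Rate of the inner code. -/
noncomputable def rateIn : ℝ := Module.finrank (ZMod 2) K.Cin / K.nin

/-- The decoder of the concatenated code, whose outer decoder makes `m` rounds. -/
noncomputable def decode (m : ℕ) (y : K.Word) : Option K.Word :=
  (K.O.decode m fun i => K.enc0.symm (K.decIn (y i))).map fun z i => (K.enc0 (z i)).1

open Classical in
/-- For some codeword, the inner decoder fails on at most `τ β n` of the `n` blocks of `y`. -/
def Correctable (τ : ℝ) (y : K.Word) : Prop :=
  ∃ w ∈ K.code,
    ((Finset.univ.filter fun i => (K.decIn (y i)).1 ≠ w i).card : ℝ) ≤ τ * K.O.beta * n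

end ConcatCode

/-! ## Input and output of the decoding programs -/

/-- A binary word as a list of zeros and ones. -/
def bits {k : ℕ} (w : Fin k → ZMod 2) : List ℕ := List.ofFn fun i => (w i).val

/-- The concatenation of the lists `f 0`, …, `f (k - 1)`. -/
def blocks {k : ℕ} (f : Fin k → List ℕ) : List ℕ := (List.ofFn f).flatten

/-- The coordinates of an element of the field with respect to a basis over `ZMod 2`. -/
noncomputable def coords {F : Type} [Field F] [Algebra (ZMod 2) F] {ℓ : ℕ}
    (b : Module.Basis (Fin ℓ) (ZMod 2) F) (x : F) : List ℕ := bits (b.repr x)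

/-- What a decoding program finds in its arrays: the received word; the numerical parameters; the
graph, with the edges at `B` numbered like those at `A`; the multiplication of `F` in terms of a
basis over `ZMod 2`, and its unit; the data of the two constituent codes; the matrices of the two
linear mappings `encA` and `enc0`. -/
noncomputable def ConcatCode.input {F : Type} [Field F] [Algebra (ZMod 2) F] {n Δ ℓ : ℕ}
    (K : ConcatCode F n Δ) (b : Module.Basis (Fin ℓ) (ZMod 2) F) (m : ℕ) (y : K.Word) :
    List (List ℕ) :=
  [ blocks fun i => bits (y i),
    [n, Δ, ℓ, K.O.CA.k, K.O.CB.k, K.nin, m],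
    blocks fun u => List.ofFn fun j => (K.O.G.rot (u, j)).1 * Δ + (K.O.G.rot (u, j)).2,
    blocks fun i => blocks fun j => coords b (b i * b j),
    coords b 1,
    blocks fun j => coords b (K.O.CA.loc j),
    blocks fun j => coords b (K.O.CA.mult j),
    blocks fun j => coords b (K.O.CB.loc j),
    blocks fun j => coords b (K.O.CB.mult j),
    blocks fun i => blocks fun j => coords b ((K.O.encA (Pi.single i 1)).1 j),
    blocks fun i => blocks fun t => bits (K.enc0 (Pi.single i (b t))).1 ]

/-- The output is the list of the bits of the codeword, or the empty list for an error. -/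
def ConcatCode.output {F : Type} [Field F] [Algebra (ZMod 2) F] {n Δ : ℕ}
    (K : ConcatCode F n Δ) : Option K.Word → List ℕ
  | none => []
  | some w => blocks fun i => bits (w i)

/-! ## Parameters -/

/-- Capacity of the binary symmetric channel with crossover probability `p`. -/
noncomputable def bscCapacity (p : ℝ) : ℝ := 1 - Real.binEntropy p / Real.log 2

/-- Dense sequences of values. -/
def IsDenseSeq (a : ℕ → ℝ) : Prop :=
  a 0 ≤ 100 ∧ Filter.Tendsto a Filter.atTop Filter.atTop ∧
    (fun i => a (i + 1) - a i) =o[Filter.atTop] a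

/-- `q` is the smallest term of the sequence `φ` of alphabet sizes with `log₂ q ≥ X`. -/
def IsSmallestAlphabet (φ : ℕ → ℕ) (X : ℝ) (q : ℕ) : Prop :=
  (∃ i, φ i = q) ∧ X ≤ Real.logb 2 q ∧ ∀ j, X ≤ Real.logb 2 (φ j) → q ≤ φ j

/-!
The decoder of the outer code can be run so that its cost is proportional to the number of symbols
that change, and a word with few errors changes few symbols.

*Expansion.* Let `c` be a codeword. A vertex is in error after a round if it then carries a word
that differs from that of `c`. A vertex in error sees at least half the minimum distance of
erroneous edges, and the opposite ends of these edges were in error before. The expander mixing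
lemma (`BipGraph.mixing`), with weights `√δ_A` and `√δ_B` on the two sides, turns this into the
recursion `y (i + 1) * (1 - θ * y i) ≤ g / 2 * (y i + y (i + 1))` for the weighted numbers `y i` of
vertices in error (`OuterCode.round_le`). If `y 0` is at most `τ` times the fixed point of the
recursion, which is what at most `τ β n` errors give, then `y` decays and its sum over all the
rounds is `O(n)` (`sum_le_of_contraction`, `OuterCode.sum_err_le`). Hence in all the rounds together
the edges change `O(n Δ)` times, with a constant that depends only on `τ` (`OuterCode.changes_le`).
For an arbitrary word there is the trivial bound `m n Δ` (`OuterCode.changes_le_mul`).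

*The queue.* A vertex whose edges hold a codeword is not affected by its constituent decoder. So
after the first round only those vertices have to be decoded that lie on an edge which the preceding
round has changed (`OuterCode.partialStep_eq_step`). The program keeps them in a queue, one entry
for each change, and stops when a round adds nothing, since then no later round changes anything.
The number of vertices decoded is at most `n` plus the number of changes, so that the time is linear
in `n` for a correctable word and at most `m + 1` times that otherwise. The second program stops
with an error as soon as the length of the queue exceeds `κ Δ n`, where the constant `κ` depends
only on `τ`. A correctable word never gets there (`queueEnd_le_of_correctable`).

*Decoding one vertex.* All that is needed here is a time polynomial in `Δ`, `ℓ` and `n_in`, so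
everything is reduced to Gaussian elimination over the field with two elements: elements of the
field are vectors of bits, and multiplication by a known element is linear in the bits. A
generalized Reed-Solomon code is decoded by a linear system for an error locator
(`GRS.locator_spec`) and a second one for the codeword, given the zeros of the locator. A final test
of the distance decides between this candidate and the zero word (`grsDecode_spec`). The passage
between the blocks of the inner code and the words of `C_A` is again a linear system.

*The machine.* The programs are written in a small language of expressions and bounded loops
(`Prog`) with a denotational semantics (`Prog.run`), a syntactic bound for the time (`Prog.bnd`),
and a compiler to the random access machine (`Prog.halts`). For a fixed program whose loops are
bounded by the sizes of the constituent codes this time is a polynomial in these sizes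
(`exists_cheap`). Only the loops over the rounds and over the calls of the inner decoder are written
for the machine directly.

*The parameters.* As the alphabet sizes are dense, the alphabet chosen has at most `2 / (κ ε) ^ h₀ +
M` bits (`IsDenseSeq.logb_le`), with `κ` now the parameter of the theorem. Since the rates of `C_A`
and of the inner code are bounded below, this bounds `Δ`, `ℓ` and `n_in` as well
(`ConcatCode.size_le`), so that the time for one vertex is polynomial in `1 / ε`.
-/

/-! ### Execution with a time bound -/

/-- Within `T` steps the program `c` takes the state `σ` to a state with the property `Q`. -/
def Halts (S : List ℕ → List ℕ → ℕ → Prop) (c : Cmd) (σ : State) (T : ℕ) (Q : State → Prop) :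
    Prop :=
  ∃ σ' t, Exec S c σ σ' t ∧ t ≤ T ∧ Q σ'

namespace Halts

variable {S : List ℕ → List ℕ → ℕ → Prop} {c d : Cmd} {σ : State} {T T' T₁ T₂ : ℕ}
  {P Q : State → Prop}

theorem mono (h : Halts S c σ T P) (hT : T ≤ T') (hQ : ∀ σ', P σ' → Q σ') :
    Halts S c σ T' Q := by
  obtain ⟨σ', t, h1, h2, h3⟩ := h
  exact ⟨σ', t, h1, h2.trans hT, hQ _ h3⟩

theorem seq (h : Halts S c σ T₁ P) (h' : ∀ σ', P σ' → Halts S d σ' T₂ Q) :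
    Halts S (.seq c d) σ (T₁ + T₂) Q := by
  obtain ⟨σ', t, h1, h2, h3⟩ := h
  obtain ⟨σ'', t', h4, h5, h6⟩ := h' _ h3
  exact ⟨σ'', t + t', .seq h1 h4, by omega, h6⟩

theorem skip (h : Q σ) : Halts S .skip σ 1 Q := ⟨_, _, .skip σ, le_rfl, h⟩

theorem const {x v : ℕ} (h : Q (σ.setReg x v)) : Halts S (.const x v) σ 1 Q :=
  ⟨_, _, .const .., le_rfl, h⟩

theorem add {x y z : ℕ} (h : Q (σ.setReg x (σ.reg y + σ.reg z))) : Halts S (.add x y z) σ 1 Q :=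
  ⟨_, _, .add .., le_rfl, h⟩

theorem sub {x y z : ℕ} (h : Q (σ.setReg x (σ.reg y - σ.reg z))) : Halts S (.sub x y z) σ 1 Q :=
  ⟨_, _, .sub .., le_rfl, h⟩

theorem load {x a y : ℕ} (h : Q (σ.setReg x (σ.arr a (σ.reg y)))) : Halts S (.load x a y) σ 1 Q :=
  ⟨_, _, .load .., le_rfl, h⟩

theorem store {x a y : ℕ} (h : Q (σ.setCell a (σ.reg y) (σ.reg x))) :
    Halts S (.store a y x) σ 1 Q :=
  ⟨_, _, .store .., le_rfl, h⟩

theorem const_seq {x v : ℕ} (h : Halts S d (σ.setReg x v) T Q) :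
    Halts S (.seq (.const x v) d) σ (1 + T) Q :=
  (Halts.const (Q := fun σ' => σ' = σ.setReg x v) rfl).seq fun _ e => e ▸ h

theorem add_seq {x y z : ℕ} (h : Halts S d (σ.setReg x (σ.reg y + σ.reg z)) T Q) :
    Halts S (.seq (.add x y z) d) σ (1 + T) Q :=
  (Halts.add (Q := fun σ' => σ' = σ.setReg x (σ.reg y + σ.reg z)) rfl).seq fun _ e => e ▸ h

theorem ite {x y : ℕ} (h₁ : σ.reg x < σ.reg y → Halts S c σ T₁ Q)
    (h₂ : ¬ σ.reg x < σ.reg y → Halts S d σ T₂ Q) : Halts S (.ite x y c d) σ (T₁ + T₂ + 1) Q := by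
  by_cases h : σ.reg x < σ.reg y
  · obtain ⟨σ', t, h1, h2, h3⟩ := h₁ h
    exact ⟨σ', t + 1, .iteTrue h h1, by omega, h3⟩
  · obtain ⟨σ', t, h1, h2, h3⟩ := h₂ h
    exact ⟨σ', t + 1, .iteFalse h h1, by omega, h3⟩

/-- A loop whose counter `x` runs up to the value `N` of `y`, with an invariant `I`. -/
theorem count {x y N : ℕ} (I : ℕ → State → Prop)
    (hI : ∀ i τ, I i τ → τ.reg x = i ∧ τ.reg y = N)
    (hc : ∀ i τ, i < N → I i τ → Halts S c τ T (I (i + 1))) (h : I 0 σ) :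
    Halts S (.while x y c) σ (N * (T + 1) + 1) (I N) := by
  suffices H : ∀ k i σ, i + k = N → I i σ → Halts S (.while x y c) σ (k * (T + 1) + 1) (I N) from
    H N 0 σ (by omega) h
  intro k
  induction k with
  | zero =>
    intro i σ hi h
    obtain rfl : i = N := by omega
    obtain ⟨h1, h2⟩ := hI _ _ h
    exact ⟨σ, 1, .whileFalse (by omega), by omega, h⟩
  | succ k ih =>
    intro i σ hi h
    obtain ⟨h1, h2⟩ := hI _ _ h
    obtain ⟨σ', t, e1, e2, e3⟩ := hc i σ (by omega) h
    obtain ⟨σ'', t', e4, e5, e6⟩ := ih (i + 1) σ' (by omega) e3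
    refine ⟨σ'', t + t' + 1, .whileTrue (by omega) e1 e4, ?_, e6⟩
    have : (k + 1) * (T + 1) = k * (T + 1) + T + 1 := by ring
    omega

end Halts

/-! ### A language of bounded loops and its compilation -/

/-- `rpt f n s` is the result of the updates `f 0`, …, `f (n - 1)`, in this order. -/
def rpt {α : Type} (f : ℕ → α → α) : ℕ → α → α
  | 0, s => s
  | n + 1, s => f n (rpt f n s)

/-- The ways to accumulate values: their sum, the parity of the number of nonzero ones, and the
last nonzero one. -/
inductive Fold : Type
  | sum | parity | last

/-- The update of an accumulated value `s` by a new value `v`. -/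
def Fold.upd : Fold → ℕ → ℕ → ℕ
  | .sum, s, v => s + v
  | .parity, s, v => if 0 < v then 1 - s else s
  | .last, s, v => if 0 < v then v else s

/-- Expressions.  Variables and arrays are numbered; `mul e r` multiplies by a variable, and
`fold o x r e` accumulates the values of `e` for `x = 0, …, r - 1`, where `x` is a bound
variable.  The machine cannot multiply, so that `mul` counts as a loop of length `r`. -/
inductive Exp : Type
  | var (x : ℕ)
  | lit (v : ℕ)
  | add (e f : Exp)
  | sub (e f : Exp)
  | mul (e : Exp) (r : ℕ)
  | get (a : ℕ) (e : Exp)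
  | ite (e f g h : Exp)
  | fold (o : Fold) (x r : ℕ) (e : Exp)

/-- Programs, all of which terminate: `loop x r p` runs `p` for `x = 0, …, r - 1`, where `r` is
evaluated at the beginning, and restores `x` afterwards. -/
inductive Prog : Type
  | assign (x : ℕ) (e : Exp)
  | store (a : ℕ) (i e : Exp)
  | seq (p q : Prog)
  | ite (e f : Exp) (p q : Prog)
  | loop (x r : ℕ) (p : Prog)

namespace Exp

def eval : Exp → State → ℕ
  | var x, σ => σ.reg x
  | lit v, _ => v
  | add e f, σ => e.eval σ + f.eval σ
  | sub e f, σ => e.eval σ - f.eval σ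
  | mul e r, σ => e.eval σ * σ.reg r
  | get a e, σ => σ.arr a (e.eval σ)
  | ite e f g h, σ => if e.eval σ < f.eval σ then g.eval σ else h.eval σ
  | fold o x r e, σ => rpt (fun i s => o.upd s (e.eval (σ.setReg x i))) (σ.reg r) 0

/-- The variables that bound the loops in an expression. -/
def lims : Exp → List ℕ
  | var _ | lit _ => []
  | add e f | sub e f => e.lims ++ f.lims
  | mul e r => r :: e.lims
  | get _ e => e.lims
  | ite e f g h => e.lims ++ (f.lims ++ (g.lims ++ h.lims))
  | fold _ _ r e => r :: e.lims

/-- The bound variables of an expression. -/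
def bv : Exp → List ℕ
  | var _ | lit _ => []
  | add e f | sub e f => e.bv ++ f.bv
  | mul e _ => e.bv
  | get _ e => e.bv
  | ite e f g h => e.bv ++ (f.bv ++ (g.bv ++ h.bv))
  | fold _ x _ e => x :: e.bv

/-- A bound for the running time, in terms of the values of the variables that bound the loops. -/
def bnd (L : ℕ → ℕ) : Exp → ℕ
  | var _ => 2
  | lit _ => 1
  | add e f | sub e f => e.bnd L + f.bnd L + 1
  | mul e r => e.bnd L + (L r * 3 + 6)
  | get _ e => e.bnd L + 1
  | ite e f g h => e.bnd L + f.bnd L + g.bnd L + h.bnd L + 1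
  | fold _ _ r e => L r * (e.bnd L + 10) + 7

end Exp

/-- The update of the value at depth `d` by the value at depth `v`, in the odd registers. -/
def Fold.code (o : Fold) (d v : ℕ) : Cmd :=
  match o with
  | .sum => .add (2 * d + 1) (2 * d + 1) (2 * v + 1)
  | .parity => .seq (.const (2 * (v + 1) + 1) 0) (.ite (2 * (v + 1) + 1) (2 * v + 1)
      (.seq (.const (2 * (v + 1) + 1) 1) (.sub (2 * d + 1) (2 * (v + 1) + 1) (2 * d + 1))) .skip)
  | .last => .seq (.const (2 * (v + 1) + 1) 0) (.ite (2 * (v + 1) + 1) (2 * v + 1)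
      (.add (2 * d + 1) (2 * v + 1) (2 * (v + 1) + 1)) .skip)

/-- `x := y`, by means of the auxiliary register `z`. -/
def Cmd.copy (x y z : ℕ) : Cmd := .seq (.const z 0) (.add x y z)

/-- Compilation: the variable `x` lives in the register `2 * x`, and the odd registers from
`2 * d + 1` on are used for intermediate results; the value of the expression ends up in the first
of them. -/
def Exp.code : Exp → ℕ → Cmd
  | var x, d => .copy (2 * d + 1) (2 * x) (2 * d + 1)
  | lit v, d => .const (2 * d + 1) v
  | add e f, d => .seq (e.code d) (.seq (f.code (d + 1))
      (.add (2 * d + 1) (2 * d + 1) (2 * (d + 1) + 1)))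
  | sub e f, d => .seq (e.code d) (.seq (f.code (d + 1))
      (.sub (2 * d + 1) (2 * d + 1) (2 * (d + 1) + 1)))
  | mul e r, d => .seq (e.code d) (.seq (.const (2 * (d + 1) + 1) 0)
      (.seq (.const (2 * (d + 2) + 1) 0) (.seq (.const (2 * (d + 3) + 1) 1)
      (.seq (.while (2 * (d + 2) + 1) (2 * r)
        (.seq (.add (2 * (d + 1) + 1) (2 * (d + 1) + 1) (2 * d + 1))
          (.add (2 * (d + 2) + 1) (2 * (d + 2) + 1) (2 * (d + 3) + 1))))
        (.copy (2 * d + 1) (2 * (d + 1) + 1) (2 * (d + 2) + 1))))))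
  | get a e, d => .seq (e.code d) (.load (2 * d + 1) a (2 * d + 1))
  | ite e f g h, d => .seq (e.code d) (.seq (f.code (d + 1))
      (.ite (2 * d + 1) (2 * (d + 1) + 1) (g.code d) (h.code d)))
  | fold o x r e, d => .seq (.const (2 * d + 1) 0) (.seq (.const (2 * (d + 1) + 1) 0)
      (.seq (.add (2 * (d + 2) + 1) (2 * r) (2 * d + 1))
      (.seq (.add (2 * (d + 3) + 1) (2 * x) (2 * d + 1))
      (.seq (.while (2 * (d + 1) + 1) (2 * (d + 2) + 1)
        (.seq (.copy (2 * x) (2 * (d + 1) + 1) (2 * (d + 4) + 1))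
        (.seq (e.code (d + 4)) (.seq (o.code d (d + 4)) (.seq (.const (2 * (d + 4) + 1) 1)
          (.add (2 * (d + 1) + 1) (2 * (d + 1) + 1) (2 * (d + 4) + 1)))))))
        (.copy (2 * x) (2 * (d + 3) + 1) (2 * (d + 4) + 1))))))

namespace Prog

def run : Prog → State → State
  | assign x e, σ => σ.setReg x (e.eval σ)
  | store a i e, σ => σ.setCell a (i.eval σ) (e.eval σ)
  | seq p q, σ => q.run (p.run σ)
  | ite e f p q, σ => if e.eval σ < f.eval σ then p.run σ else q.run σ
  | loop x r p, σ => (rpt (fun i τ => p.run (τ.setReg x i)) (σ.reg r) σ).setReg x (σ.reg x)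

/-- The variables that bound the loops in a program, multiplications included. -/
def lims : Prog → List ℕ
  | assign _ e => e.lims
  | store _ i e => i.lims ++ e.lims
  | seq p q => p.lims ++ q.lims
  | ite e f p q => e.lims ++ (f.lims ++ (p.lims ++ q.lims))
  | loop _ r p => r :: p.lims

/-- The variables that may change while the program runs. -/
def wv : Prog → List ℕ
  | assign x e => x :: e.bv
  | store _ i e => i.bv ++ e.bv
  | seq p q => p.wv ++ q.wv
  | ite e f p q => e.bv ++ (f.bv ++ (p.wv ++ q.wv))
  | loop x _ p => x :: p.wv

/-- The variables to which the program assigns. -/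
def asgn : Prog → List ℕ
  | assign x _ => [x]
  | store _ _ _ => []
  | seq p q => p.asgn ++ q.asgn
  | ite _ _ p q => p.asgn ++ q.asgn
  | loop _ _ p => p.asgn

/-- The arrays to which the program writes. -/
def wa : Prog → List ℕ
  | assign _ _ => []
  | store a _ _ => [a]
  | seq p q => p.wa ++ q.wa
  | ite _ _ p q => p.wa ++ q.wa
  | loop _ _ p => p.wa

/-- A bound for the running time, where `L` gives the values of the variables that bound loops. It
is a polynomial in these values. -/
def bnd (L : ℕ → ℕ) : Prog → ℕ
  | assign _ e => e.bnd L + 2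
  | store _ i e => i.bnd L + e.bnd L + 1
  | seq p q => p.bnd L + q.bnd L
  | ite e f p q => e.bnd L + f.bnd L + p.bnd L + q.bnd L + 1
  | loop _ r p => L r * (p.bnd L + 5) + 6

/-- Compilation.  The auxiliary registers with index less than `d` are preserved: enclosing loops
keep their counters there. -/
def code : Prog → ℕ → Cmd
  | assign x e, d => .seq (e.code d) (.copy (2 * x) (2 * d + 1) (2 * (d + 1) + 1))
  | store a i e, d => .seq (i.code d) (.seq (e.code (d + 1))
      (.store a (2 * d + 1) (2 * (d + 1) + 1)))
  | seq p q, d => .seq (p.code d) (q.code d)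
  | ite e f p q, d => .seq (e.code d) (.seq (f.code (d + 1))
      (.ite (2 * d + 1) (2 * (d + 1) + 1) (p.code d) (q.code d)))
  | loop x r p, d => .seq (.const (2 * d + 1) 0) (.seq (.add (2 * (d + 1) + 1) (2 * r) (2 * d + 1))
      (.seq (.add (2 * (d + 2) + 1) (2 * x) (2 * d + 1))
      (.seq (.while (2 * d + 1) (2 * (d + 1) + 1)
        (.seq (.copy (2 * x) (2 * d + 1) (2 * (d + 3) + 1))
        (.seq (p.code (d + 3)) (.seq (.const (2 * (d + 3) + 1) 1)
          (.add (2 * d + 1) (2 * d + 1) (2 * (d + 3) + 1))))))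
        (.copy (2 * x) (2 * (d + 2) + 1) (2 * (d + 3) + 1)))))

/-- The variables that bound loops do not change. -/
def Ok (p : Prog) : Prop := ∀ r ∈ p.lims, r ∉ p.wv

instance (p : Prog) : Decidable p.Ok := by unfold Ok; infer_instance

end Prog

namespace State

@[simp] theorem reg_setReg_self (σ : State) (x v : ℕ) : (σ.setReg x v).reg x = v := by
  simp [setReg]

theorem reg_setReg_of_ne (σ : State) {x y : ℕ} (v : ℕ) (h : y ≠ x) :
    (σ.setReg x v).reg y = σ.reg y := by
  simp [setReg, h]

theorem reg_setReg (σ : State) (x y v : ℕ) :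
    (σ.setReg x v).reg y = if y = x then v else σ.reg y := by
  simp [setReg, Function.update_apply]

@[simp] theorem arr_setReg (σ : State) (x v : ℕ) : (σ.setReg x v).arr = σ.arr := rfl

theorem setReg_setReg_self (σ : State) (x v w : ℕ) : (σ.setReg x v).setReg x w = σ.setReg x w := by
  simp [setReg]

@[simp] theorem setReg_reg (σ : State) (x : ℕ) : σ.setReg x (σ.reg x) = σ := by
  simp [setReg]

end State

/-- The machine state `τ` represents the state `σ` of the variables and arrays. -/
def Sim (σ τ : State) : Prop := (∀ x, τ.reg (2 * x) = σ.reg x) ∧ τ.arr = σ.arr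

/-- The first `d` auxiliary registers agree. -/
def Keep (d : ℕ) (τ τ' : State) : Prop := ∀ i < d, τ'.reg (2 * i + 1) = τ.reg (2 * i + 1)

theorem Keep.trans {d d' : ℕ} {τ τ' τ'' : State} (h : Keep d τ τ') (h' : Keep d' τ' τ'')
    (hd : d ≤ d') : Keep d τ τ'' := fun i hi => (h' i (by omega)).trans (h i hi)

theorem Keep.refl (d : ℕ) (τ : State) : Keep d τ τ := fun _ _ => rfl

theorem Keep.temp {d e v : ℕ} {τ τ' : State} (h : Keep d τ τ') (he : d ≤ e) :
    Keep d τ (τ'.setReg (2 * e + 1) v) := fun i hi => by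
  rw [State.reg_setReg_of_ne _ _ (by omega), h i hi]

theorem Keep.var {d x v : ℕ} {τ τ' : State} (h : Keep d τ τ') :
    Keep d τ (τ'.setReg (2 * x) v) := fun i hi => by
  rw [State.reg_setReg_of_ne _ _ (by omega), h i hi]

theorem Sim.temp {σ τ : State} {e v : ℕ} (h : Sim σ τ) : Sim σ (τ.setReg (2 * e + 1) v) :=
  ⟨fun x => by rw [State.reg_setReg_of_ne _ _ (by omega), h.1], h.2⟩

theorem Sim.var {σ τ : State} {x v : ℕ} (h : Sim σ τ) :
    Sim (σ.setReg x v) (τ.setReg (2 * x) v) :=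
  ⟨fun y => by simp [State.reg_setReg, h.1], h.2⟩

theorem Fold.halts (S : List ℕ → List ℕ → ℕ → Prop) (o : Fold) {d v : ℕ} {σ τ : State}
    (hdv : d < v) (h : Sim σ τ) :
    Halts S (o.code d v) τ 5 fun τ' => Sim σ τ' ∧
      (∀ i < v, i ≠ d → τ'.reg (2 * i + 1) = τ.reg (2 * i + 1)) ∧
      τ'.reg (2 * d + 1) = o.upd (τ.reg (2 * d + 1)) (τ.reg (2 * v + 1)) := by
  cases o with
  | sum =>
    refine (Halts.add ⟨h.temp, fun i _ hi' => ?_, ?_⟩).mono (by omega : 1 ≤ 5) fun _ h => h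
    · rw [State.reg_setReg_of_ne _ _ (by omega)]
    · simp [Fold.upd]
  | parity =>
    refine (Halts.const_seq (T := 4) ((Halts.ite (T₁ := 2) (T₂ := 1) (fun hc => ?_) fun hc => ?_)))
    · refine Halts.const_seq (T := 1) (Halts.sub ⟨h.temp.temp.temp, fun i _ hi' => ?_, ?_⟩)
      · simp only [State.reg_setReg]
        repeat rw [if_neg (by omega)]
      · simp only [State.reg_setReg, if_true] at hc ⊢
        rw [if_neg (by omega)] at hc
        simp [Fold.upd, hc, show ¬ d = v + 1 by omega]
    · refine Halts.skip ⟨h.temp, fun i _ hi' => ?_, ?_⟩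
      · rw [State.reg_setReg_of_ne _ _ (by omega)]
      · simp only [State.reg_setReg, if_true] at hc ⊢
        rw [if_neg (by omega)] at hc
        simp [Fold.upd, hc]
        intro h; omega
  | last =>
    refine (Halts.const_seq (T := 3) ((Halts.ite (T₁ := 1) (T₂ := 1)
      (fun hc => ?_) fun hc => ?_))).mono (by omega) fun _ h => h
    · refine Halts.add ⟨h.temp.temp, fun i _ hi' => ?_, ?_⟩
      · simp only [State.reg_setReg]
        repeat rw [if_neg (by omega)]
      · simp only [State.reg_setReg, if_true] at hc ⊢
        rw [if_neg (by omega)] at hc ⊢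
        simp [Fold.upd, hc]
    · refine Halts.skip ⟨h.temp, fun i _ hi' => ?_, ?_⟩
      · rw [State.reg_setReg_of_ne _ _ (by omega)]
      · simp only [State.reg_setReg, if_true] at hc ⊢
        rw [if_neg (by omega)] at hc
        simp [Fold.upd, hc]
        intro h; omega

theorem Halts.copy {S : List ℕ → List ℕ → ℕ → Prop} {x y z : ℕ} {τ : State} (hyz : y ≠ z)
    {Q : State → Prop} (h : Q ((τ.setReg z 0).setReg x (τ.reg y))) :
    Halts S (.copy x y z) τ 2 Q := by
  refine Halts.const_seq (T := 1) (Halts.add ?_)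
  rwa [State.reg_setReg_self, State.reg_setReg_of_ne _ _ hyz, Nat.add_zero]

theorem Exp.halts (S : List ℕ → List ℕ → ℕ → Prop) (L : ℕ → ℕ) (e : Exp) :
    ∀ (d : ℕ) (σ τ : State), Sim σ τ → (∀ r ∈ e.lims, r ∉ e.bv) →
      (∀ r ∈ e.lims, σ.reg r = L r) →
      Halts S (e.code d) τ (e.bnd L) fun τ' =>
        Sim σ τ' ∧ Keep d τ τ' ∧ τ'.reg (2 * d + 1) = e.eval σ := by
  induction e with
  | var x =>
    intro d σ τ h _ _
    refine Halts.const_seq (T := 1) (Halts.add ⟨h.temp.temp, (Keep.refl d τ).temp le_rfl |>.temp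
      le_rfl, ?_⟩)
    simp [eval, State.reg_setReg, h.1]
    omega
  | lit v =>
    intro d σ τ h _ _
    exact Halts.const ⟨h.temp, (Keep.refl d τ).temp le_rfl, by simp [eval]⟩
  | add e f ihe ihf =>
    intro d σ τ h ho hL
    simp only [lims, bv, List.mem_append] at ho hL
    refine ((ihe d σ τ h (fun r hr h => ho r (.inl hr) (.inl h))
      (fun r hr => hL r (.inl hr))).seq fun τ₁ ⟨h1, k1, v1⟩ =>
      (ihf (d + 1) σ τ₁ h1 (fun r hr h => ho r (.inr hr) (.inr h))
      (fun r hr => hL r (.inr hr))).seq fun τ₂ ⟨h2, k2, v2⟩ => Halts.add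
        ⟨h2.temp, (k1.trans k2 (by omega)).temp le_rfl, ?_⟩).mono (by simp only [bnd]; omega)
        fun _ h => h
    rw [State.reg_setReg_self, k2 d (by omega), v1, v2, eval]
  | sub e f ihe ihf =>
    intro d σ τ h ho hL
    simp only [lims, bv, List.mem_append] at ho hL
    refine ((ihe d σ τ h (fun r hr h => ho r (.inl hr) (.inl h))
      (fun r hr => hL r (.inl hr))).seq fun τ₁ ⟨h1, k1, v1⟩ =>
      (ihf (d + 1) σ τ₁ h1 (fun r hr h => ho r (.inr hr) (.inr h))
      (fun r hr => hL r (.inr hr))).seq fun τ₂ ⟨h2, k2, v2⟩ => Halts.sub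
        ⟨h2.temp, (k1.trans k2 (by omega)).temp le_rfl, ?_⟩).mono (by simp only [bnd]; omega)
        fun _ h => h
    rw [State.reg_setReg_self, k2 d (by omega), v1, v2, eval]
  | mul e r ih =>
    intro d σ τ h ho hL
    simp only [lims, bv, List.mem_cons] at ho hL
    have hr := hL r (.inl rfl)
    refine ((ih d σ τ h (fun r hr h => ho r (.inr hr) h) (fun r hr => hL r (.inr hr))).seq
      fun τ₁ ⟨h1, k1, v1⟩ => ?_)
    refine (Halts.const_seq <| Halts.const_seq <| Halts.const_seq <| (Halts.count (T := 2)
      (N := L r) (fun i τ' => Sim σ τ' ∧ Keep d τ τ' ∧ τ'.reg (2 * d + 1) = e.eval σ ∧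
        τ'.reg (2 * (d + 1) + 1) = e.eval σ * i ∧ τ'.reg (2 * (d + 2) + 1) = i ∧
        τ'.reg (2 * (d + 3) + 1) = 1) ?_ ?_ ?_).seq
        fun τ₂ ⟨h2, k2, v2, v3, v4, v5⟩ => Halts.copy (by omega)
        ⟨h2.temp.temp, (k2.temp (by omega)).temp (by omega), ?_⟩).mono
        (by omega : _ ≤ L r * 3 + 6) fun _ h => h
    · rintro i τ' ⟨a, -, -, -, b, -⟩
      exact ⟨b, by rw [a.1, hr]⟩
    · rintro i τ' hi ⟨a, k, b1, b2, b3, b4⟩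
      refine Halts.add_seq (T := 1) (Halts.add ⟨a.temp.temp, (k.temp (by omega)).temp (by omega),
        ?_, ?_, ?_, ?_⟩) <;>
        simp [State.reg_setReg, b1, b2, b3, b4]
      ring
    · refine ⟨h1.temp.temp.temp, ((k1.temp (by omega)).temp (by omega)).temp (by omega), ?_, ?_⟩ <;>
        simp [State.reg_setReg, v1]
    · simp [eval, v3, hr]
  | get a e ih =>
    intro d σ τ h ho hL
    refine (ih d σ τ h ho hL).seq fun τ₁ ⟨h1, k1, v1⟩ =>
      Halts.load ⟨h1.temp, k1.temp le_rfl, ?_⟩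
    rw [State.reg_setReg_self, v1, h1.2, eval]
  | ite e f g h ihe ihf ihg ihh =>
    intro d σ τ hs ho hL
    simp only [lims, bv, List.mem_append] at ho hL
    refine ((ihe d σ τ hs (fun r hr h => ho r (.inl hr) (.inl h))
      (fun r hr => hL r (.inl hr))).seq fun τ₁ ⟨h1, k1, v1⟩ =>
      (ihf (d + 1) σ τ₁ h1 (fun r hr h => ho r (.inr (.inl hr)) (.inr (.inl h)))
      (fun r hr => hL r (.inr (.inl hr)))).seq fun τ₂ ⟨h2, k2, v2⟩ => Halts.ite
      (T₁ := g.bnd L) (T₂ := h.bnd L) (fun hc => ?_) fun hc => ?_).mono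
        (by simp only [bnd]; omega) fun _ h => h
    · rw [k2 d (by omega), v1, v2] at hc
      refine (ihg d σ τ₂ h2 (fun r hr h => ho r (.inr (.inr (.inl hr))) (.inr (.inr (.inl h))))
        (fun r hr => hL r (.inr (.inr (.inl hr))))).mono le_rfl fun τ₃ ⟨h3, k3, v3⟩ =>
        ⟨h3, (k1.trans k2 (by omega)).trans k3 le_rfl, ?_⟩
      rw [v3, eval, if_pos hc]
    · rw [k2 d (by omega), v1, v2] at hc
      refine (ihh d σ τ₂ h2 (fun r hr h => ho r (.inr (.inr (.inr hr))) (.inr (.inr (.inr h))))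
        (fun r hr => hL r (.inr (.inr (.inr hr))))).mono le_rfl fun τ₃ ⟨h3, k3, v3⟩ =>
        ⟨h3, (k1.trans k2 (by omega)).trans k3 le_rfl, ?_⟩
      rw [v3, eval, if_neg hc]
  | fold o x r e ih =>
    intro d σ τ h ho hL
    simp only [lims, bv, List.mem_cons] at ho hL
    have hr := hL r (.inl rfl)
    refine (Halts.const_seq <| Halts.const_seq <| Halts.add_seq <| Halts.add_seq <|
      (Halts.count (T := e.bnd L + 9) (N := L r) (fun i τ' => (∃ w, Sim (σ.setReg x w) τ') ∧
        Keep d τ τ' ∧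
        τ'.reg (2 * d + 1) = rpt (fun i s => o.upd s (e.eval (σ.setReg x i))) i 0 ∧
        τ'.reg (2 * (d + 1) + 1) = i ∧ τ'.reg (2 * (d + 2) + 1) = L r ∧
        τ'.reg (2 * (d + 3) + 1) = σ.reg x) ?_ ?_ ?_).seq
        fun τ₂ ⟨⟨w, h2⟩, k2, v2, v3, v4, v5⟩ => Halts.copy (by omega)
        ⟨?_, (k2.temp (by omega)).var, ?_⟩).mono (by simp only [bnd]; ring_nf; omega)
        fun _ h => h
    · rintro i τ' ⟨-, -, -, b1, b2, -⟩
      exact ⟨b1, b2⟩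
    · rintro i τ' hi ⟨⟨w, a⟩, k, b1, b2, b3, b4⟩
      have a' : Sim (σ.setReg x i) ((τ'.setReg (2 * (d + 4) + 1) 0).setReg (2 * x) i) := by
        have := (a.temp (e := d + 4) (v := 0)).var (x := x) (v := i)
        rwa [State.setReg_setReg_self] at this
      have hk : ∀ j, j < d + 4 → ((τ'.setReg (2 * (d + 4) + 1) 0).setReg (2 * x) i).reg
          (2 * j + 1) = τ'.reg (2 * j + 1) := fun j hj => by
        rw [State.reg_setReg_of_ne _ _ (by omega), State.reg_setReg_of_ne _ _ (by omega)]
      refine ((Halts.copy (Q := fun σ' => σ' = (τ'.setReg (2 * (d + 4) + 1) 0).setReg (2 * x) i)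
        (by omega) (by rw [b2])).seq ?_).mono (by omega : 2 + (e.bnd L + (5 + 2)) ≤ _) fun _ h => h
      rintro _ rfl
      refine (ih (d + 4) _ _ a' (fun r hr h => ho r (.inr hr) (.inr h)) (fun r hr => ?_)).seq
        fun τ₁ ⟨h1, k1, v1⟩ => (Fold.halts S o (by omega) h1).seq fun τ₂ ⟨h2, k2, v2⟩ =>
          Halts.const_seq (T := 1) <| Halts.add ⟨⟨i, h2.temp.temp⟩, ?_, ?_, ?_, ?_, ?_⟩
      · rw [State.reg_setReg_of_ne _ _ fun h => ho r (.inr hr) (.inl h), hL r (.inr hr)]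
      · intro j hj
        rw [State.reg_setReg_of_ne _ _ (by omega), State.reg_setReg_of_ne _ _ (by omega),
          k2 j (by omega) (by omega), k1 j (by omega), hk j (by omega), k j hj]
      · rw [State.reg_setReg_of_ne _ _ (by omega), State.reg_setReg_of_ne _ _ (by omega), v2,
          k1 d (by omega), v1, hk d (by omega), b1, rpt]
      · rw [State.reg_setReg_self, State.reg_setReg_of_ne _ _ (by omega), State.reg_setReg_self,
          k2 _ (by omega) (by omega), k1 _ (by omega), hk _ (by omega), b2]
      · rw [State.reg_setReg_of_ne _ _ (by omega), State.reg_setReg_of_ne _ _ (by omega),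
          k2 _ (by omega) (by omega), k1 _ (by omega), hk _ (by omega), b3]
      · rw [State.reg_setReg_of_ne _ _ (by omega), State.reg_setReg_of_ne _ _ (by omega),
          k2 _ (by omega) (by omega), k1 _ (by omega), hk _ (by omega), b4]
    · refine ⟨⟨σ.reg x, ?_⟩, ?_, ?_, ?_, ?_, ?_⟩
      · rw [State.setReg_reg]
        exact h.temp.temp.temp.temp
      · exact ((((Keep.refl d τ).temp (by omega)).temp (by omega)).temp (by omega)).temp (by omega)
      · simp [State.reg_setReg, rpt]
      · simp [State.reg_setReg]
      · simp [State.reg_setReg, h.1, hr, show 2 * r ≠ 2 * (d + 1) + 1 by omega,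
          show 2 * r ≠ 2 * d + 1 by omega]
      · simp [State.reg_setReg, h.1, show 2 * x ≠ 2 * (d + 2) + 1 by omega,
          show 2 * x ≠ 2 * (d + 1) + 1 by omega, show 2 * x ≠ 2 * d + 1 by omega]
    · have := (h2.temp (e := d + 4) (v := 0)).var (x := x) (v := σ.reg x)
      rwa [State.setReg_setReg_self, State.setReg_reg, ← v5] at this
    · rw [State.reg_setReg_of_ne _ _ (by omega), State.reg_setReg_of_ne _ _ (by omega), v2, eval,
        hr]

theorem rpt_induction {α : Type} {f : ℕ → α → α} {n : ℕ} (I : ℕ → α → Prop) {s : α} (h0 : I 0 s)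
    (h : ∀ i < n, ∀ s, I i s → I (i + 1) (f i s)) : I n (rpt f n s) := by
  induction n with
  | zero => exact h0
  | succ n ih => exact h n (by omega) _ (ih fun i hi => h i (by omega))

/-- Variables and arrays to which a program does not write keep their values. -/
theorem Prog.frame (p : Prog) : ∀ σ : State, (∀ x, x ∉ p.asgn → (p.run σ).reg x = σ.reg x) ∧
    ∀ a, a ∉ p.wa → (p.run σ).arr a = σ.arr a := by
  induction p with
  | assign x e =>
    refine fun σ => ⟨fun y hy => ?_, fun a _ => rfl⟩
    simp only [asgn, List.mem_singleton] at hy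
    rw [run, State.reg_setReg_of_ne _ _ hy]
  | store a i e =>
    refine fun σ => ⟨fun y hy => rfl, fun b hb => ?_⟩
    simp only [wa, List.mem_singleton] at hb
    simp [run, State.setCell, Function.update_of_ne hb]
  | seq p q ihp ihq =>
    refine fun σ => ⟨fun y hy => ?_, fun a ha => ?_⟩
    · simp only [asgn, List.mem_append, not_or] at hy
      rw [run, (ihq _).1 _ hy.2, (ihp _).1 _ hy.1]
    · simp only [wa, List.mem_append, not_or] at ha
      rw [run, (ihq _).2 _ ha.2, (ihp _).2 _ ha.1]
  | ite e f p q ihp ihq =>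
    refine fun σ => ⟨fun y hy => ?_, fun a ha => ?_⟩
    · simp only [asgn, List.mem_append, not_or] at hy
      rw [run]; split_ifs
      exacts [(ihp _).1 _ hy.1, (ihq _).1 _ hy.2]
    · simp only [wa, List.mem_append, not_or] at ha
      rw [run]; split_ifs
      exacts [(ihp _).2 _ ha.1, (ihq _).2 _ ha.2]
  | loop x r p ih =>
    intro σ
    have := rpt_induction (f := fun i τ => p.run (τ.setReg x i)) (n := σ.reg r) (s := σ)
      (fun _ τ => (∀ y, y ∉ p.asgn → y ≠ x → τ.reg y = σ.reg y) ∧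
        ∀ a, a ∉ p.wa → τ.arr a = σ.arr a) ⟨fun _ _ _ => rfl, fun _ _ => rfl⟩
      fun i _ s ⟨h1, h2⟩ => ⟨fun y hy hx => by
        rw [(ih _).1 _ hy, State.reg_setReg_of_ne _ _ hx, h1 y hy hx], fun a ha => by
        rw [(ih _).2 _ ha, State.arr_setReg, h2 a ha]⟩
    refine ⟨fun y hy => ?_, fun a ha => ?_⟩
    · rw [run, State.reg_setReg]
      split_ifs with h
      · rw [h]
      · exact this.1 y hy h
    · exact this.2 a ha

theorem Prog.asgn_subset (p : Prog) : p.asgn ⊆ p.wv := by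
  induction p with
  | assign x e => simp [asgn, wv]
  | store a i e => simp [asgn, wv]
  | seq p q ihp ihq =>
    intro x hx
    simp only [asgn, wv, List.mem_append] at hx ⊢
    exact hx.imp (@ihp x) (@ihq x)
  | ite e f p q ihp ihq =>
    intro x hx
    simp only [asgn, wv, List.mem_append] at hx ⊢
    exact .inr (.inr (hx.imp (@ihp x) (@ihq x)))
  | loop x r p ih =>
    intro y hy
    exact List.mem_cons_of_mem _ (ih hy)

/-- The compiled program does what the program says, in the given time. -/
theorem Prog.halts (S : List ℕ → List ℕ → ℕ → Prop) (L : ℕ → ℕ) (p : Prog) :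
    ∀ (d : ℕ) (σ τ : State), Sim σ τ → p.Ok → (∀ r ∈ p.lims, σ.reg r = L r) →
      Halts S (p.code d) τ (p.bnd L) fun τ' => Sim (p.run σ) τ' ∧ Keep d τ τ' := by
  induction p with
  | assign x e =>
    intro d σ τ h ho hL
    refine (e.halts S L d σ τ h (fun r hr h => ho r hr (List.mem_cons_of_mem _ h)) hL).seq
      fun τ₁ ⟨h1, k1, v1⟩ => Halts.copy (by omega) ⟨?_, (k1.temp (by omega)).var⟩
    rw [v1]
    exact h1.temp.var
  | store a i e =>
    intro d σ τ h ho hL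
    simp only [Ok, lims, wv, List.mem_append] at ho hL
    refine ((i.halts S L d σ τ h (fun r hr h => ho r (.inl hr) (.inl h))
      (fun r hr => hL r (.inl hr))).seq fun τ₁ ⟨h1, k1, v1⟩ =>
      (e.halts S L (d + 1) σ τ₁ h1 (fun r hr h => ho r (.inr hr) (.inr h))
      (fun r hr => hL r (.inr hr))).seq fun τ₂ ⟨h2, k2, v2⟩ => Halts.store
        ⟨⟨h2.1, ?_⟩, k1.trans k2 (by omega)⟩).mono (by simp only [bnd]; omega) fun _ h => h
    rw [k2 d (by omega), v1, v2]
    simp only [State.setCell, h2.2, run]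
  | seq p q ihp ihq =>
    intro d σ τ h ho hL
    simp only [Ok, lims, wv, List.mem_append] at ho hL
    refine (ihp d σ τ h (fun r hr h => ho r (.inl hr) (.inl h))
      (fun r hr => hL r (.inl hr))).seq fun τ₁ ⟨h1, k1⟩ =>
      (ihq d _ τ₁ h1 (fun r hr h => ho r (.inr hr) (.inr h))
      (fun r hr => ?_)).mono le_rfl fun τ₂ ⟨h2, k2⟩ => ⟨h2, k1.trans k2 le_rfl⟩
    rw [(p.frame σ).1 _ fun h => ho r (.inr hr) (.inl (p.asgn_subset h)), hL r (.inr hr)]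
  | ite e f p q ihp ihq =>
    intro d σ τ hs ho hL
    simp only [Ok, lims, wv, List.mem_append] at ho hL
    refine ((e.halts S L d σ τ hs (fun r hr h => ho r (.inl hr) (.inl h))
      (fun r hr => hL r (.inl hr))).seq fun τ₁ ⟨h1, k1, v1⟩ =>
      (f.halts S L (d + 1) σ τ₁ h1 (fun r hr h => ho r (.inr (.inl hr)) (.inr (.inl h)))
      (fun r hr => hL r (.inr (.inl hr)))).seq fun τ₂ ⟨h2, k2, v2⟩ => Halts.ite
      (T₁ := p.bnd L) (T₂ := q.bnd L) (fun hc => ?_) fun hc => ?_).mono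
        (by simp only [bnd]; omega) fun _ h => h
    · rw [k2 d (by omega), v1, v2] at hc
      refine (ihp d σ τ₂ h2 (fun r hr h => ho r (.inr (.inr (.inl hr))) (.inr (.inr (.inl h))))
        (fun r hr => hL r (.inr (.inr (.inl hr))))).mono le_rfl fun τ₃ ⟨h3, k3⟩ =>
        ⟨?_, (k1.trans k2 (by omega)).trans k3 le_rfl⟩
      rwa [run, if_pos hc]
    · rw [k2 d (by omega), v1, v2] at hc
      refine (ihq d σ τ₂ h2 (fun r hr h => ho r (.inr (.inr (.inr hr))) (.inr (.inr (.inr h))))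
        (fun r hr => hL r (.inr (.inr (.inr hr))))).mono le_rfl fun τ₃ ⟨h3, k3⟩ =>
        ⟨?_, (k1.trans k2 (by omega)).trans k3 le_rfl⟩
      rwa [run, if_neg hc]
  | loop x r p ih =>
    intro d σ τ h ho hL
    simp only [Ok, lims, wv, List.mem_cons] at ho hL
    have hr := hL r (.inl rfl)
    set f : ℕ → State → State := fun i τ => p.run (τ.setReg x i) with hf
    have hfr : ∀ i y, y ∉ p.asgn → y ≠ x → (rpt f i σ).reg y = σ.reg y := fun i y hy hx =>
      rpt_induction (fun _ (s : State) => s.reg y = σ.reg y) rfl fun i _ s hs => by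
        rw [hf, (p.frame _).1 _ hy, State.reg_setReg_of_ne _ _ hx, hs]
    refine (Halts.const_seq <| Halts.add_seq <| Halts.add_seq <|
      (Halts.count (T := p.bnd L + 4) (N := L r) (fun i τ' => Sim (rpt f i σ) τ' ∧
        Keep d τ τ' ∧ τ'.reg (2 * d + 1) = i ∧ τ'.reg (2 * (d + 1) + 1) = L r ∧
        τ'.reg (2 * (d + 2) + 1) = σ.reg x) ?_ ?_ ?_).seq
        fun τ₂ ⟨h2, k2, v3, v4, v5⟩ => Halts.copy (by omega)
        ⟨?_, (k2.temp (by omega)).var⟩).mono (by simp only [bnd]; ring_nf; omega)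
        fun _ h => h
    · rintro i τ' ⟨-, -, b1, b2, -⟩
      exact ⟨b1, b2⟩
    · rintro i τ' hi ⟨a, k, b2, b3, b4⟩
      have a' := (a.temp (e := d + 3) (v := 0)).var (x := x) (v := i)
      have hk : ∀ j, j < d + 3 → ((τ'.setReg (2 * (d + 3) + 1) 0).setReg (2 * x) i).reg
          (2 * j + 1) = τ'.reg (2 * j + 1) := fun j hj => by
        rw [State.reg_setReg_of_ne _ _ (by omega), State.reg_setReg_of_ne _ _ (by omega)]
      refine ((Halts.copy (Q := fun σ' => σ' = (τ'.setReg (2 * (d + 3) + 1) 0).setReg (2 * x) i)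
        (by omega) (by rw [b2])).seq ?_).mono (by omega : 2 + (p.bnd L + 2) ≤ _) fun _ h => h
      rintro _ rfl
      refine (ih (d + 3) _ _ a' (fun r hr h => ho r (.inr hr) (.inr h)) (fun r hr => ?_)).seq
        fun τ₁ ⟨h1, k1⟩ => Halts.const_seq (T := 1) <| Halts.add
          ⟨h1.temp.temp, ?_, ?_, ?_, ?_⟩
      · rw [State.reg_setReg_of_ne _ _ fun h => ho r (.inr hr) (.inl h),
          hfr _ _ (fun h => ho r (.inr hr) (.inr (p.asgn_subset h)))
          (fun h => ho r (.inr hr) (.inl h)), hL r (.inr hr)]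
      · intro j hj
        rw [State.reg_setReg_of_ne _ _ (by omega), State.reg_setReg_of_ne _ _ (by omega),
          k1 j (by omega), hk j (by omega), k j hj]
      · rw [State.reg_setReg_self, State.reg_setReg_of_ne _ _ (by omega), State.reg_setReg_self,
          k1 _ (by omega), hk _ (by omega), b2]
      · rw [State.reg_setReg_of_ne _ _ (by omega), State.reg_setReg_of_ne _ _ (by omega),
          k1 _ (by omega), hk _ (by omega), b3]
      · rw [State.reg_setReg_of_ne _ _ (by omega), State.reg_setReg_of_ne _ _ (by omega),
          k1 _ (by omega), hk _ (by omega), b4]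
    · refine ⟨h.temp.temp.temp, ?_, ?_, ?_, ?_⟩
      · exact (((Keep.refl d τ).temp (by omega)).temp (by omega)).temp (by omega)
      · simp [State.reg_setReg]
      · simp [State.reg_setReg, h.1, hr, show 2 * r ≠ 2 * d + 1 by omega]
      · simp [State.reg_setReg, h.1, show 2 * x ≠ 2 * (d + 1) + 1 by omega,
          show 2 * x ≠ 2 * d + 1 by omega]
    · have := (h2.temp (e := d + 3) (v := 0)).var (x := x) (v := σ.reg x)
      rw [run, hr, ← hf]
      rwa [← v5] at this ⊢

theorem Exp.bnd_le (e : Exp) : ∃ C k, ∀ (L : ℕ → ℕ) (B : ℕ), (∀ r ∈ e.lims, L r ≤ B) →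
    e.bnd L ≤ C * (B + 1) ^ k := by
  have one : ∀ B k : ℕ, 1 ≤ (B + 1) ^ k := fun B k => Nat.one_le_pow _ _ (by omega)
  have up : ∀ (B : ℕ) {j k C x : ℕ}, x ≤ C * (B + 1) ^ j → j ≤ k → x ≤ C * (B + 1) ^ k :=
    fun B j k C x h hk => h.trans (Nat.mul_le_mul_left _ (Nat.pow_le_pow_right (by omega) hk))
  induction e with
  | var x => exact ⟨2, 0, fun L B _ => by simp [bnd]⟩
  | lit v => exact ⟨1, 0, fun L B _ => by simp [bnd]⟩
  | add e f ihe ihf | sub e f ihe ihf =>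
    obtain ⟨C, k, h⟩ := ihe
    obtain ⟨C', k', h'⟩ := ihf
    refine ⟨C + C' + 1, k + k', fun L B hL => ?_⟩
    simp only [lims, List.mem_append] at hL
    have h1 := up B (h L B fun r hr => hL r (.inl hr)) (by omega : k ≤ k + k')
    have h2 := up B (h' L B fun r hr => hL r (.inr hr)) (by omega : k' ≤ k + k')
    have := one B (k + k')
    simp only [bnd]
    nlinarith
  | mul e r ih =>
    obtain ⟨C, k, h⟩ := ih
    refine ⟨C + 9, k + 1, fun L B hL => ?_⟩
    simp only [lims, List.mem_cons] at hL
    have h1 := up B (h L B fun r hr => hL r (.inr hr)) (by omega : k ≤ k + 1)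
    have h2 := hL r (.inl rfl)
    have h3 : B + 1 ≤ (B + 1) ^ (k + 1) := by
      rw [pow_succ]; exact Nat.le_mul_of_pos_left _ (one B k)
    simp only [bnd]
    nlinarith
  | get a e ih =>
    obtain ⟨C, k, h⟩ := ih
    refine ⟨C + 1, k, fun L B hL => ?_⟩
    have h1 := h L B hL
    have := one B k
    simp only [bnd]
    nlinarith
  | ite e f g h ihe ihf ihg ihh =>
    obtain ⟨C1, k1, h1⟩ := ihe
    obtain ⟨C2, k2, h2⟩ := ihf
    obtain ⟨C3, k3, h3⟩ := ihg
    obtain ⟨C4, k4, h4⟩ := ihh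
    refine ⟨C1 + C2 + C3 + C4 + 1, k1 + k2 + k3 + k4, fun L B hL => ?_⟩
    simp only [lims, List.mem_append] at hL
    have h1 := up B (h1 L B fun r hr => hL r (.inl hr)) (by omega : k1 ≤ k1 + k2 + k3 + k4)
    have h2 := up B (h2 L B fun r hr => hL r (.inr (.inl hr)))
      (by omega : k2 ≤ k1 + k2 + k3 + k4)
    have h3 := up B (h3 L B fun r hr => hL r (.inr (.inr (.inl hr))))
      (by omega : k3 ≤ k1 + k2 + k3 + k4)
    have h4 := up B (h4 L B fun r hr => hL r (.inr (.inr (.inr hr))))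
      (by omega : k4 ≤ k1 + k2 + k3 + k4)
    have := one B (k1 + k2 + k3 + k4)
    simp only [bnd]
    nlinarith
  | fold o x r e ih =>
    obtain ⟨C, k, h⟩ := ih
    refine ⟨C + 17, k + 1, fun L B hL => ?_⟩
    simp only [lims, List.mem_cons] at hL
    have h1 := h L B fun r hr => hL r (.inr hr)
    have h2 := hL r (.inl rfl)
    have h3 := one B k
    have h4 : L r * (e.bnd L + 10) ≤ (B + 1) * (C * (B + 1) ^ k + 10 * (B + 1) ^ k) :=
      Nat.mul_le_mul (by omega) (by omega)
    have h5 := one B (k + 1)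
    simp only [bnd]
    calc _ ≤ (B + 1) * (C * (B + 1) ^ k + 10 * (B + 1) ^ k) + 7 * (B + 1) ^ (k + 1) := by omega
      _ = _ := by ring

/-- The running time of a program is at most polynomial in the variables that bound its loops. -/
theorem Prog.bnd_le (p : Prog) : ∃ C k, ∀ (L : ℕ → ℕ) (B : ℕ), (∀ r ∈ p.lims, L r ≤ B) →
    p.bnd L ≤ C * (B + 1) ^ k := by
  have one : ∀ B k : ℕ, 1 ≤ (B + 1) ^ k := fun B k => Nat.one_le_pow _ _ (by omega)
  have up : ∀ (B : ℕ) {j k C x : ℕ}, x ≤ C * (B + 1) ^ j → j ≤ k → x ≤ C * (B + 1) ^ k :=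
    fun B j k C x h hk => h.trans (Nat.mul_le_mul_left _ (Nat.pow_le_pow_right (by omega) hk))
  induction p with
  | assign x e =>
    obtain ⟨C, k, h⟩ := e.bnd_le
    refine ⟨C + 2, k, fun L B hL => ?_⟩
    have h1 := h L B hL
    have := one B k
    simp only [bnd]
    nlinarith
  | store a i e =>
    obtain ⟨C, k, h⟩ := i.bnd_le
    obtain ⟨C', k', h'⟩ := e.bnd_le
    refine ⟨C + C' + 1, k + k', fun L B hL => ?_⟩
    simp only [lims, List.mem_append] at hL
    have h1 := up B (h L B fun r hr => hL r (.inl hr)) (by omega : k ≤ k + k')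
    have h2 := up B (h' L B fun r hr => hL r (.inr hr)) (by omega : k' ≤ k + k')
    have := one B (k + k')
    simp only [bnd]
    nlinarith
  | seq p q ihp ihq =>
    obtain ⟨C, k, h⟩ := ihp
    obtain ⟨C', k', h'⟩ := ihq
    refine ⟨C + C', k + k', fun L B hL => ?_⟩
    simp only [lims, List.mem_append] at hL
    have h1 := up B (h L B fun r hr => hL r (.inl hr)) (by omega : k ≤ k + k')
    have h2 := up B (h' L B fun r hr => hL r (.inr hr)) (by omega : k' ≤ k + k')
    simp only [bnd]
    nlinarith
  | ite e f p q ihp ihq =>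
    obtain ⟨C1, k1, h1⟩ := e.bnd_le
    obtain ⟨C2, k2, h2⟩ := f.bnd_le
    obtain ⟨C3, k3, h3⟩ := ihp
    obtain ⟨C4, k4, h4⟩ := ihq
    refine ⟨C1 + C2 + C3 + C4 + 1, k1 + k2 + k3 + k4, fun L B hL => ?_⟩
    simp only [lims, List.mem_append] at hL
    have h1 := up B (h1 L B fun r hr => hL r (.inl hr)) (by omega : k1 ≤ k1 + k2 + k3 + k4)
    have h2 := up B (h2 L B fun r hr => hL r (.inr (.inl hr)))
      (by omega : k2 ≤ k1 + k2 + k3 + k4)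
    have h3 := up B (h3 L B fun r hr => hL r (.inr (.inr (.inl hr))))
      (by omega : k3 ≤ k1 + k2 + k3 + k4)
    have h4 := up B (h4 L B fun r hr => hL r (.inr (.inr (.inr hr))))
      (by omega : k4 ≤ k1 + k2 + k3 + k4)
    have := one B (k1 + k2 + k3 + k4)
    simp only [bnd]
    nlinarith
  | loop x r p ih =>
    obtain ⟨C, k, h⟩ := ih
    refine ⟨C + 11, k + 1, fun L B hL => ?_⟩
    simp only [lims, List.mem_cons] at hL
    have h1 := h L B fun r hr => hL r (.inr hr)
    have h2 := hL r (.inl rfl)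
    have h3 := one B k
    have h4 : L r * (p.bnd L + 5) ≤ (B + 1) * (C * (B + 1) ^ k + 5 * (B + 1) ^ k) :=
      Nat.mul_le_mul (by omega) (by omega)
    have h5 := one B (k + 1)
    simp only [bnd]
    calc _ ≤ (B + 1) * (C * (B + 1) ^ k + 5 * (B + 1) ^ k) + 6 * (B + 1) ^ (k + 1) := by omega
      _ = _ := by ring

/-! ### Filling arrays -/

namespace State

/-- Replace the array `a`. -/
def setArr (σ : State) (a : ℕ) (h : ℕ → ℕ) : State :=
  { σ with arr := Function.update σ.arr a h }

theorem arr_setArr (σ : State) (a b : ℕ) (h : ℕ → ℕ) :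
    (σ.setArr a h).arr b = if b = a then h else σ.arr b := by
  simp [setArr, Function.update_apply]

@[simp] theorem reg_setArr (σ : State) (a : ℕ) (h : ℕ → ℕ) : (σ.setArr a h).reg = σ.reg := rfl

theorem setArr_setReg (σ : State) (a x v : ℕ) (h : ℕ → ℕ) :
    (σ.setArr a h).setReg x v = (σ.setReg x v).setArr a h := rfl

@[simp] theorem setArr_arr (σ : State) (a : ℕ) : σ.setArr a (σ.arr a) = σ := by
  simp [setArr]

end State

open Classical in
/-- The array `h`, overwritten by `g` on the set `D` of cells. -/
noncomputable def patch (D : Set ℕ) (g h : ℕ → ℕ) : ℕ → ℕ := fun c => if c ∈ D then g c else h c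

theorem patch_of_mem {D : Set ℕ} {g h : ℕ → ℕ} {c : ℕ} (hc : c ∈ D) : patch D g h c = g c :=
  if_pos hc

theorem patch_of_notMem {D : Set ℕ} {g h : ℕ → ℕ} {c : ℕ} (hc : c ∉ D) : patch D g h c = h c :=
  if_neg hc

theorem patch_patch (D D' : Set ℕ) (g h : ℕ → ℕ) :
    patch D' g (patch D g h) = patch (D ∪ D') g h := by
  funext c
  by_cases h1 : c ∈ D <;> by_cases h2 : c ∈ D' <;> simp [patch, h1, h2]

/-- The only effect of the program `p` in the state `σ` is to write the values `g` to the cells in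
`D` of the array `a`, provided that the array already has the values `g` on `D₀`.  The values are
a function of the cell, so that it does not matter in which order, or how often, cells are
written. -/
def Fills (p : Prog) (a : ℕ) (σ : State) (D₀ D : Set ℕ) (g : ℕ → ℕ) : Prop :=
  ∀ h : ℕ → ℕ, (∀ c ∈ D₀, h c = g c) → p.run (σ.setArr a h) = σ.setArr a (patch D g h)

namespace Fills

variable {p q : Prog} {a : ℕ} {σ : State} {D₀ D D' : Set ℕ} {g : ℕ → ℕ}

theorem store {i e : Exp} (c : ℕ)
    (H : ∀ h : ℕ → ℕ, (∀ c ∈ D₀, h c = g c) →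
      i.eval (σ.setArr a h) = c ∧ e.eval (σ.setArr a h) = g c) :
    Fills (.store a i e) a σ D₀ {c} g := by
  intro h hh
  obtain ⟨h1, h2⟩ := H h hh
  rw [Prog.run, h1, h2]
  simp only [State.setCell, State.setArr]
  congr 1
  simp only [Function.update_idem, Function.update_self]
  congr 1
  funext c'
  simp only [Function.update_apply, patch, Set.mem_singleton_iff]
  split_ifs with h
  · rw [h]
  · rfl

theorem seq (hp : Fills p a σ D₀ D g) (hq : Fills q a σ (D₀ ∪ D) D' g) :
    Fills (.seq p q) a σ D₀ (D ∪ D') g := by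
  intro h hh
  rw [Prog.run, hp h hh, hq _ fun c hc => ?_, patch_patch]
  by_cases h1 : c ∈ D
  · exact patch_of_mem h1
  · rw [patch_of_notMem h1]
    exact hh c (hc.resolve_right h1)

theorem loop {x r : ℕ} (D : ℕ → Set ℕ)
    (H : ∀ i < σ.reg r, Fills p a (σ.setReg x i) (D₀ ∪ {c | ∃ i' < i, c ∈ D i'}) (D i) g) :
    Fills (.loop x r p) a σ D₀ {c | ∃ i < σ.reg r, c ∈ D i} g := by
  intro h hh
  have key : ∃ w, rpt (fun i τ => p.run (τ.setReg x i)) (σ.reg r) (σ.setArr a h) =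
      (σ.setReg x w).setArr a (patch {c | ∃ i < σ.reg r, c ∈ D i} g h) := by
    refine rpt_induction (fun i τ => ∃ w, τ = (σ.setReg x w).setArr a
      (patch {c | ∃ i' < i, c ∈ D i'} g h)) ⟨σ.reg x, ?_⟩ ?_
    · rw [State.setReg_reg]
      congr 1
      funext c
      simp [patch]
    · rintro i hi _ ⟨w, rfl⟩
      refine ⟨i, ?_⟩
      rw [State.setArr_setReg, State.setReg_setReg_self, H i hi, patch_patch]
      · congr 2
        ext c
        simp only [Set.mem_union, Set.mem_ofPred_eq]
        constructor
        · rintro (⟨j, hj, hc⟩ | hc)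
          exacts [⟨j, by omega, hc⟩, ⟨i, by omega, hc⟩]
        · rintro ⟨j, hj, hc⟩
          rcases Nat.lt_succ_iff_lt_or_eq.1 hj with hj | rfl
          exacts [.inl ⟨j, hj, hc⟩, .inr hc]
      · rintro c hc
        by_cases h1 : c ∈ {c | ∃ i' < i, c ∈ D i'}
        · exact patch_of_mem h1
        · rw [patch_of_notMem h1]
          exact hh c (hc.resolve_right h1)
  obtain ⟨w, hw⟩ := key
  rw [Prog.run]
  simp only [State.reg_setArr]
  rw [hw, State.setArr_setReg, State.setReg_setReg_self, State.setReg_reg]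

theorem mono (h : Fills p a σ D₀ D g) (hD : D = D') : Fills p a σ D₀ D' g := hD ▸ h

theorem loop₁ {x r n : ℕ} {i e : Exp} (f : ℕ → ℕ) (hn : σ.reg r = n)
    (H : ∀ k < n, ∀ h : ℕ → ℕ,
      i.eval ((σ.setReg x k).setArr a h) = f k ∧ e.eval ((σ.setReg x k).setArr a h) = g (f k)) :
    Fills (.loop x r (.store a i e)) a σ D₀ {c | ∃ k < n, c = f k} g := by
  subst hn
  exact Fills.loop (fun k => {f k}) fun k hk => Fills.store (f k) fun h _ => H k hk h

theorem loop₂ {x r y s n m : ℕ} {i e : Exp} (f : ℕ → ℕ → ℕ) (hn : σ.reg r = n) (hm : σ.reg s = m)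
    (hsx : s ≠ x) (H : ∀ k < n, ∀ l < m, ∀ h : ℕ → ℕ,
      i.eval (((σ.setReg x k).setReg y l).setArr a h) = f k l ∧
      e.eval (((σ.setReg x k).setReg y l).setArr a h) = g (f k l)) :
    Fills (.loop x r (.loop y s (.store a i e))) a σ D₀
      {c | ∃ k < n, ∃ l < m, c = f k l} g := by
  subst hn
  exact Fills.loop (fun k => {c | ∃ l < m, c = f k l}) fun k hk =>
    Fills.loop₁ (f k) (by rw [State.reg_setReg_of_ne _ _ hsx, hm]) fun l hl h => H k hk l hl h

theorem loop₃ {x r y s z t n m o : ℕ} {i e : Exp} (f : ℕ → ℕ → ℕ → ℕ) (hn : σ.reg r = n)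
    (hm : σ.reg s = m) (ho : σ.reg t = o) (hsx : s ≠ x) (htx : t ≠ x) (hty : t ≠ y)
    (H : ∀ k < n, ∀ l < m, ∀ j < o, ∀ h : ℕ → ℕ,
      i.eval ((((σ.setReg x k).setReg y l).setReg z j).setArr a h) = f k l j ∧
      e.eval ((((σ.setReg x k).setReg y l).setReg z j).setArr a h) = g (f k l j)) :
    Fills (.loop x r (.loop y s (.loop z t (.store a i e)))) a σ D₀
      {c | ∃ k < n, ∃ l < m, ∃ j < o, c = f k l j} g := by
  subst hn
  exact Fills.loop (fun k => {c | ∃ l < m, ∃ j < o, c = f k l j}) fun k hk =>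
    Fills.loop₂ (f k) (by rw [State.reg_setReg_of_ne _ _ hsx, hm])
      (by rw [State.reg_setReg_of_ne _ _ htx, ho]) hty fun l hl h => H k hk l hl h

theorem loop₄ {x r y s z t w v n m o p : ℕ} {i e : Exp} (f : ℕ → ℕ → ℕ → ℕ → ℕ)
    (hn : σ.reg r = n) (hm : σ.reg s = m) (ho : σ.reg t = o) (hp : σ.reg v = p) (hsx : s ≠ x)
    (htx : t ≠ x) (hty : t ≠ y) (hvx : v ≠ x) (hvy : v ≠ y) (hvz : v ≠ z)
    (H : ∀ k < n, ∀ l < m, ∀ j < o, ∀ u < p, ∀ h : ℕ → ℕ,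
      i.eval (((((σ.setReg x k).setReg y l).setReg z j).setReg w u).setArr a h) = f k l j u ∧
      e.eval (((((σ.setReg x k).setReg y l).setReg z j).setReg w u).setArr a h) =
        g (f k l j u)) :
    Fills (.loop x r (.loop y s (.loop z t (.loop w v (.store a i e))))) a σ D₀
      {c | ∃ k < n, ∃ l < m, ∃ j < o, ∃ u < p, c = f k l j u} g := by
  subst hn
  exact Fills.loop (fun k => {c | ∃ l < m, ∃ j < o, ∃ u < p, c = f k l j u}) fun k hk =>
    Fills.loop₃ (f k) (by rw [State.reg_setReg_of_ne _ _ hsx, hm])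
      (by rw [State.reg_setReg_of_ne _ _ htx, ho]) (by rw [State.reg_setReg_of_ne _ _ hvx, hp])
      hty hvy hvz fun l hl h => H k hk l hl h

theorem run_eq (h : Fills p a σ ∅ D g) : p.run σ = σ.setArr a (patch D g (σ.arr a)) := by
  have := h (σ.arr a) (by simp)
  rwa [State.setArr_arr] at this

theorem reg (h : Fills p a σ ∅ D g) : (p.run σ).reg = σ.reg := by rw [h.run_eq]; rfl

theorem arr (h : Fills p a σ ∅ D g) {c : ℕ} (hc : c ∈ D) : (p.run σ).arr a c = g c := by
  rw [h.run_eq, State.arr_setArr, if_pos rfl, patch_of_mem hc]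

theorem arr_of_notMem (h : Fills p a σ ∅ D g) {c : ℕ} (hc : c ∉ D) :
    (p.run σ).arr a c = σ.arr a c := by
  rw [h.run_eq, State.arr_setArr, if_pos rfl, patch_of_notMem hc]

theorem arr_of_ne (h : Fills p a σ ∅ D g) {b : ℕ} (hb : b ≠ a) : (p.run σ).arr b = σ.arr b := by
  rw [h.run_eq, State.arr_setArr, if_neg hb]

end Fills

/-! ### Bits as elements of `ZMod 2` -/

namespace Exp

/-- Conjunction of two bits. -/
def band (e f : Exp) : Exp := .ite (.lit 0) e f (.lit 0)

/-- Sum of two bits modulo 2. -/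
def bxor (e f : Exp) : Exp := .ite (.lit 0) e (.sub (.lit 1) f) f

theorem eval_band {e f : Exp} {σ : State} {x y : ZMod 2} (he : e.eval σ = x.val)
    (hf : f.eval σ = y.val) : (band e f).eval σ = (x * y).val := by
  simp only [band, eval, he, hf]
  clear he hf
  revert x y
  decide

theorem eval_bxor {e f : Exp} {σ : State} {x y : ZMod 2} (he : e.eval σ = x.val)
    (hf : f.eval σ = y.val) : (bxor e f).eval σ = (x + y).val := by
  simp only [bxor, eval, he, hf]
  clear he hf
  revert x y
  decide

theorem eval_parity {x r n : ℕ} {e : Exp} {σ : State} (f : ℕ → ZMod 2) (hn : σ.reg r = n)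
    (h : ∀ i < n, e.eval (σ.setReg x i) = (f i).val) :
    (fold .parity x r e).eval σ = (∑ i ∈ Finset.range n, f i).val := by
  have hu : ∀ s v : ZMod 2, Fold.upd .parity s.val v.val = (s + v).val := by decide
  rw [eval, hn]
  clear hn
  induction n with
  | zero => rfl
  | succ n ih =>
    rw [rpt, ih fun i hi => h i (by omega), h n (by omega), hu, Finset.sum_range_succ]

theorem eval_sum {x r n : ℕ} {e : Exp} {σ : State} (f : ℕ → ℕ) (hn : σ.reg r = n)
    (h : ∀ i < n, e.eval (σ.setReg x i) = f i) :
    (fold .sum x r e).eval σ = ∑ i ∈ Finset.range n, f i := by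
  rw [eval, hn]
  clear hn
  induction n with
  | zero => rfl
  | succ n ih =>
    rw [rpt, ih fun i hi => h i (by omega), h n (by omega), Fold.upd, Finset.sum_range_succ]

/-- The last index with a nonzero bit, where the index zero does not count. -/
theorem eval_last {x r n : ℕ} {e : Exp} {σ : State} (f : ℕ → ZMod 2) (hn : σ.reg r = n)
    (h0 : 0 < n) (h : ∀ i < n, e.eval (σ.setReg x i) = if 0 < (f i).val then i else 0) :
    (fold .last x r e).eval σ < n ∧
      ((fold .last x r e).eval σ = 0 → ∀ i < n, 0 < i → f i = 0) ∧
      ((fold .last x r e).eval σ ≠ 0 → f ((fold .last x r e).eval σ) ≠ 0) := by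
  rw [eval, hn]
  have := rpt_induction (n := n) (s := 0)
    (f := fun i s => Fold.last.upd s (e.eval (σ.setReg x i)))
    (fun k s => (s = 0 ∨ s < k) ∧ (s = 0 → ∀ i < k, 0 < i → f i = 0) ∧ (s ≠ 0 → f s ≠ 0))
    (by simp) fun i hi s ⟨h1, h2, h3⟩ => by
      have hv : 0 < (f i).val ↔ f i ≠ 0 := by rw [Nat.pos_iff_ne_zero, Ne, ZMod.val_eq_zero]
      simp only [Fold.upd, h i hi, hv]
      by_cases hf : f i = 0
      · simp only [hf, ne_eq, not_true_eq_false, if_false, lt_irrefl]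
        refine ⟨h1.imp_right fun h => by omega, fun hs j hj hj0 => ?_, h3⟩
        rcases Nat.lt_succ_iff_lt_or_eq.1 hj with hj | rfl
        exacts [h2 hs j hj hj0, hf]
      · simp only [ne_eq, hf, not_false_eq_true, if_true]
        by_cases hi0 : 0 < i
        · rw [if_pos hi0]
          exact ⟨.inr (by omega), fun h => by omega, fun _ => hf⟩
        · obtain rfl : i = 0 := by omega
          simp only [lt_irrefl, if_false]
          exact ⟨h1.imp_right fun h => by omega, fun _ j hj hj0 => by omega, h3⟩
  refine ⟨?_, this.2.1, this.2.2⟩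
  rcases this.1 with h | h <;> omega

end Exp

/-! ### Gaussian elimination over the field with two elements -/

/-- The row operations for the column `c`: `A p` is the pivot row, and there is none for
`p = 0`.  The pivot row is added to itself as well and becomes zero, so that rows need not be
swapped. -/
def elimStep (c p : ℕ) (A : ℕ → ℕ → ZMod 2) : ℕ → ℕ → ZMod 2 :=
  fun q => A q + (if p = 0 then 0 else A q c) • A p

/-- The span of the rows of the matrix `A`, without the row `0`, which holds the target. -/
def rowSpan (R : ℕ) (A : ℕ → ℕ → ZMod 2) : Submodule (ZMod 2) (ℕ → ZMod 2) :=
  Submodule.span (ZMod 2) (A '' {q | 0 < q ∧ q < R})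

/-- What is true of the matrix `A` that arises from `A₀` by elimination in the first `c` of `N`
columns. -/
structure ElimInv (R N : ℕ) (A₀ : ℕ → ℕ → ZMod 2) (c : ℕ) (A : ℕ → ℕ → ZMod 2) : Prop where
  target : A 0 - A₀ 0 ∈ rowSpan R A₀
  rows : ∀ q < R, 0 < q → A q ∈ rowSpan R A₀
  zero : ∀ c' < c, ∀ q < R, 0 < q → A q c' = 0
  solv : (∃ w ∈ rowSpan R A₀, ∀ j < N, A₀ 0 j = w j) → ∃ w ∈ rowSpan R A, ∀ j < N, A 0 j = w j

theorem rowSpan_apply_eq_zero {R c : ℕ} {A : ℕ → ℕ → ZMod 2}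
    (h : ∀ q < R, 0 < q → A q c = 0) {w : ℕ → ZMod 2} (hw : w ∈ rowSpan R A) : w c = 0 := by
  have : rowSpan R A ≤ LinearMap.ker (LinearMap.proj (R := ZMod 2) (φ := fun _ : ℕ => ZMod 2) c) :=
    Submodule.span_le.2 (by rintro _ ⟨q, hq, rfl⟩; exact h q hq.2 hq.1)
  exact this hw

/-- One column: if a combination of the rows agrees with the target, this stays true without the
pivot row, since the coefficient of the pivot row is determined by the column `c`. -/
theorem ElimInv.step {R N c p : ℕ} {A₀ A : ℕ → ℕ → ZMod 2} (h : ElimInv R N A₀ c A) (hc : c < N)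
    (hp : p < R) (h0 : p = 0 → ∀ q < R, 0 < q → A q c = 0) (h1 : p ≠ 0 → A p c ≠ 0) :
    ElimInv R N A₀ (c + 1) (elimStep c p A) := by
  by_cases hp0 : p = 0
  · have : elimStep c p A = A := by
      funext q; simp [elimStep, hp0]
    rw [this]
    refine ⟨h.target, h.rows, fun c' hc' q hq hq0 => ?_, h.solv⟩
    rcases Nat.lt_succ_iff_lt_or_eq.1 hc' with hc' | rfl
    exacts [h.zero c' hc' q hq hq0, h0 hp0 q hq hq0]
  · have hpc : A p c = 1 := by
      have := h1 hp0
      revert this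
      generalize A p c = x
      revert x
      decide
    have hs : ∀ q, elimStep c p A q = A q + A q c • A p := fun q => by simp [elimStep, hp0]
    have hpR := h.rows p hp (by omega)
    have hzc : ∀ q, elimStep c p A q c = 0 := fun q => by
      rw [hs, Pi.add_apply, Pi.smul_apply, hpc, smul_eq_mul, mul_one, CharTwo.add_self_eq_zero]
    refine ⟨?_, fun q hq hq0 => ?_, fun c' hc' q hq hq0 => ?_, fun hx => ?_⟩
    · rw [hs, add_sub_right_comm]
      exact add_mem h.target (Submodule.smul_mem _ _ hpR)
    · rw [hs]
      exact add_mem (h.rows q hq hq0) (Submodule.smul_mem _ _ hpR)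
    · rcases Nat.lt_succ_iff_lt_or_eq.1 hc' with hc' | rfl
      · rw [hs, Pi.add_apply, Pi.smul_apply, h.zero c' hc' q hq hq0,
          h.zero c' hc' p hp (by omega), smul_zero, add_zero]
      · exact hzc q
    · obtain ⟨w, hw, hwj⟩ := h.solv hx
      have hle : rowSpan R A ≤ rowSpan R (elimStep c p A) ⊔ Submodule.span (ZMod 2) {A p} := by
        refine Submodule.span_le.2 ?_
        rintro _ ⟨q, hq, rfl⟩
        refine Submodule.mem_sup.2 ⟨_, Submodule.subset_span ⟨q, hq, rfl⟩, -(A q c • A p),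
          neg_mem (Submodule.smul_mem _ _ (Submodule.mem_span_singleton_self _)), ?_⟩
        rw [hs]; abel
      obtain ⟨w', hw', v, hv, rfl⟩ := Submodule.mem_sup.1 (hle hw)
      obtain ⟨b, rfl⟩ := Submodule.mem_span_singleton.1 hv
      refine ⟨w', hw', fun j hj => ?_⟩
      have e1 : ∀ j < N, elimStep c p A 0 j = w' j + (b + A 0 c) * A p j := fun j hj => by
        rw [hs, Pi.add_apply, hwj j hj]
        simp only [Pi.add_apply, Pi.smul_apply, smul_eq_mul]
        ring
      have e2 := e1 c hc
      rw [hzc, rowSpan_apply_eq_zero (fun q _ _ => hzc q) hw', hpc, zero_add, mul_one] at e2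
      rw [e1 j hj, ← e2, zero_mul, add_zero]

/-- The last row with a one in the column in the variable `50`, and zero if there is none besides
the target, which is the row `0`. -/
def elimPivot (W R : ℕ) : Exp :=
  .fold .last 51 R (.ite (.lit 0) (.get 27 (.add (.mul (.var 51) W) (.var 50))) (.var 51) (.lit 0))

/-- The row operations for one column, with the result in the array `28`. -/
def elimRow (W R : ℕ) : Prog :=
  .loop 51 R (.loop 52 W (.store 28 (.add (.mul (.var 51) W) (.var 52))
    (.bxor (.get 27 (.add (.mul (.var 51) W) (.var 52)))
      (.band (.ite (.lit 0) (.var 53) (.get 27 (.add (.mul (.var 51) W) (.var 50))) (.lit 0))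
        (.get 27 (.add (.mul (.var 53) W) (.var 52)))))))

/-- Copy the matrix back to the array `27`. -/
def elimCopy (W R : ℕ) : Prog :=
  .loop 51 R (.loop 52 W (.store 27 (.add (.mul (.var 51) W) (.var 52))
    (.get 28 (.add (.mul (.var 51) W) (.var 52)))))

/-- Elimination with the variables `N`, `W`, `R` for the number of columns in which to eliminate,
the number of all columns, and the number of rows.  The matrix is in the array `27`. -/
def elimProg (N W R : ℕ) : Prog :=
  .loop 50 N (.seq (.assign 53 (elimPivot W R)) (.seq (elimRow W R) (elimCopy W R)))

theorem div_index {i W j : ℕ} (hj : j < W) : (i * W + j) / W = i := by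
  rw [mul_comm, Nat.mul_add_div (by omega), Nat.div_eq_of_lt hj, add_zero]

theorem mod_index {i W j : ℕ} (hj : j < W) : (i * W + j) % W = j := by
  rw [mul_comm, Nat.mul_add_mod, Nat.mod_eq_of_lt hj]

/-- The array `h` holds the entries of the matrix `A` with `R` rows and `W` columns. -/
def IsMat (h : ℕ → ℕ) (R W : ℕ) (A : ℕ → ℕ → ZMod 2) : Prop :=
  ∀ q < R, ∀ j < W, h (q * W + j) = (A q j).val

theorem elimRow_isMat {W R : ℕ} (hW : W < 50) {σ : State} {c p : ℕ}
    {A : ℕ → ℕ → ZMod 2} (hA : IsMat (σ.arr 27) (σ.reg R) (σ.reg W) A) (hc : c < σ.reg W)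
    (hp : p < σ.reg R) (h50 : σ.reg 50 = c) (h53 : σ.reg 53 = p) :
    IsMat (((elimRow W R).run σ).arr 28) (σ.reg R) (σ.reg W) (elimStep c p A) := by
  have e2 : W ≠ 51 := by omega
  have e3 : W ≠ 52 := by omega
  have hf : Fills (elimRow W R) 28 σ ∅
      {x | ∃ q < σ.reg R, ∃ j < σ.reg W, x = q * σ.reg W + j} fun x =>
      (elimStep c p A (x / σ.reg W) (x % σ.reg W)).val := by
    refine Fills.loop₂ (fun q j => q * σ.reg W + j) rfl rfl e2 fun q hq j hj h => ?_
    refine ⟨by simp [Exp.eval, State.reg_setReg, e2, e3], ?_⟩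
    rw [div_index hj, mod_index hj]
    have := Exp.eval_bxor (σ := ((σ.setReg 51 q).setReg 52 j).setArr 28 h)
      (e := .get 27 (.add (.mul (.var 51) W) (.var 52)))
      (f := .band (.ite (.lit 0) (.var 53) (.get 27 (.add (.mul (.var 51) W) (.var 50))) (.lit 0))
        (.get 27 (.add (.mul (.var 53) W) (.var 52))))
      (x := A q j) (y := (if p = 0 then 0 else A q c) * A p j) ?_ (Exp.eval_band ?_ ?_)
    · rw [this, elimStep]
      rfl
    · simp [Exp.eval, State.reg_setReg, State.arr_setArr, e2, e3, hA q hq j hj]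
    · simp only [Exp.eval, State.reg_setReg, State.arr_setArr, e2, e3, State.reg_setArr,
        State.arr_setReg, h53, h50]
      by_cases hp0 : p = 0
      · simp [hp0]
      · simp [hp0, Nat.pos_of_ne_zero hp0, hA q hq c hc]
    · simp [Exp.eval, State.reg_setReg, State.arr_setArr, e2, e3, h53, hA p hp j hj]
  intro q hq j hj
  rw [hf.arr (c := q * σ.reg W + j) ⟨q, hq, j, hj, rfl⟩, div_index hj, mod_index hj]

theorem elimCopy_isMat {W R : ℕ} (hW : W < 50) {σ : State}
    {A : ℕ → ℕ → ZMod 2} (hA : IsMat (σ.arr 28) (σ.reg R) (σ.reg W) A) :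
    IsMat (((elimCopy W R).run σ).arr 27) (σ.reg R) (σ.reg W) A := by
  have e2 : W ≠ 51 := by omega
  have e3 : W ≠ 52 := by omega
  have hf : Fills (elimCopy W R) 27 σ ∅
      {x | ∃ q < σ.reg R, ∃ j < σ.reg W, x = q * σ.reg W + j} fun x => (A (x / σ.reg W) (x % σ.reg W)).val := by
    refine Fills.loop₂ (fun q j => q * σ.reg W + j) rfl rfl e2 fun q hq j hj h => ?_
    refine ⟨by simp [Exp.eval, State.reg_setReg, e2, e3], ?_⟩
    simp [Exp.eval, State.reg_setReg, State.arr_setArr, e2, e3, hA q hq j hj, div_index hj,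
      mod_index hj]
  intro q hq j hj
  rw [hf.arr (c := q * σ.reg W + j) ⟨q, hq, j, hj, rfl⟩, div_index hj, mod_index hj]

theorem elimProg_inv {N W R : ℕ} (hW : W < 50) (hR : R < 50) {σ : State}
    {A : ℕ → ℕ → ZMod 2} (hA : IsMat (σ.arr 27) (σ.reg R) (σ.reg W) A) (hNW : σ.reg N ≤ σ.reg W)
    (hR0 : 0 < σ.reg R) :
    ∃ A', IsMat (((elimProg N W R).run σ).arr 27) (σ.reg R) (σ.reg W) A' ∧
      ElimInv (σ.reg R) (σ.reg N) A (σ.reg N) A' := by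
  have key := rpt_induction (n := σ.reg N) (s := σ)
    (f := fun i τ => Prog.run (.seq (.assign 53 (elimPivot W R)) (.seq (elimRow W R)
      (elimCopy W R))) (τ.setReg 50 i))
    (fun c τ => τ.reg W = σ.reg W ∧ τ.reg R = σ.reg R ∧ ∃ A', IsMat (τ.arr 27) (σ.reg R) (σ.reg W)
      A' ∧ ElimInv (σ.reg R) (σ.reg N) A c A')
    ⟨rfl, rfl, A, hA, by simp, fun q hq hq0 => Submodule.subset_span ⟨q, ⟨hq0, hq⟩, rfl⟩,
      by simp, fun h => h⟩ ?_
  · obtain ⟨-, -, A', h1, h2⟩ := key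
    exact ⟨A', h1, h2⟩
  rintro c hc τ ⟨hτW, hτR, A', hA', hI⟩
  simp only [Prog.run]
  set τ₁ := τ.setReg 50 c with hτ₁
  set p := (elimPivot W R).eval τ₁ with hp
  set τ₂ := τ₁.setReg 53 p with hτ₂
  have rW : τ₂.reg W = σ.reg W := by
    rw [hτ₂, hτ₁, State.reg_setReg_of_ne _ _ (by omega), State.reg_setReg_of_ne _ _ (by omega),
      hτW]
  have rR : τ₂.reg R = σ.reg R := by
    rw [hτ₂, hτ₁, State.reg_setReg_of_ne _ _ (by omega), State.reg_setReg_of_ne _ _ (by omega),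
      hτR]
  have fr1 := (elimRow W R).frame τ₂
  have fr2 := (elimCopy W R).frame ((elimRow W R).run τ₂)
  have r1 : ((elimRow W R).run τ₂).reg = τ₂.reg := funext fun x => fr1.1 x (by
    simp [elimRow, Prog.asgn])
  have r2 : ((elimCopy W R).run ((elimRow W R).run τ₂)).reg = τ₂.reg := by
    rw [← r1]; exact funext fun x => fr2.1 x (by simp [elimCopy, Prog.asgn])
  have piv := Exp.eval_last (σ := τ₁) (x := 51) (r := R) (n := σ.reg R)
    (e := .ite (.lit 0) (.get 27 (.add (.mul (.var 51) W) (.var 50))) (.var 51) (.lit 0))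
    (fun q => A' q c) (by rw [hτ₁, State.reg_setReg_of_ne _ _ (by omega), hτR]) hR0 (by
      intro i hi
      have e2 : W ≠ 51 := by omega
      have e3 : W ≠ 50 := by omega
      simp [Exp.eval, hτ₁, State.reg_setReg, e2, e3, hτW, hA' i hi c (by omega)])
  have hmat := elimRow_isMat hW (σ := τ₂) (c := c) (p := p) (A := A')
    (by rw [rR, rW]; exact hA') (by omega) (by rw [rR]; exact piv.1)
    (by simp [hτ₂, hτ₁, State.reg_setReg]) (by simp [hτ₂])
  have hmat2 := elimCopy_isMat hW (σ := (elimRow W R).run τ₂) (by rw [r1]; exact hmat)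
  rw [r1, rW, rR] at hmat2
  exact ⟨by rw [r2, rW], by rw [r2, rR], _, hmat2, hI.step hc piv.1 piv.2.1 piv.2.2⟩

/-- Elimination in the matrix with target row `(t | 0)` and the other rows `(G | H)` turns the
target into `(t + G x | H x)` for some `x`, with `G x = t` if there is such an `x` at all.  Here
`Θ = (G | H)` is a linear map, and the rows are its values at a generating family `u`. -/
theorem elimProg_spec {N W R : ℕ} (hW : W < 50) (hR : R < 50) {σ : State}
    {U : Type*} [AddCommGroup U] [Module (ZMod 2) U] (Θ : U →ₗ[ZMod 2] (ℕ → ZMod 2)) (u : ℕ → U)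
    (t : ℕ → ZMod 2) (hNW : σ.reg N ≤ σ.reg W) (hR0 : 0 < σ.reg R)
    (hu : Submodule.span (ZMod 2) (u '' {q | 0 < q ∧ q < σ.reg R}) = ⊤)
    (ht : ∀ j < σ.reg W, σ.arr 27 j = (t j).val)
    (hΘ : ∀ q < σ.reg R, 0 < q → ∀ j < σ.reg W, σ.arr 27 (q * σ.reg W + j) = (Θ (u q) j).val) :
    ∃ x, (∀ j < σ.reg W, ((elimProg N W R).run σ).arr 27 j = (t j + Θ x j).val) ∧
      ((∃ x', ∀ j < σ.reg N, t j = Θ x' j) → ∀ j < σ.reg N, t j = Θ x j) := by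
  set A : ℕ → ℕ → ZMod 2 := fun q => if q = 0 then t else Θ (u q) with hA
  have hspan : rowSpan (σ.reg R) A = LinearMap.range Θ := by
    rw [← Submodule.map_top, ← hu, Submodule.map_span, rowSpan, Set.image_image]
    congr 1
    refine Set.image_congr fun q hq => ?_
    simp only [hA, if_neg hq.1.ne']
  obtain ⟨A', hA', hI⟩ := elimProg_inv hW hR (σ := σ) (A := A) (by
    intro q hq j hj
    by_cases hq0 : q = 0
    · simp [hA, hq0, ht j hj]
    · simp only [hA, if_neg hq0]
      exact hΘ q hq (by omega) j hj) hNW hR0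
  obtain ⟨x, hx⟩ : A' 0 - A 0 ∈ LinearMap.range Θ := hspan ▸ hI.target
  have hx' : ∀ j, A' 0 j = t j + Θ x j := fun j => by
    rw [hx]; simp [hA]
  refine ⟨x, fun j hj => ?_, fun ⟨x', h'⟩ j hj => ?_⟩
  · have := hA' 0 hR0 j hj
    rw [zero_mul, zero_add] at this
    rw [this, hx']
  · obtain ⟨w, hw, hw'⟩ := hI.solv ⟨Θ x', hspan ▸ ⟨x', rfl⟩, by simpa [hA] using h'⟩
    have h0 := rowSpan_apply_eq_zero (c := j) (fun q hq hq0 => hI.zero j hj q hq hq0) hw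
    have := hw' j hj
    rw [h0, hx'] at this
    rwa [← sub_eq_zero, CharTwo.sub_eq_add]

/-! ### Arithmetic of the field in coordinates -/

section Coordinates

variable {F : Type} [Field F] [Algebra (ZMod 2) F] {ℓ : ℕ} (b : Module.Basis (Fin ℓ) (ZMod 2) F)

/-- The coordinates with respect to the basis `b`, as a function on `ℕ` that vanishes from `ℓ`
on. -/
noncomputable def crd : F →ₗ[ZMod 2] (ℕ → ZMod 2) where
  toFun x a := if h : a < ℓ then b.repr x ⟨a, h⟩ else 0
  map_add' x y := by funext a; by_cases h : a < ℓ <;> simp [h]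
  map_smul' r x := by funext a; by_cases h : a < ℓ <;> simp [h]

/-- The basis `b`, continued by zero. -/
noncomputable def bas (i : ℕ) : F := if h : i < ℓ then b ⟨i, h⟩ else 0

theorem crd_fin (x : F) (a : Fin ℓ) : crd b x a = b.repr x a := by simp [crd]

theorem crd_of_lt (x : F) {a : ℕ} (h : a < ℓ) : crd b x a = b.repr x ⟨a, h⟩ := by simp [crd, h]

theorem bas_fin (i : Fin ℓ) : bas b i = b i := by simp [bas]

theorem sum_crd (x : F) : ∑ i ∈ Finset.range ℓ, crd b x i • bas b i = x := by
  rw [Finset.sum_range]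
  simp only [crd_fin, bas_fin]
  exact b.sum_repr x

theorem eq_of_crd {x y : F} (h : ∀ a < ℓ, crd b x a = crd b y a) : x = y :=
  b.repr.injective (Finsupp.ext fun a => by rw [← crd_fin, ← crd_fin, h a a.2])

/-- The array holds the multiplication table of the basis. -/
def IsTable (h : ℕ → ℕ) : Prop :=
  ∀ i < ℓ, ∀ j < ℓ, ∀ a < ℓ, h ((i * ℓ + j) * ℓ + a) = (crd b (bas b i * bas b j) a).val

/-- The array holds the coordinates of the elements `w 0`, …, `w (N - 1)`. -/
def IsVec (N : ℕ) (h : ℕ → ℕ) (w : ℕ → F) : Prop :=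
  ∀ j < N, ∀ a < ℓ, h (j * ℓ + a) = (crd b (w j) a).val

/-- The array holds the coordinates of the entries of the matrix `G` with `D` rows and columns. -/
def IsFMat (D : ℕ) (h : ℕ → ℕ) (G : ℕ → ℕ → F) : Prop :=
  ∀ i < D, ∀ j < D, ∀ a < ℓ, h ((i * D + j) * ℓ + a) = (crd b (G i j) a).val

namespace Exp

/-- The coordinate `a` of the product of the field elements with coordinates `e` and `f`, which
are indexed by the variables `v` and `w`. -/
def fmul (v w : ℕ) (e f a : Exp) : Exp :=
  .fold .parity v 3 (.fold .parity w 3 (band e (band f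
    (.get 3 (.add (.mul (.add (.mul (.var v) 3) (.var w)) 3) a)))))

/-- The coordinate `a` of the product of the basis element with index `s` and the field element
with coordinates `f`, which are indexed by the variable `w`. -/
def bmul (w : ℕ) (s f a : Exp) : Exp :=
  .fold .parity w 3 (band f (.get 3 (.add (.mul (.add (.mul s 3) (.var w)) 3) a)))

variable {b}

theorem eval_bmul {w : ℕ} {s f a : Exp} {σ : State} {i A : ℕ} {y : F} (hℓ : σ.reg 3 = ℓ)
    (hT : IsTable b (σ.arr 3)) (hw : 3 ≠ w) (hi : i < ℓ) (hA : A < ℓ)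
    (hs : ∀ j < ℓ, s.eval (σ.setReg w j) = i)
    (hf : ∀ j < ℓ, f.eval (σ.setReg w j) = (crd b y j).val)
    (ha : ∀ j < ℓ, a.eval (σ.setReg w j) = A) :
    (bmul w s f a).eval σ = (crd b (bas b i * y) A).val := by
  rw [bmul, eval_parity (fun j => crd b y j * crd b (bas b i * bas b j) A) hℓ]
  · congr 1
    conv_rhs => rw [← sum_crd b y, Finset.mul_sum]
    simp only [Algebra.mul_smul_comm, map_sum, map_smul, Finset.sum_apply, Pi.smul_apply,
      smul_eq_mul]
  · intro j hj
    refine eval_band (hf j hj) ?_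
    simp only [eval, State.reg_setReg, if_neg hw, hℓ, hs j hj, ha j hj, State.arr_setReg,
      if_true]
    exact hT i hi j hj A hA

theorem eval_fmul {v w : ℕ} {e f a : Exp} {σ : State} {A : ℕ} {x y : F} (hℓ : σ.reg 3 = ℓ)
    (hT : IsTable b (σ.arr 3)) (hv : 3 ≠ v) (hw : 3 ≠ w) (hvw : v ≠ w) (hA : A < ℓ)
    (he : ∀ i < ℓ, ∀ j < ℓ, e.eval ((σ.setReg v i).setReg w j) = (crd b x i).val)
    (hf : ∀ i < ℓ, ∀ j < ℓ, f.eval ((σ.setReg v i).setReg w j) = (crd b y j).val)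
    (ha : ∀ i < ℓ, ∀ j < ℓ, a.eval ((σ.setReg v i).setReg w j) = A) :
    (fmul v w e f a).eval σ = (crd b (x * y) A).val := by
  rw [fmul, eval_parity (fun i => ∑ j ∈ Finset.range ℓ,
    crd b x i * (crd b y j * crd b (bas b i * bas b j) A)) hℓ]
  · congr 1
    conv_rhs => rw [← sum_crd b x, ← sum_crd b y, Finset.sum_mul_sum]
    simp only [Algebra.mul_smul_comm, Algebra.smul_mul_assoc, map_sum, map_smul,
      Finset.sum_apply, Pi.smul_apply, smul_eq_mul]
    exact Finset.sum_congr rfl fun i _ => Finset.sum_congr rfl fun j _ => mul_left_comm _ _ _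
  · intro i hi
    rw [eval_parity _ (by rw [State.reg_setReg_of_ne _ _ hv, hℓ])]
    intro j hj
    refine eval_band (he i hi j hj) (eval_band (hf i hi j hj) ?_)
    simp only [eval, State.reg_setReg, if_neg hw, if_neg hv, hℓ, ha i hi j hj, State.arr_setReg,
      if_true, if_neg hvw]
    exact hT i hi j hj A hA

end Exp

/-! ### Linear systems over the field -/

/-- The columns of `f` up to `N`, followed by those of `g`. -/
def catMap {U : Type*} [AddCommGroup U] [Module (ZMod 2) U] (N : ℕ)
    (f g : U →ₗ[ZMod 2] (ℕ → ZMod 2)) : U →ₗ[ZMod 2] (ℕ → ZMod 2) where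
  toFun x c := if c < N then f x c else g x (c - N)
  map_add' x y := by funext c; by_cases h : c < N <;> simp [h]
  map_smul' r x := by funext c; by_cases h : c < N <;> simp [h]

variable {b}

theorem exists_index {k : ℕ} {q : ℕ} (h0 : 0 < q) (hq : q < 1 + k * ℓ) :
    ∃ (i : Fin k) (s : Fin ℓ), q = 1 + (i * ℓ + s) := by
  have hℓ : 0 < ℓ := by
    rcases Nat.eq_zero_or_pos ℓ with rfl | h
    · omega
    · exact h
  have h1 := Nat.div_add_mod (q - 1) ℓ
  have h2 := Nat.mod_lt (q - 1) hℓ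
  have h3 : (q - 1) / ℓ < k := Nat.div_lt_of_lt_mul (by rw [mul_comm]; omega)
  exact ⟨⟨_, h3⟩, ⟨_, h2⟩, by simp only; rw [mul_comm _ ℓ]; omega⟩

/-- Elimination, where the unknowns form a word of length `k` over the field.  The columns carried
along, which start at zero, end up as the values of `H` at some `x`, which solves the system if
there is any solution. -/
theorem elimProg_solve {N W R k n n' : ℕ} (hW : W < 50) (hR : R < 50) {σ : State}
    (G H : (Fin k → F) →ₗ[ZMod 2] (ℕ → ZMod 2)) (t : ℕ → ZMod 2)
    (hN : σ.reg N = n) (hW' : σ.reg W = n + n') (hR' : σ.reg R = 1 + k * ℓ)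
    (ht : ∀ j < n, σ.arr 27 j = (t j).val) (ht' : ∀ j < n', σ.arr 27 (n + j) = 0)
    (hG : ∀ (i : Fin k) (s : Fin ℓ), ∀ j < n,
      σ.arr 27 ((1 + (i * ℓ + s)) * (n + n') + j) = (G (Pi.single i (b s)) j).val)
    (hH : ∀ (i : Fin k) (s : Fin ℓ), ∀ j < n',
      σ.arr 27 ((1 + (i * ℓ + s)) * (n + n') + (n + j)) = (H (Pi.single i (b s)) j).val) :
    ∃ x, (∀ j < n', ((elimProg N W R).run σ).arr 27 (n + j) = (H x j).val) ∧
      ((∃ x', ∀ j < n, t j = G x' j) → ∀ j < n, t j = G x j) := by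
  set u : ℕ → Fin k → F := fun q =>
    if h : (q - 1) / ℓ < k then Pi.single ⟨_, h⟩ (bas b ((q - 1) % ℓ)) else 0 with hu
  have hus : ∀ (i : Fin k) (s : Fin ℓ), u (1 + (i * ℓ + s)) = Pi.single i (b s) := by
    intro i s
    have h1 : (1 + (i * ℓ + s : ℕ) - 1) / ℓ = i := by
      rw [Nat.add_sub_cancel_left, div_index s.2]
    have h2 : (1 + (i * ℓ + s : ℕ) - 1) % ℓ = s := by
      rw [Nat.add_sub_cancel_left, mod_index s.2]
    simp only [hu, h1, h2, bas_fin, i.2, dif_pos]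
  have hspan : Submodule.span (ZMod 2) (u '' {q | 0 < q ∧ q < σ.reg R}) = ⊤ := by
    rw [eq_top_iff, ← (Pi.basis fun _ : Fin k => b).span_eq]
    refine Submodule.span_le.2 ?_
    rintro _ ⟨⟨i, s⟩, rfl⟩
    refine Submodule.subset_span ⟨1 + (i * ℓ + s), ⟨by omega, ?_⟩, ?_⟩
    · rw [hR']
      have : (i : ℕ) * ℓ + ℓ ≤ k * ℓ := by
        rw [← Nat.succ_mul]; exact Nat.mul_le_mul_right _ i.2
      omega
    · rw [hus, Pi.basis_apply]
  have hrow0 : ∀ j < σ.reg W, σ.arr 27 j = (if j < n then t j else 0 : ZMod 2).val := by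
    intro j hj
    by_cases h : j < n
    · simp [h, ht j h]
    · have := ht' (j - n) (by omega)
      rw [Nat.add_sub_cancel' (by omega)] at this
      simp [h, this]
  have hrows : ∀ q < σ.reg R, 0 < q → ∀ j < σ.reg W,
      σ.arr 27 (q * σ.reg W + j) = (catMap n G H (u q) j).val := by
    intro q hq h0 j hj
    obtain ⟨i, s, rfl⟩ := exists_index (ℓ := ℓ) h0 (by omega : q < 1 + k * ℓ)
    rw [hus, hW']
    by_cases h : j < n
    · simp [h, hG i s j h, catMap]
    · have := hH i s (j - n) (by omega)
      rw [Nat.add_sub_cancel' (by omega)] at this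
      simp [h, this, catMap]
  obtain ⟨x, hx1, hx2⟩ := elimProg_spec (N := N) (σ := σ) hW hR (catMap n G H) u
    (fun c => if c < n then t c else 0) (by omega) (by omega) hspan hrow0 hrows
  refine ⟨x, fun j hj => ?_, fun ⟨x', h'⟩ j hj => ?_⟩
  · rw [hx1 _ (by omega)]
    simp [catMap]
  · have := hx2 ⟨x', fun j hj => ?_⟩ j (hN ▸ hj)
    · simpa [catMap, hj] using this
    · rw [hN] at hj
      simpa [catMap, hj] using h' j hj

variable (b)

/-- The word `w` over the field as a sequence of bits. -/
noncomputable def flat (w : ℕ → F) (c : ℕ) : ZMod 2 := crd b (w (c / ℓ)) (c % ℓ)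

theorem flat_index (w : ℕ → F) {j a : ℕ} (ha : a < ℓ) : flat b w (j * ℓ + a) = crd b (w j) a := by
  rw [flat, div_index ha, mod_index ha]

/-- The bits of the linear combination of the rows of the matrix `G`. -/
noncomputable def combMap {k : ℕ} (G : ℕ → ℕ → F) :
    (Fin k → F) →ₗ[ZMod 2] (ℕ → ZMod 2) where
  toFun x := flat b fun j => ∑ i, x i * G i j
  map_add' x y := by
    funext c
    simp [flat, add_mul, Finset.sum_add_distrib]
  map_smul' r x := by
    funext c
    simp [flat, ← Finset.smul_sum]

theorem combMap_single {k : ℕ} (G : ℕ → ℕ → F) (i : Fin k) (x : F) :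
    combMap b G (Pi.single i x) = flat b fun j => x * G i j := by
  have : ∀ j, ∑ i', (Pi.single i x : Fin k → F) i' * G i' j = x * G i j := fun j => by
    rw [Finset.sum_eq_single i]
    · simp
    · intro i' _ h; simp [h]
    · simp
  simp only [combMap, LinearMap.coe_mk, AddHom.coe_mk, this]

end Coordinates

/-- Shorthand for the index `(i * r + j) * s + a`. -/
def Exp.ix (i : Exp) (r : ℕ) (j : Exp) : Exp := .add (.mul i r) j

/-- The rows of a linear system over the field, given in the array `24`, as rows of bits: every row
is multiplied by all the elements of the basis. -/
def sysRowsG : Prog :=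
  .loop 41 2 (.loop 42 3 (.loop 43 2 (.loop 44 3
    (.store 27 (.add (.mul (.add (.lit 1) (.ix (.var 41) 3 (.var 42))) 9)
        (.ix (.var 43) 3 (.var 44)))
      (.bmul 45 (.var 42) (.get 24 (.ix (.ix (.var 41) 2 (.var 43)) 3 (.var 45))) (.var 44))))))

/-- The values in the array `25`, which are to be carried along. -/
def sysRowsH : Prog :=
  .loop 41 2 (.loop 42 3 (.loop 43 2 (.loop 44 3
    (.store 27 (.add (.mul (.add (.lit 1) (.ix (.var 41) 3 (.var 42))) 9)
        (.add (.var 8) (.ix (.var 43) 3 (.var 44))))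
      (.bmul 45 (.var 42) (.get 25 (.ix (.ix (.var 41) 2 (.var 43)) 3 (.var 45))) (.var 44))))))

/-- The right hand side, which is in the array `26`, with zeros for the values carried along. -/
def sysTarget : Prog :=
  .seq (.loop 43 2 (.loop 44 3 (.store 27 (.ix (.var 43) 3 (.var 44))
      (.get 26 (.ix (.var 43) 3 (.var 44))))))
    (.loop 43 8 (.store 27 (.add (.var 8) (.var 43)) (.lit 0)))

/-- Solve the linear system, and put the combination of the values carried along into the
array `30`. -/
def sysSolve : Prog :=
  .seq (.seq sysRowsG (.seq sysRowsH sysTarget)) (.seq (elimProg 8 9 10)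
    (.loop 43 8 (.store 30 (.var 43) (.get 27 (.add (.var 8) (.var 43))))))

section

variable {F : Type} [Field F] [Algebra (ZMod 2) F] {ℓ : ℕ} {b : Module.Basis (Fin ℓ) (ZMod 2) F}

/-- What the programs for the field and for words of length `D` expect in the variables. -/
structure Dims (b : Module.Basis (Fin ℓ) (ZMod 2) F) (D : ℕ) (σ : State) : Prop where
  len : σ.reg 2 = D
  deg : σ.reg 3 = ℓ
  bits : σ.reg 8 = D * ℓ
  width : σ.reg 9 = D * ℓ + D * ℓ
  rows : σ.reg 10 = 1 + D * ℓ
  table : IsTable b (σ.arr 3)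

theorem index_lt {D i a : ℕ} (hi : i < D) (ha : a < ℓ) : i * ℓ + a < D * ℓ := by
  calc i * ℓ + a < i * ℓ + ℓ := by omega
    _ = (i + 1) * ℓ := by ring
    _ ≤ D * ℓ := Nat.mul_le_mul_right _ hi

theorem sysSolve_spec {D : ℕ} {σ : State} (hσ : Dims b D σ) {G H : ℕ → ℕ → F} {t : ℕ → F}
    (hG : IsFMat b D (σ.arr 24) G) (hH : IsFMat b D (σ.arr 25) H) (ht : IsVec b D (σ.arr 26) t) :
    ∃ x : Fin D → F, IsVec b D ((sysSolve.run σ).arr 30) (fun j => ∑ i, x i * H i j) ∧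
      ((∃ x' : Fin D → F, ∀ j < D, t j = ∑ i, x' i * G i j) → ∀ j < D, t j = ∑ i, x i * G i j) := by
  obtain ⟨h2, h3, h8, h9, h10, hT⟩ := hσ
  set g : ℕ → ℕ := fun c => (if c / (D * ℓ + D * ℓ) = 0 then
      (if c % (D * ℓ + D * ℓ) < D * ℓ then flat b t (c % (D * ℓ + D * ℓ)) else 0)
    else catMap (D * ℓ) (combMap b (k := D) G) (combMap b (k := D) H)
      (if h : (c / (D * ℓ + D * ℓ) - 1) / ℓ < D then
        Pi.single ⟨_, h⟩ (bas b ((c / (D * ℓ + D * ℓ) - 1) % ℓ)) else 0)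
      (c % (D * ℓ + D * ℓ))).val with hg
  have g0 : ∀ c < D * ℓ, g c = (flat b t c).val := fun c hc => by
    simp only [hg]
    rw [Nat.div_eq_of_lt (by omega), Nat.mod_eq_of_lt (by omega), if_pos rfl, if_pos hc]
  have g0' : ∀ c < D * ℓ, g (D * ℓ + c) = 0 := fun c hc => by
    simp only [hg]
    rw [Nat.div_eq_of_lt (by omega), Nat.mod_eq_of_lt (by omega), if_pos rfl,
      if_neg (by omega), ZMod.val_zero]
  have gr : ∀ i < D, ∀ s < ℓ, ∀ c < D * ℓ + D * ℓ,
      g ((1 + (i * ℓ + s)) * (D * ℓ + D * ℓ) + c) =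
        (catMap (D * ℓ) (combMap b (k := D) G) (combMap b (k := D) H)
          (if h : i < D then Pi.single ⟨i, h⟩ (bas b s) else 0) c).val :=
    fun i hi s hs c hc => by
      simp only [hg]
      rw [div_index hc, mod_index hc, if_neg (by omega)]
      simp only [Nat.add_sub_cancel_left, div_index hs, mod_index hs]
  have grG : ∀ i < D, ∀ s < ℓ, ∀ c < D * ℓ, g ((1 + (i * ℓ + s)) * (D * ℓ + D * ℓ) + c) =
      (flat b (fun j => bas b s * G i j) c).val := fun i hi s hs c hc => by
    rw [gr i hi s hs c (by omega), dif_pos hi]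
    simp only [catMap, LinearMap.coe_mk, AddHom.coe_mk, if_pos hc, combMap_single]
  have grH : ∀ i < D, ∀ s < ℓ, ∀ c < D * ℓ,
      g ((1 + (i * ℓ + s)) * (D * ℓ + D * ℓ) + (D * ℓ + c)) =
      (flat b (fun j => bas b s * H i j) c).val := fun i hi s hs c hc => by
    rw [gr i hi s hs _ (by omega), dif_pos hi]
    simp only [catMap, LinearMap.coe_mk, AddHom.coe_mk, combMap_single]
    rw [if_neg (by omega), Nat.add_sub_cancel_left]
  have f1 : Fills sysRowsG 27 σ ∅ {c | ∃ i < D, ∃ s < ℓ, ∃ j < D, ∃ a < ℓ,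
      c = (1 + (i * ℓ + s)) * (D * ℓ + D * ℓ) + (j * ℓ + a)} g := by
    refine Fills.loop₄ _ h2 h3 h2 h3 (by decide) (by decide) (by decide) (by decide) (by decide)
      (by decide) fun i hi s hs j hj a ha h => ⟨?_, ?_⟩
    · simp [Exp.eval, Exp.ix, State.reg_setReg, h3, h9]
    · rw [grG i hi s hs _ (index_lt hj ha), flat_index b _ ha]
      refine Exp.eval_bmul (by simp [State.reg_setReg, h3]) (by simpa [State.arr_setArr] using hT)
        (by decide) hs ha ?_ ?_ ?_
      · simp [Exp.eval, State.reg_setReg]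
      · intro q hq
        simp [Exp.eval, Exp.ix, State.reg_setReg, State.arr_setArr, h2, h3]
        exact hG i hi j hj q hq
      · simp [Exp.eval, State.reg_setReg]
  have f2 : Fills sysRowsH 27 σ (∅ ∪ {c | ∃ i < D, ∃ s < ℓ, ∃ j < D, ∃ a < ℓ,
      c = (1 + (i * ℓ + s)) * (D * ℓ + D * ℓ) + (j * ℓ + a)})
      {c | ∃ i < D, ∃ s < ℓ, ∃ j < D, ∃ a < ℓ,
      c = (1 + (i * ℓ + s)) * (D * ℓ + D * ℓ) + (D * ℓ + (j * ℓ + a))} g := by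
    refine Fills.loop₄ _ h2 h3 h2 h3 (by decide) (by decide) (by decide) (by decide) (by decide)
      (by decide) fun i hi s hs j hj a ha h => ⟨?_, ?_⟩
    · simp [Exp.eval, Exp.ix, State.reg_setReg, h3, h9, h8]
    · rw [grH i hi s hs _ (index_lt hj ha), flat_index b _ ha]
      refine Exp.eval_bmul (by simp [State.reg_setReg, h3]) (by simpa [State.arr_setArr] using hT)
        (by decide) hs ha ?_ ?_ ?_
      · simp [Exp.eval, State.reg_setReg]
      · intro q hq
        simp [Exp.eval, Exp.ix, State.reg_setReg, State.arr_setArr, h2, h3]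
        exact hH i hi j hj q hq
      · simp [Exp.eval, State.reg_setReg]
  have f3 : ∀ D₀, Fills sysTarget 27 σ D₀ ({c | ∃ j < D, ∃ a < ℓ, c = j * ℓ + a} ∪
      {c | ∃ j < D * ℓ, c = D * ℓ + j}) g := by
    intro D₀
    refine Fills.seq (Fills.loop₂ _ h2 h3 (by decide) fun j hj a ha h => ⟨?_, ?_⟩)
      (Fills.loop₁ _ h8 fun j hj h => ⟨?_, ?_⟩)
    · simp [Exp.eval, Exp.ix, State.reg_setReg, h3]
    · rw [g0 _ (index_lt hj ha), flat_index b _ ha]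
      simp [Exp.eval, Exp.ix, State.reg_setReg, h3, State.arr_setArr]
      exact ht j hj a ha
    · simp [Exp.eval, State.reg_setReg, h8]
    · rw [g0' j hj]; rfl
  have f := Fills.seq f1 (Fills.seq f2 (f3 _))
  set σ₁ := (Prog.seq sysRowsG (.seq sysRowsH sysTarget)).run σ with hσ₁
  have r1 : σ₁.reg = σ.reg := f.reg
  have split : ∀ c < D * ℓ, ∃ j < D, ∃ a < ℓ, c = j * ℓ + a := fun c hc => by
    have hℓ : 0 < ℓ := Nat.pos_of_ne_zero fun h => by simp [h] at hc
    exact ⟨c / ℓ, Nat.div_lt_of_lt_mul (by rwa [mul_comm]), c % ℓ, Nat.mod_lt _ hℓ, by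
      rw [mul_comm]; exact (Nat.div_add_mod c ℓ).symm⟩
  obtain ⟨x, hx1, hx2⟩ := elimProg_solve (N := 8) (W := 9) (R := 10) (b := b) (by decide)
    (by decide) (σ := σ₁) (combMap b (k := D) G) (combMap b H) (flat b t) (by rw [r1, h8])
    (by rw [r1, h9]) (by rw [r1, h10])
    (fun c hc => by
      rw [f.arr, g0 c hc]
      exact .inr (.inr (.inl (split c hc))))
    (fun c hc => by
      rw [f.arr, g0' c hc]
      exact .inr (.inr (.inr ⟨c, hc, rfl⟩)))
    (fun i s c hc => by
      rw [f.arr, grG i i.2 s s.2 c hc, combMap_single, bas_fin]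
      obtain ⟨j, hj, a, ha, rfl⟩ := split c hc
      exact .inl ⟨i, i.2, s, s.2, j, hj, a, ha, rfl⟩)
    (fun i s c hc => by
      rw [f.arr, grH i i.2 s s.2 c hc, combMap_single, bas_fin]
      obtain ⟨j, hj, a, ha, rfl⟩ := split c hc
      exact .inr (.inl ⟨i, i.2, s, s.2, j, hj, a, ha, rfl⟩))
  refine ⟨x, fun j hj a ha => ?_, fun ⟨x', h'⟩ j hj => ?_⟩
  · have fr := (elimProg 8 9 10).frame σ₁
    have r8 : ((elimProg 8 9 10).run σ₁).reg 8 = D * ℓ := by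
      rw [fr.1 _ (by decide), r1, h8]
    have f4 : Fills (.loop 43 8 (.store 30 (.var 43) (.get 27 (.add (.var 8) (.var 43))))) 30
        ((elimProg 8 9 10).run σ₁) ∅ {c | ∃ j < D * ℓ, c = j}
        fun c => (combMap b H x c).val :=
      Fills.loop₁ _ r8 fun c hc h => ⟨by simp [Exp.eval], by
        simp [Exp.eval, State.reg_setReg, State.arr_setArr, r8, hx1 c hc]⟩
    rw [show sysSolve.run σ = Prog.run _ ((elimProg 8 9 10).run σ₁) from rfl,
      f4.arr ⟨_, index_lt hj ha, rfl⟩]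
    simp only [combMap, LinearMap.coe_mk, AddHom.coe_mk, flat_index b _ ha]
  · refine eq_of_crd b fun a ha => ?_
    have := hx2 ⟨x', fun c hc => ?_⟩ _ (index_lt hj ha)
    · simpa [combMap, flat_index b _ ha] using this
    · obtain ⟨j, hj, a, ha, rfl⟩ := split c hc
      simp only [combMap, LinearMap.coe_mk, AddHom.coe_mk, flat_index b _ ha, h' j hj]

end

/-! ### Generalized Reed-Solomon codes -/

section HalfMinDist

variable {F ι : Type} [Field F] [Fintype ι] {C : Submodule F (ι → F)} {w c : ι → F}

open Classical in
theorem minDist_le_hammingDist {c' : ι → F} (hc : c ∈ C) (hc' : c' ∈ C) (h : c ≠ c') :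
    minDist C ≤ hammingDist c c' := by
  rw [hammingDist_eq_hammingNorm]
  exact Nat.sInf_le ⟨_, sub_mem hc' hc, sub_ne_zero.2 h.symm, hammingNorm_comm_sub c c'⟩
where
  hammingNorm_comm_sub (c c' : ι → F) : hammingNorm (c' - c) = hammingNorm (-c + c') := by
    congr 1; abel

open Classical in
theorem halfMinDistDecode_eq (hc : c ∈ C) (h : 2 * hammingDist w c < minDist C) :
    halfMinDistDecode C w = c := by
  have hex : ∃ c ∈ C, 2 * hammingDist w c < minDist C := ⟨c, hc, h⟩
  rw [halfMinDistDecode, dif_pos hex]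
  obtain ⟨h1, h2⟩ := hex.choose_spec
  by_contra hne
  have := minDist_le_hammingDist h1 hc hne
  have := hammingDist_triangle hex.choose w c
  have := hammingDist_comm w hex.choose
  omega

open Classical in
theorem halfMinDistDecode_of_forall (h : ∀ c ∈ C, ¬ 2 * hammingDist w c < minDist C) :
    halfMinDistDecode C w = 0 := by
  rw [halfMinDistDecode, dif_neg]
  rintro ⟨c, hc, h'⟩
  exact h c hc h'

theorem halfMinDistDecode_mem : halfMinDistDecode C w ∈ C := by
  rw [halfMinDistDecode]
  split_ifs with h
  exacts [h.choose_spec.1, zero_mem C]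

theorem halfMinDistDecode_self (hw : w ∈ C) (h : 0 < minDist C) : halfMinDistDecode C w = w := by
  classical
  exact halfMinDistDecode_eq hw (by rw [hammingDist_self]; omega)

end HalfMinDist

namespace GRS

open Polynomial

variable {F : Type} [Field F] {Δ : ℕ} (G : GRS F Δ)

theorem mem_code {w : Fin Δ → F} :
    w ∈ G.code ↔ ∃ f : F[X], f.degree < G.k ∧ ∀ j, w j = G.mult j * f.eval (G.loc j) := by
  simp only [code, Submodule.mem_map, mem_degreeLT]
  refine exists_congr fun f => and_congr_right fun _ => ?_
  rw [funext_iff]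
  simp only [LinearMap.pi_apply, LinearMap.smul_apply, leval_apply, smul_eq_mul]
  exact forall_congr' fun j => eq_comm

theorem eq_zero_of_eval {f : F[X]} {s : Finset (Fin Δ)} (hf : f.degree < s.card)
    (h : ∀ j ∈ s, f.eval (G.loc j) = 0) : f = 0 :=
  eq_zero_of_degree_lt_of_eval_index_eq_zero s G.loc_injective.injOn hf h

/-- Generalized Reed-Solomon codes attain the Singleton bound. -/
theorem minDist_code : minDist G.code = Δ - G.k + 1 := by
  classical
  have hk := G.k_pos
  have hkl := G.k_le
  have hsub : ∀ w : Fin Δ → F, hammingNorm w + (Finset.univ.filter fun j => w j = 0).card = Δ := by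
    intro w
    have := Finset.card_filter_add_card_filter_not (s := (Finset.univ : Finset (Fin Δ)))
      (fun j => w j = 0)
    rw [Finset.card_univ, Fintype.card_fin] at this
    rw [hammingNorm]
    simp only [ne_eq]
    omega
  refine le_antisymm (Nat.sInf_le ?_) (le_csInf ?_ ?_)
  · set s : Finset (Fin Δ) := Finset.univ.filter fun j => (j : ℕ) < G.k - 1 with hs
    have hcard : s.card = G.k - 1 := by
      rw [hs, Fin.card_filter_val_lt]
      omega
    set f : F[X] := ∏ j ∈ s, (X - C (G.loc j)) with hf
    have hfm : f.Monic := monic_prod_of_monic _ _ fun j _ => monic_X_sub_C _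
    have hfd : f.natDegree = G.k - 1 := by
      rw [hf, natDegree_prod_of_monic _ _ fun j _ => monic_X_sub_C _]
      simp [hcard]
    have hfz : ∀ j, f.eval (G.loc j) = 0 ↔ j ∈ s := by
      intro j
      rw [hf, eval_prod, Finset.prod_eq_zero_iff]
      simp only [eval_sub, eval_X, eval_C, sub_eq_zero, G.loc_injective.eq_iff]
      simp
    set w : Fin Δ → F := fun j => G.mult j * f.eval (G.loc j) with hw
    have hwz : (Finset.univ.filter fun j => w j = 0) = s := by
      ext j
      simp only [hw, mul_eq_zero, G.mult_ne_zero, false_or, hfz, Finset.mem_filter,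
        Finset.mem_univ, true_and]
    have hwn := hsub w
    rw [hwz, hcard] at hwn
    refine ⟨w, G.mem_code.2 ⟨f, ?_, fun j => rfl⟩, fun h0 => ?_, ?_⟩
    · rw [degree_eq_natDegree hfm.ne_zero, hfd]
      exact_mod_cast (by omega : G.k - 1 < G.k)
    · rw [h0, hammingNorm_zero] at hwn; omega
    · convert (show hammingNorm w = Δ - G.k + 1 by omega)
  · obtain ⟨j, hj⟩ : ∃ j : Fin Δ, j = ⟨0, by omega⟩ := ⟨_, rfl⟩
    refine ⟨_, fun j => G.mult j * (1 : F[X]).eval (G.loc j), G.mem_code.2 ⟨1, ?_, fun j => rfl⟩,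
      fun h => ?_, rfl⟩
    · rw [degree_one]; exact_mod_cast hk
    · have := congrFun h j
      simp [G.mult_ne_zero] at this
  · rintro d ⟨w, hw, hw0, rfl⟩
    obtain ⟨f, hf, hwf⟩ := G.mem_code.1 hw
    by_contra hlt
    have := hsub w
    have hf0 : f = 0 := G.eq_zero_of_eval (s := Finset.univ.filter fun j => w j = 0)
      (hf.trans_le (by
        have : hammingNorm w < Δ - G.k + 1 := by convert not_le.1 hlt
        exact_mod_cast (by omega))) fun j hj => by
        have := (Finset.mem_filter.1 hj).2
        rw [hwf, mul_eq_zero] at this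
        exact this.resolve_left (G.mult_ne_zero j)
    exact hw0 (funext fun j => by rw [hwf, hf0]; simp)

theorem minDist_pos : 0 < minDist G.code := by rw [minDist_code]; omega

/-- Half of the redundancy: the number of errors that the decoder corrects. -/
def radius : ℕ := (Δ - G.k) / 2

theorem two_mul_lt_minDist {d : ℕ} : 2 * d < minDist G.code ↔ d ≤ G.radius := by
  rw [minDist_code, radius]; omega

/-- The locators, continued by zero. -/
def locN (j : ℕ) : F := if h : j < Δ then G.loc ⟨j, h⟩ else 0

/-- The multipliers, continued by zero. -/
def multN (j : ℕ) : F := if h : j < Δ then G.mult ⟨j, h⟩ else 0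

theorem locN_fin (j : Fin Δ) : G.locN j = G.loc j := by simp [locN]

theorem multN_fin (j : Fin Δ) : G.multN j = G.mult j := by simp [multN]

/-- The polynomial with the given coefficients. -/
noncomputable def ofCoeffs (a : ℕ) (x : ℕ → F) : F[X] := ∑ i ∈ Finset.range a, C (x i) * X ^ i

theorem degree_ofCoeffs (a : ℕ) (x : ℕ → F) : (ofCoeffs a x).degree < a := by
  rw [← mem_degreeLT]
  refine Submodule.sum_mem _ fun i hi => mem_degreeLT.2 ((degree_C_mul_X_pow_le _ _).trans_lt ?_)
  exact_mod_cast Finset.mem_range.1 hi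

theorem eval_ofCoeffs (a : ℕ) (x : ℕ → F) (z : F) :
    (ofCoeffs a x).eval z = ∑ i ∈ Finset.range a, x i * z ^ i := by
  simp [ofCoeffs, eval_finsetSum]

theorem eval_eq_sum {f : F[X]} {a : ℕ} (hf : f.degree < a) (z : F) :
    f.eval z = ∑ i ∈ Finset.range a, f.coeff i * z ^ i := by
  rcases Nat.eq_zero_or_pos a with rfl | ha
  · have : f = 0 := by
      rwa [Nat.cast_zero, ← not_le, zero_le_degree_iff, not_not] at hf
    simp [this]
  · rw [eval_eq_sum_range' ((natDegree_lt_iff_degree_lt' ha.ne').2 hf)]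
where
  natDegree_lt_iff_degree_lt' {f : F[X]} {a : ℕ} (ha : a ≠ 0) :
      f.natDegree < a ↔ f.degree < a := by
    by_cases hf : f = 0
    · simp [hf, Nat.pos_of_ne_zero ha]
    · exact natDegree_lt_iff_degree_lt hf

/-- The first linear system of the decoder.  Its unknowns are the coefficients of a polynomial of
degree less than `k + t`, and those of the error locator, a monic polynomial of degree `t`, where
`t` is the number of errors that can be corrected. -/
def keyMat (y : ℕ → F) (i j : ℕ) : F :=
  if i < G.k + G.radius then G.multN j * G.locN j ^ i
  else if i < G.k + G.radius + G.radius then y j * G.locN j ^ (i - (G.k + G.radius)) else 0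

/-- The contribution of the unknowns of the first system to the values of the error locator. -/
def keyVal (i j : ℕ) : F :=
  if i < G.k + G.radius then 0
  else if i < G.k + G.radius + G.radius then G.locN j ^ (i - (G.k + G.radius)) else 0

theorem sum_split {a t N : ℕ} (h : a + t ≤ N) (x f g : ℕ → F) :
    ∑ i ∈ Finset.range N, x i * (if i < a then f i else if i < a + t then g (i - a) else 0) =
      ∑ i ∈ Finset.range a, x i * f i + ∑ i ∈ Finset.range t, x (a + i) * g i := by
  obtain ⟨r, rfl⟩ := Nat.exists_eq_add_of_le h
  rw [Finset.sum_range_add, Finset.sum_range_add, add_assoc,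
    Finset.sum_congr rfl fun i hi => ?_, add_right_inj,
    Finset.sum_congr rfl fun i hi => ?_, add_eq_left]
  · refine Finset.sum_eq_zero fun i _ => ?_
    rw [if_neg (by omega), if_neg (by omega), mul_zero]
  · rw [Finset.mem_range] at hi
    rw [if_neg (by omega), if_pos (by omega), Nat.add_sub_cancel_left]
  · rw [if_pos (Finset.mem_range.1 hi)]

theorem two_radius_le : G.k + G.radius + G.radius ≤ Δ := by
  have := G.k_le
  rw [radius]; omega

theorem sum_keyMat (x y : ℕ → F) (j : Fin Δ) :
    ∑ i ∈ Finset.range Δ, x i * G.keyMat y i j =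
      G.mult j * (ofCoeffs (G.k + G.radius) x).eval (G.loc j) +
        y j * (ofCoeffs G.radius fun i => x (G.k + G.radius + i)).eval (G.loc j) := by
  simp only [keyMat, multN_fin, locN_fin]
  rw [sum_split G.two_radius_le x (fun i => G.mult j * G.loc j ^ i) fun i => y j * G.loc j ^ i,
    eval_ofCoeffs, eval_ofCoeffs, Finset.mul_sum, Finset.mul_sum]
  congr 1 <;> exact Finset.sum_congr rfl fun i _ => by ring

theorem sum_keyVal (x : ℕ → F) (j : Fin Δ) :
    ∑ i ∈ Finset.range Δ, x i * G.keyVal i j =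
      (ofCoeffs G.radius fun i => x (G.k + G.radius + i)).eval (G.loc j) := by
  simp only [keyVal, locN_fin]
  rw [sum_split G.two_radius_le x (fun _ => 0) fun i => G.loc j ^ i, eval_ofCoeffs]
  simp

section Decoding

open Classical

variable {G} {y : ℕ → F} {c : Fin Δ → F}

/-- The first system has a solution if there are not too many errors: the product of `X - loc j`
over the positions `j` of errors, filled up by a power of `X` to the right degree, and its product
with the polynomial of the codeword. -/
theorem exists_locator (hc : c ∈ G.code) (hd : hammingDist (fun j : Fin Δ => y j) c ≤ G.radius) :
    ∃ x : ℕ → F, ∀ j : Fin Δ,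
      y j * G.loc j ^ G.radius = ∑ i ∈ Finset.range Δ, x i * G.keyMat y i j := by
  obtain ⟨f, hf, hcf⟩ := G.mem_code.1 hc
  set s : Finset (Fin Δ) := Finset.univ.filter fun j => y j ≠ c j with hs
  have hsc : s.card ≤ G.radius := hd
  set E : F[X] := (∏ j ∈ s, (X - C (G.loc j))) * X ^ (G.radius - s.card) with hE
  have hEm : E.Monic := (monic_prod_of_monic _ _ fun j _ => monic_X_sub_C _).mul (monic_X_pow _)
  have hEd : E.natDegree = G.radius := by
    rw [hE, (monic_prod_of_monic _ _ fun j _ => monic_X_sub_C _).natDegree_mul (monic_X_pow _),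
      natDegree_prod_of_monic _ _ fun j _ => monic_X_sub_C _]
    simp [hsc]
  have hEz : ∀ j : Fin Δ, y j ≠ c j → E.eval (G.loc j) = 0 := fun j hj => by
    rw [hE, eval_mul, eval_prod, Finset.prod_eq_zero (i := j) (by simp [hs, hj]) (by simp),
      zero_mul]
  have hN : (f * E).degree < (G.k + G.radius : ℕ) := by
    by_cases hf0 : f = 0
    · rw [hf0, zero_mul, degree_zero]; exact WithBot.bot_lt_coe _
    · rw [degree_mul, degree_eq_natDegree hEm.ne_zero, hEd, Nat.cast_add]
      rw [degree_eq_natDegree hf0] at hf ⊢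
      norm_cast at hf ⊢
      omega
  refine ⟨fun i => if i < G.k + G.radius then (f * E).coeff i
    else -E.coeff (i - (G.k + G.radius)), fun j => ?_⟩
  rw [sum_keyMat, eval_ofCoeffs, eval_ofCoeffs]
  have e1 : ∑ i ∈ Finset.range (G.k + G.radius), (if i < G.k + G.radius then (f * E).coeff i
      else -E.coeff (i - (G.k + G.radius))) * G.loc j ^ i = (f * E).eval (G.loc j) := by
    rw [eval_eq_sum hN]
    exact Finset.sum_congr rfl fun i hi => by rw [if_pos (Finset.mem_range.1 hi)]
  have e2 : ∑ i ∈ Finset.range G.radius, (if G.k + G.radius + i < G.k + G.radius then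
      (f * E).coeff (G.k + G.radius + i) else -E.coeff (G.k + G.radius + i - (G.k + G.radius))) *
      G.loc j ^ i = G.loc j ^ G.radius - E.eval (G.loc j) := by
    rw [eval_eq_sum_range' (n := G.radius + 1) (by omega), Finset.sum_range_succ,
      ← hEd, coeff_natDegree, hEm.leadingCoeff, one_mul, sub_add_cancel_right, hEd,
      ← Finset.sum_neg_distrib]
    refine Finset.sum_congr rfl fun i hi => ?_
    rw [if_neg (by omega), Nat.add_sub_cancel_left, neg_mul]
  rw [e1, e2, eval_mul]
  by_cases hj : y j = c j
  · rw [hj, hcf]; ring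
  · rw [hEz j hj]; ring

/-- Every solution of the first system leads to a polynomial (the error locator) that vanishes at
the locators of the errors, and not at too many others. -/
theorem locator_spec (hc : c ∈ G.code) (hd : hammingDist (fun j : Fin Δ => y j) c ≤ G.radius)
    {x : ℕ → F} (hx : ∀ j : Fin Δ,
      y j * G.loc j ^ G.radius = ∑ i ∈ Finset.range Δ, x i * G.keyMat y i j) {e : Fin Δ → F}
    (he : ∀ j, e j = G.loc j ^ G.radius - ∑ i ∈ Finset.range Δ, x i * G.keyVal i j) :
    (∀ j : Fin Δ, y j * e j = c j * e j) ∧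
      ∀ c' ∈ G.code, (∀ j : Fin Δ, y j * e j = c' j * e j) → c' = c := by
  obtain ⟨f, hf, hcf⟩ := G.mem_code.1 hc
  set P : F[X] := ofCoeffs G.radius fun i => x (G.k + G.radius + i) with hP
  set N : F[X] := ofCoeffs (G.k + G.radius) x with hN
  set E : F[X] := X ^ G.radius - P with hE
  have hPd : P.degree < G.radius := degree_ofCoeffs _ _
  have hEm : E.Monic := (monic_X_pow _).sub_of_left (by rwa [degree_X_pow])
  have hEd : E.degree = G.radius := by
    rw [hE, degree_sub_eq_left_of_degree_lt (by rwa [degree_X_pow]), degree_X_pow]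
  have heE : ∀ j, e j = E.eval (G.loc j) := fun j => by
    rw [he, sum_keyVal, hE, eval_sub, eval_pow, eval_X]
  have hyN : ∀ j : Fin Δ, y j * e j = G.mult j * N.eval (G.loc j) := fun j => by
    have := hx j
    rw [sum_keyMat] at this
    rw [he, sum_keyVal, mul_sub, this]
    ring
  have hfE : ∀ f : F[X], f.degree < G.k → (f * E).degree < (G.k + G.radius : ℕ) := fun f hf => by
    by_cases hf0 : f = 0
    · rw [hf0, zero_mul, degree_zero]; exact WithBot.bot_lt_coe _
    · rw [degree_mul, hEd, Nat.cast_add]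
      rw [degree_eq_natDegree hf0] at hf ⊢
      norm_cast at hf ⊢
      omega
  have hNf : N - f * E = 0 := by
    refine G.eq_zero_of_eval (s := Finset.univ.filter fun j => y j = c j) ?_ fun j hj => ?_
    · refine (degree_sub_lt' (degree_ofCoeffs _ _) (hfE f hf)).trans_le ?_
      have h1 := Finset.card_filter_add_card_filter_not (s := (Finset.univ : Finset (Fin Δ)))
        (fun j => y j = c j)
      rw [Finset.card_univ, Fintype.card_fin] at h1
      have h2 : (Finset.univ.filter fun j : Fin Δ => ¬ y j = c j).card ≤ G.radius := hd
      have h3 := G.two_radius_le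
      exact_mod_cast (by omega)
    · have h1 := hyN j
      rw [(Finset.mem_filter.1 hj).2, hcf, heE, mul_assoc] at h1
      rw [eval_sub, eval_mul, ← mul_left_cancel₀ (G.mult_ne_zero j) h1, sub_self]
  rw [sub_eq_zero] at hNf
  have main : ∀ j : Fin Δ, y j * e j = c j * e j := fun j => by
    rw [hyN, hNf, eval_mul, hcf, heE]; ring
  refine ⟨main, fun c' hc' h' => ?_⟩
  obtain ⟨f', hf', hcf'⟩ := G.mem_code.1 hc'
  have hz : (f' - f) * E = 0 := by
    refine G.eq_zero_of_eval (s := Finset.univ) ?_ fun j _ => ?_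
    · refine (hfE _ (degree_sub_lt' hf' hf)).trans_le ?_
      have := G.two_radius_le
      rw [Finset.card_univ, Fintype.card_fin]
      exact_mod_cast (by omega)
    · have h1 := (h' j).symm.trans (main j)
      rw [hcf', hcf, heE, mul_assoc, mul_assoc] at h1
      rw [eval_mul, eval_sub, sub_mul, mul_left_cancel₀ (G.mult_ne_zero j) h1, sub_self]
  have hff : f' = f := sub_eq_zero.1 ((mul_eq_zero.1 hz).resolve_right hEm.ne_zero)
  exact funext fun j => by rw [hcf', hcf, hff]
where
  degree_sub_lt' {f g : F[X]} {n : WithBot ℕ} (hf : f.degree < n) (hg : g.degree < n) :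
      (f - g).degree < n :=
    (degree_sub_le f g).trans_lt (max_lt hf hg)

end Decoding

/-- The rows of the matrix that generates the code, continued by zero. -/
def genMat (i j : ℕ) : F := if i < G.k then G.multN j * G.locN j ^ i else 0

theorem sum_genMat (x : ℕ → F) (j : Fin Δ) :
    ∑ i ∈ Finset.range Δ, x i * G.genMat i j = G.mult j * (ofCoeffs G.k x).eval (G.loc j) := by
  have := sum_split (a := G.k) (t := 0) (N := Δ) G.k_le x (fun i => G.mult j * G.loc j ^ i) fun _ => 0
  simp only [mul_zero, Finset.sum_const_zero, add_zero] at this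
  rw [eval_ofCoeffs, Finset.mul_sum]
  simp only [genMat, multN_fin, locN_fin]
  refine Eq.trans (Finset.sum_congr rfl fun i _ => ?_) (this.trans
    (Finset.sum_congr rfl fun i _ => by ring))
  split_ifs <;> rfl

theorem mem_code_iff_genMat {w : Fin Δ → F} :
    w ∈ G.code ↔ ∃ x : ℕ → F, ∀ j : Fin Δ, w j = ∑ i ∈ Finset.range Δ, x i * G.genMat i j := by
  rw [mem_code]
  constructor
  · rintro ⟨f, hf, h⟩
    refine ⟨f.coeff, fun j => ?_⟩
    rw [sum_genMat, h, eval_ofCoeffs, ← eval_eq_sum hf]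
  · rintro ⟨x, h⟩
    exact ⟨_, degree_ofCoeffs _ x, fun j => by rw [h, sum_genMat]⟩

end GRS

/-! ### The program that decodes generalized Reed-Solomon codes -/

/-- Fill a square matrix over the field; the entry is a function of the variables `41` (row),
`43` (column) and `44` (coordinate). -/
def matFill (a : ℕ) (e : Exp) : Prog :=
  .loop 41 2 (.loop 43 2 (.loop 44 3 (.store a (.ix (.ix (.var 41) 2 (.var 43)) 3 (.var 44)) e)))

/-- Fill a vector over the field; the entry is a function of the variables `43` and `44`. -/
def vecFill (a : ℕ) (e : Exp) : Prog :=
  .loop 43 2 (.loop 44 3 (.store a (.ix (.var 43) 3 (.var 44)) e))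

/-- The state `σ'` differs from `σ` at most in the array `a`. -/
def SameBut (a : ℕ) (σ σ' : State) : Prop := σ'.reg = σ.reg ∧ ∀ c ≠ a, σ'.arr c = σ.arr c

/-- The word `w`, continued by zero. -/
def extN {F : Type} [Zero F] {D : ℕ} (w : Fin D → F) (j : ℕ) : F :=
    if h : j < D then w ⟨j, h⟩ else 0

theorem extN_fin {F : Type} [Zero F] {D : ℕ} (w : Fin D → F) (j : Fin D) :
    extN w j = w j := by simp [extN]

theorem sum_extN {F : Type} [Field F] {D : ℕ} (x : Fin D → F) (g : ℕ → F) :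
    ∑ i, x i * g i = ∑ i ∈ Finset.range D, extN x i * g i := by
  rw [Finset.sum_range]
  simp only [extN_fin]

section

variable {F : Type} [Field F] [Algebra (ZMod 2) F] {ℓ : ℕ} {b : Module.Basis (Fin ℓ) (ZMod 2) F}
  {D : ℕ} {σ : State}

theorem matFill_spec (hσ : Dims b D σ) {a : ℕ} {e : Exp} (G : ℕ → ℕ → F)
    (H : ∀ i < D, ∀ j < D, ∀ c < ℓ, ∀ h : ℕ → ℕ,
      (∀ i' < i, ∀ j' < D, ∀ c' < ℓ, h ((i' * D + j') * ℓ + c') = (crd b (G i' j') c').val) →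
      e.eval ((((σ.setReg 41 i).setReg 43 j).setReg 44 c).setArr a h) = (crd b (G i j) c).val) :
    SameBut a σ ((matFill a e).run σ) ∧ IsFMat b D (((matFill a e).run σ).arr a) G := by
  set g : ℕ → ℕ := fun x => (crd b (G (x / ℓ / D) (x / ℓ % D)) (x % ℓ)).val with hg
  have gx : ∀ i, ∀ j < D, ∀ c < ℓ, g ((i * D + j) * ℓ + c) = (crd b (G i j) c).val :=
    fun i j hj c hc => by
      simp only [hg]
      rw [div_index hc, mod_index hc, div_index hj, mod_index hj]
  have f : Fills (matFill a e) a σ ∅ {x | ∃ i < σ.reg 2, x ∈ {x | ∃ j < D, x ∈ {x | ∃ c < ℓ,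
      x ∈ ({(i * D + j) * ℓ + c} : Set ℕ)}}} g := by
    refine Fills.loop _ fun i hi => ?_
    refine (Fills.loop (fun j => {x | ∃ c < ℓ, x ∈ ({(i * D + j) * ℓ + c} : Set ℕ)})
      fun j hj => ?_).mono (by rw [State.reg_setReg_of_ne _ _ (by decide), hσ.len])
    rw [State.reg_setReg_of_ne _ _ (by decide), hσ.len] at hj
    rw [hσ.len] at hi
    refine (Fills.loop (fun c => {(i * D + j) * ℓ + c}) fun c hc => Fills.store _ ?_).mono
      (by rw [State.reg_setReg_of_ne _ _ (by decide), State.reg_setReg_of_ne _ _ (by decide),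
        hσ.deg])
    rw [State.reg_setReg_of_ne _ _ (by decide), State.reg_setReg_of_ne _ _ (by decide),
      hσ.deg] at hc
    intro h hh
    refine ⟨by simp [Exp.eval, Exp.ix, State.reg_setReg, hσ.len, hσ.deg], ?_⟩
    rw [H i hi j hj c hc h fun i' hi' j' hj' c' hc' => ?_, gx i j hj c hc]
    rw [hh _ (.inl (.inl (.inr ⟨i', hi', j', hj', c', hc', rfl⟩))), gx _ _ hj' _ hc']
  refine ⟨⟨f.reg, fun c hc => f.arr_of_ne hc⟩, fun i hi j hj c hc => ?_⟩
  rw [f.arr ⟨i, by rwa [hσ.len], j, hj, c, hc, rfl⟩, gx i j hj c hc]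

theorem vecFill_spec (hσ : Dims b D σ) {a : ℕ} {e : Exp} (w : ℕ → F)
    (H : ∀ j < D, ∀ c < ℓ, ∀ h : ℕ → ℕ,
      e.eval (((σ.setReg 43 j).setReg 44 c).setArr a h) = (crd b (w j) c).val) :
    SameBut a σ ((vecFill a e).run σ) ∧ IsVec b D (((vecFill a e).run σ).arr a) w := by
  have f : Fills (vecFill a e) a σ ∅ {x | ∃ j < D, ∃ c < ℓ, x = j * ℓ + c}
      fun x => (flat b w x).val := by
    refine Fills.loop₂ _ hσ.len hσ.deg (by decide) fun j hj c hc h => ⟨?_, ?_⟩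
    · simp [Exp.eval, Exp.ix, State.reg_setReg, hσ.deg]
    · rw [H j hj c hc h, flat_index b w hc]
  refine ⟨⟨f.reg, fun c hc => f.arr_of_ne hc⟩, fun j hj c hc => ?_⟩
  rw [f.arr ⟨j, hj, c, hc, rfl⟩, flat_index b w hc]

end

/-- The powers of the locators. -/
def powFill : Prog :=
  matFill 23 (.ite (.lit 0) (.var 41)
    (.fmul 45 46 (.get 23 (.ix (.ix (.sub (.var 41) (.lit 1)) 2 (.var 43)) 3 (.var 45)))
      (.get 20 (.ix (.var 43) 3 (.var 46))) (.var 44))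
    (.get 4 (.var 44)))

/-- The powers of the locators, times the multipliers. -/
def genFill : Prog :=
  matFill 29 (.fmul 45 46 (.get 21 (.ix (.var 43) 3 (.var 45)))
    (.get 23 (.ix (.ix (.var 41) 2 (.var 43)) 3 (.var 46))) (.var 44))

/-- The numbers of unknowns in the first system; the dimension of the code is in the
variable `17`, and the number of errors that can be corrected goes to the variable `18`. -/
def radiusProg : Prog :=
  .seq (.assign 18 (.fold .sum 43 2 (.ite (.add (.add (.var 43) (.var 43)) (.lit 1))
    (.sub (.var 2) (.var 17)) (.lit 1) (.lit 0))))
  (.seq (.assign 19 (.add (.var 17) (.var 18))) (.assign 38 (.add (.var 19) (.var 18))))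

/-- The matrix `GRS.keyMat`. -/
def keyMatFill : Prog :=
  matFill 24 (.ite (.var 41) (.var 19) (.get 29 (.ix (.ix (.var 41) 2 (.var 43)) 3 (.var 44)))
    (.ite (.var 41) (.var 38) (.fmul 45 46 (.get 22 (.ix (.var 43) 3 (.var 45)))
      (.get 23 (.ix (.ix (.sub (.var 41) (.var 19)) 2 (.var 43)) 3 (.var 46))) (.var 44))
      (.lit 0)))

/-- The matrix `GRS.keyVal`. -/
def keyValFill : Prog :=
  matFill 25 (.ite (.var 41) (.var 19) (.lit 0)
    (.ite (.var 41) (.var 38)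
      (.get 23 (.ix (.ix (.sub (.var 41) (.var 19)) 2 (.var 43)) 3 (.var 44))) (.lit 0)))

/-- The right hand side of the first system: the received word times the leading terms of the error
locator. -/
def keyTarget : Prog :=
  vecFill 26 (.fmul 45 46 (.get 22 (.ix (.var 43) 3 (.var 45)))
      (.get 23 (.ix (.ix (.var 18) 2 (.var 43)) 3 (.var 46))) (.var 44))

/-- The values of the error locator, from the solution of the first system. -/
def locatorFill : Prog :=
  vecFill 31 (.bxor (.get 23 (.ix (.ix (.var 18) 2 (.var 43)) 3 (.var 44)))
    (.get 30 (.ix (.var 43) 3 (.var 44))))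

/-- The second system: the unknowns are the coefficients of a codeword, and the equations are
multiplied by the values of the error locator, which turns the errors into erasures. -/
def erasMatFill : Prog :=
  matFill 24 (.ite (.var 41) (.var 17)
    (.fmul 45 46 (.get 29 (.ix (.ix (.var 41) 2 (.var 43)) 3 (.var 45)))
      (.get 31 (.ix (.var 43) 3 (.var 46))) (.var 44)) (.lit 0))

/-- The generator matrix, so that the codeword itself is carried along. -/
def erasValFill : Prog :=
  matFill 25 (.ite (.var 41) (.var 17) (.get 29 (.ix (.ix (.var 41) 2 (.var 43)) 3 (.var 44)))
    (.lit 0))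

/-- The right hand side of the second system. -/
def erasTarget : Prog :=
  vecFill 26 (.fmul 45 46 (.get 22 (.ix (.var 43) 3 (.var 45)))
      (.get 31 (.ix (.var 43) 3 (.var 46))) (.var 44))

/-- Whether two values differ. -/
def Exp.ne (e f : Exp) : Exp := .ite e f (.lit 1) (.ite f e (.lit 1) (.lit 0))

/-- Whether the symbols at the position in the variable `43` differ in the arrays `a`
and `22`. -/
def symNe (a : ℕ) : Exp :=
  .ite (.lit 0) (.fold .sum 44 3 (.ne (.get a (.ix (.var 43) 3 (.var 44)))
    (.get 22 (.ix (.var 43) 3 (.var 44))))) (.lit 1) (.lit 0)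

/-- Accept the candidate if it is close enough to the received word. -/
def acceptProg : Prog :=
  .seq (.assign 39 (.fold .sum 43 2 (symNe 30)))
    (vecFill 32 (.ite (.var 18) (.var 39) (.lit 0) (.get 30 (.ix (.var 43) 3 (.var 44)))))

/-- The half minimum distance decoder: solve a linear system for an error locator, then one for a
codeword that agrees with the received word where the error locator does not vanish. -/
def grsDecode : Prog :=
  .seq (.seq radiusProg (.seq powFill genFill))
  (.seq (.seq (.seq keyMatFill (.seq keyValFill keyTarget)) sysSolve)
  (.seq (.seq locatorFill (.seq (.seq erasMatFill (.seq erasValFill erasTarget)) sysSolve))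
    acceptProg))

section

variable {F : Type} [Field F] [Algebra (ZMod 2) F] {ℓ : ℕ} {b : Module.Basis (Fin ℓ) (ZMod 2) F}
  {D : ℕ} {σ : State}

theorem Exp.eval_ne {e f : Exp} {σ : State} :
    (Exp.ne e f).eval σ = if e.eval σ = f.eval σ then 0 else 1 := by
  simp only [Exp.ne, Exp.eval]
  split_ifs <;> first | rfl | omega

theorem eval_symNe (hσ : Dims b D σ) {a : ℕ} {w y : ℕ → F} (hw : IsVec b D (σ.arr a) w)
    (hy : IsVec b D (σ.arr 22) y) {j : ℕ} (hj : j < D) [Decidable (w j = y j)] :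
    (symNe a).eval (σ.setReg 43 j) = if w j = y j then 0 else 1 := by
  rw [symNe, Exp.eval, Exp.eval_sum (n := ℓ) (fun c => if crd b (w j) c = crd b (y j) c then 0 else 1)
    (by rw [State.reg_setReg_of_ne _ _ (by decide), hσ.deg])]
  · by_cases h : w j = y j
    · simp [h, Exp.eval]
    · rw [if_neg h, if_pos]
      · rfl
      · rw [Exp.eval, Nat.pos_iff_ne_zero]
        intro h0
        rw [Finset.sum_eq_zero_iff] at h0
        refine h (eq_of_crd b fun c hc => ?_)
        by_contra hne
        have := h0 c (Finset.mem_range.2 hc)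
        simp [hne] at this
  · intro c hc
    rw [Exp.eval_ne]
    simp only [Exp.eval, Exp.ix, State.reg_setReg, State.arr_setReg]
    simp only [hσ.deg, if_true, Nat.reduceEqDiff, if_false, hw j hj c hc, hy j hj c hc,
      (ZMod.val_injective 2).eq_iff]

theorem radiusProg_spec (hσ : Dims b D σ) (G : GRS F D) (hk : σ.reg 17 = G.k) :
    ((radiusProg.run σ).reg 18 = G.radius ∧ (radiusProg.run σ).reg 19 = G.k + G.radius ∧
      (radiusProg.run σ).reg 38 = G.k + G.radius + G.radius) := by
  have : (Exp.fold .sum 43 2 (.ite (.add (.add (.var 43) (.var 43)) (.lit 1))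
      (.sub (.var 2) (.var 17)) (.lit 1) (.lit 0))).eval σ = G.radius := by
    rw [Exp.eval_sum (fun i => if i + i + 1 < D - G.k then 1 else 0) hσ.len fun i _ => by
      simp [Exp.eval, State.reg_setReg, hσ.len, hk]]
    rw [← Finset.sum_filter, Finset.sum_const, smul_eq_mul, mul_one, GRS.radius]
    conv_rhs => rw [← Finset.card_range ((D - G.k) / 2)]
    congr 1
    ext i
    simp only [Finset.mem_filter, Finset.mem_range]
    omega
  simp [radiusProg, Prog.run, Exp.eval, State.reg_setReg, ← this, hk]

/-- The data that the decoder of a code `G` finds in the memory, and the received word `y`. -/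
structure GrsIn (b : Module.Basis (Fin ℓ) (ZMod 2) F) (G : GRS F D) (y : ℕ → F) (σ : State) :
    Prop where
  dims : Dims b D σ
  dim : σ.reg 17 = G.k
  unit : ∀ c < ℓ, σ.arr 4 c = (crd b (1 : F) c).val
  loc : IsVec b D (σ.arr 20) G.locN
  mult : IsVec b D (σ.arr 21) G.multN
  word : IsVec b D (σ.arr 22) y

/-- The same, together with the tables that the decoder computes first. -/
structure GrsMid (b : Module.Basis (Fin ℓ) (ZMod 2) F) (G : GRS F D) (y : ℕ → F) (σ : State) :
    Prop extends GrsIn b G y σ where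
  radius : σ.reg 18 = G.radius
  row : σ.reg 19 = G.k + G.radius
  row' : σ.reg 38 = G.k + G.radius + G.radius
  pow : IsFMat b D (σ.arr 23) fun i j => G.locN j ^ i
  gen : IsFMat b D (σ.arr 29) fun i j => G.multN j * G.locN j ^ i

variable {G : GRS F D} {y : ℕ → F}

theorem Dims.run (hσ : Dims b D σ) (p : Prog) (hr : ∀ r ∈ [2, 3, 8, 9, 10], r ∉ p.asgn)
    (ha : 3 ∉ p.wa) : Dims b D (p.run σ) := by
  obtain ⟨h1, h2, h3, h4, h5, h6⟩ := hσ
  have f := fun r h => (p.frame σ).1 r (hr r h)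
  exact ⟨by rw [f 2 (by decide), h1], by rw [f 3 (by decide), h2], by rw [f 8 (by decide), h3],
    by rw [f 9 (by decide), h4], by rw [f 10 (by decide), h5], by rwa [(p.frame σ).2 3 ha]⟩

theorem GrsIn.run (hσ : GrsIn b G y σ) (p : Prog) (hr : ∀ r ∈ [2, 3, 8, 9, 10, 17], r ∉ p.asgn)
    (ha : ∀ a ∈ [3, 4, 20, 21, 22], a ∉ p.wa) : GrsIn b G y (p.run σ) := by
  have f := fun r h => (p.frame σ).1 r (hr r h)
  have g := fun a h => (p.frame σ).2 a (ha a h)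
  refine ⟨hσ.dims.run p (fun r h => hr r ?_) (ha 3 (by decide)), by rw [f 17 (by decide), hσ.dim],
    fun c hc => by rw [g 4 (by decide), hσ.unit c hc], by rw [g 20 (by decide)]; exact hσ.loc,
    by rw [g 21 (by decide)]; exact hσ.mult, by rw [g 22 (by decide)]; exact hσ.word⟩
  simp only [List.mem_cons] at h ⊢
  tauto

theorem GrsMid.run (hσ : GrsMid b G y σ) (p : Prog)
    (hr : ∀ r ∈ [2, 3, 8, 9, 10, 17, 18, 19, 38], r ∉ p.asgn)
    (ha : ∀ a ∈ [3, 4, 20, 21, 22, 23, 29], a ∉ p.wa) : GrsMid b G y (p.run σ) := by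
  have f := fun r h => (p.frame σ).1 r (hr r h)
  have g := fun a h => (p.frame σ).2 a (ha a h)
  refine ⟨hσ.toGrsIn.run p (fun r h => hr r ?_) (fun a h => ha a ?_),
    by rw [f 18 (by decide), hσ.radius], by rw [f 19 (by decide), hσ.row],
    by rw [f 38 (by decide), hσ.row'], by rw [g 23 (by decide)]; exact hσ.pow,
    by rw [g 29 (by decide)]; exact hσ.gen⟩
  all_goals
    simp only [List.mem_cons] at h ⊢
    tauto

theorem powFill_spec (hσ : GrsIn b G y σ) :
    IsFMat b D ((powFill.run σ).arr 23) fun i j => G.locN j ^ i := by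
  refine (matFill_spec hσ.dims _ fun i hi j hj c hc h hh => ?_).2
  rw [Exp.eval]
  by_cases h0 : 0 < i
  · rw [if_pos (by simpa [Exp.eval, State.reg_setReg] using h0)]
    obtain ⟨i, rfl⟩ : ∃ i', i = i' + 1 := ⟨i - 1, by omega⟩
    rw [pow_succ]
    refine Exp.eval_fmul (by simp [State.reg_setReg, hσ.dims.deg])
      (by simpa [State.arr_setArr] using hσ.dims.table) (by decide) (by decide) (by decide) hc
      (fun p hp q hq => ?_) (fun p hp q hq => ?_) fun p hp q hq => ?_
    · simp [Exp.eval, Exp.ix, State.reg_setReg, State.arr_setArr, hσ.dims.len, hσ.dims.deg]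
      exact hh i (by omega) j hj p hp
    · simp [Exp.eval, Exp.ix, State.reg_setReg, State.arr_setArr, hσ.dims.deg]
      exact hσ.loc j hj q hq
    · simp [Exp.eval, State.reg_setReg]
  · rw [if_neg (by simpa [Exp.eval, State.reg_setReg] using h0)]
    obtain rfl : i = 0 := by omega
    simp [Exp.eval, State.arr_setArr, hσ.unit c hc]

theorem genFill_spec (hσ : GrsIn b G y σ) (hp : IsFMat b D (σ.arr 23) fun i j => G.locN j ^ i) :
    IsFMat b D ((genFill.run σ).arr 29) fun i j => G.multN j * G.locN j ^ i := by
  refine (matFill_spec hσ.dims _ fun i hi j hj c hc h hh => ?_).2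
  refine Exp.eval_fmul (by simp [State.reg_setReg, hσ.dims.deg])
    (by simpa [State.arr_setArr] using hσ.dims.table) (by decide) (by decide) (by decide) hc
    (fun p hp q hq => ?_) (fun p hp' q hq => ?_) fun p hp q hq => ?_
  · simp [Exp.eval, Exp.ix, State.reg_setReg, State.arr_setArr, hσ.dims.deg]
    exact hσ.mult j hj p hp
  · simp [Exp.eval, Exp.ix, State.reg_setReg, State.arr_setArr, hσ.dims.len, hσ.dims.deg]
    exact hp i hi j hj q hq
  · simp [Exp.eval, State.reg_setReg]

theorem tables_spec (hσ : GrsIn b G y σ) :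
    GrsMid b G y ((Prog.seq radiusProg (.seq powFill genFill)).run σ) := by
  obtain ⟨r1, r2, r3⟩ := radiusProg_spec hσ.dims G hσ.dim
  have h1 := hσ.run radiusProg (by decide) (by decide)
  have h2 := h1.run powFill (by decide) (by decide)
  have h3 := h2.run genFill (by decide) (by decide)
  have hp := powFill_spec h1
  have f := fun r h => (genFill.frame (powFill.run (radiusProg.run σ))).1 r h
  have f' := fun r h => (powFill.frame (radiusProg.run σ)).1 r h
  refine ⟨h3, ?_, ?_, ?_, ?_, genFill_spec h2 hp⟩
  · rw [Prog.run, Prog.run, f _ (by decide), f' _ (by decide), r1]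
  · rw [Prog.run, Prog.run, f _ (by decide), f' _ (by decide), r2]
  · rw [Prog.run, Prog.run, f _ (by decide), f' _ (by decide), r3]
  · rw [Prog.run, Prog.run, (genFill.frame _).2 _ (by decide)]
    exact hp

theorem keyMatFill_spec (hσ : GrsMid b G y σ) :
    IsFMat b D ((keyMatFill.run σ).arr 24) (G.keyMat y) := by
  refine (matFill_spec hσ.dims _ fun i hi j hj c hc h hh => ?_).2
  rw [GRS.keyMat, Exp.eval]
  by_cases h1 : i < G.k + G.radius
  · rw [if_pos h1, if_pos (by simpa [Exp.eval, State.reg_setReg, hσ.row] using h1)]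
    simp [Exp.eval, Exp.ix, State.reg_setReg, State.arr_setArr, hσ.dims.len, hσ.dims.deg]
    exact hσ.gen i hi j hj c hc
  · rw [if_neg h1, if_neg (by simpa [Exp.eval, State.reg_setReg, hσ.row] using h1), Exp.eval]
    by_cases h2 : i < G.k + G.radius + G.radius
    · rw [if_pos h2, if_pos (by simpa [Exp.eval, State.reg_setReg, hσ.row'] using h2)]
      refine Exp.eval_fmul (by simp [State.reg_setReg, hσ.dims.deg])
        (by simpa [State.arr_setArr] using hσ.dims.table) (by decide) (by decide) (by decide) hc
        (fun p hp q hq => ?_) (fun p hp' q hq => ?_) fun p hp q hq => ?_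
      · simp [Exp.eval, Exp.ix, State.reg_setReg, State.arr_setArr, hσ.dims.deg]
        exact hσ.word j hj p hp
      · simp [Exp.eval, Exp.ix, State.reg_setReg, State.arr_setArr, hσ.dims.len, hσ.dims.deg,
          hσ.row]
        exact hσ.pow _ (by omega) j hj q hq
      · simp [Exp.eval, State.reg_setReg]
    · rw [if_neg h2, if_neg (by simpa [Exp.eval, State.reg_setReg, hσ.row'] using h2)]
      simp [Exp.eval]

theorem keyValFill_spec (hσ : GrsMid b G y σ) :
    IsFMat b D ((keyValFill.run σ).arr 25) G.keyVal := by
  refine (matFill_spec hσ.dims _ fun i hi j hj c hc h hh => ?_).2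
  rw [GRS.keyVal, Exp.eval]
  by_cases h1 : i < G.k + G.radius
  · rw [if_pos h1, if_pos (by simpa [Exp.eval, State.reg_setReg, hσ.row] using h1)]
    simp [Exp.eval]
  · rw [if_neg h1, if_neg (by simpa [Exp.eval, State.reg_setReg, hσ.row] using h1), Exp.eval]
    by_cases h2 : i < G.k + G.radius + G.radius
    · rw [if_pos h2, if_pos (by simpa [Exp.eval, State.reg_setReg, hσ.row'] using h2)]
      simp [Exp.eval, Exp.ix, State.reg_setReg, State.arr_setArr, hσ.dims.len, hσ.dims.deg,
        hσ.row]
      exact hσ.pow _ (by omega) j hj c hc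
    · rw [if_neg h2, if_neg (by simpa [Exp.eval, State.reg_setReg, hσ.row'] using h2)]
      simp [Exp.eval]

theorem keyTarget_spec (hσ : GrsMid b G y σ) :
    IsVec b D ((keyTarget.run σ).arr 26) fun j => y j * G.locN j ^ G.radius := by
  have hk := G.k_pos
  have hr := G.two_radius_le
  refine (vecFill_spec hσ.dims _ fun j hj c hc h => ?_).2
  refine Exp.eval_fmul (by simp [State.reg_setReg, hσ.dims.deg])
    (by simpa [State.arr_setArr] using hσ.dims.table) (by decide) (by decide) (by decide) hc
    (fun p hp q hq => ?_) (fun p hp' q hq => ?_) fun p hp q hq => ?_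
  · simp [Exp.eval, Exp.ix, State.reg_setReg, State.arr_setArr, hσ.dims.deg]
    exact hσ.word j hj p hp
  · simp [Exp.eval, Exp.ix, State.reg_setReg, State.arr_setArr, hσ.dims.len, hσ.dims.deg,
      hσ.radius]
    exact hσ.pow _ (by omega) j hj q hq
  · simp [Exp.eval, State.reg_setReg]

theorem locatorFill_spec (hσ : GrsMid b G y σ) {w : ℕ → F} (hw : IsVec b D (σ.arr 30) w) :
    IsVec b D ((locatorFill.run σ).arr 31) fun j => G.locN j ^ G.radius + w j := by
  have hk := G.k_pos
  have hr := G.two_radius_le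
  refine (vecFill_spec hσ.dims _ fun j hj c hc h => ?_).2
  rw [map_add, Pi.add_apply]
  refine Exp.eval_bxor ?_ ?_
  · simp [Exp.eval, Exp.ix, State.reg_setReg, State.arr_setArr, hσ.dims.len, hσ.dims.deg,
      hσ.radius]
    exact hσ.pow _ (by omega) j hj c hc
  · simp [Exp.eval, Exp.ix, State.reg_setReg, State.arr_setArr, hσ.dims.deg]
    exact hw j hj c hc

theorem erasMatFill_spec (hσ : GrsMid b G y σ) {e : ℕ → F} (he : IsVec b D (σ.arr 31) e) :
    IsFMat b D ((erasMatFill.run σ).arr 24) fun i j => G.genMat i j * e j := by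
  refine (matFill_spec hσ.dims _ fun i hi j hj c hc h hh => ?_).2
  rw [GRS.genMat, Exp.eval]
  by_cases h1 : i < G.k
  · rw [if_pos h1, if_pos (by simpa [Exp.eval, State.reg_setReg, hσ.dim] using h1)]
    refine Exp.eval_fmul (by simp [State.reg_setReg, hσ.dims.deg])
      (by simpa [State.arr_setArr] using hσ.dims.table) (by decide) (by decide) (by decide) hc
      (fun p hp q hq => ?_) (fun p hp' q hq => ?_) fun p hp q hq => ?_
    · simp [Exp.eval, Exp.ix, State.reg_setReg, State.arr_setArr, hσ.dims.len, hσ.dims.deg]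
      exact hσ.gen i hi j hj p hp
    · simp [Exp.eval, Exp.ix, State.reg_setReg, State.arr_setArr, hσ.dims.deg]
      exact he j hj q hq
    · simp [Exp.eval, State.reg_setReg]
  · rw [if_neg h1, if_neg (by simpa [Exp.eval, State.reg_setReg, hσ.dim] using h1)]
    simp [Exp.eval]

theorem erasValFill_spec (hσ : GrsMid b G y σ) :
    IsFMat b D ((erasValFill.run σ).arr 25) G.genMat := by
  refine (matFill_spec hσ.dims _ fun i hi j hj c hc h hh => ?_).2
  rw [GRS.genMat, Exp.eval]
  by_cases h1 : i < G.k
  · rw [if_pos h1, if_pos (by simpa [Exp.eval, State.reg_setReg, hσ.dim] using h1)]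
    simp [Exp.eval, Exp.ix, State.reg_setReg, State.arr_setArr, hσ.dims.len, hσ.dims.deg]
    exact hσ.gen i hi j hj c hc
  · rw [if_neg h1, if_neg (by simpa [Exp.eval, State.reg_setReg, hσ.dim] using h1)]
    simp [Exp.eval]

theorem erasTarget_spec (hσ : GrsMid b G y σ) {e : ℕ → F} (he : IsVec b D (σ.arr 31) e) :
    IsVec b D ((erasTarget.run σ).arr 26) fun j => y j * e j := by
  refine (vecFill_spec hσ.dims _ fun j hj c hc h => ?_).2
  refine Exp.eval_fmul (by simp [State.reg_setReg, hσ.dims.deg])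
    (by simpa [State.arr_setArr] using hσ.dims.table) (by decide) (by decide) (by decide) hc
    (fun p hp q hq => ?_) (fun p hp' q hq => ?_) fun p hp q hq => ?_
  · simp [Exp.eval, Exp.ix, State.reg_setReg, State.arr_setArr, hσ.dims.deg]
    exact hσ.word j hj p hp
  · simp [Exp.eval, Exp.ix, State.reg_setReg, State.arr_setArr, hσ.dims.deg]
    exact he j hj q hq
  · simp [Exp.eval, State.reg_setReg]

theorem keySolve_spec (hσ : GrsMid b G y σ) :
    ∃ x : ℕ → F, IsVec b D
        (((Prog.seq (.seq keyMatFill (.seq keyValFill keyTarget)) sysSolve).run σ).arr 30)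
        (fun j => ∑ i ∈ Finset.range D, x i * G.keyVal i j) ∧
      ((∃ x' : ℕ → F, ∀ j : Fin D,
          y j * G.loc j ^ G.radius = ∑ i ∈ Finset.range D, x' i * G.keyMat y i j) →
        ∀ j : Fin D, y j * G.loc j ^ G.radius = ∑ i ∈ Finset.range D, x i * G.keyMat y i j) := by
  have h1 := hσ.run keyMatFill (by decide) (by decide)
  have h2 := h1.run keyValFill (by decide) (by decide)
  have h3 := h2.run keyTarget (by decide) (by decide)
  have m1 := keyMatFill_spec hσ
  have m2 := keyValFill_spec h1
  have m3 := keyTarget_spec h2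
  rw [← (keyValFill.frame _).2 24 (by decide), ← (keyTarget.frame _).2 24 (by decide)] at m1
  rw [← (keyTarget.frame _).2 25 (by decide)] at m2
  obtain ⟨x, hx1, hx2⟩ := sysSolve_spec h3.dims m1 m2 m3
  refine ⟨extN x, fun j hj c hc => ?_, fun ⟨x', h'⟩ j => ?_⟩
  · simp only [← sum_extN x fun i => G.keyVal i j]
    exact hx1 j hj c hc
  · have := hx2 ⟨fun i => x' i, fun j hj => ?_⟩ j j.2
    · rwa [sum_extN x fun i => G.keyMat y i j, G.locN_fin] at this
    · have := h' ⟨j, hj⟩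
      rwa [← G.locN_fin, Finset.sum_range] at this

theorem erasSolve_spec (hσ : GrsMid b G y σ) {e : ℕ → F} (he : IsVec b D (σ.arr 31) e) :
    ∃ c ∈ G.code, IsVec b D
        (((Prog.seq (.seq erasMatFill (.seq erasValFill erasTarget)) sysSolve).run σ).arr 30)
        (extN c) ∧
      ((∃ c' ∈ G.code, ∀ j : Fin D, y j * e j = c' j * e j) →
        ∀ j : Fin D, y j * e j = c j * e j) := by
  have h1 := hσ.run erasMatFill (by decide) (by decide)
  have h2 := h1.run erasValFill (by decide) (by decide)
  have h3 := h2.run erasTarget (by decide) (by decide)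
  have m1 := erasMatFill_spec hσ he
  have m2 := erasValFill_spec h1
  have m3 := erasTarget_spec h2 (e := e) (by
    rw [(erasValFill.frame _).2 31 (by decide), (erasMatFill.frame _).2 31 (by decide)]
    exact he)
  rw [← (erasValFill.frame _).2 24 (by decide), ← (erasTarget.frame _).2 24 (by decide)] at m1
  rw [← (erasTarget.frame _).2 25 (by decide)] at m2
  obtain ⟨x, hx1, hx2⟩ := sysSolve_spec h3.dims m1 m2 m3
  have sum_mul : ∀ (x : ℕ → F) (j : ℕ), ∑ i ∈ Finset.range D, x i * (G.genMat i j * e j) =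
      (∑ i ∈ Finset.range D, x i * G.genMat i j) * e j := fun x j => by
    rw [Finset.sum_mul]; exact Finset.sum_congr rfl fun i _ => (mul_assoc _ _ _).symm
  refine ⟨fun j => ∑ i ∈ Finset.range D, extN x i * G.genMat i j,
    G.mem_code_iff_genMat.2 ⟨_, fun j => rfl⟩, fun j hj c hc => ?_, fun ⟨c', hc', h'⟩ j => ?_⟩
  · rw [extN, dif_pos hj, ← sum_extN x fun i => G.genMat i j]
    exact hx1 j hj c hc
  · obtain ⟨x', hx'⟩ := G.mem_code_iff_genMat.1 hc'
    have := hx2 ⟨fun i => x' i, fun j hj => ?_⟩ j j.2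
    · rwa [sum_extN x fun i => G.genMat i j * e j, sum_mul] at this
    · have := h' ⟨j, hj⟩
      rw [hx'] at this
      simp only at this
      rw [this, ← sum_mul, Finset.sum_range]

open Classical in
theorem acceptProg_spec (hσ : GrsMid b G y σ) {c : Fin D → F}
    (hc : IsVec b D (σ.arr 30) (extN c)) :
    IsVec b D ((acceptProg.run σ).arr 32)
      (if hammingDist (fun j : Fin D => y j) c ≤ G.radius then extN c else 0) := by
  have hd : (Exp.fold .sum 43 2 (symNe 30)).eval σ = hammingDist (fun j : Fin D => y j) c := by
    rw [Exp.eval_sum (fun j => if extN c j = y j then 0 else 1) hσ.dims.len fun j hj =>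
      eval_symNe hσ.dims hc hσ.word hj, Finset.sum_range, hammingDist, Finset.card_filter]
    refine Finset.sum_congr rfl fun j _ => ?_
    rw [extN_fin]
    by_cases h : c j = y j
    · rw [if_pos h, if_neg (by simp [h])]
    · rw [if_neg h, if_pos (Ne.symm h)]
  have h1 := hσ.run (.assign 39 (.fold .sum 43 2 (symNe 30))) (by decide) (by decide)
  refine (vecFill_spec h1.dims _ fun j hj a ha h => ?_).2
  simp only [Prog.run, hd]
  by_cases hle : hammingDist (fun j : Fin D => y j) c ≤ G.radius
  · rw [if_pos hle, Exp.eval, if_neg (by simpa [Exp.eval, State.reg_setReg, hσ.radius] using hle)]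
    simp [Exp.eval, Exp.ix, State.reg_setReg, State.arr_setArr, hσ.dims.deg]
    exact hc j hj a ha
  · rw [if_neg hle, Exp.eval,
      if_pos (by simpa [Exp.eval, State.reg_setReg, hσ.radius] using hle)]
    simp [Exp.eval]

/-- If there is a codeword within the radius, the two systems lead to it; if there is none, whatever
they lead to is rejected.  In both cases the result is that of the half minimum distance
decoder. -/
theorem grsDecode_spec (hσ : GrsIn b G y σ) :
    IsVec b D ((grsDecode.run σ).arr 32)
      (extN (halfMinDistDecode G.code fun j : Fin D => y j)) := by
  classical
  have : CharP F 2 := charP_of_injective_algebraMap (algebraMap (ZMod 2) F).injective 2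
  have h1 := tables_spec hσ
  set σ₁ := (Prog.seq radiusProg (.seq powFill genFill)).run σ
  have h2 := h1.run (.seq (.seq keyMatFill (.seq keyValFill keyTarget)) sysSolve) (by decide)
    (by decide)
  obtain ⟨x, hx1, hx2⟩ := keySolve_spec h1
  set σ₂ := (Prog.seq (.seq keyMatFill (.seq keyValFill keyTarget)) sysSolve).run σ₁
  have h3 := h2.run locatorFill (by decide) (by decide)
  have he := locatorFill_spec h2 hx1
  set σ₃ := locatorFill.run σ₂
  have h4 := h3.run (.seq (.seq erasMatFill (.seq erasValFill erasTarget)) sysSolve) (by decide)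
    (by decide)
  obtain ⟨c, hc, hc1, hc2⟩ := erasSolve_spec h3 he
  set σ₄ := (Prog.seq (.seq erasMatFill (.seq erasValFill erasTarget)) sysSolve).run σ₃
  have h5 := acceptProg_spec h4 hc1
  have hrun : grsDecode.run σ = acceptProg.run σ₄ := rfl
  rw [hrun]
  convert h5 using 1
  by_cases hle : hammingDist (fun j : Fin D => y j) c ≤ G.radius
  · rw [if_pos hle, halfMinDistDecode_eq hc]
    convert G.two_mul_lt_minDist.2 hle
  · rw [if_neg hle, halfMinDistDecode_of_forall]
    · funext j; simp [extN]
    intro c₀ hc₀ hd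
    have hd' : hammingDist (fun j : Fin D => y j) c₀ ≤ G.radius :=
      G.two_mul_lt_minDist.1 (by convert hd)
    have hsol := hx2 (GRS.exists_locator hc₀ hd')
    obtain ⟨e1, e2⟩ := GRS.locator_spec hc₀ hd' hsol
      (e := fun j : Fin D => G.locN j ^ G.radius + ∑ i ∈ Finset.range D, x i * G.keyVal i j)
      fun j => by rw [G.locN_fin, CharTwo.sub_eq_add]
    have := e2 c hc (hc2 ⟨c₀, hc₀, e1⟩)
    rw [this] at hle
    exact hle hd'

end

/-! ### Expansion -/

section Spectral

open Matrix

theorem dotProduct_mulVec_symm {V : Type} [Fintype V] {M : Matrix V V ℝ} (hM : M.IsHermitian)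
    (x y : V → ℝ) : x ⬝ᵥ M *ᵥ y = y ⬝ᵥ M *ᵥ x := by
  have : Mᵀ = M := by rw [← Matrix.conjTranspose_eq_transpose_of_trivial]; exact hM
  rw [dotProduct_mulVec, ← mulVec_transpose, this, dotProduct_comm]

variable {V : Type} [Fintype V] [DecidableEq V] {M : Matrix V V ℝ} (hM : M.IsHermitian)

/-- On the complement of the first eigenvector, the quadratic form is bounded by the second
eigenvalue. -/
theorem quadForm_le_of_orthogonal_first (h : 1 < Fintype.card V) :
    ∃ v₀ : V → ℝ, ∀ y : V → ℝ, v₀ ⬝ᵥ y = 0 →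
      y ⬝ᵥ M *ᵥ y ≤ hM.eigenvalues₀ ⟨1, h⟩ * (y ⬝ᵥ y) := by
  set w : V → V → ℝ := fun i => (hM.eigenvectorBasis i).ofLp with hw
  set e : Fin (Fintype.card V) ≃ V := Fintype.equivOfCardEq (Fintype.card_fin _) with he
  refine ⟨w (e ⟨0, by omega⟩), fun y hy => ?_⟩
  have hexp : y = ∑ i, (w i ⬝ᵥ y) • w i := by
    have := hM.eigenvectorBasis.sum_repr' (WithLp.toLp 2 y)
    have h2 := congrArg WithLp.ofLp this
    simp only [WithLp.ofLp_sum, WithLp.ofLp_smul] at h2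
    refine h2.symm.trans (Finset.sum_congr rfl fun i _ => ?_)
    rw [EuclideanSpace.inner_eq_star_dotProduct, star_trivial, dotProduct_comm]
  have h1 : ∀ z : V → ℝ, z ⬝ᵥ y = ∑ i, (w i ⬝ᵥ y) * (z ⬝ᵥ w i) := fun z => by
    conv_lhs => rw [hexp]
    simp [dotProduct_sum, dotProduct_smul]
  have hMw : ∀ i, M *ᵥ w i = hM.eigenvalues i • w i := hM.mulVec_eigenvectorBasis
  have h2 : y ⬝ᵥ M *ᵥ y = ∑ i, hM.eigenvalues i * (w i ⬝ᵥ y) ^ 2 := by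
    rw [dotProduct_comm, h1]
    refine Finset.sum_congr rfl fun i _ => ?_
    rw [dotProduct_comm (M *ᵥ y), dotProduct_mulVec_symm hM, hMw, dotProduct_smul, smul_eq_mul,
      dotProduct_comm y]
    ring
  rw [h2, h1 y, Finset.mul_sum]
  refine Finset.sum_le_sum fun i _ => ?_
  rw [dotProduct_comm y]
  by_cases hi : i = e ⟨0, by omega⟩
  · rw [hi, hy]; simp
  · have h3 : hM.eigenvalues i ≤ hM.eigenvalues₀ ⟨1, h⟩ := by
      refine hM.eigenvalues₀_antitone (not_lt.1 fun hlt => hi ?_)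
      rw [← Equiv.symm_apply_eq]
      exact Fin.ext (Nat.lt_one_iff.1 (Fin.lt_def.1 hlt))
    nlinarith [mul_le_mul_of_nonneg_right h3 (sq_nonneg (w i ⬝ᵥ y))]

theorem eigenvalues₀_le {d : ℝ} (hd : ∀ x : V → ℝ, x ⬝ᵥ M *ᵥ x ≤ d * (x ⬝ᵥ x))
    (i : Fin (Fintype.card V)) : hM.eigenvalues₀ i ≤ d := by
  set e : Fin (Fintype.card V) ≃ V := Fintype.equivOfCardEq (Fintype.card_fin _)
  have h1 := hd (hM.eigenvectorBasis (e i)).ofLp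
  have h2 : (hM.eigenvectorBasis (e i)).ofLp ⬝ᵥ (hM.eigenvectorBasis (e i)).ofLp = 1 := by
    have := hM.eigenvectorBasis.inner_eq_ite (e i) (e i)
    rw [if_pos rfl, EuclideanSpace.inner_eq_star_dotProduct] at this
    simpa using this
  rw [hM.mulVec_eigenvectorBasis, dotProduct_smul, h2] at h1
  simpa [Matrix.IsHermitian.eigenvalues, e] using h1

/-- The same on the complement of an eigenvector for the largest eigenvalue, even if this
eigenvalue is not simple. -/
theorem quadForm_le_of_orthogonal (h : 1 < Fintype.card V) {d : ℝ} {u : V → ℝ}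
    (hu : M *ᵥ u = d • u) (hu0 : 0 < u ⬝ᵥ u) (hd : ∀ x : V → ℝ, x ⬝ᵥ M *ᵥ x ≤ d * (x ⬝ᵥ x))
    {x : V → ℝ} (hx : x ⬝ᵥ u = 0) :
    x ⬝ᵥ M *ᵥ x ≤ hM.eigenvalues₀ ⟨1, h⟩ * (x ⬝ᵥ x) := by
  obtain ⟨v₀, hv⟩ := quadForm_le_of_orthogonal_first hM h
  set l := hM.eigenvalues₀ ⟨1, h⟩ with hl
  have hxx : 0 ≤ x ⬝ᵥ x := by
    simpa using dotProduct_star_self_nonneg x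
  have huQ : u ⬝ᵥ M *ᵥ u = d * (u ⬝ᵥ u) := by rw [hu, dotProduct_smul, smul_eq_mul]
  have hld : l ≤ d := eigenvalues₀_le hM hd _
  by_cases h0 : v₀ ⬝ᵥ u = 0
  · have h1 := hv u h0
    rw [huQ] at h1
    have h2 : d ≤ l := le_of_mul_le_mul_right h1 hu0
    exact (hd x).trans (mul_le_mul_of_nonneg_right h2 hxx)
  · set α := v₀ ⬝ᵥ x with hα
    set β := v₀ ⬝ᵥ u with hβ
    have h1 := hv (β • x - α • u) (by
      rw [dotProduct_sub, dotProduct_smul, dotProduct_smul, ← hα, ← hβ, smul_eq_mul, smul_eq_mul]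
      ring)
    have hux : u ⬝ᵥ x = 0 := by rw [dotProduct_comm, hx]
    have e1 : (β • x - α • u) ⬝ᵥ (β • x - α • u) = β ^ 2 * (x ⬝ᵥ x) + α ^ 2 * (u ⬝ᵥ u) := by
      simp only [sub_dotProduct, dotProduct_sub, smul_dotProduct, dotProduct_smul, smul_eq_mul, hx,
        hux]
      ring
    have hxMu : x ⬝ᵥ M *ᵥ u = 0 := by rw [hu, dotProduct_smul, hx, smul_zero]
    have huMx : u ⬝ᵥ M *ᵥ x = 0 := by rw [dotProduct_mulVec_symm hM, hxMu]
    have e2 : (β • x - α • u) ⬝ᵥ M *ᵥ (β • x - α • u) =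
        β ^ 2 * (x ⬝ᵥ M *ᵥ x) + α ^ 2 * (d * (u ⬝ᵥ u)) := by
      simp only [mulVec_sub, mulVec_smul, sub_dotProduct, dotProduct_sub, smul_dotProduct,
        dotProduct_smul, smul_eq_mul, hxMu, huMx, huQ]
      ring
    rw [e1, e2] at h1
    have hβ2 : 0 < β ^ 2 := by positivity
    have h2 : α ^ 2 * (u ⬝ᵥ u) * l ≤ α ^ 2 * (u ⬝ᵥ u) * d :=
      mul_le_mul_of_nonneg_left hld (by positivity)
    refine le_of_mul_le_mul_left ?_ hβ2
    linarith

end Spectral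

namespace BipGraph

open Matrix Finset

variable {n Δ : ℕ} (G : BipGraph n Δ)

theorem adj_inl_inr (u v : Fin n) :
    G.graph.Adj (.inl u) (.inr v) ↔ ∃ j, (G.rot (u, j)).1 = v := by
  simp only [graph, SimpleGraph.fromRel_adj]
  constructor
  · rintro ⟨-, ⟨u', j, h1, h2⟩ | ⟨u', j, h1, h2⟩⟩
    · cases h1; cases h2; exact ⟨j, rfl⟩
    · cases h1
  · rintro ⟨j, rfl⟩
    exact ⟨by simp, .inl ⟨u, j, rfl, rfl⟩⟩

theorem not_adj_inl_inl (u v : Fin n) : ¬ G.graph.Adj (.inl u) (.inl v) := by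
  simp [graph, SimpleGraph.fromRel_adj]

theorem not_adj_inr_inr (u v : Fin n) : ¬ G.graph.Adj (.inr u) (.inr v) := by
  simp [graph, SimpleGraph.fromRel_adj]

open Classical in
theorem adjMatrix_inl_inr (u v : Fin n) :
    G.graph.adjMatrix ℝ (.inl u) (.inr v) = ∑ j, if (G.rot (u, j)).1 = v then 1 else 0 := by
  rw [SimpleGraph.adjMatrix_apply]
  simp only [adj_inl_inr]
  split_ifs with h
  · obtain ⟨j, rfl⟩ := h
    rw [sum_eq_single j]
    · simp
    · intro j' _ hj'
      rw [if_neg fun h => hj' (G.simple u h)]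
    · simp
  · rw [sum_eq_zero]
    intro j _
    rw [if_neg fun h' => h ⟨j, h'⟩]

open Classical in
theorem mulVec_inl (x : Fin n ⊕ Fin n → ℝ) (u : Fin n) :
    (G.graph.adjMatrix ℝ *ᵥ x) (.inl u) = ∑ j, x (.inr (G.rot (u, j)).1) := by
  rw [mulVec, dotProduct, Fintype.sum_sum_type]
  simp only [adjMatrix_inl_inr, sum_mul, ite_mul, one_mul, zero_mul]
  rw [sum_comm]
  simp [not_adj_inl_inl]

open Classical in
theorem mulVec_inr (x : Fin n ⊕ Fin n → ℝ) (v : Fin n) :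
    (G.graph.adjMatrix ℝ *ᵥ x) (.inr v) = ∑ i, x (.inl (G.rot.symm (v, i)).1) := by
  have h1 : ∀ u, G.graph.adjMatrix ℝ (.inr v) (.inl u) =
      ∑ j, if (G.rot (u, j)).1 = v then 1 else 0 := fun u => by
    rw [← adjMatrix_inl_inr, SimpleGraph.adjMatrix_apply, SimpleGraph.adjMatrix_apply,
      SimpleGraph.adj_comm]
  rw [mulVec, dotProduct, Fintype.sum_sum_type]
  simp only [h1, sum_mul, ite_mul, one_mul, zero_mul]
  rw [← Fintype.sum_prod_type' fun u j => if (G.rot (u, j)).1 = v then x (.inl u) else 0,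
    ← Equiv.sum_comp G.rot.symm, Fintype.sum_prod_type, sum_eq_single v]
  · simp [not_adj_inr_inr]
  · intro v' _ hv'
    simp [hv']
  · simp

open Classical in
/-- The quadratic form of the adjacency matrix as a sum over the edges. -/
theorem quadForm (x : Fin n ⊕ Fin n → ℝ) :
    x ⬝ᵥ G.graph.adjMatrix ℝ *ᵥ x =
      2 * ∑ e : Fin n × Fin Δ, x (.inl e.1) * x (.inr (G.rot e).1) := by
  rw [dotProduct, Fintype.sum_sum_type]
  simp only [mulVec_inl, mulVec_inr, mul_sum]
  have h1 := Fintype.sum_prod_type' fun u j => x (.inl u) * x (.inr (G.rot (u, j)).1)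
  have h2 := Fintype.sum_prod_type' fun v i => x (.inr v) * x (.inl (G.rot.symm (v, i)).1)
  rw [← h1, ← h2, ← Equiv.sum_comp G.rot
    fun e => x (.inr e.1) * x (.inl (G.rot.symm (e.1, e.2)).1), ← sum_add_distrib]
  simp only [Prod.mk.eta, Equiv.symm_apply_apply]
  exact sum_congr rfl fun e _ => by ring

theorem sum_fst (f : Fin n → ℝ) : ∑ e : Fin n × Fin Δ, f e.1 = Δ * ∑ u, f u := by
  rw [Fintype.sum_prod_type, mul_sum]
  simp

theorem sum_rot_fst (f : Fin n → ℝ) : ∑ e : Fin n × Fin Δ, f (G.rot e).1 = Δ * ∑ u, f u := by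
  rw [Equiv.sum_comp G.rot fun e => f e.1, sum_fst]

theorem dotProduct_sum_type (x y : Fin n ⊕ Fin n → ℝ) :
    x ⬝ᵥ y = ∑ u, x (.inl u) * y (.inl u) + ∑ v, x (.inr v) * y (.inr v) := by
  rw [dotProduct, Fintype.sum_sum_type]

open Classical in
theorem quadForm_le (x : Fin n ⊕ Fin n → ℝ) :
    x ⬝ᵥ G.graph.adjMatrix ℝ *ᵥ x ≤ Δ * (x ⬝ᵥ x) := by
  rw [quadForm, dotProduct_sum_type, mul_add, ← sum_fst fun u => x (.inl u) * x (.inl u),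
    ← G.sum_rot_fst fun v => x (.inr v) * x (.inr v), mul_sum, ← sum_add_distrib]
  refine sum_le_sum fun e _ => ?_
  nlinarith [sq_nonneg (x (.inl e.1) - x (.inr (G.rot e).1))]

theorem one_lt_card (hn : 0 < n) : 1 < Fintype.card (Fin n ⊕ Fin n) := by
  rw [Fintype.card_sum, Fintype.card_fin]; omega

theorem secondEigenvalue_le (hn : 0 < n) : G.secondEigenvalue ≤ Δ := by
  rw [secondEigenvalue, dif_pos (one_lt_card hn)]
  exact eigenvalues₀_le _ G.quadForm_le _

open Classical in
theorem quadForm_le_second (hn : 0 < n) {x : Fin n ⊕ Fin n → ℝ} (hx : ∑ i, x i = 0) :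
    x ⬝ᵥ G.graph.adjMatrix ℝ *ᵥ x ≤ G.secondEigenvalue * (x ⬝ᵥ x) := by
  rw [secondEigenvalue, dif_pos (one_lt_card hn)]
  refine quadForm_le_of_orthogonal _ _ (d := Δ) (u := fun _ => 1) ?_ ?_ G.quadForm_le ?_
  · funext i
    rcases i with u | v
    · rw [mulVec_inl]; simp
    · rw [mulVec_inr]; simp
  · rw [dotProduct_sum_type]
    simp only [mul_one, sum_const, card_univ, Fintype.card_fin, nsmul_eq_mul]
    positivity
  · simpa [dotProduct] using hx

theorem secondEigenvalue_nonneg (hn : 1 < n) : 0 ≤ G.secondEigenvalue := by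
  classical
  set u₀ : Fin n := ⟨0, by omega⟩
  set u₁ : Fin n := ⟨1, hn⟩
  have hne : u₀ ≠ u₁ := by simp [u₀, u₁]
  have h := G.quadForm_le_second (by omega) (x := Sum.elim (Pi.single u₀ 1 - Pi.single u₁ 1) 0)
    (by rw [Fintype.sum_sum_type]; simp)
  rw [quadForm, dotProduct_sum_type] at h
  simp only [Sum.elim_inl, Sum.elim_inr, Pi.zero_apply, mul_zero, sum_const_zero, add_zero] at h
  refine nonneg_of_mul_nonneg_left h (sum_pos' (fun u _ => mul_self_nonneg _) ⟨u₀, mem_univ _, ?_⟩)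
  simp [hne]

/-- The expander mixing lemma, in the form of a quadratic inequality in the weights `p` and `q` of
the two sets of vertices. -/
theorem mixing (hn : 0 < n) (S T : Finset (Fin n)) (p q : ℝ) :
    2 * p * q * ((univ.filter fun e : Fin n × Fin Δ => e.1 ∈ S ∧ (G.rot e).1 ∈ T).card -
        Δ * S.card * T.card / n) ≤
      G.secondEigenvalue * (p ^ 2 * (S.card - (S.card : ℝ) ^ 2 / n) +
        q ^ 2 * (T.card - (T.card : ℝ) ^ 2 / n)) := by
  classical
  have hn' : (n : ℝ) ≠ 0 := by positivity
  set f : Finset (Fin n) → Fin n → ℝ := fun S u => (if u ∈ S then 1 else 0) - S.card / n with hf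
  have hind : ∀ S : Finset (Fin n), ∑ u, (if u ∈ S then (1 : ℝ) else 0) = S.card := fun S => by
    simp
  have hsum : ∀ S, ∑ u, f S u = 0 := fun S => by
    simp only [hf, sum_sub_distrib, hind, sum_const, card_univ, Fintype.card_fin, nsmul_eq_mul]
    field_simp
    ring
  have hsq : ∀ S, ∑ u, f S u * f S u = S.card - (S.card : ℝ) ^ 2 / n := fun S => by
    have : ∀ u, f S u * f S u = (if u ∈ S then (1 : ℝ) else 0) - S.card / n * (if u ∈ S then 1
        else 0) - S.card / n * f S u := fun u => by
      simp only [hf]; split_ifs <;> ring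
    simp only [this, sum_sub_distrib, ← mul_sum, hsum, hind]
    ring
  have h := G.quadForm_le_second hn (x := Sum.elim (fun u => p * f S u) fun v => q * f T v) (by
    rw [Fintype.sum_sum_type]
    simp [← mul_sum, hsum])
  rw [quadForm, dotProduct_sum_type] at h
  simp only [Sum.elim_inl, Sum.elim_inr] at h
  have e1 : ∑ e : Fin n × Fin Δ, p * f S e.1 * (q * f T (G.rot e).1) = p * q *
      ((univ.filter fun e : Fin n × Fin Δ => e.1 ∈ S ∧ (G.rot e).1 ∈ T).card -
        Δ * S.card * T.card / n) := by
    have : ∀ e : Fin n × Fin Δ, p * f S e.1 * (q * f T (G.rot e).1) = p * q *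
        ((if e.1 ∈ S ∧ (G.rot e).1 ∈ T then 1 else 0) - T.card / n * (if e.1 ∈ S then 1 else 0) -
          S.card / n * f T (G.rot e).1) := fun e => by
      simp only [hf]
      by_cases h1 : e.1 ∈ S <;> by_cases h2 : (G.rot e).1 ∈ T <;> simp [h1, h2] <;> ring
    simp only [this, ← mul_sum, sum_sub_distrib]
    rw [sum_fst (fun u => if u ∈ S then (1 : ℝ) else 0), sum_rot_fst, hsum, hind, sum_boole]
    ring
  have e2 : ∀ (p : ℝ) (S : Finset (Fin n)), ∑ u, p * f S u * (p * f S u) =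
      p ^ 2 * (S.card - (S.card : ℝ) ^ 2 / n) := fun p S => by
    rw [← hsq, mul_sum]
    exact sum_congr rfl fun u _ => by ring
  rw [e1, e2, e2] at h
  linarith

end BipGraph

/-! ### The rounds of the decoder -/

/-- If `f i` are the weights of the erroneous sets in consecutive rounds, the recursion that the
mixing lemma gives makes their sum finite. -/
theorem sum_le_of_contraction {τ g θ : ℝ} (hτ1 : τ < 1) (hg0 : 0 ≤ g) (hg1 : g < 1)
    (hθ : 0 < θ) {f : ℕ → ℝ} (hf : ∀ i, 0 ≤ f i) (h0 : θ * f 0 ≤ τ * (1 - g))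
    (hrec : ∀ i, f (i + 1) * (1 - θ * f i) ≤ g / 2 * (f i + f (i + 1))) (m : ℕ) :
    (1 - τ) * θ * ∑ i ∈ Finset.range m, f (i + 1) ≤ g / 2 * τ := by
  have key : ∀ i, θ * f i ≤ τ * (1 - g) →
      f (i + 1) * (g / 2 + (1 - g) * (1 - τ)) ≤ g / 2 * f i := fun i hi => by
    have h1 := mul_le_mul_of_nonneg_left hi (hf (i + 1))
    nlinarith [hrec i]
  have hρ : 0 < (1 - g) * (1 - τ) := mul_pos (by linarith) (by linarith)
  have hmono : ∀ i, θ * f i ≤ τ * (1 - g) := fun i => by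
    induction i with
    | zero => exact h0
    | succ i ih =>
      have h1 := key i ih
      have h2 : f (i + 1) ≤ f i := by
        by_contra h
        have := mul_le_mul_of_nonneg_left (not_le.1 h).le hg0
        nlinarith [mul_pos ((hf i).trans_lt (not_le.1 h)) hρ]
      exact (mul_le_mul_of_nonneg_left h2 hθ.le).trans ih
  have htel : (1 - g) * (1 - τ) * ∑ i ∈ Finset.range m, f (i + 1) ≤ g / 2 * (f 0 - f m) := by
    induction m with
    | zero => simp
    | succ m ih =>
      rw [Finset.sum_range_succ, mul_add]
      have := key m (hmono m)
      linarith
  have h2 : (1 - g) * (1 - τ) * ∑ i ∈ Finset.range m, f (i + 1) ≤ g / 2 * f 0 :=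
    htel.trans (mul_le_mul_of_nonneg_left (by linarith [hf m]) (by linarith))
  have h3 := mul_le_mul_of_nonneg_left h2 hθ.le
  have h4 := mul_le_mul_of_nonneg_left h0 (show 0 ≤ g / 2 by linarith)
  have h5 : (1 - g) * ((1 - τ) * θ * ∑ i ∈ Finset.range m, f (i + 1)) ≤ (1 - g) * (g / 2 * τ) := by
    linarith
  exact le_of_mul_le_mul_left h5 (by linarith)

namespace OuterCode

open Finset

variable {F : Type} [Field F] {n Δ : ℕ} (O : OuterCode F n Δ)

/-- The numbering of the edges by the vertices of `A` (`false`) or of `B` (`true`). -/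
def slot : Bool → (Fin n × Fin Δ ≃ Fin n × Fin Δ)
  | false => Equiv.refl _
  | true => O.G.rot.symm

/-- The constituent code on a side. -/
def grs : Bool → GRS F Δ
  | false => O.CA
  | true => O.CB

/-- The endpoint of an edge on a side. -/
def own (s : Bool) (e : Fin n × Fin Δ) : Fin n := ((O.slot s).symm e).1

/-- The subword on the edges at a vertex of a side. -/
def word (s : Bool) (z : Fin n × Fin Δ → F) (v : Fin n) : Fin Δ → F := fun j => z (O.slot s (v, j))

/-- One round of decoding at all the vertices of a side. -/
noncomputable def step (s : Bool) (z : Fin n × Fin Δ → F) : Fin n × Fin Δ → F := fun e =>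
  halfMinDistDecode (O.grs s).code (O.word s z (O.own s e)) ((O.slot s).symm e).2

theorem iter_succ (x : Fin n → O.Phi) (i : ℕ) :
    O.iter x (i + 1) = O.step (i + 1).bodd (O.iter x i) := by
  have h := Nat.mod_two_of_bodd (i + 1)
  cases hb : (i + 1).bodd
  · rw [iter, if_pos (by rw [Nat.even_iff, h, hb]; rfl)]; rfl
  · rw [iter, if_neg (by rw [Nat.even_iff, h, hb]; decide)]; rfl

theorem mem_edgeCode {z : Fin n × Fin Δ → F} :
    z ∈ O.edgeCode ↔ ∀ s v, O.word s z v ∈ (O.grs s).code :=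
  ⟨fun h s => by cases s; exacts [h.1, h.2], fun h => ⟨h false, h true⟩⟩

theorem word_step (s : Bool) (z : Fin n × Fin Δ → F) (v : Fin n) :
    O.word s (O.step s z) v = halfMinDistDecode (O.grs s).code (O.word s z v) := by
  funext j
  simp [word, step, own]

theorem word_step_mem (s : Bool) (z : Fin n × Fin Δ → F) (v : Fin n) :
    O.word s (O.step s z) v ∈ (O.grs s).code := by
  rw [word_step]
  exact halfMinDistDecode_mem

theorem word_iter_mem (x : Fin n → O.Phi) (i : ℕ) (v : Fin n) :
    O.word i.bodd (O.iter x i) v ∈ (O.grs i.bodd).code := by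
  cases i with
  | zero => exact (O.encA (x v)).2
  | succ i => rw [iter_succ]; exact O.word_step_mem _ _ _

theorem slot_own (s : Bool) (e : Fin n × Fin Δ) :
    O.slot s (O.own s e, ((O.slot s).symm e).2) = e := by
  simp [own]

theorem own_slot (s : Bool) (e : Fin n × Fin Δ) : O.own s (O.slot s e) = e.1 := by simp [own]

open Classical in
/-- The vertices of a side at which two words differ. -/
noncomputable def err (s : Bool) (z c : Fin n × Fin Δ → F) : Finset (Fin n) :=
  univ.filter fun v => O.word s z v ≠ O.word s c v

open Classical in
/-- The edges whose contents two words do not agree about. -/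
noncomputable def diff {F : Type} (z z' : Fin n × Fin Δ → F) : Finset (Fin n × Fin Δ) :=
  univ.filter fun e => z e ≠ z' e

theorem mem_diff {F : Type} {z c : Fin n × Fin Δ → F} {e : Fin n × Fin Δ} :
    e ∈ diff z c ↔ z e ≠ c e := by
  simp [diff]

variable {O}

theorem mem_err {s : Bool} {z c : Fin n × Fin Δ → F} {v : Fin n} :
    v ∈ O.err s z c ↔ O.word s z v ≠ O.word s c v := by simp [err]

theorem own_mem_err {s : Bool} {z c : Fin n × Fin Δ → F} {e : Fin n × Fin Δ} (h : z e ≠ c e) :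
    O.own s e ∈ O.err s z c := by
  refine mem_err.2 fun heq => h ?_
  have := congrFun heq ((O.slot s).symm e).2
  simpa only [word, slot_own] using this

theorem card_own_mem (s : Bool) (T : Finset (Fin n)) :
    (univ.filter fun e => O.own s e ∈ T).card = Δ * T.card := by
  have : (univ.filter fun e => O.own s e ∈ T) = (T ×ˢ univ).map (O.slot s).toEmbedding := by
    ext e
    rw [mem_filter, mem_map_equiv, mem_product]
    simp [own]
  rw [this, card_map, card_product, card_univ, Fintype.card_fin, mul_comm]

/-- A vertex which is decoded wrongly sees errors on half the minimum distance of its edges. -/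
theorem minDist_mul_card_err_le (s : Bool) {z c : Fin n × Fin Δ → F} (hc : c ∈ O.edgeCode) :
    minDist (O.grs s).code * (O.err s (O.step s z) c).card ≤
      2 * (univ.filter fun e => O.own s e ∈ O.err s (O.step s z) c ∧
        O.own (!s) e ∈ O.err (!s) z c).card := by
  classical
  set T := O.err s (O.step s z) c with hT
  set S := O.err (!s) z c
  have h1 : ∀ v ∈ T, minDist (O.grs s).code ≤
      2 * (univ.filter fun j => O.own (!s) (O.slot s (v, j)) ∈ S).card := fun v hv => by
    have h2 : O.word s (O.step s z) v ≠ O.word s c v := mem_err.1 hv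
    have h3 : minDist (O.grs s).code ≤ 2 * hammingDist (O.word s z v) (O.word s c v) := by
      by_contra h
      exact h2 ((O.word_step s z v).trans
        (halfMinDistDecode_eq (O.mem_edgeCode.1 hc s v) (not_le.1 h)))
    refine h3.trans (Nat.mul_le_mul_left 2 (card_le_card fun j hj => ?_))
    rw [mem_filter] at hj ⊢
    exact ⟨mem_univ _, own_mem_err hj.2⟩
  have h4 : (univ.filter fun e => O.own s e ∈ T ∧ O.own (!s) e ∈ S).card =
      ∑ v ∈ T, (univ.filter fun j => O.own (!s) (O.slot s (v, j)) ∈ S).card := by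
    rw [← card_sigma]
    refine (card_bij (fun a _ => O.slot s (a.1, a.2)) ?_ ?_ ?_).symm
    · intro a ha
      simp only [mem_sigma, mem_filter, mem_univ, true_and] at ha ⊢
      exact ⟨by rw [own_slot]; exact ha.1, ha.2⟩
    · rintro ⟨a, a'⟩ - ⟨d, d'⟩ - h
      have := (O.slot s).injective h
      cases this
      rfl
    · intro e he
      simp only [mem_filter, mem_univ, true_and] at he
      refine ⟨⟨O.own s e, ((O.slot s).symm e).2⟩, ?_, O.slot_own s e⟩
      simp only [mem_sigma, mem_filter, mem_univ, true_and, slot_own]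
      exact he
  rw [h4, mul_comm, ← smul_eq_mul, ← sum_const, mul_sum]
  exact sum_le_sum h1

/-- An edge changes only if it was wrong before or is wrong afterwards. -/
theorem card_diff_step_le (s : Bool) (z c : Fin n × Fin Δ → F) :
    (diff (O.step s z) z).card ≤
      Δ * (O.err s (O.step s z) c).card + Δ * (O.err (!s) z c).card := by
  classical
  rw [← card_own_mem (O := O) s, ← card_own_mem (O := O) (!s)]
  refine (card_le_card fun e he => ?_).trans (card_union_le _ _)
  rw [mem_diff] at he
  simp only [mem_union, mem_filter, mem_univ, true_and]
  by_cases h : O.step s z e = c e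
  · exact .inr (own_mem_err fun h' => he (h.trans h'.symm))
  · exact .inl (own_mem_err h)

variable (O) in
theorem edge_filter (s : Bool) (S T : Finset (Fin n)) :
    (univ.filter fun e => O.own s e ∈ T ∧ O.own (!s) e ∈ S) =
      univ.filter fun e => e.1 ∈ (if s then S else T) ∧ (O.G.rot e).1 ∈ (if s then T else S) := by
  cases s
  · rfl
  · ext e; simp only [mem_filter]; exact and_congr_right fun _ => and_comm

variable (O)

theorem dims_pos {F : Type} [Field F] {n Δ : ℕ} (O : OuterCode F n Δ) :
    0 < Δ := O.CA.k_pos.trans_le O.CA.k_le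

/-- The relative minimum distance of the constituent code on a side. -/
noncomputable def delta (s : Bool) : ℝ := minDist (O.grs s).code / Δ

theorem delta_pos (s : Bool) : 0 < O.delta s :=
  div_pos (by exact_mod_cast (O.grs s).minDist_pos) (by exact_mod_cast O.dims_pos)

theorem delta_le_one (s : Bool) : O.delta s ≤ 1 := by
  refine div_le_one_of_le₀ ?_ (Nat.cast_nonneg _)
  have := (O.grs s).minDist_code
  have := (O.grs s).k_pos
  have := (O.grs s).k_le
  exact_mod_cast (by omega : minDist (O.grs s).code ≤ Δ)

theorem gamma_le_one (hn : 0 < n) : O.G.gamma ≤ 1 :=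
  div_le_one_of_le₀ (O.G.secondEigenvalue_le hn) (Nat.cast_nonneg _)

theorem gamma_nonneg (hn : 1 < n) : 0 ≤ O.G.gamma :=
  div_nonneg (O.G.secondEigenvalue_nonneg hn) (Nat.cast_nonneg _)

/-- One round in terms of the weights `p²` and `q²` times the numbers of erroneous vertices. -/
theorem round_le (hn : 1 < n) (s : Bool) {z c : Fin n × Fin Δ → F}
    (hc : c ∈ O.edgeCode) {p q : ℝ} (hp : 0 < p) (hq : 0 < q) (hps : p ^ 2 = O.delta s)
    (a b : ℝ) (ha : a = (O.err (!s) z c).card) (hb : b = (O.err s (O.step s z) c).card) :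
    p * q * (p ^ 2 * b) ≤
      O.G.gamma * (q ^ 2 * a + p ^ 2 * b) + 2 * p * q * (1 - O.G.gamma) * (a * b) / n := by
  have hn0 : (0 : ℝ) < n := by exact_mod_cast (by omega : 0 < n)
  have hΔ : (0 : ℝ) < Δ := by exact_mod_cast O.dims_pos
  have h1 := minDist_mul_card_err_le s (z := z) hc
  set S := O.err (!s) z c
  set T := O.err s (O.step s z) c
  set E := (univ.filter fun e => O.own s e ∈ T ∧ O.own (!s) e ∈ S).card with hE
  have h2 : p ^ 2 * Δ * b ≤ 2 * (E : ℝ) := by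
    rw [hps, delta, div_mul_cancel₀ _ hΔ.ne', hb]
    exact_mod_cast h1
  have h3 : 2 * p * q * (E - Δ * a * b / n) ≤
      O.G.secondEigenvalue * (q ^ 2 * (a - a ^ 2 / n) + p ^ 2 * (b - b ^ 2 / n)) := by
    rw [hE, edge_filter, ha, hb]
    cases s
    · have := O.G.mixing (by omega) T S p q
      simp only [Bool.false_eq_true, if_false]
      rw [show (Δ : ℝ) * S.card * T.card = Δ * T.card * S.card by ring]
      linarith
    · have := O.G.mixing (by omega) S T q p
      simp only [if_true]
      linarith
  have h4 : O.G.secondEigenvalue = O.G.gamma * Δ := by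
    rw [BipGraph.gamma, div_mul_cancel₀ _ hΔ.ne']
  rw [h4] at h3
  have hγ := O.gamma_nonneg hn
  set γ := O.G.gamma
  have h5 : 2 * p * q * (a * b) / n ≤ q ^ 2 * (a ^ 2 / n) + p ^ 2 * (b ^ 2 / n) := by
    rw [← mul_div_assoc, ← mul_div_assoc, ← add_div]
    gcongr
    nlinarith [sq_nonneg (q * a - p * b)]
  have h6 := mul_le_mul_of_nonneg_left h5 (mul_nonneg hγ hΔ.le)
  have h7 := mul_le_mul_of_nonneg_left h2 (mul_pos hp hq).le
  refine le_of_mul_le_mul_left ?_ hΔ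
  have e1 : 2 * p * q * (1 - γ) * (a * b) / n =
    2 * p * q * (a * b) / n - γ * (2 * p * q * (a * b) / n) := by ring
  have e2 : 2 * p * q * (E - Δ * a * b / n) = 2 * p * q * E - Δ * (2 * p * q * (a * b) / n) := by
    ring
  rw [e2] at h3
  rw [e1]
  set W := 2 * p * q * (a * b) / n
  nlinarith

theorem err_eq_empty (s : Bool) {z c : Fin n × Fin Δ → F} (hc : c ∈ O.edgeCode)
    (h : O.err (!s) z c = ∅) : O.err s (O.step s z) c = ∅ := by
  have h1 := minDist_mul_card_err_le s (z := z) hc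
  rw [h] at h1
  simp only [notMem_empty, and_false, filter_false, card_empty, mul_zero, Nat.le_zero,
    mul_eq_zero] at h1
  exact card_eq_zero.1 (h1.resolve_left (O.grs s).minDist_pos.ne')

/-- The bound `β` in terms of the square roots `p` and `q` of the relative minimum distances. -/
theorem beta_eq {p q : ℝ} (hp : 0 < p) (hq : 0 < q) (hpB : p ^ 2 = O.delta true)
    (hqA : q ^ 2 = O.delta false) :
    O.beta = p ^ 2 * (1 - 2 * O.G.gamma / (p * q)) / (2 * (1 - O.G.gamma)) := by
  have hB : O.deltaB = p ^ 2 := hpB.symm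
  have hA : O.deltaA = q ^ 2 := hqA.symm
  rw [beta, hB, hA, Real.sqrt_div (sq_nonneg p), Real.sqrt_sq hp.le, Real.sqrt_sq hq.le]
  rw [← div_div]
  congr 1
  field_simp

/-- With few errors at the start, the numbers of erroneous vertices over all rounds have a sum
which is linear in `n`. -/
theorem sum_err_le {τ : ℝ} (hτ0 : 0 < τ) (hτ1 : τ < 1) (x : Fin n → O.Phi)
    {c : Fin n × Fin Δ → F} (hc : c ∈ O.edgeCode)
    (h0 : ((O.err false (O.iter x 0) c).card : ℝ) ≤ τ * O.beta * n) (m : ℕ) :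
    (1 - τ) * ∑ i ∈ range m, ((O.err (i + 1).bodd (O.iter x (i + 1)) c).card : ℝ) ≤ τ * n := by
  set f : ℕ → ℝ := fun i => (O.err i.bodd (O.iter x i) c).card with hf
  have hf0 : ∀ i, 0 ≤ f i := fun i => Nat.cast_nonneg _
  have hΔ := O.dims_pos
  have hn0 : (0 : ℝ) ≤ n := Nat.cast_nonneg _
  by_cases hS : O.err false (O.iter x 0) c = ∅
  · have h1 : ∀ i, O.err i.bodd (O.iter x i) c = ∅ := fun i => by
      induction i with
      | zero => exact hS
      | succ i ih =>
        rw [iter_succ]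
        refine O.err_eq_empty _ hc ?_
        rwa [Nat.bodd_succ, Bool.not_not]
    rw [sum_eq_zero fun i _ => by rw [h1]; simp]
    simpa using mul_nonneg hτ0.le hn0
  obtain ⟨v, -⟩ := nonempty_iff_ne_empty.2 hS
  have hn : 0 < n := v.pos
  have hn0 : (0 : ℝ) < n := by exact_mod_cast hn
  have hf1 : 1 ≤ f 0 := by
    simp only [hf, Nat.bodd_zero]
    exact_mod_cast card_pos.2 (nonempty_iff_ne_empty.2 hS)
  have hγ1 := O.gamma_le_one hn
  have hβ : 0 < O.beta := by
    by_contra h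
    have := mul_nonpos_of_nonpos_of_nonneg
      (mul_nonpos_of_nonneg_of_nonpos hτ0.le (not_lt.1 h)) hn0.le
    have : f 0 ≤ τ * O.beta * n := h0
    linarith
  have hγne : O.G.gamma ≠ 1 := fun h => by
    rw [beta, h, sub_self, div_zero] at hβ
    exact lt_irrefl _ hβ
  have hγ : 0 < 1 - O.G.gamma := by
    have := lt_of_le_of_ne hγ1 hγne
    linarith
  obtain ⟨p, hp, hpB⟩ : ∃ p : ℝ, 0 < p ∧ p ^ 2 = O.delta true :=
    ⟨_, Real.sqrt_pos.2 (O.delta_pos _), Real.sq_sqrt (O.delta_pos _).le⟩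
  obtain ⟨q, hq, hqA⟩ : ∃ q : ℝ, 0 < q ∧ q ^ 2 = O.delta false :=
    ⟨_, Real.sqrt_pos.2 (O.delta_pos _), Real.sq_sqrt (O.delta_pos _).le⟩
  have hβe := O.beta_eq hp hq hpB hqA
  have hp1 : p ^ 2 ≤ 1 := hpB.trans_le (O.delta_le_one _)
  have hq1 : q ^ 2 ≤ 1 := hqA.trans_le (O.delta_le_one _)
  have hpq : 0 < p * q := mul_pos hp hq
  have h0' : f 0 ≤ τ * O.beta * n := h0
  rcases Nat.lt_or_ge 1 n with hn1 | hn1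
  swap
  -- A single vertex on each side has degree one, and then less than one error means none.
  · exfalso
    have hn' : n = 1 := by omega
    subst hn'
    have hΔ1 : Δ = 1 := by
      have := Fintype.card_le_of_injective _ (O.G.simple 0)
      simp only [Fintype.card_fin] at this
      omega
    have hd : ∀ s, O.delta s = 1 := fun s => by
      have := (O.grs s).minDist_code
      have := (O.grs s).k_pos
      have := (O.grs s).k_le
      have : minDist (O.grs s).code = 1 := by omega
      rw [delta, this, hΔ1]; norm_num
    have hp' : p = 1 := by rw [hd] at hpB; nlinarith
    have hq' : q = 1 := by rw [hd] at hqA; nlinarith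
    have h1 : O.beta < 1 := by
      rw [hβe, hp', hq', div_lt_one (by linarith)]
      norm_num
      linarith
    have h2 : τ * O.beta < 1 := by nlinarith
    simp only [Nat.cast_one, mul_one] at h0'
    linarith
  have hγ0 := O.gamma_nonneg hn1
  set γ := O.G.gamma with hγd
  set g : ℝ := 2 * γ / (p * q) with hg
  have hg0 : 0 ≤ g := by positivity
  have hg1 : g < 1 := by
    rw [hβe] at hβ
    by_contra h
    have h1 : p ^ 2 * (1 - g) ≤ 0 :=
      mul_nonpos_of_nonneg_of_nonpos (sq_nonneg p) (by linarith [not_lt.1 h])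
    exact absurd hβ (not_lt.2 (div_nonpos_of_nonpos_of_nonneg h1 (by linarith)))
  have hgγ : 2 * γ ≤ p * q := by
    rw [hg, div_lt_one hpq] at hg1
    exact hg1.le
  set θ : ℝ := 2 * (1 - γ) / (n * (p ^ 2 * q ^ 2)) with hθ
  have hθ0 : 0 < θ := by positivity
  set w : Bool → ℝ := fun s => if s then p else q with hw
  have hw0 : ∀ s, 0 < w s := fun s => by cases s; exacts [hq, hp]
  have hw1 : ∀ s, w s ^ 2 = O.delta s := fun s => by cases s; exacts [hqA, hpB]
  have hww : ∀ s, w s * w (!s) = p * q := fun s => by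
    cases s
    · exact mul_comm q p
    · rfl
  set y : ℕ → ℝ := fun i => w i.bodd ^ 2 * f i with hy
  have hy0 : ∀ i, 0 ≤ y i := fun i => mul_nonneg (sq_nonneg _) (hf0 i)
  have hstart : θ * y 0 ≤ τ * (1 - g) := by
    have e1 : θ * y 0 = 2 * (1 - γ) / (n * p ^ 2) * f 0 := by
      simp only [hθ, hy, hw, Nat.bodd_zero, Bool.false_eq_true, if_false]
      field_simp
    have e2 : 2 * (1 - γ) / (n * p ^ 2) * (τ * O.beta * n) = τ * (1 - g) := by
      rw [hβe]
      field_simp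
    rw [e1, ← e2]
    exact mul_le_mul_of_nonneg_left h0' (by positivity)
  have hrec : ∀ i, y (i + 1) * (1 - θ * y i) ≤ g / 2 * (y i + y (i + 1)) := fun i => by
    have h1 := O.round_le hn1 (i + 1).bodd (z := O.iter x i) hc (hw0 _) (hw0 (!(i + 1).bodd))
      (hw1 _) (f i) (f (i + 1)) (by simp only [hf, Nat.bodd_succ, Bool.not_not])
      (by simp only [hf, iter_succ])
    rw [mul_assoc 2, hww, ← hγd] at h1
    have e3 : w (!(i + 1).bodd) = w i.bodd := by rw [Nat.bodd_succ, Bool.not_not]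
    rw [e3] at h1
    change p * q * y (i + 1) ≤ γ * (y i + y (i + 1)) + _ at h1
    have e4 : y i * y (i + 1) = p ^ 2 * q ^ 2 * (f i * f (i + 1)) := by
      have := hww i.bodd
      rw [← Nat.bodd_succ] at this
      simp only [hy]
      rw [← mul_pow, ← this]
      ring
    have e5 : 2 * (p * q) * (1 - γ) * (f i * f (i + 1)) / n = p * q * (θ * (y i * y (i + 1))) := by
      rw [e4, hθ]
      field_simp
    have e6 : γ = p * q * (g / 2) := by
      rw [hg]
      field_simp
    rw [e5] at h1
    have h2 : p * q * (y (i + 1) * (1 - θ * y i)) ≤ p * q * (g / 2 * (y i + y (i + 1))) := by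
      have : γ * (y i + y (i + 1)) = p * q * (g / 2 * (y i + y (i + 1))) := by
        conv_lhs => rw [e6]
        ring
      nlinarith
    exact le_of_mul_le_mul_left h2 hpq
  have hsum := sum_le_of_contraction hτ1 hg0 hg1 hθ0 hy0 hstart hrec m
  have hwle : ∀ s, p ^ 2 * q ^ 2 ≤ w s ^ 2 := fun s => by
    cases s
    · exact mul_le_of_le_one_left (sq_nonneg q) hp1
    · exact mul_le_of_le_one_right (sq_nonneg p) hq1
  have h1 : p ^ 2 * q ^ 2 * ∑ i ∈ range m, f (i + 1) ≤ ∑ i ∈ range m, y (i + 1) := by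
    rw [mul_sum]
    exact sum_le_sum fun i _ => mul_le_mul_of_nonneg_right (hwle _) (hf0 _)
  have h2 := (mul_le_mul_of_nonneg_left h1 (mul_nonneg (by linarith : 0 ≤ 1 - τ) hθ0.le)).trans hsum
  set A := ∑ i ∈ range m, f (i + 1) with hA
  have e7 : (1 - τ) * θ * (p ^ 2 * q ^ 2 * A) = 2 * (1 - γ) * ((1 - τ) * A) / n := by
    rw [hθ]
    field_simp
  rw [e7, div_le_iff₀ hn0] at h2
  have h3 : 1 ≤ 2 * (1 - γ) := by nlinarith
  have hA0 : 0 ≤ (1 - τ) * A := mul_nonneg (by linarith) (sum_nonneg fun i _ => hf0 _)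
  have h4 : (1 - τ) * A ≤ 2 * (1 - γ) * ((1 - τ) * A) := le_mul_of_one_le_left hA0 h3
  have h5 : g / 2 * τ * n ≤ τ * n := by
    have := mul_pos hτ0 hn0
    nlinarith
  linarith

/-- The number of edges whose contents change in the rounds up to the `m`-th one. -/
noncomputable def changes (x : Fin n → O.Phi) (m : ℕ) : ℕ :=
  ∑ i ∈ range m, (diff (O.iter x (i + 1)) (O.iter x i)).card

theorem changes_le_mul (x : Fin n → O.Phi) (m : ℕ) : O.changes x m ≤ m * (n * Δ) := by
  refine (sum_le_card_nsmul _ _ (n * Δ) fun i _ => ?_).trans (by simp)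
  refine (card_le_univ _).trans ?_
  simp

/-- With few errors at the start, the contents of the edges change `O(n Δ)` times in all the rounds
together, however many rounds there are. -/
theorem changes_le {τ : ℝ} (hτ0 : 0 < τ) (hτ1 : τ < 1) (x : Fin n → O.Phi)
    {c : Fin n × Fin Δ → F} (hc : c ∈ O.edgeCode)
    (h0 : ((O.err false (O.iter x 0) c).card : ℝ) ≤ τ * O.beta * n) (m : ℕ) :
    (O.changes x m : ℝ) ≤ (1 + 2 * (τ / (1 - τ))) * (n * Δ) := by
  set f : ℕ → ℝ := fun i => (O.err i.bodd (O.iter x i) c).card with hf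
  have hf0 : ∀ i, 0 ≤ f i := fun i => Nat.cast_nonneg _
  have h1 : (O.changes x m : ℝ) ≤ ∑ i ∈ range m, (Δ * f (i + 1) + Δ * f i) := by
    rw [changes, Nat.cast_sum]
    refine sum_le_sum fun i _ => ?_
    have := card_diff_step_le (O := O) (i + 1).bodd (O.iter x i) c
    rw [← iter_succ, Nat.bodd_succ, Bool.not_not, ← Nat.bodd_succ] at this
    simp only [hf]
    exact_mod_cast this
  have h2 : ∑ i ∈ range m, f i ≤ f 0 + ∑ i ∈ range m, f (i + 1) := by
    rw [add_comm, ← sum_range_succ']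
    exact sum_le_sum_of_subset_of_nonneg (range_mono (Nat.le_succ m)) fun i _ _ => hf0 i
  have h3 : f 0 ≤ n := by
    have := card_le_univ (O.err false (O.iter x 0) c)
    rw [Fintype.card_fin] at this
    simp only [hf, Nat.bodd_zero]
    exact_mod_cast this
  have h4 := O.sum_err_le hτ0 hτ1 x hc h0 m
  change (1 - τ) * ∑ i ∈ range m, f (i + 1) ≤ τ * n at h4
  rw [sum_add_distrib, ← mul_sum, ← mul_sum] at h1
  set A := ∑ i ∈ range m, f (i + 1)
  have h5 : A ≤ τ / (1 - τ) * n := by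
    rw [div_mul_eq_mul_div, le_div_iff₀ (by linarith)]
    linarith
  have hΔ0 : (0 : ℝ) ≤ Δ := Nat.cast_nonneg _
  calc (O.changes x m : ℝ) ≤ Δ * A + Δ * ∑ i ∈ range m, f i := h1
    _ ≤ Δ * (τ / (1 - τ) * n) + Δ * (n + τ / (1 - τ) * n) := by gcongr; linarith
    _ = _ := by ring

end OuterCode

/-! ### Lists in the memory -/

theorem length_blocks {k w : ℕ} {f : Fin k → List ℕ} (hf : ∀ i, (f i).length = w) :
    (blocks f).length = k * w := by
  simp [blocks, List.length_flatten, List.map_ofFn, Function.comp_def, hf]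

theorem getD_blocks {k w : ℕ} {f : Fin k → List ℕ} (hf : ∀ i, (f i).length = w) (i : Fin k) {j : ℕ}
    (hj : j < w) : (blocks f).getD (i * w + j) 0 = (f i).getD j 0 := by
  induction k with
  | zero => exact i.elim0
  | succ k ih =>
    have h1 : blocks f = f 0 ++ blocks fun i => f i.succ := by simp [blocks, List.ofFn_succ]
    rw [h1]
    cases i using Fin.cases with
    | zero =>
      rw [List.getD_append _ _ _ _ (by simp [hf, hj])]
      simp
    | succ i =>
      rw [List.getD_append_right _ _ _ _ (by rw [hf, Fin.val_succ, Nat.succ_mul]; omega), hf,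
        ← ih (fun i => hf i.succ) i]
      congr 1
      rw [Fin.val_succ, Nat.succ_mul]
      omega

@[simp] theorem length_bits {k : ℕ} (w : Fin k → ZMod 2) : (bits w).length = k := by simp [bits]

theorem getD_ofFn {k : ℕ} (f : Fin k → ℕ) {j : ℕ} (hj : j < k) :
    (List.ofFn f).getD j 0 = f ⟨j, hj⟩ := by
  rw [List.getD_eq_getElem _ _ (by simpa using hj), List.getElem_ofFn]

theorem getD_bits {k : ℕ} (w : Fin k → ZMod 2) {j : ℕ} (hj : j < k) :
    (bits w).getD j 0 = (w ⟨j, hj⟩).val := getD_ofFn _ hj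

theorem read_eq_bits {k : ℕ} (w : Fin k → ZMod 2) (σ : State) (a : ℕ)
    (h : ∀ j : Fin k, σ.arr a j = (w j).val) : σ.read a k = bits w := by
  refine List.ext_getElem (by simp [State.read]) fun j h1 h2 => ?_
  rw [length_bits] at h2
  simp [State.read, bits, h ⟨j, h2⟩]

theorem read_eq_blocks {n k : ℕ} (w : Fin n → Fin k → ZMod 2) (σ : State) (a : ℕ)
    (h : ∀ (i : Fin n) (j : Fin k), σ.arr a (i * k + j) = (w i j).val) :
    σ.read a (n * k) = blocks fun i => bits (w i) := by
  refine List.ext_getElem (by simp [State.read, length_blocks (w := k)]) fun x h1 h2 => ?_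
  rw [length_blocks (w := k) (by simp)] at h2
  have hk : 0 < k := Nat.pos_of_ne_zero fun h => by simp [h] at h2
  have h3 := Nat.div_add_mod x k
  have h4 := Nat.mod_lt x hk
  have h5 : x / k < n := Nat.div_lt_of_lt_mul (by rwa [mul_comm])
  have h6 : x = (⟨x / k, h5⟩ : Fin n) * k + x % k := by rw [mul_comm]; exact h3.symm
  have h7 := h ⟨x / k, h5⟩ ⟨x % k, h4⟩
  have h8 := getD_blocks (f := fun i => bits (w i)) (w := k) (by simp) ⟨x / k, h5⟩ h4
  rw [← h6, getD_bits _ h4, List.getD_eq_getElem _ _ (by rwa [length_blocks (w := k) (by simp)])]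
    at h8
  rw [h8, ← h7]
  simp only [State.read, List.getElem_map, List.getElem_range]
  exact congrArg _ h6

/-! ### Compiled programs in sequence -/

/-- The variables and arrays that a state of the machine represents. -/
def State.vars (τ : State) : State := ⟨fun x => τ.reg (2 * x), τ.arr⟩

theorem Sim.eq_vars {σ τ : State} (h : Sim σ τ) : τ.vars = σ := by
  cases σ
  simp only [State.vars, State.mk.injEq]
  exact ⟨funext h.1, h.2⟩

theorem Prog.halts_vars (S : List ℕ → List ℕ → ℕ → Prop) {p : Prog} (hp : p.Ok) {τ : State} {T : ℕ}
    {Q : State → Prop} (hT : p.bnd τ.vars.reg ≤ T)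
    (hQ : ∀ τ' : State, τ'.vars = p.run τ.vars → Q τ') : Halts S (p.code 0) τ T Q :=
  (p.halts S τ.vars.reg 0 τ.vars τ ⟨fun _ => rfl, rfl⟩ hp fun _ _ => rfl).mono hT
    fun _ h => hQ _ h.1.eq_vars

theorem Halts.while_steps {S : List ℕ → List ℕ → ℕ → Prop} {x y : ℕ} {c : Cmd} {σ : State} {f : ℕ}
    (I : ℕ → State → Prop) (T : ℕ → ℕ) (hgo : ∀ i ≤ f, ∀ τ, I i τ → (τ.reg x < τ.reg y ↔ i < f))
    (hc : ∀ i < f, ∀ τ, I i τ → Halts S c τ (T i) (I (i + 1))) (h : I 0 σ) :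
    Halts S (.while x y c) σ (∑ i ∈ Finset.range f, (T i + 1) + 1) (I f) := by
  suffices H : ∀ k i σ, i + k = f → I i σ →
      Halts S (.while x y c) σ (∑ j ∈ Finset.range k, (T (i + j) + 1) + 1) (I f) by
    have := H f 0 σ (by omega) h
    simpa only [zero_add] using this
  intro k
  induction k with
  | zero =>
    intro i σ hi h
    obtain rfl : i = f := by omega
    exact ⟨σ, 1, .whileFalse (by rw [hgo i le_rfl σ h]; omega), by omega, h⟩
  | succ k ih =>
    intro i σ hi h
    obtain ⟨σ', t, e1, e2, e3⟩ := hc i (by omega) σ h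
    obtain ⟨σ'', t', e4, e5, e6⟩ := ih (i + 1) σ' (by omega) e3
    refine ⟨σ'', t + t' + 1, .whileTrue ((hgo i (by omega) σ h).2 (by omega)) e1 e4, ?_, e6⟩
    rw [Finset.sum_range_succ', add_zero]
    simp only [Nat.add_right_comm i 1, ← Nat.add_assoc] at e5 ⊢
    omega

/-! ### The memory of the decoder -/

/-- The number of a vertex of the side `s` among the vertices of both sides. -/
def vtx {n : ℕ} (s : Bool) (v : Fin n) : ℕ := (if s then n else 0) + v

theorem vtx_injective {n : ℕ} {s s' : Bool} {v v' : Fin n} (h : vtx s v = vtx s' v') :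
    s = s' ∧ v = v' := by
  have := v.2
  have := v'.2
  simp only [vtx] at h
  cases s <;> cases s' <;> simp at h ⊢ <;> omega

theorem exists_vtx {n g : ℕ} (h : g < n + n) : ∃ (s : Bool) (v : Fin n), g = vtx s v := by
  by_cases hg : g < n
  · exact ⟨false, ⟨g, hg⟩, by simp [vtx]⟩
  · exact ⟨true, ⟨g - n, by omega⟩, by simp [vtx]; omega⟩

theorem index_inj {D i i' j j' : ℕ} (hj : j < D) (hj' : j' < D) (h : i * D + j = i' * D + j') :
    i = i' ∧ j = j' :=
  ⟨by rw [← div_index (i := i) hj, h, div_index hj'], by rw [← mod_index (i := i) hj, h,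
    mod_index hj']⟩

/-- The number of an edge. -/
def edgeIx {n Δ : ℕ} (e : Fin n × Fin Δ) : ℕ := e.1 * Δ + e.2

theorem edgeIx_injective {n Δ : ℕ} : Function.Injective (edgeIx : Fin n × Fin Δ → ℕ) := by
  rintro ⟨u, j⟩ ⟨u', j'⟩ h
  obtain ⟨h1, h2⟩ := index_inj j.2 j'.2 h
  exact Prod.ext (Fin.ext h1) (Fin.ext h2)

/-- The number of an edge in the numbering by the vertices of both sides. -/
def slotIx {n Δ : ℕ} (x : Bool × Fin n × Fin Δ) : ℕ := vtx x.1 x.2.1 * Δ + x.2.2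

theorem slotIx_injective {n Δ : ℕ} : Function.Injective (slotIx : Bool × Fin n × Fin Δ → ℕ) := by
  rintro ⟨s, u, j⟩ ⟨s', u', j'⟩ h
  obtain ⟨h1, h2⟩ := index_inj j.2 j'.2 h
  obtain ⟨rfl, rfl⟩ := vtx_injective h1
  exact Prod.ext rfl (Prod.ext rfl (Fin.ext h2))

section

variable {F : Type} [Field F] [Algebra (ZMod 2) F] {n Δ ℓ : ℕ}

/-- The array `h` holds the contents `z` of the edges. -/
def HoldsEdges (b : Module.Basis (Fin ℓ) (ZMod 2) F) (h : ℕ → ℕ) (z : Fin n × Fin Δ → F) : Prop :=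
  ∀ e, ∀ c < ℓ, h (edgeIx e * ℓ + c) = (crd b (z e) c).val

/-- The fixed data in the memory, after some preparations: the parameters in the variables up to
`14` (where the variable `14` holds a limit for the number of steps of the iteration), the
input in the arrays `3` to `10`, and the graph in the arrays `11` and `12`, where the edges are
numbered by the vertices of both sides: the first of these arrays leads to the original number of
an edge, and the other one to its other endpoint. -/
structure Data (K : ConcatCode F n Δ) (b : Module.Basis (Fin ℓ) (ZMod 2) F) (m κ : ℕ) (σ : State) :
    Prop where
  dims : Dims b Δ σ
  card : σ.reg 1 = n
  dimA : σ.reg 4 = K.O.CA.k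
  dimB : σ.reg 5 = K.O.CB.k
  nin : σ.reg 6 = K.nin
  rounds : σ.reg 7 = m
  width : σ.reg 11 = K.nin + Δ * ℓ
  rows : σ.reg 12 = 1 + K.O.CA.k * ℓ
  card2 : σ.reg 13 = n + n
  cap : σ.reg 14 = κ * Δ * n
  unit : ∀ c < ℓ, σ.arr 4 c = (crd b (1 : F) c).val
  locA : IsVec b Δ (σ.arr 5) K.O.CA.locN
  multA : IsVec b Δ (σ.arr 6) K.O.CA.multN
  locB : IsVec b Δ (σ.arr 7) K.O.CB.locN
  multB : IsVec b Δ (σ.arr 8) K.O.CB.multN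
  encA : ∀ (i : Fin K.O.CA.k) (j : Fin Δ), ∀ c < ℓ,
    σ.arr 9 ((i * Δ + j) * ℓ + c) = (crd b ((K.O.encA (Pi.single i 1)).1 j) c).val
  enc0 : ∀ (i : Fin K.O.CA.k) (t : Fin ℓ) (j : Fin K.nin),
    σ.arr 10 ((i * ℓ + t) * K.nin + j) = ((K.enc0 (Pi.single i (b t))).1 j).val
  edge : ∀ (s : Bool) (v : Fin n) (j : Fin Δ),
    σ.arr 11 (vtx s v * Δ + j) = edgeIx (K.O.slot s (v, j))
  other : ∀ (s : Bool) (v : Fin n) (j : Fin Δ),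
    σ.arr 12 (vtx s v * Δ + j) = vtx (!s) (K.O.own (!s) (K.O.slot s (v, j)))

variable {K : ConcatCode F n Δ} {b : Module.Basis (Fin ℓ) (ZMod 2) F} {m κ : ℕ} {σ σ' : State}

theorem Data.congr (h : Data K b m κ σ) (hr : ∀ r < 15, 0 < r → σ'.reg r = σ.reg r)
    (ha : ∀ a < 13, 2 < a → σ'.arr a = σ.arr a) : Data K b m κ σ' := by
  obtain ⟨⟨h1, h2, h3, h4, h5, h6⟩, h7, h8, h9, h10, h11, h12, h13, h14, h15, h16, h17, h18, h19, h20,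
    h21, h22, h23, h24⟩ := h
  rw [← hr _ (by decide) (by decide)] at h1 h2 h3 h4 h5 h7 h8 h9 h10 h11 h12 h13 h14 h15
  refine ⟨⟨h1, h2, h3, h4, h5, ?_⟩, h7, h8, h9, h10, h11, h12, h13, h14, h15, ?_, ?_, ?_, ?_, ?_, ?_, ?_,
    ?_, ?_⟩
  all_goals rw [ha _ (by decide) (by decide)]; assumption

theorem Data.run (h : Data K b m κ σ) (p : Prog) (hr : ∀ r < 15, 0 < r → r ∉ p.asgn)
    (ha : ∀ a < 13, 2 < a → a ∉ p.wa) : Data K b m κ (p.run σ) :=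
  h.congr (fun r h h0 => (p.frame σ).1 r (hr r h h0)) fun a h h0 => (p.frame σ).2 a (ha a h h0)

theorem Data.setReg (h : Data K b m κ σ) {x v : ℕ} (hx : 15 ≤ x) : Data K b m κ (σ.setReg x v) :=
  h.congr (fun r h _ => State.reg_setReg_of_ne _ _ (by omega)) fun _ _ _ => rfl

end

/-! ### Preparations -/

/-- The parameters that are part of the input. -/
def paramProg : Prog :=
  .seq (.assign 1 (.get 1 (.lit 0))) (.seq (.assign 2 (.get 1 (.lit 1)))
  (.seq (.assign 3 (.get 1 (.lit 2))) (.seq (.assign 4 (.get 1 (.lit 3)))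
  (.seq (.assign 5 (.get 1 (.lit 4))) (.seq (.assign 6 (.get 1 (.lit 5)))
  (.assign 7 (.get 1 (.lit 6))))))))

/-- The parameters computed from them. -/
def derivedProg (κ : ℕ) : Prog :=
  .seq (.assign 8 (.mul (.var 2) 3)) (.seq (.assign 9 (.add (.var 8) (.var 8)))
  (.seq (.assign 10 (.add (.lit 1) (.var 8))) (.seq (.assign 11 (.add (.var 6) (.var 8)))
  (.seq (.assign 12 (.add (.lit 1) (.mul (.var 4) 3))) (.seq (.assign 13 (.add (.var 1) (.var 1)))
  (.assign 14 (.mul (.mul (.lit κ) 2) 1)))))))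

/-- The index of an edge at a vertex of `B`, from its index among the edges at `B`. -/
def sideB (e : Exp) : Exp := .add (.mul (.var 1) 2) e

/-- The number of each edge, at its own place among the edges at the vertices of `A`. -/
def edgeProgA : Prog :=
  .loop 40 1 (.loop 43 2 (.store 11 (.ix (.var 40) 2 (.var 43)) (.ix (.var 40) 2 (.var 43))))

/-- The number of each edge, at its place among the edges at the vertices of `B`. -/
def edgeProgB : Prog :=
  .loop 40 1 (.loop 43 2 (.store 11 (sideB (.get 2 (.ix (.var 40) 2 (.var 43))))
    (.ix (.var 40) 2 (.var 43))))

/-- The endpoint in `A` of each edge, at its place among the edges at the vertices of `B`. -/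
def otherProgB : Prog :=
  .loop 40 1 (.loop 43 2 (.store 12 (sideB (.get 2 (.ix (.var 40) 2 (.var 43)))) (.var 40)))

/-- The endpoint in `B` of each edge, at its place among the edges at the vertices of `A`.  The loop
is over the edges at `B`, and the array `11` leads back to `A`. -/
def otherProgA : Prog :=
  .loop 40 1 (.loop 43 2 (.store 12 (.get 11 (sideB (.ix (.var 40) 2 (.var 43))))
    (.add (.var 1) (.var 40))))

/-- The arrays `11` and `12`, which describe the graph. -/
def graphProg : Prog :=
  .seq (.seq edgeProgA edgeProgB) (.seq otherProgB otherProgA)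

section

variable {F : Type} [Field F] [Algebra (ZMod 2) F] {n Δ ℓ : ℕ}

theorem slotIx_false (u : Fin n) (j : Fin Δ) : slotIx (false, u, j) = u * Δ + j := by
  simp [slotIx, vtx]

theorem slotIx_true (u : Fin n) (j : Fin Δ) : slotIx (true, u, j) = n * Δ + (u * Δ + j) := by
  simp only [slotIx, vtx, if_true]; ring

/-- What the input arrays contain. -/
structure Input (K : ConcatCode F n Δ) (b : Module.Basis (Fin ℓ) (ZMod 2) F) (m : ℕ) (y : K.Word)
    (σ : State) : Prop where
  word : ∀ (i : Fin n) (j : Fin K.nin), σ.arr 0 (i * K.nin + j) = (y i j).val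
  params : σ.arr 1 0 = n ∧ σ.arr 1 1 = Δ ∧ σ.arr 1 2 = ℓ ∧ σ.arr 1 3 = K.O.CA.k ∧
    σ.arr 1 4 = K.O.CB.k ∧ σ.arr 1 5 = K.nin ∧ σ.arr 1 6 = m
  rot : ∀ (u : Fin n) (j : Fin Δ), σ.arr 2 (u * Δ + j) = edgeIx (K.O.G.rot (u, j))
  table : IsTable b (σ.arr 3)
  unit : ∀ c < ℓ, σ.arr 4 c = (crd b (1 : F) c).val
  locA : IsVec b Δ (σ.arr 5) K.O.CA.locN
  multA : IsVec b Δ (σ.arr 6) K.O.CA.multN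
  locB : IsVec b Δ (σ.arr 7) K.O.CB.locN
  multB : IsVec b Δ (σ.arr 8) K.O.CB.multN
  encA : ∀ (i : Fin K.O.CA.k) (j : Fin Δ), ∀ c < ℓ,
    σ.arr 9 ((i * Δ + j) * ℓ + c) = (crd b ((K.O.encA (Pi.single i 1)).1 j) c).val
  enc0 : ∀ (i : Fin K.O.CA.k) (t : Fin ℓ) (j : Fin K.nin),
    σ.arr 10 ((i * ℓ + t) * K.nin + j) = ((K.enc0 (Pi.single i (b t))).1 j).val

variable {K : ConcatCode F n Δ} {b : Module.Basis (Fin ℓ) (ZMod 2) F} {m κ : ℕ} {y : K.Word}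
  {σ : State}

@[simp] theorem length_coords (x : F) : (coords b x).length = ℓ := by simp [coords]

theorem getD_coords (x : F) {c : ℕ} (hc : c < ℓ) : (coords b x).getD c 0 = (crd b x c).val := by
  rw [coords, getD_bits _ hc, crd_of_lt b x hc]

theorem isVec_blocks {D : ℕ} (f : Fin D → F) (w : ℕ → F) (hw : ∀ j : Fin D, w j = f j) :
    IsVec b D (fun i => (blocks fun j => coords b (f j)).getD i 0) w := fun j hj c hc => by
  have := getD_blocks (f := fun j => coords b (f j)) (w := ℓ) (by simp) ⟨j, hj⟩ hc
  dsimp only at this ⊢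
  rw [this, getD_coords _ hc, ← hw]

theorem input_init (K : ConcatCode F n Δ) (b : Module.Basis (Fin ℓ) (ZMod 2) F) (m : ℕ)
    (y : K.Word) : Input K b m y (State.init (K.input b m y)).vars := by
  refine ⟨fun i j => ?_, ⟨rfl, rfl, rfl, rfl, rfl, rfl, rfl⟩, fun u j => ?_, fun i hi j hj a ha => ?_,
    fun c hc => getD_coords _ hc, isVec_blocks _ _ K.O.CA.locN_fin, isVec_blocks _ _ K.O.CA.multN_fin,
    isVec_blocks _ _ K.O.CB.locN_fin, isVec_blocks _ _ K.O.CB.multN_fin, fun i j c hc => ?_,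
    fun i t j => ?_⟩
  · exact (getD_blocks (f := fun i => bits (y i)) (w := K.nin) (by simp) i j.2).trans
      (getD_bits _ j.2)
  · exact (getD_blocks (f := fun u => List.ofFn fun j => _) (w := Δ) (by simp) u j.2).trans
      (getD_ofFn _ j.2)
  · have h1 := getD_blocks (f := fun i => blocks fun j => coords b (b i * b j)) (w := ℓ * ℓ)
      (fun i => length_blocks (by simp)) ⟨i, hi⟩ (j := j * ℓ + a) (index_lt hj ha)
    have h2 := getD_blocks (f := fun j => coords b (b ⟨i, hi⟩ * b j)) (w := ℓ) (by simp) ⟨j, hj⟩ ha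
    have e1 : i * (ℓ * ℓ) + (j * ℓ + a) = (i * ℓ + j) * ℓ + a := by ring
    dsimp only at h1 h2
    rw [e1, h2, getD_coords _ ha] at h1
    have e2 : bas b i = b ⟨i, hi⟩ := bas_fin b ⟨i, hi⟩
    have e3 : bas b j = b ⟨j, hj⟩ := bas_fin b ⟨j, hj⟩
    rw [e2, e3]
    exact h1
  · have h1 := getD_blocks (f := fun i => blocks fun j => coords b ((K.O.encA (Pi.single i 1)).1 j))
      (w := Δ * ℓ) (fun i => length_blocks (by simp)) i (j := j * ℓ + c) (index_lt j.2 hc)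
    have h2 := getD_blocks (f := fun j => coords b ((K.O.encA (Pi.single i 1)).1 j)) (w := ℓ)
      (by simp) j hc
    have e1 : i * (Δ * ℓ) + (j * ℓ + c) = (i * Δ + j) * ℓ + c := by ring
    rw [e1, h2, getD_coords _ hc] at h1
    exact h1
  · have h1 := getD_blocks (f := fun i => blocks fun t => bits (K.enc0 (Pi.single i (b t))).1)
      (w := ℓ * K.nin) (fun i => length_blocks (by simp)) i (j := t * K.nin + j) (index_lt t.2 j.2)
    have h2 := getD_blocks (f := fun t => bits (K.enc0 (Pi.single i (b t))).1) (w := K.nin)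
      (by simp) t j.2
    have e1 : i * (ℓ * K.nin) + (t * K.nin + j) = (i * ℓ + t) * K.nin + j := by ring
    rw [e1, h2, getD_bits _ j.2] at h1
    exact h1

theorem graphProg_spec (h1 : σ.reg 1 = n) (h2 : σ.reg 2 = Δ)
    (hrot : ∀ (u : Fin n) (j : Fin Δ), σ.arr 2 (u * Δ + j) = edgeIx (K.O.G.rot (u, j))) :
    (∀ (s : Bool) (v : Fin n) (j : Fin Δ),
      (graphProg.run σ).arr 11 (vtx s v * Δ + j) = edgeIx (K.O.slot s (v, j))) ∧
    ∀ (s : Bool) (v : Fin n) (j : Fin Δ), (graphProg.run σ).arr 12 (vtx s v * Δ + j) =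
      vtx (!s) (K.O.own (!s) (K.O.slot s (v, j))) := by
  set g : ℕ → ℕ := Function.extend slotIx
    (fun x : Bool × Fin n × Fin Δ => edgeIx (K.O.slot x.1 x.2)) 0 with hg
  set g' : ℕ → ℕ := Function.extend slotIx
    (fun x : Bool × Fin n × Fin Δ => vtx (!x.1) (K.O.own (!x.1) (K.O.slot x.1 x.2))) 0 with hg'
  have gx : ∀ x, g (slotIx x) = edgeIx (K.O.slot x.1 x.2) := slotIx_injective.extend_apply _ _
  have gx' : ∀ x, g' (slotIx x) = vtx (!x.1) (K.O.own (!x.1) (K.O.slot x.1 x.2)) :=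
    slotIx_injective.extend_apply _ _
  have hrotB : ∀ (u : Fin n) (j : Fin Δ), n * Δ + σ.arr 2 (u * Δ + j) =
      slotIx (true, K.O.G.rot (u, j)) := fun u j => by
    rw [hrot, edgeIx, ← slotIx_true]
  have hback : ∀ (u : Fin n) (j : Fin Δ), K.O.slot true (K.O.G.rot (u, j)) = (u, j) := fun u j => by
    simp [OuterCode.slot]
  have f1 : Fills edgeProgA 11 σ ∅ {c | ∃ k < n, ∃ l < Δ, c = k * Δ + l} g :=
    Fills.loop₂ _ h1 h2 (by decide) fun k hk l hl h => by
      have e := gx (false, ⟨k, hk⟩, ⟨l, hl⟩)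
      rw [slotIx_false] at e
      refine ⟨by simp [Exp.eval, Exp.ix, State.reg_setReg, h2], ?_⟩
      simp only [] at e
      rw [e]
      simp [Exp.eval, Exp.ix, State.reg_setReg, h2, edgeIx, OuterCode.slot]
  have f2 : ∀ D₀, Fills edgeProgB 11 σ D₀
      {c | ∃ k < n, ∃ l < Δ, c = n * Δ + σ.arr 2 (k * Δ + l)} g := fun D₀ =>
    Fills.loop₂ (fun k l => n * Δ + σ.arr 2 (k * Δ + l)) h1 h2 (by decide) fun k hk l hl h => by
      refine ⟨by simp [sideB, Exp.eval, Exp.ix, State.reg_setReg, State.arr_setArr, h1, h2], ?_⟩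
      have e := gx (true, K.O.G.rot (⟨k, hk⟩, ⟨l, hl⟩))
      rw [← hrotB, hback] at e
      simp only [] at e
      rw [e]
      simp [Exp.eval, Exp.ix, State.reg_setReg, h2, edgeIx]
  have f12 := f1.seq (f2 _)
  set σ₁ := (Prog.seq edgeProgA edgeProgB).run σ
  have hr : σ₁.reg = σ.reg := f12.reg
  have ha : σ₁.arr 2 = σ.arr 2 := f12.arr_of_ne (by decide)
  have hedge : ∀ (s : Bool) (v : Fin n) (j : Fin Δ),
      σ₁.arr 11 (vtx s v * Δ + j) = edgeIx (K.O.slot s (v, j)) := fun s v j => by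
    have e := gx (s, v, j)
    change g (vtx s v * Δ + j) = _ at e
    rw [f12.arr, e]
    cases s
    · exact .inl ⟨v, v.2, j, j.2, by simp [vtx]⟩
    · refine .inr ⟨(K.O.G.rot.symm (v, j)).1, Fin.is_lt _, (K.O.G.rot.symm (v, j)).2, Fin.is_lt _, ?_⟩
      rw [hrotB, Prod.mk.eta, Equiv.apply_symm_apply]
      rfl
  have f3 : Fills otherProgB 12 σ₁ ∅ {c | ∃ k < n, ∃ l < Δ, c = n * Δ + σ.arr 2 (k * Δ + l)} g' :=
    Fills.loop₂ (fun k l => n * Δ + σ.arr 2 (k * Δ + l)) (by rw [hr, h1]) (by rw [hr, h2])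
      (by decide) fun k hk l hl h => by
      refine ⟨by simp [sideB, Exp.eval, Exp.ix, State.reg_setReg, State.arr_setArr, hr, ha, h1, h2],
        ?_⟩
      have e := gx' (true, K.O.G.rot (⟨k, hk⟩, ⟨l, hl⟩))
      rw [← hrotB, hback] at e
      simp only [] at e
      rw [e]
      simp [Exp.eval, State.reg_setReg, vtx, OuterCode.own, OuterCode.slot]
  have f4 : ∀ D₀, Fills otherProgA 12 σ₁ D₀
      {c | ∃ k < n, ∃ l < Δ, c = σ₁.arr 11 (n * Δ + (k * Δ + l))} g' := fun D₀ =>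
    Fills.loop₂ (fun k l => σ₁.arr 11 (n * Δ + (k * Δ + l))) (by rw [hr, h1]) (by rw [hr, h2])
      (by decide) fun k hk l hl h => by
      refine ⟨by simp [sideB, Exp.eval, Exp.ix, State.reg_setReg, State.arr_setArr, hr, h1, h2],
        ?_⟩
      have e1 := hedge true ⟨k, hk⟩ ⟨l, hl⟩
      have e2 : vtx true (⟨k, hk⟩ : Fin n) * Δ + l = n * Δ + (k * Δ + l) := by
        simp only [vtx, if_true]; ring
      simp only [e2] at e1
      set q := K.O.slot true (⟨k, hk⟩, ⟨l, hl⟩) with hq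
      have e := gx' (false, q)
      have e3 : slotIx (false, q) = edgeIx q := slotIx_false _ _
      have e4 : K.O.own true q = ⟨k, hk⟩ := K.O.own_slot _ _
      rw [e3, Bool.not_false, show K.O.slot false q = q from rfl, e4] at e
      rw [e1, e]
      simp [Exp.eval, State.reg_setReg, vtx, hr, h1]
  have f34 := f3.seq (f4 _)
  have hrun : graphProg.run σ = (Prog.seq otherProgB otherProgA).run σ₁ := rfl
  refine ⟨fun s v j => ?_, fun s v j => ?_⟩
  · rw [hrun, f34.arr_of_ne (by decide), hedge]
  · have e := gx' (s, v, j)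
    change g' (vtx s v * Δ + j) = _ at e
    rw [hrun, f34.arr, e]
    cases s
    · refine .inr ⟨(K.O.G.rot (v, j)).1, Fin.is_lt _, (K.O.G.rot (v, j)).2, Fin.is_lt _, ?_⟩
      have := hedge true (K.O.G.rot (v, j)).1 (K.O.G.rot (v, j)).2
      rw [Prod.mk.eta, hback] at this
      have e2 : vtx true (K.O.G.rot (v, j)).1 * Δ + (K.O.G.rot (v, j)).2 =
          n * Δ + ((K.O.G.rot (v, j)).1 * Δ + (K.O.G.rot (v, j)).2) := by
        simp only [vtx, if_true]; ring
      rw [← e2, this]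
      simp [vtx, edgeIx]
    · refine .inl ⟨(K.O.G.rot.symm (v, j)).1, Fin.is_lt _, (K.O.G.rot.symm (v, j)).2, Fin.is_lt _, ?_⟩
      rw [hrotB, Prod.mk.eta, Equiv.apply_symm_apply]
      rfl

theorem prepare_spec (h : Input K b m y σ) (κ : ℕ) :
    Data K b m κ (graphProg.run ((derivedProg κ).run (paramProg.run σ))) ∧
      ∀ (i : Fin n) (j : Fin K.nin),
        (graphProg.run ((derivedProg κ).run (paramProg.run σ))).arr 0 (i * K.nin + j) = (y i j).val := by
  obtain ⟨p1, p2, p3, p4, p5, p6, p7⟩ := h.params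
  set σ₂ := (derivedProg κ).run (paramProg.run σ) with hσ₂
  have ha : σ₂.arr = σ.arr := rfl
  have q1 : σ₂.reg 1 = n := p1
  have q2 : σ₂.reg 2 = Δ := p2
  have q8 : (paramProg.run σ).reg 2 * (paramProg.run σ).reg 3 = Δ * ℓ := by
    rw [show (paramProg.run σ).reg 2 = Δ from p2, show (paramProg.run σ).reg 3 = ℓ from p3]
  obtain ⟨g1, g2⟩ := graphProg_spec (K := K) q1 q2 h.rot
  have fr := graphProg.frame σ₂
  have r := fun x (hx : x ∉ graphProg.asgn) => fr.1 x hx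
  have a := fun x (hx : x ∉ graphProg.wa) => fr.2 x hx
  refine ⟨⟨⟨?_, ?_, ?_, ?_, ?_, ?_⟩, ?_, ?_, ?_, ?_, ?_, ?_, ?_, ?_, ?_, ?_, ?_, ?_, ?_, ?_, ?_, ?_,
    g1, g2⟩, ?_⟩
  all_goals try rw [r _ (by decide)]
  all_goals try rw [a _ (by decide)]
  · exact p2
  · exact p3
  · exact q8
  · exact congrArg₂ (· + ·) q8 q8
  · exact congrArg (1 + ·) q8
  · exact h.table
  · exact p1
  · exact p4
  · exact p5
  · exact p6
  · exact p7
  · exact congrArg₂ (· + ·) p6 q8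
  · exact congrArg (1 + ·) (congrArg₂ (· * ·) p4 p3)
  · exact congrArg₂ (· + ·) p1 p1
  · exact congrArg₂ (κ * · * ·) p2 p1
  · exact h.unit
  · exact h.locA
  · exact h.multA
  · exact h.locB
  · exact h.multB
  · exact h.encA
  · exact h.enc0
  · exact h.word

end

/-! ### Between symbols of the inner code and words of the outer constituent code -/

/-- Set up a matrix whose rows are the images of the basis of the alphabet under the two encoders,
at the offsets `o₀` (inner code) and `oA` (constituent code), together with a target. -/
def encRows (o₀ oA : Exp) : Prog :=
  .seq (.loop 41 4 (.loop 42 3 (.loop 43 6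
    (.store 27 (.ix (.add (.lit 1) (.ix (.var 41) 3 (.var 42))) 11 (.add o₀ (.var 43)))
      (.get 10 (.ix (.ix (.var 41) 3 (.var 42)) 6 (.var 43)))))))
  (.loop 41 4 (.loop 42 3 (.loop 43 2 (.loop 44 3
    (.store 27 (.ix (.add (.lit 1) (.ix (.var 41) 3 (.var 42))) 11
        (.add oA (.ix (.var 43) 3 (.var 44))))
      (.bmul 45 (.var 42) (.get 9 (.ix (.ix (.var 41) 2 (.var 43)) 3 (.var 45))) (.var 44)))))))

/-- The target of the elimination: `t₀` on the columns of the inner code, `tA` on those of the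
constituent code. -/
def encTarget (o₀ oA t₀ tA : Exp) : Prog :=
  .seq (.loop 43 6 (.store 27 (.add o₀ (.var 43)) t₀))
    (.loop 43 2 (.loop 44 3 (.store 27 (.add oA (.ix (.var 43) 3 (.var 44))) tA)))

/-- The program for the block in the variable `40`: from the codeword of the inner code in the
array `17` to the contents of the edges in the array `13`. -/
def loadBlock : Prog :=
  .seq (.seq (encRows (.lit 0) (.var 6)) (encTarget (.lit 0) (.var 6)
    (.get 17 (.ix (.var 40) 6 (.var 43))) (.lit 0)))
  (.seq (elimProg 6 11 12) (.loop 43 2 (.loop 44 3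
    (.store 13 (.ix (.ix (.var 40) 2 (.var 43)) 3 (.var 44))
      (.get 27 (.add (.var 6) (.ix (.var 43) 3 (.var 44))))))))

/-- The reverse direction, with the output in the array `0`. -/
def unloadBlock : Prog :=
  .seq (.seq (encRows (.var 8) (.lit 0)) (encTarget (.var 8) (.lit 0) (.lit 0)
    (.get 13 (.ix (.ix (.var 40) 2 (.var 43)) 3 (.var 44)))))
  (.seq (elimProg 8 11 12) (.loop 43 6
    (.store 0 (.ix (.var 40) 6 (.var 43)) (.get 27 (.add (.var 8) (.var 43))))))

section

variable {F : Type} [Field F] [Algebra (ZMod 2) F] {n Δ ℓ : ℕ}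
  (K : ConcatCode F n Δ) (b : Module.Basis (Fin ℓ) (ZMod 2) F)

/-- The encoder of the inner code, continued by zero. -/
noncomputable def innerMap : K.O.Phi →ₗ[ZMod 2] (ℕ → ZMod 2) where
  toFun x j := if h : j < K.nin then (K.enc0 x).1 ⟨j, h⟩ else 0
  map_add' x y := by funext j; by_cases h : j < K.nin <;> simp [h]
  map_smul' r x := by funext j; by_cases h : j < K.nin <;> simp [h]

/-- The generator matrix of the encoder of the constituent code. -/
noncomputable def rowA (i j : ℕ) : F :=
  if h : i < K.O.CA.k then extN (K.O.encA (Pi.single ⟨i, h⟩ 1)).1 j else 0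

theorem sum_rowA (x : K.O.Phi) (j : ℕ) :
    ∑ i : Fin K.O.CA.k, x i * rowA K i j = extN (K.O.encA x).1 j := by
  have h1 : x = ∑ i, x i • (Pi.single i 1 : K.O.Phi) := by
    funext i
    simp [Pi.single_apply]
  by_cases hj : j < Δ
  · conv_rhs => rw [h1, map_sum]
    simp [rowA, extN, hj]
  · simp [rowA, extN, hj]

/-- The encoder of the constituent code, as a sequence of bits. -/
noncomputable def outerMap : K.O.Phi →ₗ[ZMod 2] (ℕ → ZMod 2) := combMap b (rowA K)

theorem outerMap_apply (x : K.O.Phi) : outerMap K b x = flat b (extN (K.O.encA x).1) := by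
  change flat b (fun j => ∑ i : Fin K.O.CA.k, x i * rowA K i j) = _
  congr 1
  funext j
  exact sum_rowA K x j

theorem outerMap_index (x : K.O.Phi) (j : Fin Δ) {c : ℕ} (hc : c < ℓ) :
    outerMap K b x (j * ℓ + c) = crd b ((K.O.encA x).1 j) c := by
  rw [outerMap_apply, flat_index _ _ hc, extN_fin]

theorem split_index {D ℓ c : ℕ} (hc : c < D * ℓ) : ∃ j < D, ∃ a < ℓ, c = j * ℓ + a := by
  have hℓ : 0 < ℓ := Nat.pos_of_ne_zero fun h => by simp [h] at hc
  exact ⟨c / ℓ, Nat.div_lt_of_lt_mul (by rwa [mul_comm]), c % ℓ, Nat.mod_lt _ hℓ, by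
    rw [mul_comm]; exact (Nat.div_add_mod c ℓ).symm⟩

variable {K b} {m κ : ℕ} {σ : State}

/-- The matrix that `encRows` and `encTarget` set up. -/
structure EncMat (K : ConcatCode F n Δ) (b : Module.Basis (Fin ℓ) (ZMod 2) F) (p₀ pA : ℕ)
    (s₀ sA : ℕ → ZMod 2) (h : ℕ → ℕ) : Prop where
  target₀ : ∀ j < K.nin, h (p₀ + j) = (s₀ j).val
  targetA : ∀ c < Δ * ℓ, h (pA + c) = (sA c).val
  row₀ : ∀ (i : Fin K.O.CA.k) (s : Fin ℓ), ∀ j < K.nin,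
    h ((1 + (i * ℓ + s)) * (K.nin + Δ * ℓ) + (p₀ + j)) = (innerMap K (Pi.single i (b s)) j).val
  rowA : ∀ (i : Fin K.O.CA.k) (s : Fin ℓ), ∀ c < Δ * ℓ,
    h ((1 + (i * ℓ + s)) * (K.nin + Δ * ℓ) + (pA + c)) = (outerMap K b (Pi.single i (b s)) c).val

theorem encFill_spec (hσ : Data K b m κ σ) {o₀ oA t₀ tA : Exp} {p₀ pA : ℕ} (s₀ sA : ℕ → ZMod 2)
    (ho₀ : ∀ τ : State, τ.reg 6 = K.nin → τ.reg 8 = Δ * ℓ → o₀.eval τ = p₀)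
    (hoA : ∀ τ : State, τ.reg 6 = K.nin → τ.reg 8 = Δ * ℓ → oA.eval τ = pA)
    (hp₀ : p₀ + K.nin ≤ K.nin + Δ * ℓ) (hpA : pA + Δ * ℓ ≤ K.nin + Δ * ℓ)
    (hdis : ∀ c < Δ * ℓ, ¬ (p₀ ≤ pA + c ∧ pA + c < p₀ + K.nin))
    (ht₀ : ∀ j < K.nin, ∀ h, t₀.eval ((σ.setReg 43 j).setArr 27 h) = (s₀ j).val)
    (htA : ∀ j < Δ, ∀ c < ℓ, ∀ h,
      tA.eval (((σ.setReg 43 j).setReg 44 c).setArr 27 h) = (sA (j * ℓ + c)).val) :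
    SameBut 27 σ ((Prog.seq (encRows o₀ oA) (encTarget o₀ oA t₀ tA)).run σ) ∧
      EncMat K b p₀ pA s₀ sA
        (((Prog.seq (encRows o₀ oA) (encTarget o₀ oA t₀ tA)).run σ).arr 27) := by
  obtain ⟨h2, h3, h8, h9, h10, hT⟩ := hσ.dims
  have h4 := hσ.dimA
  have h6 := hσ.nin
  have h11 := hσ.width
  set W := K.nin + Δ * ℓ with hW
  set V : ℕ → ℕ → ZMod 2 := fun q col =>
    if q = 0 then (if p₀ ≤ col ∧ col < p₀ + K.nin then s₀ (col - p₀) else sA (col - pA))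
    else
      (if p₀ ≤ col ∧ col < p₀ + K.nin then
        innerMap K (if h : (q - 1) / ℓ < K.O.CA.k then Pi.single ⟨_, h⟩ (bas b ((q - 1) % ℓ)) else 0)
          (col - p₀)
      else outerMap K b
        (if h : (q - 1) / ℓ < K.O.CA.k then Pi.single ⟨_, h⟩ (bas b ((q - 1) % ℓ)) else 0)
        (col - pA)) with hV
  set g : ℕ → ℕ := fun c => (V (c / W) (c % W)).val with hg
  have gt₀ : ∀ j < K.nin, g (p₀ + j) = (s₀ j).val := fun j hj => by
    simp only [hg, hV]
    rw [Nat.div_eq_of_lt (by omega), Nat.mod_eq_of_lt (by omega), if_pos rfl, if_pos (by omega),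
      Nat.add_sub_cancel_left]
  have gtA : ∀ c < Δ * ℓ, g (pA + c) = (sA c).val := fun c hc => by
    simp only [hg, hV]
    rw [Nat.div_eq_of_lt (by omega), Nat.mod_eq_of_lt (by omega), if_pos rfl, if_neg (hdis c hc),
      Nat.add_sub_cancel_left]
  have gr₀ : ∀ (i : Fin K.O.CA.k) (s : Fin ℓ), ∀ j < K.nin,
      g ((1 + (i * ℓ + s)) * W + (p₀ + j)) = (innerMap K (Pi.single i (b s)) j).val :=
    fun i s j hj => by
      simp only [hg, hV]
      rw [div_index (by omega), mod_index (by omega), if_neg (by omega), if_pos (by omega),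
        Nat.add_sub_cancel_left]
      simp only [Nat.add_sub_cancel_left, div_index s.2, mod_index s.2, i.2, dif_pos, bas_fin]
  have grA : ∀ (i : Fin K.O.CA.k) (s : Fin ℓ), ∀ c < Δ * ℓ,
      g ((1 + (i * ℓ + s)) * W + (pA + c)) = (outerMap K b (Pi.single i (b s)) c).val :=
    fun i s c hc => by
      simp only [hg, hV]
      rw [div_index (by omega), mod_index (by omega), if_neg (by omega), if_neg (hdis c hc),
        Nat.add_sub_cancel_left]
      simp only [Nat.add_sub_cancel_left, div_index s.2, mod_index s.2, i.2, dif_pos, bas_fin]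
  have f1 : Fills _ 27 σ ∅ {c | ∃ i < K.O.CA.k, ∃ s < ℓ, ∃ j < K.nin,
      c = (1 + (i * ℓ + s)) * W + (p₀ + j)} g :=
    Fills.loop₃ (i := .ix (.add (.lit 1) (.ix (.var 41) 3 (.var 42))) 11 (.add o₀ (.var 43)))
      (e := .get 10 (.ix (.ix (.var 41) 3 (.var 42)) 6 (.var 43))) (x := 41) (y := 42) (z := 43)
      _ h4 h3 h6 (by decide) (by decide) (by decide) fun i hi s hs j hj h => by
      refine ⟨?_, ?_⟩
      · simp [Exp.eval, Exp.ix, State.reg_setReg, h3, h11, ho₀, h6, h8]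
      · rw [gr₀ ⟨i, hi⟩ ⟨s, hs⟩ j hj]
        simp [Exp.eval, Exp.ix, State.reg_setReg, State.arr_setArr, h3, h6, innerMap, hj]
        exact hσ.enc0 ⟨i, hi⟩ ⟨s, hs⟩ ⟨j, hj⟩
  have f2 : ∀ D₀, Fills _ 27 σ D₀ {c | ∃ i < K.O.CA.k, ∃ s < ℓ, ∃ j < Δ, ∃ a < ℓ,
      c = (1 + (i * ℓ + s)) * W + (pA + (j * ℓ + a))} g := fun D₀ =>
    Fills.loop₄ (i := .ix (.add (.lit 1) (.ix (.var 41) 3 (.var 42))) 11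
        (.add oA (.ix (.var 43) 3 (.var 44))))
      (e := .bmul 45 (.var 42) (.get 9 (.ix (.ix (.var 41) 2 (.var 43)) 3 (.var 45))) (.var 44))
      (x := 41) (y := 42) (z := 43) (w := 44)
      _ h4 h3 h2 h3 (by decide) (by decide) (by decide) (by decide) (by decide)
      (by decide) fun i hi s hs j hj a ha h => by
      refine ⟨?_, ?_⟩
      · simp [Exp.eval, Exp.ix, State.reg_setReg, h3, h11, hoA, h6, h8]
      · rw [grA ⟨i, hi⟩ ⟨s, hs⟩ _ (index_lt hj ha), outerMap, combMap_single, flat_index b _ ha,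
          ← bas_fin]
        refine Exp.eval_bmul (by simp [State.reg_setReg, h3]) (by simpa [State.arr_setArr] using hT)
          (by decide) hs ha ?_ ?_ ?_
        · simp [Exp.eval, State.reg_setReg]
        · intro q hq
          simp [Exp.eval, Exp.ix, State.reg_setReg, State.arr_setArr, h2, h3, rowA, extN, hi, hj]
          exact hσ.encA ⟨i, hi⟩ ⟨j, hj⟩ q hq
        · simp [Exp.eval, State.reg_setReg]
  have f3 : ∀ D₀, Fills (encTarget o₀ oA t₀ tA) 27 σ D₀ ({c | ∃ j < K.nin, c = p₀ + j} ∪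
      {c | ∃ j < Δ, ∃ a < ℓ, c = pA + (j * ℓ + a)}) g := fun D₀ => by
    refine Fills.seq (Fills.loop₁ _ h6 fun j hj h => ⟨?_, ?_⟩)
      (Fills.loop₂ _ h2 h3 (by decide) fun j hj a ha h => ⟨?_, ?_⟩)
    · simp [Exp.eval, State.reg_setReg, ho₀, h6, h8]
    · rw [gt₀ j hj, ht₀ j hj]
    · simp [Exp.eval, Exp.ix, State.reg_setReg, h3, hoA, h6, h8]
    · rw [gtA _ (index_lt hj ha), htA j hj a ha]
  have f : Fills (.seq (encRows o₀ oA) (encTarget o₀ oA t₀ tA)) 27 σ ∅ _ g :=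
    Fills.seq (Fills.seq f1 (f2 _)) (f3 _)
  refine ⟨⟨f.reg, fun c hc => f.arr_of_ne hc⟩, fun j hj => ?_, fun c hc => ?_, fun i s j hj => ?_,
    fun i s c hc => ?_⟩
  · rw [f.arr (.inr (.inl ⟨j, hj, rfl⟩)), gt₀ j hj]
  · obtain ⟨j, hj, a, ha, rfl⟩ := split_index hc
    rw [f.arr (.inr (.inr ⟨j, hj, a, ha, rfl⟩)), gtA _ hc]
  · rw [f.arr (.inl (.inl ⟨i, i.2, s, s.2, j, hj, rfl⟩)), gr₀ i s j hj]
  · obtain ⟨j, hj, a, ha, rfl⟩ := split_index hc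
    rw [f.arr (.inl (.inr ⟨i, i.2, s, s.2, j, hj, a, ha, rfl⟩)), grA i s _ hc]

theorem loadBlock_spec (hσ : Data K b m κ σ) {u : ℕ} (h40 : σ.reg 40 = u) (x : K.O.Phi)
    (hx : ∀ j : Fin K.nin, σ.arr 17 (u * K.nin + j) = ((K.enc0 x).1 j).val) :
    (∀ j : Fin Δ, ∀ c < ℓ, (loadBlock.run σ).arr 13 ((u * Δ + j) * ℓ + c) =
      (crd b ((K.O.encA x).1 j) c).val) ∧
    ∀ c, (∀ j < Δ, ∀ a < ℓ, c ≠ (u * Δ + j) * ℓ + a) → (loadBlock.run σ).arr 13 c = σ.arr 13 c := by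
  obtain ⟨hs, hE⟩ := encFill_spec hσ (o₀ := .lit 0) (oA := .var 6)
    (t₀ := .get 17 (.ix (.var 40) 6 (.var 43))) (tA := .lit 0) (p₀ := 0) (pA := K.nin)
    (innerMap K x) 0 (fun _ _ _ => rfl) (fun _ h _ => h) (by omega) le_rfl (fun c _ => by omega)
    (fun j hj h => by
      simp [Exp.eval, Exp.ix, State.reg_setReg, State.arr_setArr, hσ.nin, h40, innerMap, hj]
      exact hx ⟨j, hj⟩)
    (fun j _ c _ h => by simp [Exp.eval])
  set σ₁ := (Prog.seq (encRows (.lit 0) (.var 6)) (encTarget (.lit 0) (.var 6)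
    (.get 17 (.ix (.var 40) 6 (.var 43))) (.lit 0))).run σ
  obtain ⟨x', h1, h2⟩ := elimProg_solve (N := 6) (W := 11) (R := 12) (b := b) (σ := σ₁) (by decide)
    (by decide) (innerMap K) (outerMap K b) (innerMap K x) (n := K.nin) (n' := Δ * ℓ)
    (by rw [hs.1, hσ.nin]) (by rw [hs.1, hσ.width]) (by rw [hs.1, hσ.rows])
    (fun j hj => by rw [← hE.target₀ j hj, zero_add]) (fun c hc => by rw [hE.targetA c hc]; simp)
    (fun i s j hj => by rw [← hE.row₀ i s j hj, zero_add]) (fun i s c hc => hE.rowA i s c hc)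
  have hxx : x' = x := by
    have h3 := h2 ⟨x, fun _ _ => rfl⟩
    refine K.enc0.injective (Subtype.ext (funext fun j => ?_))
    have := h3 j j.2
    simpa [innerMap] using this.symm
  subst hxx
  set σ₂ := (elimProg 6 11 12).run σ₁
  have fr := (elimProg 6 11 12).frame σ₁
  have r : ∀ y ∈ [2, 3, 6, 40], σ₂.reg y = σ.reg y := fun y hy => by
    have : y ∉ (elimProg 6 11 12).asgn := by revert y; decide
    rw [fr.1 y this, hs.1]
  set g : ℕ → ℕ := fun c => (flat b (extN (K.O.encA x').1) (c - u * Δ * ℓ)).val with hg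
  have hi : ∀ j c, (u * Δ + j) * ℓ + c = u * Δ * ℓ + (j * ℓ + c) := fun j c => by ring
  have gx : ∀ j, ∀ c < ℓ, g ((u * Δ + j) * ℓ + c) = (crd b (extN (K.O.encA x').1 j) c).val :=
    fun j c hc => by
      simp only [hg]
      rw [hi, Nat.add_sub_cancel_left, flat_index _ _ hc]
  have f : Fills (.loop 43 2 (.loop 44 3
      (.store 13 (.ix (.ix (.var 40) 2 (.var 43)) 3 (.var 44))
      (.get 27 (.add (.var 6) (.ix (.var 43) 3 (.var 44))))))) 13 σ₂ ∅
      {c | ∃ j < Δ, ∃ a < ℓ, c = (u * Δ + j) * ℓ + a} g :=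
    Fills.loop₂ _ (by rw [r _ (by decide), hσ.dims.len]) (by rw [r _ (by decide), hσ.dims.deg])
      (by decide) fun j hj a ha h => by
      refine ⟨?_, ?_⟩
      · simp [Exp.eval, Exp.ix, State.reg_setReg, r, hσ.dims.len, hσ.dims.deg, h40]
      · rw [gx _ _ ha]
        simp [Exp.eval, Exp.ix, State.reg_setReg, State.arr_setArr, r, hσ.dims.deg, hσ.nin]
        rw [h1 _ (index_lt hj ha), outerMap_apply, flat_index _ _ ha]
  refine ⟨fun j c hc => ?_, fun c hc => ?_⟩
  · rw [show loadBlock.run σ = Prog.run _ σ₂ from rfl, f.arr ⟨j, j.2, c, hc, rfl⟩, gx _ _ hc,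
    extN_fin]
  · rw [show loadBlock.run σ = Prog.run _ σ₂ from rfl, f.arr_of_notMem, fr.2 _ (by decide),
      hs.2 _ (by decide)]
    rintro ⟨j, hj, a, ha, rfl⟩
    exact hc j hj a ha rfl

theorem unloadBlock_spec (hσ : Data K b m κ σ) {u : ℕ} (h40 : σ.reg 40 = u) :
    (∀ x : K.O.Phi, (∀ j : Fin Δ, ∀ c < ℓ,
      σ.arr 13 ((u * Δ + j) * ℓ + c) = (crd b ((K.O.encA x).1 j) c).val) →
      ∀ j : Fin K.nin, (unloadBlock.run σ).arr 0 (u * K.nin + j) = ((K.enc0 x).1 j).val) ∧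
    ∀ c, (∀ j < K.nin, c ≠ u * K.nin + j) → (unloadBlock.run σ).arr 0 c = σ.arr 0 c := by
  set p := Prog.seq (encRows (.var 8) (.lit 0)) (encTarget (.var 8) (.lit 0) (.lit 0)
    (.get 13 (.ix (.ix (.var 40) 2 (.var 43)) 3 (.var 44)))) with hp
  set σ₁ := p.run σ
  set σ₂ := (elimProg 8 11 12).run σ₁
  have fr₁ := p.frame σ
  have fr := (elimProg 8 11 12).frame σ₁
  have r : ∀ y ∈ [2, 3, 6, 8, 40], σ₂.reg y = σ.reg y := fun y hy => by
    have h1 : y ∉ (elimProg 8 11 12).asgn := by revert y; decide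
    have h2 : y ∉ p.asgn := by rw [hp]; revert y; decide
    rw [fr.1 y h1, fr₁.1 y h2]
  set g : ℕ → ℕ := fun c => σ₂.arr 27 (Δ * ℓ + (c - u * K.nin)) with hg
  have f : Fills (.loop 43 6
      (.store 0 (.ix (.var 40) 6 (.var 43)) (.get 27 (.add (.var 8) (.var 43))))) 0 σ₂ ∅
      {c | ∃ j < K.nin, c = u * K.nin + j} g :=
    Fills.loop₁ _ (by rw [r _ (by decide), hσ.nin]) fun j hj h => by
      refine ⟨?_, ?_⟩
      · simp [Exp.eval, Exp.ix, State.reg_setReg, r, hσ.nin, h40]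
      · simp [Exp.eval, State.reg_setReg, State.arr_setArr, r, hσ.dims.bits, hg]
  have hrun : unloadBlock.run σ = Prog.run _ σ₂ := rfl
  refine ⟨fun x hx j => ?_, fun c hc => ?_⟩
  · obtain ⟨hs, hE⟩ := encFill_spec hσ (o₀ := .var 8) (oA := .lit 0) (t₀ := .lit 0)
      (tA := .get 13 (.ix (.ix (.var 40) 2 (.var 43)) 3 (.var 44))) (p₀ := Δ * ℓ) (pA := 0)
      0 (outerMap K b x) (fun _ _ h => h) (fun _ _ _ => rfl) (by omega) (by omega)
      (fun c _ => by omega) (fun j hj h => by simp [Exp.eval])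
      (fun j hj c hc h => by
        simp [Exp.eval, Exp.ix, State.reg_setReg, State.arr_setArr, hσ.dims.len, hσ.dims.deg, h40]
        rw [outerMap_index K b x ⟨j, hj⟩ hc]
        exact hx ⟨j, hj⟩ c hc)
    obtain ⟨x', h1, h2⟩ := elimProg_solve (N := 8) (W := 11) (R := 12) (b := b) (σ := σ₁)
      (by decide) (by decide) (outerMap K b) (innerMap K) (outerMap K b x) (n := Δ * ℓ)
      (n' := K.nin) (by rw [hs.1, hσ.dims.bits]) (by rw [hs.1, hσ.width, add_comm])
      (by rw [hs.1, hσ.rows])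
      (fun c hc => by rw [← hE.targetA c hc, zero_add])
      (fun c hc => by rw [hE.target₀ c hc]; simp)
      (fun i s c hc => by rw [← hE.rowA i s c hc, zero_add, add_comm (Δ * ℓ)])
      (fun i s j hj => by rw [add_comm (Δ * ℓ) K.nin]; exact hE.row₀ i s j hj)
    have hxx : x' = x := by
      have h3 := h2 ⟨x, fun _ _ => rfl⟩
      refine K.O.encA.injective (Subtype.ext (funext fun j => eq_of_crd b fun c hc => ?_))
      rw [← outerMap_index K b x' j hc, ← outerMap_index K b x j hc]
      exact (h3 _ (index_lt j.2 hc)).symm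
    subst hxx
    rw [hrun, f.arr ⟨j, j.2, rfl⟩, hg]
    simp only [Nat.add_sub_cancel_left]
    rw [h1 j j.2]
    simp [innerMap]
  · rw [hrun, f.arr_of_notMem, fr.2 _ (by decide), fr₁.2 _ (by rw [hp]; decide)]
    rintro ⟨j, hj, rfl⟩
    exact hc j hj rfl

end

/-! ### One vertex of the graph -/

/-- The initial contents of the edges. -/
def loadProg : Prog := .loop 40 1 loadBlock

/-- From the contents of the edges to the decoded word. -/
def unloadProg : Prog := .loop 40 1 unloadBlock

/-- Prepare the input of the decoder of the constituent code for the vertex in the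
variable `26`: its number tells on which side it is. -/
def fetchProg : Prog :=
  .seq (.assign 17 (.ite (.var 26) (.var 1) (.var 4) (.var 5)))
  (.seq (vecFill 20 (.ite (.var 26) (.var 1) (.get 5 (.ix (.var 43) 3 (.var 44)))
    (.get 7 (.ix (.var 43) 3 (.var 44)))))
  (.seq (vecFill 21 (.ite (.var 26) (.var 1) (.get 6 (.ix (.var 43) 3 (.var 44)))
    (.get 8 (.ix (.var 43) 3 (.var 44)))))
  (vecFill 22 (.get 13 (.ix (.get 11 (.ix (.var 26) 2 (.var 43))) 3 (.var 44))))))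

/-- Decode at the vertex in the variable `26`: the word on its edges goes to the array `22`, and
the result of decoding to the array `32`. -/
def vertexDecode : Prog := .seq fetchProg grsDecode

/-- Append the other endpoints of the edges whose contents are about to change to the queue in the
array `14`, whose end is in the variable `16`. -/
def appendProg : Prog :=
  .loop 43 2 (.seq (.store 14 (.var 16) (.get 12 (.ix (.var 26) 2 (.var 43))))
    (.assign 16 (.add (.var 16) (symNe 32))))

/-- Write the result of decoding to the edges at the vertex in the variable `26`. -/
def scatterProg : Prog :=
  .loop 43 2 (.loop 44 3 (.store 13 (.ix (.get 11 (.ix (.var 26) 2 (.var 43))) 3 (.var 44))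
    (.get 32 (.ix (.var 43) 3 (.var 44)))))

section

variable {F : Type} [Field F] [Algebra (ZMod 2) F] {n Δ ℓ : ℕ} {K : ConcatCode F n Δ}
  {b : Module.Basis (Fin ℓ) (ZMod 2) F} {m κ : ℕ} {σ : State}

theorem loadProg_spec (hσ : Data K b m κ σ) (x : Fin n → K.O.Phi)
    (hx : ∀ (u : Fin n) (j : Fin K.nin), σ.arr 17 (u * K.nin + j) = ((K.enc0 (x u)).1 j).val) :
    HoldsEdges b ((loadProg.run σ).arr 13) (K.O.iter x 0) := by
  have key := rpt_induction (n := σ.reg 1) (s := σ) (f := fun i τ => loadBlock.run (τ.setReg 40 i))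
    (fun k τ => Data K b m κ τ ∧ τ.arr 17 = σ.arr 17 ∧ ∀ u : Fin n, (u : ℕ) < k → ∀ j : Fin Δ, ∀ c < ℓ,
      τ.arr 13 ((u * Δ + j) * ℓ + c) = (crd b ((K.O.encA (x u)).1 j) c).val)
    ⟨hσ, rfl, fun u h => by omega⟩ ?_
  · rintro ⟨u, j⟩ c hc
    exact key.2.2 u (by rw [hσ.card]; exact u.2) j c hc
  · rintro k hk τ ⟨h1, h2, h3⟩
    rw [hσ.card] at hk
    have h4 := h1.setReg (x := 40) (v := k) (by decide)
    obtain ⟨s1, s2⟩ := loadBlock_spec h4 (u := k) (by simp) (x ⟨k, hk⟩) fun j => by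
      rw [State.arr_setReg, h2]
      exact hx ⟨k, hk⟩ j
    refine ⟨h4.run loadBlock (by decide) (by decide), ?_, fun u hu j c hc => ?_⟩
    · rw [(loadBlock.frame _).2 _ (by decide), State.arr_setReg, h2]
    · rcases Nat.lt_succ_iff_lt_or_eq.1 hu with hu | rfl
      · rw [s2, State.arr_setReg, h3 u hu j c hc]
        intro j' hj' c' hc' he
        have h5 := (index_inj hc hc' he).1
        have := (index_inj j.2 hj' h5).1
        omega
      · exact s1 j c hc

theorem unloadProg_spec (hσ : Data K b m κ σ) (x : Fin n → K.O.Phi)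
    (hz : HoldsEdges b (σ.arr 13) fun e => (K.O.encA (x e.1)).1 e.2) (u : Fin n) (j : Fin K.nin) :
    (unloadProg.run σ).arr 0 (u * K.nin + j) = ((K.enc0 (x u)).1 j).val := by
  have key := rpt_induction (n := σ.reg 1) (s := σ) (f := fun i τ => unloadBlock.run (τ.setReg 40 i))
    (fun k τ => Data K b m κ τ ∧ τ.arr 13 = σ.arr 13 ∧ ∀ u : Fin n, (u : ℕ) < k → ∀ j : Fin K.nin,
      τ.arr 0 (u * K.nin + j) = ((K.enc0 (x u)).1 j).val)
    ⟨hσ, rfl, fun u h => by omega⟩ ?_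
  · exact key.2.2 u (by rw [hσ.card]; exact u.2) j
  · rintro k hk τ ⟨h1, h2, h3⟩
    rw [hσ.card] at hk
    have h4 := h1.setReg (x := 40) (v := k) (by decide)
    obtain ⟨s1, s2⟩ := unloadBlock_spec h4 (u := k) (by simp)
    have s1 := s1 (x ⟨k, hk⟩) fun j c hc => by
      rw [State.arr_setReg, h2]
      exact hz (⟨k, hk⟩, j) c hc
    refine ⟨h4.run unloadBlock (by decide) (by decide), ?_, fun u hu j => ?_⟩
    · rw [(unloadBlock.frame _).2 _ (by decide), State.arr_setReg, h2]
    · rcases Nat.lt_succ_iff_lt_or_eq.1 hu with hu | rfl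
      · rw [s2, State.arr_setReg, h3 u hu j]
        intro j' hj' he
        have := (index_inj j.2 hj' he).1
        omega
      · exact s1 j

theorem vtx_lt {s : Bool} {v : Fin n} : vtx s v < n ↔ s = false := by
  cases s <;> simp [vtx]

theorem fetchProg_spec (hσ : Data K b m κ σ) {z : Fin n × Fin Δ → F}
    (hz : HoldsEdges b (σ.arr 13) z) {s : Bool} {v : Fin n} (hv : σ.reg 26 = vtx s v) :
    GrsIn b (K.O.grs s) (extN (K.O.word s z v)) (fetchProg.run σ) := by
  set p₁ := Prog.assign 17 (.ite (.var 26) (.var 1) (.var 4) (.var 5)) with hp₁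
  set σ₁ := p₁.run σ with hσ₁
  have h17 : σ₁.reg 17 = (K.O.grs s).k := by
    simp only [hσ₁, hp₁, Prog.run, State.reg_setReg_self, Exp.eval, hσ.card, hσ.dimA, hσ.dimB, hv,
      vtx_lt]
    cases s <;> rfl
  have hd₁ : Data K b m κ σ₁ := hσ.run p₁ (by decide) (by decide)
  have hv₁ : σ₁.reg 26 = vtx s v := by rw [hσ₁, (p₁.frame σ).1 _ (by decide), hv]
  have loc : IsVec b Δ (σ₁.arr (if s then 7 else 5)) (K.O.grs s).locN := by
    cases s; exacts [hd₁.locA, hd₁.locB]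
  have mult : IsVec b Δ (σ₁.arr (if s then 8 else 6)) (K.O.grs s).multN := by
    cases s; exacts [hd₁.multA, hd₁.multB]
  set p₂ := vecFill 20 (.ite (.var 26) (.var 1) (.get 5 (.ix (.var 43) 3 (.var 44)))
    (.get 7 (.ix (.var 43) 3 (.var 44)))) with hp₂
  obtain ⟨b2, v2⟩ := vecFill_spec (a := 20) (e := .ite (.var 26) (.var 1)
    (.get 5 (.ix (.var 43) 3 (.var 44))) (.get 7 (.ix (.var 43) 3 (.var 44)))) hd₁.dims
    (K.O.grs s).locN fun j hj c hc h => by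
      simp [Exp.eval, Exp.ix, State.reg_setReg, State.arr_setArr, hv₁, hd₁.card, hd₁.dims.deg,
        vtx_lt]
      have := loc j hj c hc
      cases s <;> exact this
  set σ₂ := p₂.run σ₁ with hσ₂
  have hd₂ : Data K b m κ σ₂ := hd₁.run p₂ (by decide) (by decide)
  have hv₂ : σ₂.reg 26 = vtx s v := by rw [b2.1, hv₁]
  set p₃ := vecFill 21 (.ite (.var 26) (.var 1) (.get 6 (.ix (.var 43) 3 (.var 44)))
    (.get 8 (.ix (.var 43) 3 (.var 44)))) with hp₃
  obtain ⟨b3, v3⟩ := vecFill_spec (a := 21) (e := .ite (.var 26) (.var 1)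
    (.get 6 (.ix (.var 43) 3 (.var 44))) (.get 8 (.ix (.var 43) 3 (.var 44)))) hd₂.dims
    (K.O.grs s).multN fun j hj c hc h => by
      simp [Exp.eval, Exp.ix, State.reg_setReg, State.arr_setArr, hv₂, hd₂.card, hd₂.dims.deg,
        vtx_lt]
      have := mult j hj c hc
      rw [← b2.2 _ (by cases s <;> decide)] at this
      cases s <;> exact this
  set σ₃ := p₃.run σ₂ with hσ₃
  have hd₃ : Data K b m κ σ₃ := hd₂.run p₃ (by decide) (by decide)
  have hv₃ : σ₃.reg 26 = vtx s v := by rw [b3.1, hv₂]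
  have hz₃ : HoldsEdges b (σ₃.arr 13) z := by
    rw [b3.2 _ (by decide), b2.2 _ (by decide)]
    exact hz
  obtain ⟨b4, v4⟩ := vecFill_spec (a := 22)
    (e := .get 13 (.ix (.get 11 (.ix (.var 26) 2 (.var 43))) 3 (.var 44))) hd₃.dims
    (extN (K.O.word s z v)) fun j hj c hc h => by
      simp [Exp.eval, Exp.ix, State.reg_setReg, State.arr_setArr, hv₃, hd₃.dims.len, hd₃.dims.deg]
      rw [hd₃.edge s v ⟨j, hj⟩, hz₃ _ c hc]
      simp [extN, hj, OuterCode.word]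
  have hd₄ := hd₃.run (vecFill 22 (.get 13 (.ix (.get 11 (.ix (.var 26) 2 (.var 43))) 3 (.var 44))))
    (by decide) (by decide)
  refine ⟨hd₄.dims, ?_, hd₄.unit, ?_, ?_, v4⟩
  · change State.reg (Prog.run _ σ₃) 17 = _
    rw [b4.1, b3.1, b2.1, h17]
  · change IsVec b Δ (State.arr (Prog.run _ σ₃) 20) _
    rw [b4.2 _ (by decide), b3.2 _ (by decide)]
    exact v2
  · change IsVec b Δ (State.arr (Prog.run _ σ₃) 21) _
    rw [b4.2 _ (by decide)]
    exact v3

theorem vertexDecode_spec (hσ : Data K b m κ σ) {z : Fin n × Fin Δ → F}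
    (hz : HoldsEdges b (σ.arr 13) z) {s : Bool} {v : Fin n} (hv : σ.reg 26 = vtx s v) :
    IsVec b Δ ((vertexDecode.run σ).arr 22) (extN (K.O.word s z v)) ∧
    IsVec b Δ ((vertexDecode.run σ).arr 32)
      (extN (halfMinDistDecode (K.O.grs s).code (K.O.word s z v))) := by
  have h := fetchProg_spec hσ hz hv
  have h1 := (h.run grsDecode (by decide) (by decide)).word
  have h2 := grsDecode_spec h
  simp only [extN_fin] at h2
  exact ⟨h1, h2⟩

theorem appendProg_spec (hσ : Data K b m κ σ) {s : Bool} {v : Fin n} (hv : σ.reg 26 = vtx s v)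
    {w w' : ℕ → F} (hw : IsVec b Δ (σ.arr 22) w) (hw' : IsVec b Δ (σ.arr 32) w') {T : ℕ}
    (hT : σ.reg 16 = T) [DecidableEq F] :
    (appendProg.run σ).reg 16 = T + ∑ j ∈ Finset.range Δ, (if w' j = w j then 0 else 1) ∧
    (∀ x < T, (appendProg.run σ).arr 14 x = σ.arr 14 x) ∧
    (∀ x, T ≤ x → x < (appendProg.run σ).reg 16 →
      ∃ v' : Fin n, (appendProg.run σ).arr 14 x = vtx (!s) v') ∧
    ∀ j : Fin Δ, w' j ≠ w j → ∃ x, T ≤ x ∧ x < (appendProg.run σ).reg 16 ∧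
      (appendProg.run σ).arr 14 x = vtx (!s) (K.O.own (!s) (K.O.slot s (v, j))) := by
  set q : Prog := .seq (.store 14 (.var 16) (.get 12 (.ix (.var 26) 2 (.var 43))))
    (.assign 16 (.add (.var 16) (symNe 32))) with hq
  have key := rpt_induction (n := σ.reg 2) (s := σ) (f := fun i τ => q.run (τ.setReg 43 i))
    (fun k τ => Data K b m κ τ ∧ τ.reg 26 = vtx s v ∧ τ.arr 22 = σ.arr 22 ∧ τ.arr 32 = σ.arr 32 ∧
      τ.reg 16 = T + ∑ j ∈ Finset.range k, (if w' j = w j then 0 else 1) ∧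
      (∀ x < T, τ.arr 14 x = σ.arr 14 x) ∧
      (∀ x, T ≤ x → x < τ.reg 16 → ∃ v' : Fin n, τ.arr 14 x = vtx (!s) v') ∧
      ∀ j : Fin Δ, (j : ℕ) < k → w' j ≠ w j → ∃ x, T ≤ x ∧ x < τ.reg 16 ∧
        τ.arr 14 x = vtx (!s) (K.O.own (!s) (K.O.slot s (v, j))))
    ⟨hσ, hv, rfl, rfl, by simp [hT], fun _ _ => rfl, fun x h1 h2 => by omega,
      fun j h => by omega⟩ ?_
  · obtain ⟨-, -, -, -, h1, h2, h3, h4⟩ := key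
    have e : ∀ x ≠ 43, (appendProg.run σ).reg x =
        (rpt (fun i τ => q.run (τ.setReg 43 i)) (σ.reg 2) σ).reg x := fun x hx =>
      State.reg_setReg_of_ne _ _ hx
    rw [e 16 (by decide)]
    refine ⟨?_, h2, h3, fun j hj => h4 j (by rw [hσ.dims.len]; exact j.2) hj⟩
    rw [h1, hσ.dims.len]
  · rintro k hk τ ⟨h1, h2, h3, h4, h5, h6, h7, h8⟩
    rw [hσ.dims.len] at hk
    set O := K.O.own (!s) (K.O.slot s (v, ⟨k, hk⟩)) with hO
    have hge : T ≤ τ.reg 16 := by omega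
    have hval : (Exp.get 12 (.ix (.var 26) 2 (.var 43))).eval (τ.setReg 43 k) = vtx (!s) O := by
      simp [Exp.eval, Exp.ix, State.reg_setReg, h2, h1.dims.len]
      exact h1.other s v ⟨k, hk⟩
    set τ₁ := τ.setCell 14 (τ.reg 16) (vtx (!s) O) with hτ₁
    have hrun : q.run (τ.setReg 43 k) =
        (τ₁.setReg 43 k).setReg 16 (τ.reg 16 + (symNe 32).eval (τ₁.setReg 43 k)) := by
      have hst : (Prog.store 14 (.var 16) (.get 12 (.ix (.var 26) 2 (.var 43)))).run
          (τ.setReg 43 k) = τ₁.setReg 43 k := by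
        rw [Prog.run, hval]
        rfl
      rw [hq, Prog.run, hst]
      rfl
    have ha : ∀ a ≠ 14, τ₁.arr a = τ.arr a := fun a ha => by
      simp [hτ₁, State.setCell, ha]
    have ha14 : ∀ x, τ₁.arr 14 x = if x = τ.reg 16 then vtx (!s) O else τ.arr 14 x := fun x => by
      simp [hτ₁, State.setCell, Function.update_apply]
    have hd₁ : Data K b m κ τ₁ := h1.congr (fun _ _ _ => rfl) fun a h _ => ha a (by omega)
    have hne := eval_symNe (σ := τ₁) hd₁.dims (a := 32) (w := w') (y := w)
      (by rw [ha _ (by decide), h4]; exact hw') (by rw [ha _ (by decide), h3]; exact hw) hk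
    have hd₂ := (hd₁.setReg (x := 43) (v := k) (by decide)).setReg (x := 16)
      (v := τ.reg 16 + (symNe 32).eval (τ₁.setReg 43 k)) (by decide)
    rw [hrun]
    refine ⟨hd₂, ?_, ?_, ?_, ?_, fun x hx => ?_, fun x hx1 hx2 => ?_, fun j hj hjne => ?_⟩
    · rw [State.reg_setReg_of_ne _ _ (by decide), State.reg_setReg_of_ne _ _ (by decide)]
      exact h2
    · exact (ha _ (by decide)).trans h3
    · exact (ha _ (by decide)).trans h4
    · rw [State.reg_setReg_self, Finset.sum_range_succ, hne, h5, add_assoc]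
    · simp only [State.arr_setReg]
      rw [ha14, if_neg (by omega), h6 x hx]
    · rw [State.reg_setReg_self, hne] at hx2
      simp only [State.arr_setReg]
      rw [ha14]
      split_ifs with hx
      · exact ⟨O, rfl⟩
      · refine h7 x hx1 ?_
        split_ifs at hx2 <;> omega
    · simp only [State.reg_setReg_self, State.arr_setReg]
      rcases Nat.lt_succ_iff_lt_or_eq.1 hj with hj | hj
      · obtain ⟨x, e1, e2, e3⟩ := h8 j hj hjne
        exact ⟨x, e1, by omega, by rw [ha14, if_neg (by omega), e3]⟩
      · refine ⟨τ.reg 16, hge, ?_, ?_⟩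
        · rw [hne, if_neg (by rwa [← hj])]
          omega
        · rw [ha14, if_pos rfl, hO]
          congr 4
          exact Fin.ext hj.symm

theorem scatterProg_spec (hσ : Data K b m κ σ) {s : Bool} {v : Fin n} (hv : σ.reg 26 = vtx s v)
    {z : Fin n × Fin Δ → F} (hz : HoldsEdges b (σ.arr 13) z) {w : Fin Δ → F}
    (hw : IsVec b Δ (σ.arr 32) (extN w)) :
    HoldsEdges b ((scatterProg.run σ).arr 13)
      fun e => if K.O.own s e = v then w ((K.O.slot s).symm e).2 else z e := by
  set z' : Fin n × Fin Δ → F := fun e => if K.O.own s e = v then w ((K.O.slot s).symm e).2 else z e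
    with hz'
  have hinj : Function.Injective fun x : (Fin n × Fin Δ) × Fin ℓ => edgeIx x.1 * ℓ + x.2 := by
    rintro ⟨e, c⟩ ⟨e', c'⟩ h
    obtain ⟨h1, h2⟩ := index_inj c.2 c'.2 h
    exact Prod.ext (edgeIx_injective h1) (Fin.ext h2)
  set g : ℕ → ℕ := Function.extend (fun x : (Fin n × Fin Δ) × Fin ℓ => edgeIx x.1 * ℓ + x.2)
    (fun x => (crd b (z' x.1) x.2).val) 0 with hg
  have gx : ∀ e, ∀ c < ℓ, g (edgeIx e * ℓ + c) = (crd b (z' e) c).val := fun e c hc =>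
    hinj.extend_apply (fun x => (crd b (z' x.1) x.2).val) 0 (e, ⟨c, hc⟩)
  have f : Fills scatterProg 13 σ ∅ {c | ∃ k < Δ, ∃ l < ℓ, c = σ.arr 11 (vtx s v * Δ + k) * ℓ + l} g :=
    Fills.loop₂ (fun k l => σ.arr 11 (vtx s v * Δ + k) * ℓ + l) hσ.dims.len hσ.dims.deg (by decide)
      fun k hk l hl h => by
      refine ⟨?_, ?_⟩
      · simp [Exp.eval, Exp.ix, State.reg_setReg, State.arr_setArr, hv, hσ.dims.len, hσ.dims.deg]
      · rw [hσ.edge s v ⟨k, hk⟩, gx _ _ hl]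
        simp [Exp.eval, Exp.ix, State.reg_setReg, State.arr_setArr, hσ.dims.deg]
        rw [hw k hk l hl]
        simp [hz', K.O.own_slot, extN, hk]
  intro e c hc
  by_cases he : K.O.own s e = v
  · have h1 := hσ.edge s v ((K.O.slot s).symm e).2
    rw [← he, K.O.slot_own] at h1
    rw [f.arr ⟨_, Fin.is_lt _, c, hc, by rw [← he, h1]⟩, gx e c hc]
  · rw [f.arr_of_notMem, hz e c hc]
    · simp only [hz', if_neg he]
    · rintro ⟨k, hk, l, hl, h⟩
      rw [hσ.edge s v ⟨k, hk⟩] at h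
      have := edgeIx_injective (index_inj hc hl h).1
      rw [this, K.O.own_slot] at he
      exact he rfl

end

/-! ### One round -/

/-- Process the vertex whose place in the queue is the sum of the variables `15` (start of the
current segment of the queue) and `40`. -/
def vertexProg : Prog :=
  .seq (.assign 26 (.get 14 (.add (.var 15) (.var 40))))
    (.seq vertexDecode (.seq appendProg scatterProg))

/-- Process the segment of the queue whose length is in the variable `20`. -/
def segmentProg : Prog := .loop 40 20 vertexProg

namespace OuterCode

open Finset

variable {F : Type} [Field F] {n Δ : ℕ} (O : OuterCode F n Δ)

open Classical in
/-- The contents of the edges when one round has been executed at the vertices in `A` only. -/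
noncomputable def partialStep (s : Bool) (z : Fin n × Fin Δ → F) (A : Finset (Fin n)) :
    Fin n × Fin Δ → F := fun e => if O.own s e ∈ A then O.step s z e else z e

variable {O} {s : Bool} {z : Fin n × Fin Δ → F} {A : Finset (Fin n)} {v : Fin n}

theorem word_partialStep_of_mem (h : v ∈ A) :
    O.word s (O.partialStep s z A) v = O.word s (O.step s z) v := by
  funext j
  simp [word, partialStep, own_slot, h]

theorem word_partialStep_of_notMem (h : v ∉ A) :
    O.word s (O.partialStep s z A) v = O.word s z v := by
  funext j
  simp [word, partialStep, own_slot, h]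

/-- It does not matter if a vertex has already been processed. -/
theorem decode_partialStep : halfMinDistDecode (O.grs s).code (O.word s (O.partialStep s z A) v) =
    O.word s (O.step s z) v := by
  by_cases h : v ∈ A
  · rw [word_partialStep_of_mem h]
    exact halfMinDistDecode_self (O.word_step_mem s z v) (O.grs s).minDist_pos
  · rw [word_partialStep_of_notMem h, word_step]

theorem partialStep_insert : (fun e => if O.own s e = v then
    O.word s (O.step s z) v ((O.slot s).symm e).2 else O.partialStep s z A e) =
      O.partialStep s z (insert v A) := by
  classical
  funext e
  by_cases h : O.own s e = v
  · rw [if_pos h, partialStep, if_pos (by rw [h]; exact mem_insert_self _ _), word, ← h, slot_own]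
  · simp only [partialStep, mem_insert, h, false_or, if_false]

/-- The length of the queue goes up by the number of edges whose contents change for the first time
in this round: a vertex that occurs again in the queue does not change anything. -/
theorem card_diff_partialStep_insert [DecidableEq F] :
    (diff (O.partialStep s z (insert v A)) z).card = (diff (O.partialStep s z A) z).card +
      ∑ j ∈ range Δ, (if extN (O.word s (O.step s z) v) j =
        extN (O.word s (O.partialStep s z A) v) j then 0 else 1) := by
  rw [sum_range]
  simp only [extN_fin]
  by_cases h : v ∈ A
  · rw [insert_eq_of_mem h, word_partialStep_of_mem h]
    simp
  · rw [word_partialStep_of_notMem h]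
    have h1 : ∑ j, (if O.word s (O.step s z) v j = O.word s z v j then 0 else 1) =
        ((univ.filter fun j => O.word s (O.step s z) v j ≠ O.word s z v j).image
          fun j => O.slot s (v, j)).card := by
      rw [card_image_of_injective _ fun j j' hj => by simpa using hj, card_filter]
      exact sum_congr rfl fun j _ => by split_ifs <;> simp_all
    rw [h1, ← card_union_of_disjoint]
    · congr 1
      ext e
      simp only [mem_union, mem_diff, mem_image, mem_filter, mem_univ, true_and,
        partialStep, mem_insert]
      constructor
      · intro h2
        by_cases h3 : O.own s e = v
        · rw [if_pos (.inl h3)] at h2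
          refine .inr ⟨((O.slot s).symm e).2, ?_, ?_⟩
          · rwa [word, word, ← h3, slot_own]
          · rw [← h3, slot_own]
        · simp only [h3, false_or] at h2
          exact .inl h2
      · rintro (h2 | ⟨j, h2, rfl⟩)
        · by_cases h3 : O.own s e ∈ A
          · rw [if_pos h3] at h2
            rwa [if_pos (.inr h3)]
          · rw [if_neg h3] at h2
            exact absurd rfl h2
        · rw [own_slot, if_pos (.inl rfl)]
          exact h2
    · rw [disjoint_left]
      intro e h2 h3
      rw [mem_image] at h3
      obtain ⟨j, -, rfl⟩ := h3
      rw [mem_diff] at h2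
      apply h2
      simp only [partialStep, own_slot, if_neg h]

/-- Only the vertices at which the word is not a codeword matter in a round. -/
theorem partialStep_eq_step (h : ∀ v, O.word s z v ∉ (O.grs s).code → v ∈ A) :
    O.partialStep s z A = O.step s z := by
  funext e
  by_cases hA : O.own s e ∈ A
  · rw [partialStep, if_pos hA]
  · rw [partialStep, if_neg hA, step, halfMinDistDecode_self (by_contra fun h' => hA (h _ h'))
      (O.grs s).minDist_pos, word, slot_own]

end OuterCode

section

open Finset OuterCode

variable {F : Type} [Field F] [Algebra (ZMod 2) F] {n Δ ℓ : ℕ} {K : ConcatCode F n Δ}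
  {b : Module.Basis (Fin ℓ) (ZMod 2) F} {m κ : ℕ} {σ : State}

/-- The cells of the array `h` from `lo` up to `hi` contain vertices of the side `s` only. -/
def QueueIn (n : ℕ) (s : Bool) (h : ℕ → ℕ) (lo hi : ℕ) : Prop :=
  ∀ x, lo ≤ x → x < hi → ∃ v : Fin n, h x = vtx s v

theorem vertexProg_spec (hσ : Data K b m κ σ) {s : Bool} {z : Fin n × Fin Δ → F}
    {A : Finset (Fin n)}
    (hz : HoldsEdges b (σ.arr 13) (K.O.partialStep s z A)) {v : Fin n} {t : ℕ}
    (hv : σ.arr 14 (σ.reg 15 + σ.reg 40) = vtx s v)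
    (ht : σ.reg 16 = t + (diff (K.O.partialStep s z A) z).card)
    (hq : QueueIn n (!s) (σ.arr 14) t (σ.reg 16))
    (hd : ∀ e ∈ diff (K.O.partialStep s z A) z, ∃ x, t ≤ x ∧ x < σ.reg 16 ∧
      σ.arr 14 x = vtx (!s) (K.O.own (!s) e)) :
    HoldsEdges b ((vertexProg.run σ).arr 13) (K.O.partialStep s z (insert v A)) ∧
    (vertexProg.run σ).reg 16 = t + (diff (K.O.partialStep s z (insert v A)) z).card ∧
    (∀ x < t, (vertexProg.run σ).arr 14 x = σ.arr 14 x) ∧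
    QueueIn n (!s) ((vertexProg.run σ).arr 14) t ((vertexProg.run σ).reg 16) ∧
    ∀ e ∈ diff (K.O.partialStep s z (insert v A)) z, ∃ x, t ≤ x ∧ x < (vertexProg.run σ).reg 16 ∧
      (vertexProg.run σ).arr 14 x = vtx (!s) (K.O.own (!s) e) := by
  classical
  set σ₁ := σ.setReg 26 (vtx s v) with hσ₁
  have e1 : (Prog.assign 26 (.get 14 (.add (.var 15) (.var 40)))).run σ = σ₁ := by
    simp only [Prog.run, Exp.eval, hv, hσ₁]
  have d₁ : Data K b m κ σ₁ := hσ.setReg (by decide)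
  obtain ⟨w1, w2⟩ := vertexDecode_spec d₁ (z := K.O.partialStep s z A) hz (s := s) (v := v)
    (State.reg_setReg_self _ _ _)
  rw [decode_partialStep] at w2
  have d₂ := d₁.run vertexDecode (by decide) (by decide)
  have f₂ := vertexDecode.frame σ₁
  set σ₂ := vertexDecode.run σ₁
  have v₂ : σ₂.reg 26 = vtx s v := by rw [f₂.1 _ (by decide), State.reg_setReg_self]
  have t₂ : σ₂.reg 16 = σ.reg 16 := by
    rw [f₂.1 _ (by decide), State.reg_setReg_of_ne _ _ (by decide)]
  have q₂ : σ₂.arr 14 = σ.arr 14 := f₂.2 _ (by decide)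
  have z₂ : HoldsEdges b (σ₂.arr 13) (K.O.partialStep s z A) := by
    rw [f₂.2 _ (by decide)]; exact hz
  obtain ⟨a1, a2, a3, a4⟩ := appendProg_spec d₂ v₂ w1 w2 t₂
  have d₃ := d₂.run appendProg (by decide) (by decide)
  have f₃ := appendProg.frame σ₂
  set σ₃ := appendProg.run σ₂
  have v₃ : σ₃.reg 26 = vtx s v := by rw [f₃.1 _ (by decide), v₂]
  have hz₃ := scatterProg_spec d₃ v₃ (z := K.O.partialStep s z A)
    (w := K.O.word s (K.O.step s z) v) (by rw [f₃.2 _ (by decide)]; exact z₂)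
    (by rw [f₃.2 _ (by decide)]; exact w2)
  have f₄ := scatterProg.frame σ₃
  have hrun : vertexProg.run σ = scatterProg.run σ₃ := by
    rw [vertexProg, Prog.run, e1]; rfl
  rw [partialStep_insert] at hz₃
  rw [hrun, f₄.1 16 (by decide), f₄.2 14 (by decide)]
  have hle : t ≤ σ.reg 16 := by omega
  have hle' : σ.reg 16 ≤ σ₃.reg 16 := by omega
  have hx : ∀ x < σ.reg 16, σ₃.arr 14 x = σ.arr 14 x := fun x hx => by rw [a2 x hx, q₂]
  refine ⟨hz₃, ?_, fun x h => hx x (by omega), fun x h1 h2 => ?_, fun e he => ?_⟩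
  · rw [card_diff_partialStep_insert, a1, ht, add_assoc]
  · by_cases h : x < σ.reg 16
    · rw [hx x h]
      exact hq x h1 h
    · exact a3 x (by omega) h2
  · rw [mem_diff] at he
    by_cases h : K.O.partialStep s z A e ≠ z e
    · obtain ⟨x, h1, h2, h3⟩ := hd e (mem_diff.2 h)
      exact ⟨x, h1, by omega, by rw [hx x h2, h3]⟩
    · rw [not_not] at h
      have hown : K.O.own s e = v := by
        by_contra hne
        apply he
        rw [← partialStep_insert]
        simp only [if_neg hne, h]
      rw [← partialStep_insert] at he
      simp only [if_pos hown] at he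
      obtain ⟨x, h1, h2, h3⟩ := a4 ((K.O.slot s).symm e).2 (by
        rw [extN_fin, extN_fin]
        have : K.O.word s (K.O.partialStep s z A) v ((K.O.slot s).symm e).2 = z e := by
          rw [OuterCode.word, ← hown, K.O.slot_own, h]
        rwa [this])
      refine ⟨x, by omega, h2, ?_⟩
      rw [h3, ← hown, K.O.slot_own]

theorem segmentProg_spec (hσ : Data K b m κ σ) {s : Bool} {z : Fin n × Fin Δ → F}
    (hz : HoldsEdges b (σ.arr 13) z) (hseg : σ.reg 15 + σ.reg 20 = σ.reg 16)
    (hq : QueueIn n s (σ.arr 14) (σ.reg 15) (σ.reg 16))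
    (hbad : ∀ v, K.O.word s z v ∉ (K.O.grs s).code →
      ∃ x, σ.reg 15 ≤ x ∧ x < σ.reg 16 ∧ σ.arr 14 x = vtx s v) :
    HoldsEdges b ((segmentProg.run σ).arr 13) (K.O.step s z) ∧
    (segmentProg.run σ).reg 16 = σ.reg 16 + (diff (K.O.step s z) z).card ∧
    QueueIn n (!s) ((segmentProg.run σ).arr 14) (σ.reg 16) ((segmentProg.run σ).reg 16) ∧
    ∀ e ∈ diff (K.O.step s z) z, ∃ x, σ.reg 16 ≤ x ∧ x < (segmentProg.run σ).reg 16 ∧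
      (segmentProg.run σ).arr 14 x = vtx (!s) (K.O.own (!s) e) := by
  classical
  set t := σ.reg 16 with ht
  have hempty : K.O.partialStep s z ∅ = z := by
    funext e; simp [partialStep]
  have hempty' : diff z z = ∅ := by
    ext e; simp [mem_diff]
  have key := rpt_induction (n := σ.reg 20) (s := σ)
    (f := fun i τ => vertexProg.run (τ.setReg 40 i))
    (fun k τ => ∃ A : Finset (Fin n), Data K b m κ τ ∧ τ.reg 15 = σ.reg 15 ∧
      (∀ x < k, ∃ v ∈ A, σ.arr 14 (σ.reg 15 + x) = vtx s v) ∧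
      HoldsEdges b (τ.arr 13) (K.O.partialStep s z A) ∧
      τ.reg 16 = t + (diff (K.O.partialStep s z A) z).card ∧
      (∀ x < t, τ.arr 14 x = σ.arr 14 x) ∧
      QueueIn n (!s) (τ.arr 14) t (τ.reg 16) ∧
      ∀ e ∈ diff (K.O.partialStep s z A) z, ∃ x, t ≤ x ∧ x < τ.reg 16 ∧
        τ.arr 14 x = vtx (!s) (K.O.own (!s) e))
    ⟨∅, hσ, rfl, fun x h => by omega, by rwa [hempty], by rw [hempty, hempty']; simp [ht],
      fun _ _ => rfl, fun x h1 h2 => by omega, by rw [hempty, hempty']; simp⟩ ?_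
  · obtain ⟨A, -, -, h1, h2, h3, -, h4, h5⟩ := key
    have hA : K.O.partialStep s z A = K.O.step s z := partialStep_eq_step fun v hv => by
      obtain ⟨x, x1, x2, x3⟩ := hbad v hv
      obtain ⟨v', hv', h⟩ := h1 (x - σ.reg 15) (by omega)
      rw [Nat.add_sub_cancel' x1, x3] at h
      rwa [(vtx_injective h).2]
    rw [hA] at h2 h3 h5
    have e : ∀ x ≠ 40, (segmentProg.run σ).reg x =
        (rpt (fun i τ => vertexProg.run (τ.setReg 40 i)) (σ.reg 20) σ).reg x := fun x hx =>
      State.reg_setReg_of_ne _ _ hx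
    rw [e 16 (by decide)]
    exact ⟨h2, h3, h4, h5⟩
  · rintro k hk τ ⟨A, h1, h2, h3, h4, h5, h6, h7, h8⟩
    obtain ⟨v, hv⟩ := hq (σ.reg 15 + k) (by omega) (by omega)
    have d := h1.setReg (x := 40) (v := k) (by decide)
    have r : ∀ x ≠ 40, (τ.setReg 40 k).reg x = τ.reg x := fun x hx =>
      State.reg_setReg_of_ne _ _ hx
    obtain ⟨s1, s2, s3, s4, s5⟩ := vertexProg_spec d (s := s) (z := z) (A := A) h4 (v := v) (t := t)
      (by rw [r _ (by decide), State.reg_setReg_self, h2, State.arr_setReg, h6 _ (by omega), hv])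
      (by rw [r _ (by decide)]; exact h5) (by rw [r _ (by decide)]; exact h7)
      (by rw [r _ (by decide)]; exact h8)
    refine ⟨insert v A, d.run vertexProg (by decide) (by decide), ?_, fun x hx => ?_, s1, s2,
      fun x hx => (s3 x hx).trans (h6 x hx), s4, s5⟩
    · rw [(vertexProg.frame _).1 _ (by decide), r _ (by decide), h2]
    · rcases Nat.lt_succ_iff_lt_or_eq.1 hx with hx | rfl
      · obtain ⟨v', hv', h⟩ := h3 x hx
        exact ⟨v', mem_insert_of_mem hv', h⟩
      · exact ⟨v, mem_insert_self _ _, hv⟩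

end

/-! ### The rounds as a program -/

/-- Check whether the words at all vertices are codewords; the number of deviations is added to the
variable `24`. -/
def checkProg : Prog :=
  .loop 40 13 (.seq (.assign 26 (.var 40)) (.seq vertexDecode
    (.assign 24 (.add (.var 24) (.fold .sum 43 2 (symNe 32))))))

/-- Whether the queue has become longer than the limit; without a clock, there is no limit. -/
def overExp (clk : Bool) : Exp :=
  if clk then .ite (.var 14) (.var 16) (.lit 1) (.lit 0) else .lit 0

/-- Whether there is another round to execute: the current segment of the queue is not empty, the
number of remaining rounds, in the variable `21`, is positive, and time is not over. -/
def goExp (clk : Bool) : Exp :=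
  .ite (.var 15) (.var 16) (.ite (.lit 0) (.var 21) (.sub (.lit 1) (overExp clk)) (.lit 0)) (.lit 0)

/-- At the beginning, all the vertices of `B` are in the queue. -/
def startProg (clk : Bool) : Prog :=
  .seq (.loop 40 1 (.store 14 (.var 40) (.add (.var 1) (.var 40))))
  (.seq (.assign 15 (.lit 0)) (.seq (.assign 16 (.var 1)) (.seq (.assign 21 (.var 7))
    (.seq (.assign 23 (.lit 0)) (.assign 22 (goExp clk))))))

/-- The length of the current segment of the queue. -/
def openProg : Prog := .assign 20 (.sub (.var 16) (.var 15))

/-- Move on to the next segment of the queue. -/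
def closeProg (clk : Bool) : Prog :=
  .seq (.assign 15 (.add (.var 15) (.var 20))) (.seq (.assign 21 (.sub (.var 21) (.lit 1)))
    (.assign 22 (goExp clk)))

section

open Finset OuterCode

variable {F : Type} [Field F] [Algebra (ZMod 2) F] {n Δ ℓ : ℕ} {K : ConcatCode F n Δ}
  {b : Module.Basis (Fin ℓ) (ZMod 2) F} {m κ : ℕ} {σ : State}

/-- Codewords are the fixed points of the decoder. -/
theorem decode_eq_self_iff {F : Type} [Field F] {D : ℕ} {G : GRS F D} {w : Fin D → F} :
    halfMinDistDecode G.code w = w ↔ w ∈ G.code :=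
  ⟨fun h => h ▸ halfMinDistDecode_mem, fun h => halfMinDistDecode_self h G.minDist_pos⟩

theorem Prog.run_seq (p q : Prog) (σ : State) : (Prog.seq p q).run σ = q.run (p.run σ) := rfl

theorem Prog.run_assign (x : ℕ) (e : Exp) (σ : State) :
    (Prog.assign x e).run σ = σ.setReg x (e.eval σ) := rfl

theorem checkProg_spec (hσ : Data K b m κ σ) {z : Fin n × Fin Δ → F}
    (hz : HoldsEdges b (σ.arr 13) z) :
    (checkProg.run σ).reg 24 = 0 ↔ σ.reg 24 = 0 ∧ z ∈ K.O.edgeCode := by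
  classical
  set q : Prog := .seq (.assign 26 (.var 40)) (.seq vertexDecode
    (.assign 24 (.add (.var 24) (.fold .sum 43 2 (symNe 32))))) with hq
  have key := rpt_induction (n := σ.reg 13) (s := σ) (f := fun i τ => q.run (τ.setReg 40 i))
    (fun k τ => Data K b m κ τ ∧ HoldsEdges b (τ.arr 13) z ∧ (τ.reg 24 = 0 ↔ σ.reg 24 = 0 ∧
      ∀ (s : Bool) (v : Fin n), vtx s v < k → K.O.word s z v ∈ (K.O.grs s).code))
    ⟨hσ, hz, by simp⟩ ?_
  · have e : (checkProg.run σ).reg 24 =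
        (rpt (fun i τ => q.run (τ.setReg 40 i)) (σ.reg 13) σ).reg 24 :=
      State.reg_setReg_of_ne _ _ (by decide)
    rw [e, key.2.2, K.O.mem_edgeCode, hσ.card2]
    refine and_congr_right fun _ => forall_congr' fun s => forall_congr' fun v => ?_
    have : vtx s v < n + n := by
      have := v.2
      cases s
      · simp [vtx]; omega
      · simp [vtx]
    simp [this]
  · rintro k hk τ ⟨h1, h2, h3⟩
    rw [hσ.card2] at hk
    obtain ⟨s, v, rfl⟩ := exists_vtx hk
    set σ₁ := (τ.setReg 40 (vtx s v)).setReg 26 (vtx s v) with hσ₁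
    have d₁ : Data K b m κ σ₁ := (h1.setReg (by decide)).setReg (by decide)
    obtain ⟨w1, w2⟩ := vertexDecode_spec d₁ (z := z) h2 (s := s) (v := v)
      (State.reg_setReg_self _ _ _)
    have d₂ := d₁.run vertexDecode (by decide) (by decide)
    have f₂ := vertexDecode.frame σ₁
    set σ₂ := vertexDecode.run σ₁ with hσ₂
    have h24 : σ₂.reg 24 = τ.reg 24 := by
      rw [f₂.1 _ (by decide), State.reg_setReg_of_ne _ _ (by decide),
        State.reg_setReg_of_ne _ _ (by decide)]
    have hrun : q.run (τ.setReg 40 (vtx s v)) = (Prog.assign 24 (.add (.var 24) (.fold .sum 43 2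
        (symNe 32)))).run σ₂ := by
      have : (Prog.assign 26 (.var 40)).run (τ.setReg 40 (vtx s v)) = σ₁ := by
        simp only [Prog.run, Exp.eval, State.reg_setReg_self, hσ₁]
      rw [hq, Prog.run_seq, this, Prog.run_seq]
    have hev := Exp.eval_sum (x := 43) (r := 2) (e := symNe 32) (σ := σ₂)
      (fun j => if extN (halfMinDistDecode (K.O.grs s).code (K.O.word s z v)) j =
        extN (K.O.word s z v) j then 0 else 1) d₂.dims.len fun j hj =>
        eval_symNe d₂.dims w2 w1 hj
    rw [hrun]
    refine ⟨d₂.run _ (by decide) (by decide), ?_, ?_⟩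
    · rw [Prog.run_assign, State.arr_setReg, f₂.2 _ (by decide)]
      exact h2
    · rw [Prog.run_assign, State.reg_setReg_self, Exp.eval, hev, Exp.eval, h24, Nat.add_eq_zero_iff, h3,
        sum_range]
      have hw : (∑ j : Fin Δ, (if extN (halfMinDistDecode (K.O.grs s).code (K.O.word s z v)) j =
          extN (K.O.word s z v) j then 0 else 1)) = 0 ↔ K.O.word s z v ∈ (K.O.grs s).code := by
        rw [← decode_eq_self_iff, sum_eq_zero_iff, funext_iff]
        simp only [extN_fin, mem_univ, true_implies, ite_eq_left_iff, one_ne_zero, imp_false,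
          not_not]
      rw [hw, and_assoc]
      refine and_congr_right fun _ => ⟨?_, fun h => ⟨fun s' v' h' => h s' v' (by omega),
        h s v (by omega)⟩⟩
      rintro ⟨h4, h5⟩ s' v' h'
      rcases Nat.lt_succ_iff_lt_or_eq.1 h' with h' | h'
      · exact h4 s' v' h'
      · obtain ⟨rfl, rfl⟩ := vtx_injective h'
        exact h5

/-- The end of the queue after `i` rounds. -/
noncomputable def queueEnd (K : ConcatCode F n Δ) (x : Fin n → K.O.Phi) (i : ℕ) : ℕ :=
  n + K.O.changes x i

/-- The place up to which the queue has been processed after `i` rounds. -/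
noncomputable def queuePos (K : ConcatCode F n Δ) (x : Fin n → K.O.Phi) : ℕ → ℕ
  | 0 => 0
  | i + 1 => queueEnd K x i

theorem queuePos_le_queueEnd (K : ConcatCode F n Δ) (x : Fin n → K.O.Phi) (i : ℕ) :
    queuePos K x i ≤ queueEnd K x i := by
  cases i with
  | zero => exact Nat.zero_le _
  | succ i =>
    simp only [queuePos, queueEnd, changes, sum_range_succ]
    omega

/-- Time is over. -/
def Over (clk : Bool) (κ : ℕ) (K : ConcatCode F n Δ) (x : Fin n → K.O.Phi) (i : ℕ) : Prop :=
  clk = true ∧ κ * Δ * n < queueEnd K x i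

/-- After `i` rounds, another round is to be executed. -/
def Goes (clk : Bool) (m κ : ℕ) (K : ConcatCode F n Δ) (x : Fin n → K.O.Phi) (i : ℕ) : Prop :=
  queuePos K x i < queueEnd K x i ∧ i < m ∧ ¬ Over clk κ K x i

/-- The state after `i` rounds, apart from the decision whether to continue.  The decoders at the
vertices outside the current segment of the queue would not change anything in the next round. -/
structure RoundCore (K : ConcatCode F n Δ) (b : Module.Basis (Fin ℓ) (ZMod 2) F) (m κ : ℕ)
    (x : Fin n → K.O.Phi) (i : ℕ) (σ : State) : Prop where
  data : Data K b m κ σ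
  edges : HoldsEdges b (σ.arr 13) (K.O.iter x i)
  pos : σ.reg 15 = queuePos K x i
  fin : σ.reg 16 = queueEnd K x i
  rem : σ.reg 21 = m - i
  zero : σ.reg 23 = 0
  queue : QueueIn n (i + 1).bodd (σ.arr 14) (queuePos K x i) (queueEnd K x i)
  bad : ∀ v, K.O.word (i + 1).bodd (K.O.iter x i) v ∉ (K.O.grs (i + 1).bodd).code →
    ∃ y, queuePos K x i ≤ y ∧ y < queueEnd K x i ∧ σ.arr 14 y = vtx (i + 1).bodd v

variable {x : Fin n → K.O.Phi} {i : ℕ} {clk : Bool}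

open Classical in
theorem RoundCore.eval_over (h : RoundCore K b m κ x i σ) :
    (overExp clk).eval σ = if Over clk κ K x i then 1 else 0 := by
  have h1 := h.data.cap
  cases clk <;> simp [overExp, Exp.eval, Over, h.fin, h1]

theorem RoundCore.eval_go (h : RoundCore K b m κ x i σ) :
    0 < (goExp clk).eval σ ↔ Goes clk m κ K x i := by
  classical
  rw [goExp, Exp.eval, Exp.eval, Exp.eval, Exp.eval, Exp.eval, Exp.eval, Exp.eval, Exp.eval,
    h.eval_over, h.pos, h.fin, h.rem, Goes]
  simp only [Exp.eval]
  split_ifs with h1 h2 h3 <;> simp_all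

theorem RoundCore.setReg (h : RoundCore K b m κ x i σ) {y v : ℕ} (hy : 15 ≤ y)
    (hy' : y ∉ [15, 16, 21, 23]) : RoundCore K b m κ x i (σ.setReg y v) := by
  simp only [List.mem_cons, not_or] at hy'
  have r : ∀ w ≠ y, (σ.setReg y v).reg w = σ.reg w := fun w hw => State.reg_setReg_of_ne _ _ hw
  exact ⟨h.data.setReg hy, h.edges, by rw [r _ (by omega), h.pos], by rw [r _ (by omega), h.fin],
    by rw [r _ (by omega), h.rem], by rw [r _ (by omega), h.zero], h.queue, h.bad⟩

/-- The state after `i` rounds. -/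
def RoundInv (clk : Bool) (K : ConcatCode F n Δ) (b : Module.Basis (Fin ℓ) (ZMod 2) F) (m κ : ℕ)
    (x : Fin n → K.O.Phi) (i : ℕ) (σ : State) : Prop :=
  RoundCore K b m κ x i σ ∧ (0 < σ.reg 22 ↔ Goes clk m κ K x i)

theorem startProg_spec (hσ : Data K b m κ σ) (hz : HoldsEdges b (σ.arr 13) (K.O.iter x 0)) :
    RoundInv clk K b m κ x 0 ((startProg clk).run σ) := by
  set p : Prog := .loop 40 1 (.store 14 (.var 40) (.add (.var 1) (.var 40))) with hp
  have f : Fills p 14 σ ∅ {c | ∃ k < n, c = k} fun c => n + c :=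
    Fills.loop₁ _ hσ.card fun k hk h => ⟨by simp [Exp.eval], by
      simp [Exp.eval, State.reg_setReg, hσ.card]⟩
  have d := hσ.run p (by decide) (by decide)
  have fr := p.frame σ
  set τ := p.run σ
  set τ' := (((τ.setReg 15 0).setReg 16 (τ.reg 1)).setReg 21 (τ.reg 7)).setReg 23 0 with hτ'
  have hrun : (startProg clk).run σ = τ'.setReg 22 ((goExp clk).eval τ') := rfl
  have hend : queueEnd K x 0 = n := by simp [queueEnd, changes]
  have d' : Data K b m κ τ' := (((d.setReg (by decide)).setReg (by decide)).setReg
    (by decide)).setReg (by decide)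
  have hq : ∀ v : Fin n, τ'.arr 14 v = vtx true v := fun v => by
    change τ.arr 14 v = _
    rw [f.arr ⟨v, v.2, rfl⟩]
    simp [vtx]
  have core : RoundCore K b m κ x 0 τ' := by
    refine ⟨d', ?_, ?_, ?_, ?_, ?_, fun y _ hy => ?_, fun v _ => ⟨v, Nat.zero_le _, ?_, hq v⟩⟩
    · change HoldsEdges b (τ.arr 13) _
      rw [fr.2 _ (by decide)]
      exact hz
    · simp [hτ', State.reg_setReg, queuePos]
    · rw [hend, ← d.card]
      simp [hτ', State.reg_setReg]
    · rw [Nat.sub_zero, ← d.rounds]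
      simp [hτ', State.reg_setReg]
    · simp [hτ']
    · rw [hend] at hy
      exact ⟨⟨y, hy⟩, hq ⟨y, hy⟩⟩
    · rw [hend]; exact v.2
  rw [hrun]
  refine ⟨core.setReg (by decide) (by decide), ?_⟩
  rw [State.reg_setReg_self]
  exact core.eval_go

/-- A vertex that is not in the next segment of the queue has seen no change in this round, and its
word was a codeword before. -/
theorem round_spec (h : RoundInv clk K b m κ x i σ) :
    RoundInv clk K b m κ x (i + 1) ((closeProg clk).run (segmentProg.run (openProg.run σ))) := by
  obtain ⟨hc, -⟩ := h
  set s := (i + 1).bodd with hs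
  set σ₁ := openProg.run σ with hσ₁
  have hle := queuePos_le_queueEnd K x i
  have c₁ : RoundCore K b m κ x i σ₁ := hc.setReg (by decide) (by decide)
  have h20 : σ₁.reg 20 = queueEnd K x i - queuePos K x i := by
    rw [hσ₁, openProg, Prog.run, State.reg_setReg_self, Exp.eval, Exp.eval, Exp.eval, hc.fin,
      hc.pos]
  obtain ⟨s1, s2, s3, s4⟩ := segmentProg_spec c₁.data (s := s) c₁.edges
    (by rw [c₁.pos, h20, c₁.fin]; omega) (by rw [c₁.pos, c₁.fin]; exact c₁.queue)
    (by rw [c₁.pos, c₁.fin]; exact c₁.bad)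
  have d₂ := c₁.data.run segmentProg (by decide) (by decide)
  have f := segmentProg.frame σ₁
  set σ₂ := segmentProg.run σ₁
  have hiter : K.O.iter x (i + 1) = K.O.step s (K.O.iter x i) := K.O.iter_succ x i
  rw [← hiter] at s1 s2 s4
  have hend : σ₂.reg 16 = queueEnd K x (i + 1) := by
    rw [s2, c₁.fin, queueEnd, queueEnd, changes, changes, sum_range_succ, add_assoc]
  rw [hend, c₁.fin] at s3 s4
  set τ := (σ₂.setReg 15 (σ₂.reg 15 + σ₂.reg 20)).setReg 21 (σ₂.reg 21 - 1) with hτ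
  have hrun : (closeProg clk).run σ₂ = τ.setReg 22 ((goExp clk).eval τ) := by
    simp only [closeProg, Prog.run, Exp.eval, hτ]
    rw [State.reg_setReg_of_ne _ _ (by decide : (21 : ℕ) ≠ 15)]
  have hs' : (i + 1 + 1).bodd = !s := Nat.bodd_succ _
  have core : RoundCore K b m κ x (i + 1) τ := by
    refine ⟨(d₂.setReg (by decide)).setReg (by decide), s1, ?_, ?_, ?_, ?_, ?_, fun v hv => ?_⟩
    · rw [hτ, State.reg_setReg_of_ne _ _ (by decide), State.reg_setReg_self, f.1 _ (by decide),
        f.1 _ (by decide), c₁.pos, h20, queuePos]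
      omega
    · rw [hτ, State.reg_setReg_of_ne _ _ (by decide), State.reg_setReg_of_ne _ _ (by decide), hend]
    · rw [hτ, State.reg_setReg_self, f.1 _ (by decide), c₁.rem]
      omega
    · rw [hτ, State.reg_setReg_of_ne _ _ (by decide), State.reg_setReg_of_ne _ _ (by decide),
        f.1 _ (by decide), c₁.zero]
    · rw [hs']; exact s3
    · rw [hs'] at hv ⊢
      -- The word at `v` was a codeword before this round, so one of its edges has changed.
      have h1 : K.O.word (!s) (K.O.iter x i) v ∈ (K.O.grs (!s)).code := by
        have := K.O.word_iter_mem x i v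
        rw [hs, Nat.bodd_succ, Bool.not_not]
        exact this
      have h2 : K.O.word (!s) (K.O.iter x (i + 1)) v ≠ K.O.word (!s) (K.O.iter x i) v :=
        fun h => hv (h ▸ h1)
      obtain ⟨j, hj⟩ := Function.ne_iff.1 h2
      obtain ⟨y, y1, y2, y3⟩ := s4 (K.O.slot (!s) (v, j)) (mem_diff.2 hj)
      rw [own_slot] at y3
      exact ⟨y, y1, y2, y3⟩
  rw [hrun]
  refine ⟨core.setReg (by decide) (by decide), ?_⟩
  rw [State.reg_setReg_self]
  exact core.eval_go

/-- If the current segment of the queue is empty, the iteration has become stationary. -/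
theorem iter_eq_of_queue_empty (h : RoundCore K b m κ x i σ) (hq : queueEnd K x i ≤ queuePos K x i)
    (j : ℕ) : K.O.iter x (i + j) = K.O.iter x i := by
  have hmem : ∀ s v, K.O.word s (K.O.iter x i) v ∈ (K.O.grs s).code := fun s v => by
    by_cases hs : s = i.bodd
    · rw [hs]; exact K.O.word_iter_mem x i v
    · have hs' : s = (i + 1).bodd := by
        rw [Nat.bodd_succ]
        revert hs
        cases s <;> cases i.bodd <;> decide
      by_contra hn
      rw [hs'] at hn
      obtain ⟨y, h1, h2, -⟩ := h.bad v hn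
      omega
  induction j with
  | zero => rfl
  | succ j ih =>
    rw [← add_assoc, iter_succ, ih]
    funext e
    rw [step, halfMinDistDecode_self (hmem _ _) (K.O.grs _).minDist_pos, word, slot_own]

end

/-! ### Polynomial time bounds -/

/-- A function that is bounded by a polynomial. -/
def PolyBdd (w : ℕ → ℕ) : Prop := ∃ C k, ∀ B, w B ≤ C * (B + 1) ^ k

theorem PolyBdd.const (c : ℕ) : PolyBdd fun _ => c := ⟨c, 0, fun B => by simp⟩

theorem PolyBdd.id : PolyBdd fun B => B := ⟨1, 1, fun B => by simp⟩

theorem PolyBdd.add {v w : ℕ → ℕ} (hv : PolyBdd v) (hw : PolyBdd w) :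
    PolyBdd fun B => v B + w B := by
  obtain ⟨C, k, h⟩ := hv
  obtain ⟨C', k', h'⟩ := hw
  refine ⟨C + C', k + k', fun B => ?_⟩
  rw [add_mul]
  exact add_le_add
    ((h B).trans (Nat.mul_le_mul_left _ (Nat.pow_le_pow_right (by omega) (by omega))))
    ((h' B).trans (Nat.mul_le_mul_left _ (Nat.pow_le_pow_right (by omega) (by omega))))

/-- The running time of `p` is at most `w B` if the variables that bound its loops are at
most `B`. -/
def Cheap (p : Prog) (w : ℕ → ℕ) : Prop :=
  ∀ (L : ℕ → ℕ) (B : ℕ), (∀ r ∈ p.lims, L r ≤ B) → p.bnd L ≤ w B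

theorem exists_cheap (p : Prog) : ∃ w, PolyBdd w ∧ Cheap p w := by
  obtain ⟨C, k, h⟩ := p.bnd_le
  exact ⟨fun B => C * (B + 1) ^ k, ⟨C, k, fun _ => le_rfl⟩, h⟩

/-- A bound for the sizes of the matrices that occur in the decoding at one vertex. -/
def ConcatCode.size {F : Type} [Field F] [Algebra (ZMod 2) F] {n Δ : ℕ} (K : ConcatCode F n Δ)
    (ℓ : ℕ) : ℕ :=
  1 + (Δ * ℓ + Δ * ℓ) + Δ + ℓ + K.O.CA.k + K.nin + K.O.CA.k * ℓ

/-! ### The decoding program -/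

/-- Copy the block in the variable `28` to the array `15`. -/
def copyIn : Prog := .loop 43 6 (.store 15 (.var 43) (.get 0 (.ix (.var 28) 6 (.var 43))))

/-- Copy the result to its block in the array `17`, and move on to the next block. -/
def copyOut : Prog :=
  .seq (.loop 43 6 (.store 17 (.ix (.var 28) 6 (.var 43)) (.get 16 (.var 43))))
    (.assign 28 (.add (.var 28) (.lit 1)))

/-- Apply the decoder of the inner code to all blocks of the received word; the results go to the
array `17`. -/
def innerCmd : Cmd :=
  .seq ((Prog.assign 28 (.lit 0)).code 0) (.while (2 * 28) (2 * 1)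
    (.seq (copyIn.code 0) (.seq (.call (2 * 6) 15 16 (2 * 34)) (copyOut.code 0))))

/-- Read the parameters, and set up the arrays that describe the graph. -/
def prepareCmd (κ : ℕ) : Cmd :=
  .seq (paramProg.code 0) (.seq ((derivedProg κ).code 0) (graphProg.code 0))

/-- The rounds of the outer decoder. -/
def roundsCmd (clk : Bool) : Cmd :=
  .seq (loadProg.code 0) (.seq ((startProg clk).code 0) (.while (2 * 23) (2 * 22)
    (.seq (openProg.code 0) (.seq (segmentProg.code 0) ((closeProg clk).code 0)))))

/-- The length of the output: zero if the variable `24` records a failure. -/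
def outProg : Prog := .assign 0 (.ite (.lit 0) (.var 24) (.lit 0) (.mul (.var 1) 6))

/-- The output, which is empty if time is over or if the result is not a codeword. -/
def finishCmd (clk : Bool) : Cmd :=
  .seq ((Prog.assign 24 (overExp clk)).code 0) (.seq (checkProg.code 0)
    (.seq (unloadProg.code 0) (outProg.code 0)))

/-- The decoder of the concatenated code.  With the clock, it gives up when the queue gets longer
than `κ` times the number of edges. -/
def decodeCmd (clk : Bool) (κ : ℕ) : Cmd :=
  .seq (prepareCmd κ) (.seq innerCmd (.seq (roundsCmd clk) (finishCmd clk)))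

section

open Finset OuterCode

variable {F : Type} [Field F] [Algebra (ZMod 2) F] {n Δ ℓ : ℕ} {K : ConcatCode F n Δ}
  {b : Module.Basis (Fin ℓ) (ZMod 2) F} {m κ : ℕ} {σ : State}

theorem Data.reg_le (h : Data K b m κ σ) {r : ℕ} (hr : r ∈ [2, 3, 4, 6, 8, 9, 10, 11, 12]) :
    σ.reg r ≤ K.size ℓ := by
  have h1 := h.dims.len
  have h2 := h.dims.deg
  have h3 := h.dims.bits
  have h4 := h.dims.width
  have h5 := h.dims.rows
  have h6 := h.dimA
  have h7 := h.nin
  have h8 := h.width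
  have h9 := h.rows
  simp only [ConcatCode.size]
  simp only [List.mem_cons, List.not_mem_nil, or_false] at hr
  rcases hr with rfl | rfl | rfl | rfl | rfl | rfl | rfl | rfl | rfl <;> omega

theorem Cheap.bnd_le {p : Prog} {w : ℕ → ℕ} (hw : Cheap p w) (h : Data K b m κ σ)
    (hp : ∀ r ∈ p.lims, r ∈ [2, 3, 4, 6, 8, 9, 10, 11, 12]) : p.bnd σ.reg ≤ w (K.size ℓ) :=
  hw _ _ fun r hr => h.reg_le (hp r hr)

theorem graphProg_cheap : ∃ w, PolyBdd w ∧ ∀ (L : ℕ → ℕ) (B : ℕ), L 2 ≤ B →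
    graphProg.bnd L ≤ w B * (L 1 + 1) := by
  have key : ∀ p : Prog, (∀ r ∈ p.lims, r = 2) → ∃ w, PolyBdd w ∧ ∀ (L : ℕ → ℕ) (B : ℕ), L 2 ≤ B →
      (Prog.loop 40 1 p).bnd L ≤ w B * (L 1 + 1) := fun p hp => by
    obtain ⟨w, hw, h⟩ := exists_cheap p
    refine ⟨fun B => w B + 6, hw.add (.const 6), fun L B hL => ?_⟩
    have := Nat.mul_le_mul_left (L 1) (h L B fun r hr => (hp r hr).symm ▸ hL)
    simp only [Prog.bnd]
    linarith [Nat.zero_le (w B)]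
  obtain ⟨w₁, p₁, h₁⟩ := key (.loop 43 2 (.store 11 (.ix (.var 40) 2 (.var 43))
    (.ix (.var 40) 2 (.var 43)))) (by decide)
  obtain ⟨w₂, p₂, h₂⟩ := key (.loop 43 2 (.store 11 (sideB (.get 2 (.ix (.var 40) 2 (.var 43))))
    (.ix (.var 40) 2 (.var 43)))) (by decide)
  obtain ⟨w₃, p₃, h₃⟩ := key (.loop 43 2 (.store 12 (sideB (.get 2 (.ix (.var 40) 2 (.var 43))))
    (.var 40))) (by decide)
  obtain ⟨w₄, p₄, h₄⟩ := key (.loop 43 2 (.store 12 (.get 11 (sideB (.ix (.var 40) 2 (.var 43))))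
    (.add (.var 1) (.var 40)))) (by decide)
  refine ⟨_, (p₁.add p₂).add (p₃.add p₄), fun L B hL => ?_⟩
  rw [add_mul, add_mul, add_mul]
  exact add_le_add (add_le_add (h₁ L B hL) (h₂ L B hL)) (add_le_add (h₃ L B hL) (h₄ L B hL))

theorem prepareCmd_halts (κ : ℕ) : ∃ w, PolyBdd w ∧ ∀ (F : Type) [Field F] [Algebra (ZMod 2) F]
    (n Δ ℓ : ℕ) (K : ConcatCode F n Δ) (b : Module.Basis (Fin ℓ) (ZMod 2) F) (m : ℕ) (y : K.Word)
    (S : List ℕ → List ℕ → ℕ → Prop) (τ : State), Input K b m y τ.vars →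
      Halts S (prepareCmd κ) τ (w (K.size ℓ) * (n + 1)) fun τ' => Data K b m κ τ'.vars ∧
        ∀ (i : Fin n) (j : Fin K.nin), τ'.arr 0 (i * K.nin + j) = (y i j).val := by
  obtain ⟨w, hw, hg⟩ := graphProg_cheap
  refine ⟨fun B => w B + (100 + (10 * B)), hw.add ((PolyBdd.const 100).add ⟨10, 1, fun B => by simp⟩),
    fun F _ _ n Δ ℓ K b m y S τ h => ?_⟩
  obtain ⟨p1, p2, p3, -⟩ := h.params
  set B := K.size ℓ with hB
  have hΔ : Δ ≤ B := by simp only [hB, ConcatCode.size]; omega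
  have hℓ : ℓ ≤ B := by simp only [hB, ConcatCode.size]; omega
  have b1 : paramProg.bnd τ.vars.reg ≤ 28 := le_rfl
  have b2 : (derivedProg κ).bnd (paramProg.run τ.vars).reg ≤ 64 + 6 * ℓ + 3 * Δ + 3 * n := by
    have e1 : (paramProg.run τ.vars).reg 1 = n := p1
    have e2 : (paramProg.run τ.vars).reg 2 = Δ := p2
    have e3 : (paramProg.run τ.vars).reg 3 = ℓ := p3
    simp only [derivedProg, Prog.bnd, Exp.bnd, e1, e2, e3]
    omega
  have b3 : graphProg.bnd ((derivedProg κ).run (paramProg.run τ.vars)).reg ≤ w B * (n + 1) := by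
    have e1 : ((derivedProg κ).run (paramProg.run τ.vars)).reg 1 = n := p1
    have e2 : ((derivedProg κ).run (paramProg.run τ.vars)).reg 2 = Δ := p2
    have := hg ((derivedProg κ).run (paramProg.run τ.vars)).reg B (e2.symm ▸ hΔ)
    rwa [e1] at this
  have hs := prepare_spec h κ
  have okd : (derivedProg κ).Ok := show (derivedProg 0).Ok by decide
  have H : Halts S (prepareCmd κ) τ (28 + (64 + 6 * ℓ + 3 * Δ + 3 * n + w B * (n + 1)))
      fun τ' => τ'.vars = graphProg.run ((derivedProg κ).run (paramProg.run τ.vars)) :=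
    (Prog.halts_vars S (by decide) b1 fun τ₁ h1 => h1).seq fun τ₁ h1 =>
      (Prog.halts_vars S okd (h1 ▸ b2) fun τ₂ h2 => h2).seq
        fun τ₂ h2 => Prog.halts_vars S (by decide) (by rw [h2, h1]; exact b3) fun τ₃ h3 => by
          rw [h3, h2, h1]
  refine H.mono (by nlinarith [Nat.zero_le (n * B)]) fun τ' h' => ?_
  rw [h']
  refine ⟨hs.1, fun i j => ?_⟩
  rw [← hs.2 i j, ← h']
  rfl

theorem Data.call (h : Data K b m κ σ.vars) (l : List ℕ) :
    Data K b m κ ((σ.write 16 l).setReg (2 * 34) l.length).vars :=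
  h.congr (fun r hr _ => State.reg_setReg_of_ne _ _ (by omega)) fun a ha _ =>
    Function.update_of_ne (by omega) _ _

theorem innerCmd_halts : ∃ w, PolyBdd w ∧ ∀ (F : Type) [Field F] [Algebra (ZMod 2) F]
    (n Δ ℓ : ℕ) (K : ConcatCode F n Δ) (b : Module.Basis (Fin ℓ) (ZMod 2) F) (m κ : ℕ) (y : K.Word)
    (S : List ℕ → List ℕ → ℕ → Prop) (T : ℕ) (τ : State),
    (∀ v, ∃ t ≤ T, S (bits v) (bits (K.decIn v).1) t) → Data K b m κ τ.vars →
    (∀ (i : Fin n) (j : Fin K.nin), τ.arr 0 (i * K.nin + j) = (y i j).val) →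
      Halts S innerCmd τ (w (K.size ℓ) * (n + 1) + n * T) fun τ' => Data K b m κ τ'.vars ∧
        ∀ (i : Fin n) (j : Fin K.nin), τ'.arr 17 (i * K.nin + j) = ((K.decIn (y i)).1 j).val := by
  obtain ⟨w₁, p₁, h₁⟩ := exists_cheap copyIn
  obtain ⟨w₂, p₂, h₂⟩ := exists_cheap copyOut
  refine ⟨fun B => w₁ B + w₂ B + (10 + 2 * B), (p₁.add p₂).add
    ((PolyBdd.const 10).add ⟨2, 1, fun B => by simp⟩), fun F _ _ n Δ ℓ K b m κ y S T τ hS hd hy => ?_⟩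
  set B := K.size ℓ with hB
  have hnin : K.nin ≤ B := by simp only [hB, ConcatCode.size]; omega
  let I : ℕ → State → Prop := fun k τ => Data K b m κ τ.vars ∧ τ.vars.reg 28 = k ∧
    (∀ (i : Fin n) (j : Fin K.nin), τ.arr 0 (i * K.nin + j) = (y i j).val) ∧
    ∀ (i : Fin n) (j : Fin K.nin), (i : ℕ) < k →
      τ.arr 17 (i * K.nin + j) = ((K.decIn (y i)).1 j).val
  have body : ∀ k τ, k < n → I k τ → Halts S
      (.seq (copyIn.code 0) (.seq (.call (2 * 6) 15 16 (2 * 34)) (copyOut.code 0))) τ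
      (w₁ B + (1 + 2 * B + T + w₂ B)) (I (k + 1)) := by
    rintro k τ hk ⟨d, hc, hy, hz⟩
    refine (Prog.halts_vars S (by decide) (h₁.bnd_le d (by decide)) fun τ₁ e₁ => e₁).seq
      fun τ₁ e₁ => ?_
    have d₁ : Data K b m κ τ₁.vars := e₁ ▸ d.run copyIn (by decide) (by decide)
    have f₁ : Fills copyIn 15 τ.vars ∅ {c | ∃ j < K.nin, c = j} fun j =>
        τ.arr 0 (k * K.nin + j) :=
      Fills.loop₁ _ d.nin fun j hj h => ⟨by simp [Exp.eval], by
        simp [Exp.eval, Exp.ix, State.reg_setReg, hc, d.nin, State.arr_setArr]; rfl⟩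
    have fr₁ := copyIn.frame τ.vars
    have a0 : τ₁.arr 0 = τ.arr 0 := (congrArg (fun σ => σ.arr 0) e₁).trans (fr₁.2 0 (by decide))
    have a17 : τ₁.arr 17 = τ.arr 17 := (congrArg (fun σ => σ.arr 17) e₁).trans (fr₁.2 17 (by decide))
    have hin : τ₁.reg (2 * 6) = K.nin := d₁.nin
    have hread : τ₁.read 15 (τ₁.reg (2 * 6)) = bits (y ⟨k, hk⟩) := by
      rw [hin]
      refine read_eq_bits _ _ _ fun j => ?_
      rw [← hy ⟨k, hk⟩ j]
      exact (congrArg (fun σ => σ.arr 15 j) e₁).trans (f₁.arr ⟨j, j.2, rfl⟩)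
    obtain ⟨t, ht, hSt⟩ := hS (y ⟨k, hk⟩)
    set l := bits (K.decIn (y ⟨k, hk⟩)).1 with hl
    have hcall := Exec.call (S := S) (x := 2 * 6) (a := 15) (b := 16) (y := 2 * 34) (σ := τ₁)
      (l := l) (t := t) (hread ▸ hSt)
    refine Halts.seq (T₁ := 1 + 2 * B + T)
      (P := fun σ' => σ' = (τ₁.write 16 l).setReg (2 * 34) l.length)
      ⟨_, _, hcall, by rw [hin, hl, length_bits]; omega, rfl⟩ ?_
    rintro _ rfl
    have d₂ := d₁.call l
    set τ₂ := (τ₁.write 16 l).setReg (2 * 34) l.length with hτ₂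
    refine Prog.halts_vars S (by decide) (h₂.bnd_le d₂ (by decide)) fun τ₃ e₃ => ?_
    have fr₂ := copyOut.frame τ₂.vars
    have c₂ : τ₂.vars.reg 28 = k := by
      have : τ₂.vars.reg 28 = τ₁.vars.reg 28 :=
        State.reg_setReg_of_ne (x := 2 * 34) (y := 2 * 28) (τ₁.write 16 l) l.length (by decide)
      rw [this, e₁, fr₁.1 _ (by decide), hc]
    have l₂ : ∀ j : Fin K.nin, τ₂.arr 16 j = ((K.decIn (y ⟨k, hk⟩)).1 j).val := fun j => by
      have : τ₂.arr 16 j = l.getD j (τ₁.arr 16 j) := by simp [hτ₂, State.write]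
      rw [this, List.getD_eq_getElem _ _ (by rw [hl, length_bits]; exact j.2)]
      simp [hl, bits]
    set q : Prog := .loop 43 6 (.store 17 (.ix (.var 28) 6 (.var 43)) (.get 16 (.var 43)))
    have f₃ : Fills q 17 τ₂.vars ∅ {c | ∃ j < K.nin, c = k * K.nin + j} fun c =>
        τ₂.arr 16 (c - k * K.nin) :=
      Fills.loop₁ _ d₂.nin fun j hj h => ⟨by
        simp [Exp.eval, Exp.ix, State.reg_setReg, c₂, d₂.nin], by
        simp [Exp.eval, State.arr_setArr]; rfl⟩
    have o17 : τ₃.arr 17 = (q.run τ₂.vars).arr 17 := congrArg (fun σ => σ.arr 17) e₃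
    refine ⟨e₃ ▸ d₂.run copyOut (by decide) (by decide), ?_, fun i j => ?_, fun i j hi => ?_⟩
    · have : τ₃.vars.reg 28 = (q.run τ₂.vars).reg 28 + 1 := by
        rw [e₃]; exact State.reg_setReg_self _ _ _
      rw [this, (q.frame _).1 _ (by decide), c₂]
    · have : τ₃.arr 0 = τ.arr 0 :=
        ((congrArg (fun σ => σ.arr 0) e₃).trans (fr₂.2 0 (by decide))).trans a0
      rw [this, hy]
    · rw [o17]
      rcases Nat.lt_succ_iff_lt_or_eq.1 hi with hi | rfl
      · rw [f₃.arr_of_notMem]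
        · exact (congrFun a17 _).trans (hz i j hi)
        · rintro ⟨j', hj', he⟩
          have := (index_inj j.2 hj' he).1
          omega
      · rw [f₃.arr ⟨j, j.2, rfl⟩, Nat.add_sub_cancel_left, l₂]
  have start : Halts S ((Prog.assign 28 (.lit 0)).code 0) τ 3 (I 0) :=
    Prog.halts_vars S (by decide) le_rfl fun τ₁ e₁ => by
      refine ⟨e₁ ▸ hd.setReg (by decide), by rw [e₁]; exact State.reg_setReg_self _ _ _, ?_,
        fun i j h => absurd h (Nat.not_lt_zero _)⟩
      have : τ₁.arr = τ.arr := congrArg (fun σ => σ.arr) e₁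
      rw [this]; exact hy
  refine (start.seq fun τ₁ h => Halts.count I (fun i τ hI => ⟨hI.2.1, hI.1.card⟩) body h).mono ?_ ?_
  · nlinarith [Nat.zero_le (n * B), Nat.zero_le (w₁ B), Nat.zero_le (w₂ B)]
  · exact fun τ' h => ⟨h.1, fun i j => h.2.2.2 i j i.2⟩

end

/-! ### The rounds and the output in the machine model -/

section

open Finset OuterCode

variable {F : Type} [Field F] [Algebra (ZMod 2) F] {n Δ ℓ : ℕ} {K : ConcatCode F n Δ}
  {b : Module.Basis (Fin ℓ) (ZMod 2) F} {m κ : ℕ} {σ : State} {x : Fin n → K.O.Phi} {clk : Bool}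

theorem sum_segments (f : ℕ) :
    ∑ i ∈ range f, (queueEnd K x i - queuePos K x i) = queuePos K x f := by
  induction f with
  | zero => rfl
  | succ f ih =>
    rw [sum_range_succ, ih, queuePos]
    exact Nat.add_sub_cancel' (queuePos_le_queueEnd K x f)

theorem exists_last_round (clk : Bool) (m κ : ℕ) (K : ConcatCode F n Δ) (x : Fin n → K.O.Phi) :
    ∃ f, (∀ i < f, Goes clk m κ K x i) ∧ ¬ Goes clk m κ K x f := by
  classical
  have h : ∃ f, ¬ Goes clk m κ K x f := ⟨m, fun h => absurd h.2.1 (lt_irrefl m)⟩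
  exact ⟨Nat.find h, fun i hi => not_not.1 (Nat.find_min h hi), Nat.find_spec h⟩

set_option maxRecDepth 10000 in
theorem segmentProg_ok : segmentProg.Ok := by decide

set_option maxRecDepth 10000 in
theorem loadProg_ok : loadProg.Ok := by decide

set_option maxRecDepth 10000 in
theorem unloadProg_ok : unloadProg.Ok := by decide

set_option maxRecDepth 10000 in
theorem checkProg_ok : checkProg.Ok := by decide

set_option maxRecDepth 10000 in
/-- The time for a round is proportional to the length of the segment of the queue that it
processes, which is not empty. -/
theorem roundsCmd_halts (clk : Bool) : ∃ w, PolyBdd w ∧ ∀ (F : Type) [Field F]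
    [Algebra (ZMod 2) F] (n Δ ℓ : ℕ) (K : ConcatCode F n Δ) (b : Module.Basis (Fin ℓ) (ZMod 2) F)
    (m κ : ℕ) (x : Fin n → K.O.Phi) (f : ℕ) (S : List ℕ → List ℕ → ℕ → Prop) (τ : State),
    (∀ i < f, Goes clk m κ K x i) → ¬ Goes clk m κ K x f → Data K b m κ τ.vars →
    (∀ (u : Fin n) (j : Fin K.nin), τ.arr 17 (u * K.nin + j) = ((K.enc0 (x u)).1 j).val) →
      Halts S (roundsCmd clk) τ (w (K.size ℓ) * (n + 1 + queuePos K x f)) fun τ' =>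
        RoundInv clk K b m κ x f τ'.vars := by
  obtain ⟨w₁, p₁, h₁⟩ := exists_cheap loadBlock
  obtain ⟨w₂, p₂, h₂⟩ := exists_cheap vertexProg
  refine ⟨fun B => w₁ B + w₂ B + 200, (p₁.add p₂).add (.const 200),
    fun F _ _ n Δ ℓ K b m κ x f S τ hgo hlast d hx => ?_⟩
  set B := K.size ℓ with hB
  have c₁ : loadProg.bnd τ.vars.reg ≤ n * (w₁ B + 5) + 6 := by
    simp only [loadProg, Prog.bnd, d.card]
    gcongr
    exact h₁.bnd_le d (by decide)
  have cgo : ∀ L, (goExp clk).bnd L ≤ 30 := fun L => by cases clk <;> exact Nat.le_of_ble_eq_true rfl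
  let I : ℕ → State → Prop := fun i τ => RoundInv clk K b m κ x i τ.vars
  have start : Halts S (.seq (loadProg.code 0) ((startProg clk).code 0)) τ
      (n * (w₁ B + 5) + 6 + (13 * n + 80)) (I 0) := by
    have hl := loadProg_spec d x hx
    refine (Prog.halts_vars S loadProg_ok c₁ fun τ₁ e₁ => e₁).seq fun τ₁ e₁ => ?_
    have d₁ : Data K b m κ τ₁.vars := e₁ ▸ d.run loadProg (by decide) (by decide)
    refine Prog.halts_vars S (by cases clk <;> decide) ?_ fun τ₂ e₂ => ?_
    · have := cgo τ₁.vars.reg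
      simp only [startProg, Prog.bnd, Exp.bnd, d₁.card]
      omega
    · change RoundInv clk K b m κ x 0 τ₂.vars
      rw [e₂]
      exact startProg_spec d₁ (e₁ ▸ hl)
  have body : ∀ i < f, ∀ τ, I i τ → Halts S
      (.seq (openProg.code 0) (.seq (segmentProg.code 0) ((closeProg clk).code 0))) τ
      (10 + ((queueEnd K x i - queuePos K x i) * (w₂ B + 5) + 6 + 60)) (I (i + 1)) := by
    intro i hi τ h
    have hr := round_spec h
    refine (Prog.halts_vars S (by decide) (Nat.le_of_ble_eq_true rfl) fun τ₁ e₁ => e₁).seq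
      fun τ₁ e₁ => ?_
    have d₁ : Data K b m κ τ₁.vars := e₁ ▸ h.1.data.run openProg (by decide) (by decide)
    have l₁ : τ₁.vars.reg 20 = queueEnd K x i - queuePos K x i := by
      rw [e₁, openProg, Prog.run, State.reg_setReg_self, Exp.eval, Exp.eval, Exp.eval, h.1.fin,
        h.1.pos]
    refine (Prog.halts_vars S segmentProg_ok (T := (queueEnd K x i - queuePos K x i) * (w₂ B + 5) + 6) ?_
      fun τ₂ e₂ => e₂).seq fun τ₂ e₂ => ?_
    · simp only [segmentProg, Prog.bnd, l₁]
      gcongr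
      exact h₂.bnd_le d₁ (by decide)
    · refine Prog.halts_vars S (by cases clk <;> decide) ?_ fun τ₃ e₃ => ?_
      · have := cgo τ₂.vars.reg
        simp only [closeProg, Prog.bnd, Exp.bnd]
        omega
      · change RoundInv clk K b m κ x (i + 1) τ₃.vars
        rw [e₃, e₂, e₁]
        exact hr
  have hgo' : ∀ i ≤ f, ∀ τ, I i τ → (τ.reg (2 * 23) < τ.reg (2 * 22) ↔ i < f) := fun i hi τ h => by
    have h0 : τ.reg (2 * 23) = 0 := h.1.zero
    rw [h0]
    refine h.2.trans ⟨fun hG => ?_, hgo i⟩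
    rcases hi.lt_or_eq with hi | rfl
    · exact hi
    · exact absurd hG hlast
  obtain ⟨σ₁, t₁, x₁, le₁, i₁⟩ := start
  obtain ⟨σ₂, t₂, x₂, le₂, i₂⟩ := Halts.while_steps I _ hgo' body i₁
  have hsum : ∑ i ∈ range f, (10 + ((queueEnd K x i - queuePos K x i) * (w₂ B + 5) + 6 + 60) + 1) ≤
      queuePos K x f * (w₂ B + 82) := by
    rw [← sum_segments, sum_mul]
    refine sum_le_sum fun i hi => ?_
    have h1 : 1 ≤ queueEnd K x i - queuePos K x i := by
      have := (hgo i (mem_range.1 hi)).1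
      omega
    nlinarith
  cases x₁ with
  | seq xa xb =>
    refine ⟨σ₂, _, .seq xa (.seq xb x₂), ?_, i₂⟩
    nlinarith [Nat.zero_le (n * w₂ B), Nat.zero_le (queuePos K x f * w₁ B), Nat.zero_le (w₁ B),
      Nat.zero_le (w₂ B), Nat.zero_le (queuePos K x f)]

/-- If the rounds end before time is over, the remaining ones would not change anything. -/
theorem iter_eq_of_not_goes {f : ℕ} (h : RoundCore K b m κ x f σ) (hf : f ≤ m)
    (hlast : ¬ Goes clk m κ K x f) (hover : ¬ Over clk κ K x f) : K.O.iter x m = K.O.iter x f := by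
  rcases hf.lt_or_eq with hf | rfl
  · have hq : queueEnd K x f ≤ queuePos K x f := by
      by_contra hq
      exact hlast ⟨not_le.1 hq, hf, hover⟩
    have := iter_eq_of_queue_empty h hq (m - f)
    rwa [Nat.add_sub_cancel' hf.le] at this
  · rfl

open Classical in
set_option maxRecDepth 10000 in
/-- If time is not over, the edges hold what the decoder has after all its rounds, so that the
output is that of the decoder. -/
theorem finishCmd_halts (clk : Bool) : ∃ w, PolyBdd w ∧ ∀ (F : Type) [Field F]
    [Algebra (ZMod 2) F] (n Δ ℓ : ℕ) (K : ConcatCode F n Δ) (b : Module.Basis (Fin ℓ) (ZMod 2) F)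
    (m κ : ℕ) (x : Fin n → K.O.Phi) (f : ℕ) (S : List ℕ → List ℕ → ℕ → Prop) (τ : State),
    f ≤ m → ¬ Goes clk m κ K x f → RoundCore K b m κ x f τ.vars →
      Halts S (finishCmd clk) τ (w (K.size ℓ) * (n + 1)) fun τ' =>
        τ'.output = K.output (if Over clk κ K x f then none else
          (K.O.decode m x).map fun z i => (K.enc0 (z i)).1) := by
  obtain ⟨w₁, p₁, h₁⟩ := exists_cheap (.seq (.assign 26 (.var 40)) (.seq vertexDecode
    (.assign 24 (.add (.var 24) (.fold .sum 43 2 (symNe 32))))))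
  obtain ⟨w₂, p₂, h₂⟩ := exists_cheap unloadBlock
  refine ⟨fun B => (w₁ B + w₁ B) + w₂ B + (100 + 3 * B), ((p₁.add p₁).add p₂).add
    ((PolyBdd.const 100).add ⟨3, 1, fun B => by simp⟩), fun F _ _ n Δ ℓ K b m κ x f S τ hf hlast h => ?_⟩
  set B := K.size ℓ with hB
  have hnin : K.nin ≤ B := by simp only [hB, ConcatCode.size]; omega
  have h24 := h.eval_over (clk := clk)
  have H : Halts S (finishCmd clk) τ (20 + (((n + n) * (w₁ B + 5) + 6) + ((n * (w₂ B + 5) + 6) +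
      (3 * K.nin + 20)))) fun τ' => τ'.vars = outProg.run (unloadProg.run (checkProg.run
        ((Prog.assign 24 (overExp clk)).run τ.vars))) := by
    have d := h.data
    refine (Prog.halts_vars S (by cases clk <;> decide) ?_ fun τ₁ e₁ => e₁).seq fun τ₁ e₁ => ?_
    · cases clk <;> exact Nat.le_of_ble_eq_true rfl
    have d₁ : Data K b m κ τ₁.vars := e₁ ▸ d.run _ (by cases clk <;> decide) (by cases clk <;> decide)
    refine (Prog.halts_vars S checkProg_ok ?_ fun τ₂ e₂ => e₂).seq fun τ₂ e₂ => ?_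
    · simp only [checkProg, Prog.bnd.eq_5, d₁.card2]
      gcongr
      exact h₁.bnd_le d₁ (by decide)
    have d₂ : Data K b m κ τ₂.vars := e₂ ▸ d₁.run checkProg (by decide) (by decide)
    refine (Prog.halts_vars S unloadProg_ok ?_ fun τ₃ e₃ => e₃).seq fun τ₃ e₃ => ?_
    · simp only [unloadProg, Prog.bnd.eq_5, d₂.card]
      gcongr
      exact h₂.bnd_le d₂ (by decide)
    have d₃ : Data K b m κ τ₃.vars := e₃ ▸ d₂.run unloadProg (by decide) (by decide)
    refine Prog.halts_vars S (by decide) ?_ fun τ₄ e₄ => by rw [e₄, e₃, e₂, e₁]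
    simp only [outProg, Prog.bnd, Exp.bnd, d₃.nin]
    omega
  refine H.mono (by nlinarith [Nat.zero_le (n * B), Nat.zero_le (w₁ B), Nat.zero_le (w₂ B)])
    fun τ' hτ' => ?_
  set σ₁ := (Prog.assign 24 (overExp clk)).run τ.vars with hσ₁
  have d₁ : Data K b m κ σ₁ := h.data.setReg (by decide)
  have v₁ : σ₁.reg 24 = if Over clk κ K x f then 1 else 0 := by
    rw [hσ₁, Prog.run_assign, State.reg_setReg_self, h24]
  have z₁ : HoldsEdges b (σ₁.arr 13) (K.O.iter x f) := h.edges
  have c₂ := checkProg_spec d₁ z₁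
  have d₂ : Data K b m κ (checkProg.run σ₁) := d₁.run checkProg (by decide) (by decide)
  have a₂ := (checkProg.frame σ₁).2 13 (by decide)
  set σ₂ := checkProg.run σ₁
  have u₃ := unloadProg_spec d₂
  have d₃ : Data K b m κ (unloadProg.run σ₂) := d₂.run unloadProg (by decide) (by decide)
  have r₃ := (unloadProg.frame σ₂).1 24 (by decide)
  set σ₃ := unloadProg.run σ₂
  have hr : τ'.reg 0 = if 0 < σ₂.reg 24 then 0 else n * K.nin := by
    have e1 : τ'.reg 0 = (outProg.run σ₃).reg 0 := congrArg (fun σ => σ.reg 0) hτ'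
    rw [e1, outProg, Prog.run_assign, State.reg_setReg_self]
    simp only [Exp.eval, r₃, d₃.card, d₃.nin]
  have ha : τ'.arr 0 = σ₃.arr 0 := congrArg (fun σ => σ.arr 0) hτ'
  rw [State.output, hr]
  by_cases hO : Over clk κ K x f
  · rw [v₁, if_pos hO] at c₂
    rw [if_pos hO, if_pos (Nat.pos_of_ne_zero fun h0 => absurd (c₂.1 h0).1 one_ne_zero)]
    rfl
  rw [v₁, if_neg hO] at c₂
  rw [if_neg hO]
  have hit := iter_eq_of_not_goes h hf hlast hO
  rw [OuterCode.decode]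
  by_cases hc : K.O.iter x f ∈ K.O.edgeCode
  · have hc' : K.O.iter x m ∈ K.O.edgeCode := hit ▸ hc
    rw [dif_pos hc', if_neg (by rw [c₂.2 ⟨rfl, hc⟩]; exact lt_irrefl 0)]
    refine read_eq_blocks _ _ _ fun u j => ?_
    rw [ha]
    refine u₃ (K.O.psi ⟨_, hc'⟩) (fun e => ?_) u j
    rw [a₂]
    have hz : (fun e : Fin n × Fin Δ => (K.O.encA (K.O.psi ⟨_, hc'⟩ e.1)).1 e.2) = K.O.iter x f := by
      funext e
      simp only [psi, LinearEquiv.apply_symm_apply, wordA, hit]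
    rw [hz]
    exact z₁ e
  · rw [dif_neg (hit ▸ hc), if_pos (Nat.pos_of_ne_zero fun h0 => hc (c₂.1 h0).2)]
    rfl

end

/-! ### The running time of the decoder -/

section

open Finset OuterCode

theorem PolyBdd.mul {v w : ℕ → ℕ} (hv : PolyBdd v) (hw : PolyBdd w) :
    PolyBdd fun B => v B * w B := by
  obtain ⟨C, k, h⟩ := hv
  obtain ⟨C', k', h'⟩ := hw
  refine ⟨C * C', k + k', fun B => (Nat.mul_le_mul (h B) (h' B)).trans_eq (by ring)⟩

/-- The word over the alphabet of the outer code that results from decoding the blocks. -/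
noncomputable def ConcatCode.innerDecode {F : Type} [Field F] [Algebra (ZMod 2) F] {n Δ : ℕ}
    (K : ConcatCode F n Δ) (y : K.Word) : Fin n → K.O.Phi := fun i => K.enc0.symm (K.decIn (y i))

open Classical in
/-- Apart from the calls of the inner decoder, the time is proportional to the number of blocks plus
the length of the queue that has been processed. -/
theorem decodeCmd_halts (clk : Bool) (κ : ℕ) : ∃ w, PolyBdd w ∧ ∀ (F : Type) [Field F]
    [Algebra (ZMod 2) F] (n Δ ℓ : ℕ) (K : ConcatCode F n Δ) (b : Module.Basis (Fin ℓ) (ZMod 2) F)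
    (m : ℕ) (y : K.Word) (S : List ℕ → List ℕ → ℕ → Prop) (T : ℕ),
    (∀ v, ∃ t ≤ T, S (bits v) (bits (K.decIn v).1) t) →
    ∃ f, (∀ i < f, Goes clk m κ K (K.innerDecode y) i) ∧
      Halts S (decodeCmd clk κ) (.init (K.input b m y))
        (w (K.size ℓ) * (n + 1 + queuePos K (K.innerDecode y) f) + n * T) fun τ' => τ'.output =
          K.output (if Over clk κ K (K.innerDecode y) f then none else K.decode m y) := by
  obtain ⟨w₁, p₁, h₁⟩ := prepareCmd_halts κ
  obtain ⟨w₂, p₂, h₂⟩ := innerCmd_halts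
  obtain ⟨w₃, p₃, h₃⟩ := roundsCmd_halts clk
  obtain ⟨w₄, p₄, h₄⟩ := finishCmd_halts clk
  refine ⟨_, (p₁.add p₂).add (p₃.add p₄), fun F _ _ n Δ ℓ K b m y S T hS => ?_⟩
  set x := K.innerDecode y with hx
  obtain ⟨f, hf, hf'⟩ := exists_last_round clk m κ K x
  have hfm : f ≤ m := by
    cases f with
    | zero => exact Nat.zero_le _
    | succ f => exact (hf f (Nat.lt_succ_self f)).2.1
  refine ⟨f, hf, ?_⟩
  have H := (h₁ F n Δ ℓ K b m y S _ (input_init K b m y)).seq fun τ₁ e₁ =>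
    (h₂ F n Δ ℓ K b m κ y S T τ₁ hS e₁.1 e₁.2).seq fun τ₂ e₂ =>
    (h₃ F n Δ ℓ K b m κ x f S τ₂ hf hf' e₂.1 fun u j => by
      rw [e₂.2, hx, ConcatCode.innerDecode, LinearEquiv.apply_symm_apply]).seq fun τ₃ e₃ =>
    h₄ F n Δ ℓ K b m κ x f S τ₃ hfm hf' e₃.1
  refine H.mono ?_ fun τ' h => h
  set B := K.size ℓ
  have q := Nat.zero_le (queuePos K x f)
  nlinarith [Nat.zero_le (w₁ B * queuePos K x f), Nat.zero_le (w₂ B * queuePos K x f),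
    Nat.zero_le (w₄ B * queuePos K x f)]

section

variable {F : Type} [Field F] [Algebra (ZMod 2) F] {n Δ ℓ : ℕ} {K : ConcatCode F n Δ}
  {m κ : ℕ} {clk : Bool} {y : K.Word} {τ : ℝ}

theorem ConcatCode.one_le (K : ConcatCode F n Δ) : 1 ≤ n := by
  obtain ⟨x⟩ := K.O.connected.nonempty
  rcases x with x | x <;> exact x.pos

/-- A correctable word never exceeds the limit for the length of the queue. -/
theorem queueEnd_le_of_correctable (hτ0 : 0 < τ) (hτ1 : τ < 1) (hκ : 2 + 2 * (τ / (1 - τ)) ≤ κ)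
    (hy : K.Correctable τ y) (i : ℕ) : queueEnd K (K.innerDecode y) i ≤ κ * Δ * n := by
  classical
  obtain ⟨w, ⟨_, ⟨c, rfl⟩, rfl⟩, h⟩ := hy
  have herr : ((K.O.err false (K.O.iter (K.innerDecode y) 0) c.1).card : ℝ) ≤ τ * K.O.beta * n := by
    refine le_trans (Nat.cast_le.2 (card_le_card fun v hv => ?_)) h
    refine mem_filter.2 ⟨mem_univ _, fun he => mem_err.1 hv ?_⟩
    have h1 : K.innerDecode y v = K.O.psi c v := by
      rw [ConcatCode.innerDecode, LinearEquiv.symm_apply_eq]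
      exact Subtype.ext he
    have h2 := congrArg (fun z => (K.O.encA z).1) h1
    simp only [psi, LinearEquiv.apply_symm_apply] at h2
    exact h2
  have hc := K.O.changes_le hτ0 hτ1 _ c.2 herr i
  have hΔ : (1 : ℝ) ≤ Δ := by exact_mod_cast K.O.dims_pos
  have hn : (0 : ℝ) ≤ n := Nat.cast_nonneg n
  have : ((n + K.O.changes (K.innerDecode y) i : ℕ) : ℝ) ≤ (κ * Δ * n : ℕ) := by
    push_cast
    have h3 : (n : ℝ) ≤ n * Δ := le_mul_of_one_le_right hn hΔ
    have h4 := mul_le_mul_of_nonneg_right hκ (mul_nonneg hn (zero_le_one.trans hΔ))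
    linarith
  exact_mod_cast this

theorem queuePos_le_of_goes {x : Fin n → K.O.Phi} {f B : ℕ} (hf : ∀ i < f, Goes clk m κ K x i)
    (h : ∀ i < m, ¬ Over clk κ K x i → queueEnd K x i ≤ B) : queuePos K x f ≤ B := by
  cases f with
  | zero => exact Nat.zero_le _
  | succ f => exact h f (hf f f.lt_succ_self).2.1 (hf f f.lt_succ_self).2.2

end

/-- The running times of the two decoders, in terms of the number of blocks, the sizes of the
constituent codes and the time `T` for decoding one block. -/
theorem exists_decoders {τ : ℝ} (hτ0 : 0 < τ) (hτ1 : τ < 1) : ∃ prog progClocked : Cmd,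
    ∃ w, PolyBdd w ∧ ∀ (F : Type) [Field F] [Algebra (ZMod 2) F] (n Δ ℓ : ℕ) (K : ConcatCode F n Δ)
    (b : Module.Basis (Fin ℓ) (ZMod 2) F) (m : ℕ) (y : K.Word) (S : List ℕ → List ℕ → ℕ → Prop)
    (T : ℕ), (∀ v, ∃ t ≤ T, S (bits v) (bits (K.decIn v).1) t) →
    (∃ t, Runs S prog (K.input b m y) (K.output (K.decode m y)) t ∧
      t ≤ n * (w (K.size ℓ) + T) * (m + 1) ∧
      (K.Correctable τ y → t ≤ n * (w (K.size ℓ) + T))) ∧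
    ∃ (t : ℕ) (out : Option K.Word), Runs S progClocked (K.input b m y) (K.output out) t ∧
      t ≤ n * (w (K.size ℓ) + T) ∧ (out = K.decode m y ∨ out = none) ∧
        (K.Correctable τ y → out = K.decode m y) := by
  classical
  -- By `changes_le` the queue of a correctable word has at most `n + (1 + 2 τ / (1 - τ)) n Δ`
  -- entries, and this is at most `κ Δ n`.
  obtain ⟨κ, hκ⟩ := exists_nat_ge (2 + 2 * (τ / (1 - τ)))
  obtain ⟨w₁, p₁, h₁⟩ := decodeCmd_halts false κ
  obtain ⟨w₂, p₂, h₂⟩ := decodeCmd_halts true κ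
  refine ⟨decodeCmd false κ, decodeCmd true κ, fun B => (w₁ B + w₂ B) * ((κ + 1) * B + 3),
    (p₁.add p₂).mul (((PolyBdd.const (κ + 1)).mul .id).add (.const 3)),
    fun F _ _ n Δ ℓ K b m y S T hS => ?_⟩
  have hn := K.one_le
  set B := K.size ℓ with hB
  have hΔ : Δ ≤ B := by simp only [hB, ConcatCode.size]; omega
  have hle : ∀ w q, w ≤ w₁ B + w₂ B → q ≤ κ * Δ * n →
      w * (n + 1 + q) + n * T ≤ n * ((w₁ B + w₂ B) * ((κ + 1) * B + 3) + T) := fun w q hw hq =>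
    calc w * (n + 1 + q) + n * T ≤ (w₁ B + w₂ B) * (n + n + κ * B * n) + n * T := by
          gcongr; exact hq.trans (by gcongr)
      _ ≤ (w₁ B + w₂ B) * (n * ((κ + 1) * B + 3)) + n * T := by
          gcongr; nlinarith [Nat.zero_le (n * B)]
      _ = _ := by ring
  constructor
  · obtain ⟨f, hf, σ', t, e, ht, ho⟩ := h₁ F n Δ ℓ K b m y S T hS
    rw [if_neg (by rintro ⟨h, -⟩; cases h)] at ho
    refine ⟨t, ⟨σ', e, ho⟩, ht.trans ?_, fun hy => ht.trans (hle _ _ (Nat.le_add_right _ _) ?_)⟩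
    · have hq : queuePos K (K.innerDecode y) f ≤ n + m * (n * B) :=
        queuePos_le_of_goes hf fun i hi _ => by
          refine Nat.add_le_add_left ((K.O.changes_le_mul _ i).trans ?_) n
          gcongr
      calc _ ≤ (w₁ B + w₂ B) * (n + n + (n + m * (n * B))) + n * T := by
            gcongr; exact Nat.le_add_right _ _
        _ ≤ (w₁ B + w₂ B) * (n * ((κ + 1) * B + 3) * (m + 1)) + n * T * (m + 1) := by
            refine add_le_add (Nat.mul_le_mul_left _ ?_) (Nat.le_mul_of_pos_right _ m.succ_pos)
            nlinarith [Nat.zero_le (n * B * m * κ), Nat.zero_le (n * B * κ), Nat.zero_le (n * B),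
              Nat.zero_le (n * m)]
        _ = _ := by ring
    · exact queuePos_le_of_goes hf fun i _ _ => queueEnd_le_of_correctable hτ0 hτ1 hκ hy i
  · obtain ⟨f, hf, σ', t, e, ht, ho⟩ := h₂ F n Δ ℓ K b m y S T hS
    refine ⟨t, _, ⟨σ', e, ho⟩, ht.trans (hle _ _ (Nat.le_add_left _ _) ?_), ?_, fun hy => if_neg ?_⟩
    · exact queuePos_le_of_goes hf fun i _ h => not_lt.1 fun h' => h ⟨rfl, h'⟩
    · split_ifs
      · exact .inr rfl
      · exact .inl rfl
    · exact fun h => h.2.not_ge (queueEnd_le_of_correctable hτ0 hτ1 hκ hy f)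

end

/-! ### The parameters -/

/-- In a dense sequence of alphabet sizes, the smallest one that is large enough is not much larger
than necessary. -/
theorem IsDenseSeq.logb_le {φ : ℕ → ℕ} (h : IsDenseSeq fun i => Real.logb 2 (φ i)) :
    ∃ M : ℝ, 0 ≤ M ∧ ∀ X q, 0 ≤ X → IsSmallestAlphabet φ X q → Real.logb 2 q ≤ 2 * X + M := by
  obtain ⟨-, h1, h2⟩ := h
  set a : ℕ → ℝ := fun i => Real.logb 2 (φ i) with ha
  obtain ⟨i₀, h3⟩ := Filter.eventually_atTop.1 ((h2.bound one_pos).and (h1.eventually_ge_atTop 0))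
  have hmono : ∀ q j, q ≤ φ j → Real.logb 2 q ≤ max (a j) 0 := fun q j hq => by
    rcases q.eq_zero_or_pos with rfl | h0
    · simp
    · exact (Real.logb_le_logb_of_le one_lt_two (by exact_mod_cast h0) (by exact_mod_cast hq)).trans
        (le_max_left _ _)
  refine ⟨∑ i ∈ Finset.range (i₀ + 1), |a i|, Finset.sum_nonneg fun _ _ => abs_nonneg _,
    fun X q hX hq => ?_⟩
  have hM : ∀ j ≤ i₀, max (a j) 0 ≤ ∑ i ∈ Finset.range (i₀ + 1), |a i| := fun j hj =>
    (max_le (le_abs_self _) (abs_nonneg _)).trans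
      (Finset.single_le_sum (f := fun i => |a i|) (fun _ _ => abs_nonneg _)
        (Finset.mem_range.2 (by omega)))
  have hM0 := (le_max_right _ _).trans (hM i₀ le_rfl)
  have hex : ∃ j, X ≤ a j := (h1.eventually_ge_atTop X).exists
  classical
  set j := Nat.find hex
  have hj : X ≤ a j := Nat.find_spec hex
  refine (hmono q j (hq.2.2 j hj)).trans ?_
  by_cases hji : j ≤ i₀
  · linarith [hM j hji]
  obtain ⟨i, hi⟩ : ∃ i, j = i + 1 := ⟨j - 1, by omega⟩
  have h4 : a i < X := not_le.1 (Nat.find_min hex (by omega))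
  obtain ⟨h5, h6⟩ := h3 i (by omega)
  rw [one_mul, Real.norm_eq_abs, Real.norm_eq_abs, abs_of_nonneg h6] at h5
  have h7 := (le_abs_self _).trans h5
  rw [hi]
  exact max_le (by linarith) (by linarith)

theorem bscCapacity_pos {p : ℝ} (hp : p ≠ 1 / 2) : 0 < bscCapacity p := by
  have h := Real.binEntropy_lt_log_two.2 (by rwa [one_div] at hp : p ≠ 2⁻¹)
  rw [bscCapacity, sub_pos, div_lt_one (Real.log_pos one_lt_two)]
  exact h

section

variable {F : Type} [Field F] [Algebra (ZMod 2) F] {n Δ ℓ : ℕ}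

theorem logb_card_phi (K : ConcatCode F n Δ) (b : Module.Basis (Fin ℓ) (ZMod 2) F) :
    Real.logb 2 (Nat.card K.O.Phi) = K.O.CA.k * ℓ := by
  have : Nat.card K.O.Phi = 2 ^ (ℓ * K.O.CA.k) := by
    rw [Nat.card_fun, Nat.card_congr b.equivFun.toEquiv, Nat.card_fun]
    simp [Nat.card_eq_fintype_card, pow_mul]
  rw [this]
  push_cast
  rw [Real.logb_pow, Real.logb_self_eq_one one_lt_two]
  push_cast; ring

theorem finrank_Cin (K : ConcatCode F n Δ) (b : Module.Basis (Fin ℓ) (ZMod 2) F) :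
    Module.finrank (ZMod 2) K.Cin = K.O.CA.k * ℓ := by
  have : Module.Finite (ZMod 2) F := Module.Finite.of_basis b
  rw [← K.enc0.finrank_eq, Module.finrank_pi_fintype]
  simp [Module.finrank_eq_card_basis b]

/-- The conditions on the rates bound all the parameters by the number `k ℓ` of bits of a symbol of
the outer code: the rate of `C_A` is bounded below, and so is the rate of the inner code. -/
theorem ConcatCode.size_le (K : ConcatCode F n Δ) (b : Module.Basis (Fin ℓ) (ZMod 2) F)
    {κ ε ε₀ C : ℝ} (hκ0 : 0 < κ) (hκ1 : κ < 1) (hε : 0 < ε) (hε₀ : ε < ε₀) (h1 : ε₀ < 1) (hC : 0 < C)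
    (hr : (1 - ε) / (1 - κ * ε) ≤ K.O.rateA + K.O.rateB - 1) (hin : (1 - κ * ε) * C ≤ K.rateIn) :
    1 ≤ K.nin ∧ (K.size ℓ + 1 : ℝ) ≤
      (5 + 3 / (1 - ε₀) + 1 / ((1 - κ) * C)) * (K.O.CA.k * ℓ) := by
  have hkε : κ * ε < 1 := by nlinarith
  have h0 : 0 < 1 - ε₀ := by linarith
  have h2 : 0 < (1 - κ) * C := mul_pos (by linarith) hC
  have hΔ : (0 : ℝ) < Δ := by exact_mod_cast K.O.dims_pos
  have hk : (1 : ℝ) ≤ K.O.CA.k := by exact_mod_cast K.O.CA.k_pos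
  have hℓ : (1 : ℝ) ≤ ℓ := by
    rcases Nat.eq_zero_or_pos ℓ with rfl | h
    · have : (1 : F) = 0 := b.repr.injective (Subsingleton.elim _ _)
      exact absurd this one_ne_zero
    · exact_mod_cast h
  set k := (K.O.CA.k : ℝ)
  have hN : 1 ≤ k * ℓ := one_le_mul_of_one_le_of_one_le hk hℓ
  have hB : K.O.rateB ≤ 1 := (div_le_one hΔ).2 (by exact_mod_cast K.O.CB.k_le)
  have hA : 1 - ε₀ ≤ K.O.rateA := by
    have : 1 - ε ≤ (1 - ε) / (1 - κ * ε) := by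
      rw [le_div_iff₀ (by linarith)]
      nlinarith [mul_pos hκ0 hε]
    linarith
  have hΔk : Δ ≤ 1 / (1 - ε₀) * k := by
    rw [OuterCode.rateA, le_div_iff₀ hΔ] at hA
    rw [one_div, inv_mul_eq_div, le_div_iff₀ h0]
    linarith
  have hrin : (1 - κ) * C ≤ K.rateIn := le_trans (mul_le_mul_of_nonneg_right (by nlinarith) hC.le) hin
  rw [ConcatCode.rateIn, finrank_Cin K b] at hrin
  have hnin : 1 ≤ K.nin := by
    by_contra h
    obtain h : K.nin = 0 := by omega
    rw [h, Nat.cast_zero, div_zero] at hrin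
    linarith
  have hnin' : K.nin ≤ 1 / ((1 - κ) * C) * (k * ℓ) := by
    rw [le_div_iff₀ (by exact_mod_cast hnin)] at hrin
    rw [one_div, inv_mul_eq_div, le_div_iff₀ h2]
    push_cast at hrin
    linarith
  refine ⟨hnin, ?_⟩
  have hD : 0 < 1 / (1 - ε₀) := by positivity
  have e1 : (Δ * ℓ : ℝ) ≤ 1 / (1 - ε₀) * (k * ℓ) := by
    rw [← mul_assoc]
    exact mul_le_mul_of_nonneg_right hΔk (by linarith)
  have e2 : (Δ : ℝ) ≤ 1 / (1 - ε₀) * (k * ℓ) := le_trans (le_mul_of_one_le_right hΔ.le hℓ) e1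
  have e3 : k ≤ k * ℓ := le_mul_of_one_le_right (by linarith) hℓ
  have e4 : (ℓ : ℝ) ≤ k * ℓ := le_mul_of_one_le_left (by linarith) hk
  have e5 : 3 / (1 - ε₀) = 3 * (1 / (1 - ε₀)) := by ring
  rw [e5]
  simp only [ConcatCode.size]
  push_cast
  linarith

end

open Polynomial in
/-- Here `w` bounds the time that is spent on one block by the programs themselves, and the power of
`K.nin` the time that is spent by the decoder of the inner code. -/
theorem exists_polynomial {w : ℕ → ℕ} (hw : PolyBdd w) {p κ h₀ s r c ε₀ : ℝ} {φ : ℕ → ℕ}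
    (hp : p ≠ 1 / 2) (hκ0 : 0 < κ) (hκ1 : κ < 1) (h₀0 : 0 < h₀)
    (h1 : ε₀ < 1) (hφ : IsDenseSeq fun i => Real.logb 2 (φ i)) :
    ∃ P : ℝ[X], ∀ ε : ℝ, 0 < ε → ε < ε₀ → ∀ (F : Type) [Field F] [Algebra (ZMod 2) F] (ℓ n Δ : ℕ)
      (_ : Module.Basis (Fin ℓ) (ZMod 2) F) (K : ConcatCode F n Δ),
      IsSmallestAlphabet φ (1 / (κ * ε) ^ h₀) (Nat.card K.O.Phi) →
      (1 - ε) / (1 - κ * ε) ≤ K.O.rateA + K.O.rateB - 1 →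
      (1 - κ * ε) * bscCapacity p ≤ K.rateIn →
      (n : ℝ) * (w (K.size ℓ) + |c| * ((K.nin : ℝ) ^ s * (1 / ε ^ r))) ≤
        K.length * P.eval (1 / ε) := by
  obtain ⟨A, k, hA⟩ := hw
  obtain ⟨M, hM0, hM⟩ := hφ.logb_le
  have hC := bscCapacity_pos hp
  set G : ℝ := (5 + 3 / (1 - ε₀) + 1 / ((1 - κ) * bscCapacity p)) * (2 + M) * (1 / κ) ^ ⌈h₀⌉₊ with hG
  have hD1 : 0 < 1 - ε₀ := by linarith
  have hD2 : 0 < 1 - κ := by linarith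
  refine ⟨Polynomial.C (A : ℝ) * (Polynomial.C G * X ^ ⌈h₀⌉₊) ^ k +
    Polynomial.C |c| * ((Polynomial.C G * X ^ ⌈h₀⌉₊) ^ ⌈s⌉₊ * X ^ ⌈r⌉₊),
    fun ε hε hε₀ F _ _ ℓ n Δ b K hΦ hrate hin => ?_⟩
  obtain ⟨hnin, hsize⟩ := K.size_le b hκ0 hκ1 hε hε₀ h1 hC hrate hin
  have hκε : 0 < κ * ε := mul_pos hκ0 hε
  have hκε1 : κ * ε ≤ 1 := by nlinarith
  have hε1 : ε ≤ 1 := by linarith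
  have hX := hM _ _ (by positivity) hΦ
  rw [logb_card_phi K b] at hX
  have hX1 : 1 / (κ * ε) ^ h₀ ≤ (1 / κ) ^ ⌈h₀⌉₊ * (1 / ε) ^ ⌈h₀⌉₊ := by
    rw [← mul_pow, one_div_mul_one_div, one_div_pow, ← Real.rpow_natCast]
    exact one_div_le_one_div_of_le (Real.rpow_pos_of_pos hκε _)
      (Real.rpow_le_rpow_of_exponent_ge hκε hκε1 (Nat.le_ceil _))
  have hX0 : 1 ≤ 1 / (κ * ε) ^ h₀ :=
    one_le_one_div (Real.rpow_pos_of_pos hκε _) (Real.rpow_le_one hκε.le hκε1 h₀0.le)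
  have hsize' : (K.size ℓ + 1 : ℝ) ≤ G * (1 / ε) ^ ⌈h₀⌉₊ := by
    refine hsize.trans ?_
    rw [hG, mul_assoc, mul_assoc]
    refine mul_le_mul_of_nonneg_left ?_ (by positivity)
    nlinarith
  set Y := G * (1 / ε) ^ ⌈h₀⌉₊ with hY
  have hY0 : 0 ≤ Y := le_trans (by positivity) hsize'
  have t1 : (w (K.size ℓ) : ℝ) ≤ A * Y ^ k := by
    have : (w (K.size ℓ) : ℝ) ≤ A * (K.size ℓ + 1 : ℝ) ^ k := by exact_mod_cast hA (K.size ℓ)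
    exact this.trans (by gcongr)
  have hninY : (K.nin : ℝ) ≤ Y := by
    have : K.nin ≤ K.size ℓ + 1 := by simp only [ConcatCode.size]; omega
    exact le_trans (by exact_mod_cast this) hsize'
  have t2 : (K.nin : ℝ) ^ s ≤ Y ^ ⌈s⌉₊ := by
    refine le_trans ?_ (pow_le_pow_left₀ (Nat.cast_nonneg _) hninY _)
    rw [← Real.rpow_natCast]
    exact Real.rpow_le_rpow_of_exponent_le (by exact_mod_cast hnin) (Nat.le_ceil _)
  have t3 : 1 / ε ^ r ≤ (1 / ε) ^ ⌈r⌉₊ := by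
    rw [one_div_pow, ← Real.rpow_natCast]
    exact one_div_le_one_div_of_le (Real.rpow_pos_of_pos hε _)
      (Real.rpow_le_rpow_of_exponent_ge hε hε1 (Nat.le_ceil _))
  have hP : (w (K.size ℓ) + |c| * ((K.nin : ℝ) ^ s * (1 / ε ^ r)) : ℝ) ≤
      A * Y ^ k + |c| * (Y ^ ⌈s⌉₊ * (1 / ε) ^ ⌈r⌉₊) := by gcongr
  simp only [eval_add, eval_mul, eval_C, eval_pow, eval_X, ← hY]
  refine (mul_le_mul_of_nonneg_left hP (Nat.cast_nonneg n)).trans ?_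
  refine mul_le_mul_of_nonneg_right ?_ (by positivity)
  rw [ConcatCode.length]
  push_cast
  exact le_mul_of_one_le_right (Nat.cast_nonneg n) (by exact_mod_cast hnin)

theorem theorem2 (τ : ℝ) (hτ0 : 0 < τ) (hτ1 : τ < 1) :
    ∃ prog progClocked : Cmd,
    ∀ (p κ h₀ s r c ε₀ : ℝ) (φ : ℕ → ℕ),
      0 ≤ p → p ≤ 1 → p ≠ 1 / 2 → 0 < κ → κ < 1 → 0 < h₀ → 1 ≤ s → 1 ≤ r → ε₀ < 1 →
      IsDenseSeq (fun i => Real.logb 2 (φ i)) →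
    ∃ P : Polynomial ℝ,
    ∀ ε : ℝ, 0 < ε → ε < ε₀ →
    ∀ (F : Type) [Field F] [Algebra (ZMod 2) F] (ℓ n Δ : ℕ)
      (b : Module.Basis (Fin ℓ) (ZMod 2) F) (K : ConcatCode F n Δ),
      IsSmallestAlphabet φ (1 / (κ * ε) ^ h₀) (Nat.card K.O.Phi) →
      (1 - ε) / (1 - κ * ε) ≤ K.O.rateA + K.O.rateB - 1 →
      (1 - κ * ε) * bscCapacity p ≤ K.rateIn →
    ∀ (Din : Cmd) (desc : List (List ℕ)),
      (∀ w : Fin K.nin → ZMod 2, ∃ t : ℕ,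
        Runs noSub Din (bits w :: desc) (bits (K.decIn w).1) t ∧
        (t : ℝ) ≤ c * ((K.nin : ℝ) ^ s * (1 / ε ^ r))) →
    ∀ (m : ℕ) (y : K.Word),
      (∃ t : ℕ, Runs (asSub Din desc) prog (K.input b m y) (K.output (K.decode m y)) t ∧
        (t : ℝ) ≤ K.length * P.eval (1 / ε) * (m + 1) ∧
        (K.Correctable τ y → (t : ℝ) ≤ K.length * P.eval (1 / ε))) ∧
      (∃ (t : ℕ) (out : Option K.Word),
        Runs (asSub Din desc) progClocked (K.input b m y) (K.output out) t ∧
        (t : ℝ) ≤ K.length * P.eval (1 / ε) ∧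
        (out = K.decode m y ∨ out = none) ∧
        (K.Correctable τ y → out = K.decode m y)) := by
  obtain ⟨prog, progClocked, w, hw, H⟩ := exists_decoders hτ0 hτ1
  refine ⟨prog, progClocked, fun p κ h₀ s r c ε₀ φ _ _ hp hκ0 hκ1 h₀0 _ _ h1 hφ => ?_⟩
  obtain ⟨P, hP⟩ := exists_polynomial (c := c) hw hp hκ0 hκ1 h₀0 h1 hφ
  refine ⟨P, fun ε hε hε₀ F _ _ ℓ n Δ b K hΦ hrate hin Din desc hD m y => ?_⟩
  have hP := hP ε hε hε₀ F ℓ n Δ b K hΦ hrate hin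
  set V := (K.nin : ℝ) ^ s * (1 / ε ^ r) with hV
  have hV0 : 0 ≤ V := by positivity
  -- `|c|` in place of `c`, for which no sign is assumed
  obtain ⟨⟨t, h1, h2, h3⟩, t', out, h4, h5, h6⟩ := H F n Δ ℓ K b m y (asSub Din desc) ⌊|c| * V⌋₊
    fun v => by
      obtain ⟨t, ht, hle⟩ := hD v
      exact ⟨t, Nat.le_floor (hle.trans (by gcongr; exact le_abs_self c)), ht⟩
  have key : ((n * (w (K.size ℓ) + ⌊|c| * V⌋₊) : ℕ) : ℝ) ≤ K.length * P.eval (1 / ε) := by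
    refine le_trans ?_ hP
    push_cast
    gcongr
    exact Nat.floor_le (by positivity)
  have key' : ∀ {t : ℕ}, t ≤ n * (w (K.size ℓ) + ⌊|c| * V⌋₊) →
      (t : ℝ) ≤ K.length * P.eval (1 / ε) := fun h => (Nat.cast_le.2 h).trans key
  refine ⟨⟨t, h1, (Nat.cast_le.2 h2).trans ?_, fun hy => key' (h3 hy)⟩, t', out, h4, key' h5, h6⟩
  rw [Nat.cast_mul, Nat.cast_add_one]
  gcongr
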